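/- **Setting.** Let $k$ be a field and $Q$ a finite quiver without sinks, with source and target maps $s,t$. Write paths from right to left: $\alpha_m\cdots\alpha_1=\alpha_{m,1}$ is defined when $t(\alpha_i)=s(\alpha_{i+1})$; $Q_m$ is the set of paths of length $m$. Let $J\subset kQ$ be the ideal spanned by the paths of positive length, $\Lambda=kQ/J^2$, $E=kQ_0\subset\Lambda$ and $\overline\Lambda=\Lambda/E=kQ_1$ (regarded also as the span of the arrows in $\Lambda$; $\pi\colon\Lambda\to\overline\Lambda$ is the projection). Signs come from giving $s\overline\Lambda$ degree $-1$. **The combinatorial complex.** A parallel path is a pair $(\gamma,\gamma')\in Q_m//Q_p$, i.e. $\gamma\in Q_m,\gamma'\in Q_p$ with equal sources and equal targets; it has degree $m-p$. Let $\theta(\gamma,\gamma')=\sum_{\alpha\in Q_1,\,s(\alpha)=t(\gamma)}(\alpha\gamma,\alpha\gamma')$, let $\overline C^{\,n}_0=\varinjlim_{\theta}k(Q_{n+p}//Q_p)$ and $$\overline C^*_{\mathrm{sg},R}(Q,Q)=\overline C_0^{\,*}\oplus s^{-1}\overline C_0^{\,*},\qquad |s^{-1}a|=|a|+1 .$$ The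 differential $\delta$ vanishes on $s^{-1}\overline C_0^{\,*}$, and for $(\gamma,\gamma')\in Q_m//Q_p$ $$\delta(\gamma,\gamma')=\sum_{s(\alpha)=t(\gamma)}s^{-1}(\alpha\gamma,\alpha\gamma')-(-1)^{m-p}\sum_{t(\beta)=s(\gamma)}s^{-1}(\gamma\beta,\gamma'\beta)\quad(\alpha,\beta\in Q_1).$$ Depict $z=(\alpha_{m,1},\beta_{p,1})$ by the sequence $\xrightarrow{\beta_1}\cdots\xrightarrow{\beta_p}\xleftarrow{\alpha_m}\cdots\xleftarrow{\alpha_1}$, and $s^{-1}x=s^{-1}(\alpha_{m,1},\beta_{p,0})$ by the same sequence preceded by $\xrightarrow{\beta_0}$. A composite sequence is evaluated by replacing each $\xleftarrow{\alpha}\xrightarrow{\beta}$ by $\delta_{\alpha,\beta}$, iteratively, until a parallel path remains; it is $0$ if the sequence is not composable in $Q$. *Cup product.* Let $z,w$ be parallel paths, and let $s^{-1}x$, $s^{-1}y$ be as above, with $w=(\alpha'_{n,1},\beta'_{q,1})$, $y=(\alpha'_{n,1},\beta'_{q,0})$. (C1) $(s^{-1}x)\cup_R(s^{-1}y)=0$.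 (C2) $z\cup_R w$ is the value of the concatenation of the sequences of $z$ and $w$. (C3) $(s^{-1}x)\cup_R w$ is the value, in $s^{-1}\overline C_0$, of the concatenation of the sequences of $s^{-1}x$ and $w$. (C4) $z\cup_R(s^{-1}y)$ is the value, in $s^{-1}\overline C_0$, of $\xrightarrow{\beta_0'}$, followed by the sequence of $z$, followed by $\xrightarrow{\beta'_1}\cdots\xrightarrow{\beta'_q}\xleftarrow{\alpha'_n}\cdots\xleftarrow{\alpha'_1}$. *Brace operation* ($r\ge1$ arguments). (B1) $x\{y_1,\dots,y_r\}_R=0$ if some $y_j\in\overline C_0^{\,*}$. (B2), (B3) If $u$ is $s^{-1}(\alpha_{m,1},\beta_{p,0})$ or $(\alpha_{m,1},\beta_{p,1})$ and $y_1,\dots,y_r$ are parallel paths, then $$u\{s^{-1}y_1,\dots,s^{-1}y_r\}_R=\sum(-1)^{a+\epsilon}\,\mathfrak b^{(i_1,\dots,i_a)}_{(l_1,\dots,l_b)},\qquad \epsilon=\sum_{j=1}^b(|s^{-1}y_j|-1)(m+p-l_j+1)+\sum_{j=1}^a(|s^{-1}y_{r-j+1}|-1)(i_j-1),$$ summed over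 $a+b=r$ ($a,b\ge 0$), $1\le i_1<\cdots<i_a\le m$ and $1\le l_1\le\cdots\le l_b\le p$. Here $\mathfrak b$ is the value of the sequence of $u$ in which, for $1\le j\le b$, the sequence of $y_j$ is inserted immediately before $\xrightarrow{\beta_{l_j}}$ (keeping the order $y_1,\dots,y_b$), and, for $1\le j\le a$, the sequence of $y_{r-j+1}$ is inserted immediately after $\xleftarrow{\alpha_{i_j}}$; it lies in the same summand $\overline C_0$ or $s^{-1}\overline C_0$ as $u$. **The singular Hochschild complex.** $\overline C^*_{\mathrm{sg},R,E}(\Lambda,\Lambda)$ is the colimit along $\theta\colon f\mapsto \mathbf 1_{s\overline\Lambda}\otimes f$ (with Koszul sign $(-1)^{|f|}$ on elements) of the spaces $$\operatorname{Hom}_{E\text{-}E}\big((s\overline\Lambda)^{\otimes_E m},\ (s\overline\Lambda)^{\otimes_E p}\otimes_E\Lambda\big)\quad\text{(degree } m-p).$$ Its differential is the Hochschild differential $$\delta f(a_{1},\dots,a_{m+1})=-(-1)^{|f|}a_1\blacktriangleright f(a_2,\dots,a_{m+1})+(-1)^{|f|}\sum_{i=1}^m(-1)^{i-1}f(\dots,a_ia_{i+1},\dots)+(-1)^{|f|+m}f(a_1,\dots,a_m)a_{m+1},$$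 where $a_0\blacktriangleright(a_1\otimes\cdots\otimes a_{p+1})=\sum_{i=0}^{p}(-1)^i a_0\otimes\cdots\otimes a_ia_{i+1}\otimes\cdots\otimes a_{p+1}$. For $f$ of type $(m,p)$ and $g$ of type $(n,q)$, the cup product is $f\cup_R g=(\mathbf 1^{\otimes p+q}\otimes\mu)(\mathbf 1^{\otimes q}\otimes f\otimes\mathbf 1_\Lambda)(\mathbf 1^{\otimes m}\otimes g)$, with sign $(-1)^{mn+pq}$ on elements, $\mu$ being the multiplication of $\Lambda$. For $x$ of type $(m,p)$ and $y_i$ of type $(n_i,q_i)$, $1\le i\le r$, $r\geq 1$, the brace is $$x\{y_1,\dots,y_r\}_R=\sum(-1)^{b}B^{(i_1,\dots,i_a)}_{(l_1,\dots,l_b)},$$ summed over the same indices as above. Put $\bar y_i=(\mathbf 1^{\otimes q_i}\otimes\pi)y_i$. After adding identity strands on the left (which does not change a class in the colimit), $B$ takes $m+\sum n_i$ inputs to $P=p+\sum q_i+r$ strands $\overline\Lambda$ followed by $\Lambda$, and is the following composition: start with the inputs followed by $1_\Lambda$; apply $\bar y_r,\bar y_{r-1},\dots,\bar y_{b+1}$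 in this order, $\bar y_{r-j+1}$ having exactly $i_j-1$ strands on its right; apply $x$ to the last $m$ strands and multiply its $\Lambda$-output onto $\Lambda$; apply $\bar y_b,\dots,\bar y_1$ in this order, $\bar y_j$ having exactly $l_j-1$ strands on its right. Evaluated on elements, $B$ carries the Koszul sign $(-1)^{\epsilon'}$, where, with $m'=m-p$ and $n_i'=n_i-q_i-1$, $$\epsilon'=\Big(m'+\sum_i n_i'\Big)P+m'p+\sum_i n_i'q_i+\sum_i q_i+\sum_{j=1}^{b}(n_1'+\cdots+n_j'+l_j-1)n_j'+\sum_{j=1}^{a}(n_1'+\cdots+n'_{r-j+1}+m'-i_j-1)n'_{r-j+1}.$$ **The map $\kappa$.** $\kappa\colon\overline C^*_{\mathrm{sg},R}(Q,Q)\to\overline C^*_{\mathrm{sg},R,E}(\Lambda,\Lambda)$ is induced by the linear maps which send $(\alpha_{m,1},\beta_{p,1})$, resp. $s^{-1}(\alpha_{m,1},\beta_{p,0})$, to the cochain with value $(-1)^{\epsilon}s\beta_p\otimes\cdots\otimes s\beta_1\otimes e_{s(\alpha_{m,1})}$, resp. $(-1)^\epsilon s\beta_p\otimes\cdots\otimes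 s\beta_1\otimes\beta_0$, on $s\alpha_m\otimes\cdots\otimes s\alpha_1$ (on $e_{s(\alpha_{m,1})}\in E$ if $m=0$), and with value $0$ on the tensors of all other paths of length $m$; here $\epsilon=(m-p)p+\frac{(m-p)(m-p+1)}2$. **$B_\infty$-algebras.** A $B_\infty$-algebra is a graded space with multilinear operations $m_n$ ($n\ge1$, degree $2-n$) satisfying the $A_\infty$-relations, and $\mu_{p,q}$ ($p,q\ge 0$, degree $1-p-q$) satisfying the unital condition $\mu_{1,0}=\mathbf 1=\mu_{0,1}$, $\mu_{k,0}=0=\mu_{0,k}$ ($k\neq1$), the associativity relations for the $\mu_{p,q}$, and the Leibniz relations between the $m_n$ and the $\mu_{p,q}$. It is a brace $B_\infty$-algebra if $m_n=0$ for $n>2$ and $\mu_{p,q}=0$ for $p>1$; one then writes $a\{b_1,\dots,b_p\}=(-1)^{p|a|+(p-1)|b_1|+\cdots+|b_{p-1}|}\mu_{1,p}(a;b_1,\dots,b_p)$. A $B_\infty$-morphism $(f_n)_{n\ge1}$, $|f_n|=1-n$, is strict if $f_n=0$ for $n\ne1$, and an isomorphism if it has a two-sided inverse $B_\infty$-morphism.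 **Theorem.** 1. The complex $(\overline C^*_{\mathrm{sg},R}(Q,Q),\delta)$ with the cup product given by (C1)–(C4) and the brace operation given by (B1)–(B3) is a brace $B_\infty$-algebra: the formulas are compatible with the colimit, and there is exactly one brace $B_\infty$-algebra structure with $m_1=\delta$, $m_2=\cup_R$ and these braces. 2. Likewise, $\overline C^*_{\mathrm{sg},R,E}(\Lambda,\Lambda)$ with its Hochschild differential, cup product and brace operation is a brace $B_\infty$-algebra. 3. The map $\kappa$ is well defined and is (the linear part of) a strict $B_\infty$-isomorphism between these two brace $B_\infty$-algebras. -/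

import Mathlib

noncomputable section

/-- The sign `(-1)^z` in the field `k`. -/
def ksign (k : Type*) [Field k] (z : ℤ) : k := ((Int.negOnePow z : ℤ) : k)

namespace BInf

/-! ## A-infinity and B-infinity algebras

All identities between multilinear operations are evaluated on words of homogeneous elements; a
word is a list of pairs `(degree, element)`, and the Koszul signs are computed from the degrees. -/

section Words

variable {A : Type*}

/-- Total degree of a word. -/
def wdeg (L : List (ℤ × A)) : ℤ := (L.map Prod.fst).sum

/-- The `i`-th block when a word is cut into consecutive blocks of lengths `c 0, c 1, …`. -/
def block {r : ℕ} (c : Fin r → ℕ) (i : Fin r) (L : List (ℤ × A)) : List (ℤ × A) :=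
  (L.drop (∑ j with j < i, c j)).take (c i)

/-- All ways to write `n` as an ordered sum of `r` non-negative integers. -/
def parts (n r : ℕ) : Finset (Fin r → ℕ) := Finset.Nat.antidiagonalTuple r n

/-- All ways to write `n` as an ordered sum of `r` positive integers. -/
def posParts (n r : ℕ) : Finset (Fin r → ℕ) := (parts n r).filter fun c => ∀ i, 1 ≤ c i

/-- Exponent of the sign of the permutation `τ` which moves the blocks of `L` between the blocks
of `K`. -/
def tauExp {r : ℕ} (ks ls : Fin r → ℕ) (K L : List (ℤ × A)) : ℤ :=
  ∑ i, wdeg (block ls i L) * ∑ j with i < j, wdeg (block ks j K)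

/-- Koszul exponent of applying `μ_{ks 0, ls 0} ⊗ μ_{ks 1, ls 1} ⊗ ⋯` to the word arranged in
blocks; the operation `μ_{p, q}` has degree `1 - p - q`. -/
def kosExp {r : ℕ} (ks ls : Fin r → ℕ) (K L : List (ℤ × A)) : ℤ :=
  ∑ i, (1 - (ks i : ℤ) - (ls i : ℤ)) * ∑ j with j < i, (wdeg (block ks j K) + wdeg (block ls j L))

/-- The exponent
`∑ (kᵢ + lᵢ - 1)(c + r - i) + ∑ lᵢ (kᵢ₊₁ + ⋯ + k_r)` (with `i` running from `1` to `r`). -/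
def bexp {r : ℕ} (ks ls : Fin r → ℕ) (c : ℕ) : ℤ :=
  (∑ i, ((ks i : ℤ) + ls i - 1) * ((c : ℤ) + r - ((i : ℕ) + 1 : ℤ)))
    + ∑ i, (ls i : ℤ) * ∑ j with i < j, (ks j : ℤ)

/-- Koszul exponent of applying `f_{c 0} ⊗ f_{c 1} ⊗ ⋯` to a word, where `f_n` has degree
`1 - n`. -/
def kosExpHom {r : ℕ} (c : Fin r → ℕ) (L : List (ℤ × A)) : ℤ :=
  ∑ i, (1 - (c i : ℤ)) * ∑ j with j < i, wdeg (block c j L)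

/-- The exponent `∑ (cᵢ - 1)(d + r - i)` (with `i` running from `1` to `r`). -/
def homExp {r : ℕ} (c : Fin r → ℕ) (d : ℕ) : ℤ :=
  ∑ i, ((c i : ℤ) - 1) * ((d : ℤ) + r - ((i : ℕ) + 1 : ℤ))

end Words

variable {k : Type*} [Field k]

/-- A word whose letters are homogeneous of the indicated degrees. -/
def Homog {A : Type*} [AddCommGroup A] [Module k A] (𝒜 : ℤ → Submodule k A)
    (L : List (ℤ × A)) : Prop := ∀ x ∈ L, x.2 ∈ 𝒜 x.1

/-- Two families of multilinear operations `m_n : A^{⊗ n} → A` and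
`μ_{p, q} : A^{⊗ p} ⊗ A^{⊗ q} → A`. -/
structure Ops (k : Type*) [Field k] (A : Type*) [AddCommGroup A] [Module k A] where
  m : ∀ n : ℕ, MultilinearMap k (fun _ : Fin n => A) A
  mu : ∀ p q : ℕ, MultilinearMap k (fun _ : Fin p => A) (MultilinearMap k (fun _ : Fin q => A) A)

namespace Ops

variable {A : Type*} [AddCommGroup A] [Module k A] (O : Ops k A)

/-- `m_n` on a word of length `n`, together with the degree of the result. -/
def mW (L : List (ℤ × A)) : ℤ × A :=
  (wdeg L + 2 - L.length, O.m L.length fun i => (L.get i).2)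

/-- `μ_{p, q}` on two words of lengths `p` and `q`, together with the degree of the result. -/
def muW (K L : List (ℤ × A)) : ℤ × A :=
  (wdeg K + wdeg L + 1 - K.length - L.length,
    O.mu K.length L.length (fun i => (K.get i).2) fun i => (L.get i).2)

/-- The word `μ_{ks 0, ls 0}(…) ⊗ μ_{ks 1, ls 1}(…) ⊗ ⋯` (without signs). -/
def muWords {r : ℕ} (ks ls : Fin r → ℕ) (K L : List (ℤ × A)) : List (ℤ × A) :=
  List.ofFn fun i => O.muW (block ks i K) (block ls i L)

/-- The brace operation `a{b_1, …, b_p} = (-1)^{p|a| + (p-1)|b_1| + ⋯ + |b_{p-1}|} μ_{1, p}` on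
elements of degrees `d` and `e_1, …, e_p`. -/
def brace {p : ℕ} (d : ℤ) (e : Fin p → ℤ) (a : A) (b : Fin p → A) : A :=
  ksign k (p * d + ∑ i : Fin p, ((p : ℤ) - ((i : ℕ) + 1 : ℤ)) * e i) • O.mu 1 p (fun _ => a) b

end Ops

/-- A `B_∞`-algebra structure on the space `A` graded by the subspaces `𝒜 n`. -/
structure BInfty {A : Type*} [AddCommGroup A] [Module k A] (𝒜 : ℤ → Submodule k A)
    extends Ops k A where
  internal : DirectSum.IsInternal 𝒜
  m_zero : m 0 = 0
  m_deg : ∀ (n : ℕ) (d : Fin n → ℤ) (a : Fin n → A), (∀ i, a i ∈ 𝒜 (d i)) →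
    m n a ∈ 𝒜 ((∑ i, d i) + 2 - n)
  mu_deg : ∀ (p q : ℕ) (d : Fin p → ℤ) (e : Fin q → ℤ) (a : Fin p → A) (b : Fin q → A),
    (∀ i, a i ∈ 𝒜 (d i)) → (∀ i, b i ∈ 𝒜 (e i)) →
    mu p q a b ∈ 𝒜 ((∑ i, d i) + (∑ i, e i) + 1 - p - q)
  /-- The `A_∞`-relations. -/
  a_infty : ∀ L : List (ℤ × A), Homog 𝒜 L →
    ∑ j ∈ Finset.range L.length, ∑ s ∈ Finset.Icc 1 (L.length - j),
      ksign k (j + s * ((L.length : ℤ) - j - s) + (2 - s) * wdeg (L.take j)) •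
        (toOps.mW (L.take j ++ [toOps.mW ((L.drop j).take s)] ++ L.drop (j + s))).2 = 0
  /-- The unital condition. -/
  mu_one_zero : ∀ a : Fin 1 → A, ∀ b : Fin 0 → A, mu 1 0 a b = a 0
  mu_zero_one : ∀ a : Fin 0 → A, ∀ b : Fin 1 → A, mu 0 1 a b = b 0
  mu_left_zero : ∀ p, p ≠ 1 → mu p 0 = 0
  mu_right_zero : ∀ q, q ≠ 1 → mu 0 q = 0
  /-- The associativity of the `μ_{p, q}`. -/
  assoc : ∀ K L N : List (ℤ × A), Homog 𝒜 K → Homog 𝒜 L → Homog 𝒜 N →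
    ∑ r ∈ Finset.range (L.length + N.length + 1),
      ∑ ls ∈ parts L.length r, ∑ ns ∈ parts N.length r,
        ksign k (bexp ls ns 0 + tauExp ls ns L N + kosExp ls ns L N
            + (∑ i, (1 - (ls i : ℤ) - ns i)) * wdeg K) •
          (toOps.muW K (toOps.muWords ls ns L N)).2 =
    ∑ s ∈ Finset.range (K.length + L.length + 1),
      ∑ ks ∈ parts K.length s, ∑ ls ∈ parts L.length s,
        ksign k (bexp ks ls N.length + tauExp ks ls K L + kosExp ks ls K L) •
          (toOps.muW (toOps.muWords ks ls K L) N).2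
  /-- The Leibniz rule for the `m_n` with respect to the `μ_{p, q}`. -/
  leibniz : ∀ K L : List (ℤ × A), Homog 𝒜 K → Homog 𝒜 L →
    ∑ r ∈ Finset.Icc 1 (K.length + L.length),
      ∑ ks ∈ parts K.length r, ∑ ls ∈ parts L.length r,
        ksign k (bexp ks ls 0 + tauExp ks ls K L + kosExp ks ls K L) •
          (toOps.mW (toOps.muWords ks ls K L)).2 =
    (∑ r ∈ Finset.Icc 1 K.length, ∑ i ∈ Finset.range (K.length - r + 1),
      ksign k (r * ((K.length : ℤ) - r - i + L.length) + i + (2 - r) * wdeg (K.take i)) •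
        (toOps.muW (K.take i ++ [toOps.mW ((K.drop i).take r)] ++ K.drop (i + r)) L).2) +
    ∑ s ∈ Finset.Icc 1 L.length, ∑ i ∈ Finset.range (L.length - s + 1),
      ksign k (s * ((L.length : ℤ) - i - s) + K.length + i
          + (2 - s) * (wdeg K + wdeg (L.take i))) •
        (toOps.muW K (L.take i ++ [toOps.mW ((L.drop i).take s)] ++ L.drop (i + s))).2

/-- A brace `B_∞`-algebra: `m_n = 0` for `n > 2` and `μ_{p, q} = 0` for `p > 1`. -/
def BInfty.IsBrace {A : Type*} [AddCommGroup A] [Module k A] {𝒜 : ℤ → Submodule k A}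
    (S : BInfty 𝒜) : Prop :=
  (∀ n, 2 < n → S.m n = 0) ∧ ∀ p q, 1 < p → S.mu p q = 0

section Morphisms

variable {A : Type*} [AddCommGroup A] [Module k A] {A' : Type*} [AddCommGroup A'] [Module k A']
  {A'' : Type*} [AddCommGroup A''] [Module k A'']

/-- `f_n` on a word of length `n`, with the degree `wdeg L + 1 - n` of the result. -/
def fW (f : ∀ n : ℕ, MultilinearMap k (fun _ : Fin n => A) A') (L : List (ℤ × A)) : ℤ × A' :=
  (wdeg L + 1 - L.length, f L.length fun i => (L.get i).2)

/-- The word `f_{c 0}(…) ⊗ f_{c 1}(…) ⊗ ⋯` (without signs). -/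
def fWords (f : ∀ n : ℕ, MultilinearMap k (fun _ : Fin n => A) A') {r : ℕ} (c : Fin r → ℕ)
    (L : List (ℤ × A)) : List (ℤ × A') :=
  List.ofFn fun i => fW f (block c i L)

/-- A `B_∞`-morphism. -/
structure BInftyHom {𝒜 : ℤ → Submodule k A} {𝒜' : ℤ → Submodule k A'} (S : BInfty 𝒜)
    (S' : BInfty 𝒜') where
  f : ∀ n : ℕ, MultilinearMap k (fun _ : Fin n => A) A'
  f_zero : f 0 = 0
  f_deg : ∀ (n : ℕ) (d : Fin n → ℤ) (a : Fin n → A), (∀ i, a i ∈ 𝒜 (d i)) →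
    f n a ∈ 𝒜' ((∑ i, d i) + 1 - n)
  /-- Compatibility with the `A_∞`-structures. -/
  map_m : ∀ L : List (ℤ × A), Homog 𝒜 L →
    ∑ a ∈ Finset.range L.length, ∑ s ∈ Finset.Icc 1 (L.length - a),
      ksign k (a + s * ((L.length : ℤ) - a - s) + (2 - s) * wdeg (L.take a)) •
        (fW f (L.take a ++ [S.mW ((L.drop a).take s)] ++ L.drop (a + s))).2 =
    ∑ r ∈ Finset.Icc 1 L.length, ∑ c ∈ posParts L.length r,
      ksign k (homExp c 0 + kosExpHom c L) • (S'.mW (fWords f c L)).2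
  /-- Compatibility with the `B_∞`-products. -/
  map_mu : ∀ K L : List (ℤ × A), Homog 𝒜 K → Homog 𝒜 L →
    ∑ r ∈ Finset.range (K.length + 1), ∑ s ∈ Finset.range (L.length + 1),
      ∑ c ∈ posParts K.length r, ∑ c' ∈ posParts L.length s,
        ksign k (homExp c s + homExp c' 0 + kosExpHom c K + kosExpHom c' L
            + (∑ i, (1 - (c' i : ℤ))) * wdeg K) •
          (S'.muW (fWords f c K) (fWords f c' L)).2 =
    ∑ t ∈ Finset.Icc 1 (K.length + L.length),
      ∑ ks ∈ parts K.length t, ∑ ls ∈ parts L.length t,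
        ksign k (bexp ks ls 0 + tauExp ks ls K L + kosExp ks ls K L) •
          (fW f (S.muWords ks ls K L)).2

/-- A strict morphism: `f_n = 0` for `n ≠ 1`. -/
def BInftyHom.IsStrict {𝒜 : ℤ → Submodule k A} {𝒜' : ℤ → Submodule k A'} {S : BInfty 𝒜}
    {S' : BInfty 𝒜'} (F : BInftyHom S S') : Prop :=
  ∀ n, n ≠ 1 → F.f n = 0

/-- The value of the composition `g ∘_∞ f` on a word. -/
def compW (g : ∀ n : ℕ, MultilinearMap k (fun _ : Fin n => A') A'')
    (f : ∀ n : ℕ, MultilinearMap k (fun _ : Fin n => A) A') (L : List (ℤ × A)) : A'' :=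
  ∑ r ∈ Finset.Icc 1 L.length, ∑ c ∈ posParts L.length r,
    ksign k (homExp c 0 + kosExpHom c L) • (fW g (fWords f c L)).2

/-- The value of the identity morphism on a word. -/
def idW (L : List (ℤ × A)) : A := if h : L.length = 1 then (L.get ⟨0, by omega⟩).2 else 0

/-- A `B_∞`-isomorphism: there is a `B_∞`-morphism in the other direction such that both
compositions are the identity morphisms. -/
def BInftyHom.IsIso {𝒜 : ℤ → Submodule k A} {𝒜' : ℤ → Submodule k A'} {S : BInfty 𝒜}
    {S' : BInfty 𝒜'} (F : BInftyHom S S') : Prop :=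
  ∃ G : BInftyHom S' S,
    (∀ L : List (ℤ × A), Homog 𝒜 L → compW G.f F.f L = idW L) ∧
    ∀ L : List (ℤ × A'), Homog 𝒜' L → compW F.f G.f L = idW L

end Morphisms

end BInf

/-! ## Colimits of inductive systems -/

namespace SeqColim

open scoped DirectSum

variable {k : Type*} [Field k] {G : ℕ → ℕ → Type*} [∀ m p, AddCommGroup (G m p)]
  [∀ m p, Module k (G m p)]

/-- The relations identifying an element with its image under the structure maps. -/
def rel (θ : ∀ m p, G m p →ₗ[k] G (m + 1) (p + 1)) :
    Submodule k (⨁ i : ℕ × ℕ, G i.1 i.2) :=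
  Submodule.span k {z | ∃ m p, ∃ x : G m p,
    z = DirectSum.lof k (ℕ × ℕ) (fun i => G i.1 i.2) (m, p) x
      - DirectSum.lof k (ℕ × ℕ) (fun i => G i.1 i.2) (m + 1, p + 1) (θ m p x)}

/-- The direct sum over `n` of the colimits over `p` of the spaces `G (n + p) p` along `θ`. -/
abbrev Colim (θ : ∀ m p, G m p →ₗ[k] G (m + 1) (p + 1)) : Type _ :=
  (⨁ i : ℕ × ℕ, G i.1 i.2) ⧸ rel θ

/-- The class of an element in the colimit. -/
def cl (θ : ∀ m p, G m p →ₗ[k] G (m + 1) (p + 1)) (m p : ℕ) : G m p →ₗ[k] Colim θ :=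
  (rel θ).mkQ ∘ₗ DirectSum.lof k (ℕ × ℕ) (fun i => G i.1 i.2) (m, p)

/-- The part of degree `n`: the classes of the elements of `G m p` with `m - p = n`. -/
def piece (θ : ∀ m p, G m p →ₗ[k] G (m + 1) (p + 1)) (n : ℤ) : Submodule k (Colim θ) :=
  ⨆ (m : ℕ) (p : ℕ) (_ : (m : ℤ) - p = n), LinearMap.range (cl θ m p)

end SeqColim

namespace Comb

/-! ## Parallel paths in a quiver and the combinatorial complex -/

open Classical SeqColim

universe w v u

/-- A parallel path `(top, bot)` in the quiver: two paths with the same source and target. -/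
structure ParPath (V : Type u) [Quiver.{v} V] where
  src : V
  tgt : V
  top : Quiver.Path src tgt
  bot : Quiver.Path src tgt

/-- A parallel path `(top, bot)` where `bot` has at least one arrow; `b0` is the first arrow of
`bot` and `rest` is the remaining part. -/
structure ParPathPos (V : Type u) [Quiver.{v} V] where
  src : V
  mid : V
  tgt : V
  top : Quiver.Path src tgt
  b0 : src ⟶ mid
  rest : Quiver.Path mid tgt

variable {V : Type u} [Quiver.{v} V]

/-- The underlying parallel path. -/
def ParPathPos.toPar (x : ParPathPos V) : ParPath V :=
  ⟨x.src, x.tgt, x.top, x.b0.toPath.comp x.rest⟩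

/-- Compose both paths with an arrow starting at their target. -/
def ParPath.post (z : ParPath V) {c : V} (a : z.tgt ⟶ c) : ParPath V :=
  ⟨z.src, c, z.top.cons a, z.bot.cons a⟩

/-- Compose both paths with an arrow ending at their source. -/
def ParPath.pre (z : ParPath V) {c : V} (a : c ⟶ z.src) : ParPath V :=
  ⟨c, z.tgt, a.toPath.comp z.top, a.toPath.comp z.bot⟩

/-- The parallel paths whose two paths have lengths `m` and `p`. -/
abbrev ParIdx (V : Type u) [Quiver.{v} V] (m p : ℕ) : Type _ :=
  {z : ParPath V // z.top.length = m ∧ z.bot.length = p}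

variable (k : Type w) [Field k] [Fintype V] [∀ a b : V, Fintype (a ⟶ b)]

/-- The map sending `(γ, γ')` to the sum of `(αγ, αγ')` over all arrows `α` which start at the
target of `γ`. -/
def theta (m p : ℕ) : (ParIdx V m p →₀ k) →ₗ[k] (ParIdx V (m + 1) (p + 1) →₀ k) :=
  Finsupp.linearCombination k fun z =>
    ∑ c : V, ∑ a : (z.1.tgt ⟶ c), Finsupp.single
      ⟨z.1.post a, by simp [ParPath.post, z.2.1], by simp [ParPath.post, z.2.2]⟩ (1 : k)

variable (V) in
/-- The colimit of the spaces spanned by parallel paths. -/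
abbrev C0 : Type _ := Colim (theta (V := V) k)

variable (V) in
/-- The part of degree `n` of the colimit. -/
def C0deg (n : ℤ) : Submodule k (C0 V k) := piece (theta (V := V) k) n

variable (V) in
/-- The underlying space `C₀ ⊕ s⁻¹ C₀` of the combinatorial complex. -/
abbrev Csg : Type _ := C0 V k × C0 V k

variable (V) in
/-- The part of degree `n` of `C₀ ⊕ s⁻¹ C₀`. -/
def CsgDeg (n : ℤ) : Submodule k (Csg V k) := (C0deg V k n).prod (C0deg V k (n - 1))

/-- The class of a parallel path in the colimit. -/
def cls (z : ParPath V) : C0 V k :=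
  cl (theta (V := V) k) z.top.length z.bot.length (Finsupp.single ⟨z, rfl, rfl⟩ 1)

/-! ### Sequences of arrows and their reduction -/

/-- A letter of a sequence: a rightward arrow, a leftward arrow, or a vertex (which only records
the position in the quiver). -/
inductive Letter (V : Type u) [Quiver.{v} V]
  | vert (a : V)
  | out (e : Quiver.Total V)
  | inn (e : Quiver.Total V)

/-- The arrows of a path, the first arrow (at the source) first. -/
def arrows {a : V} : ∀ {b : V}, Quiver.Path a b → List (Quiver.Total V)
  | _, .nil => []
  | _, .cons p e => arrows p ++ [⟨_, _, e⟩]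

/-- The sequence `→ β₁ ⋯ → β_p ← α_m ⋯ ← α₁` of the parallel path `(α_m ⋯ α₁, β_p ⋯ β₁)`. -/
def word (z : ParPath V) : List (Letter V) :=
  [.vert z.src] ++ (arrows z.bot).map .out ++ (arrows z.top).reverse.map .inn

/-- Walk along a sequence from a given vertex; `none` if the letters are not composable. -/
def walk : V → List (Letter V) → Option V
  | a, [] => some a
  | a, .vert b :: w => if a = b then walk b w else none
  | a, .out e :: w => if a = e.left then walk e.right w else none
  | a, .inn e :: w => if a = e.right then walk e.left w else none

/-- Replace all subsequences `← α → β` by `δ_{α, β}`, iteratively, reading from left to right.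
`ins` holds the pending leftward arrows (the rightmost first) and `outs` the rightward arrows found
so far (the leftmost first). The result is `none` if some factor `δ_{α, β}` vanishes, and
otherwise the arrows `β` from left to right and the arrows `α` from right to left. -/
def reduce : List (Quiver.Total V) → List (Quiver.Total V) → List (Letter V) →
    Option (List (Quiver.Total V) × List (Quiver.Total V))
  | outs, ins, [] => some (outs, ins)
  | outs, ins, .vert _ :: w => reduce outs ins w
  | outs, [], .out e :: w => reduce (outs ++ [e]) [] w
  | outs, f :: ins, .out e :: w => if f = e then reduce outs ins w else none
  | outs, ins, .inn e :: w => reduce outs (e :: ins) w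

/-- The class of the parallel path obtained by reducing a sequence which starts and ends at the
vertex `a`; zero if the sequence is not composable or if some factor `δ_{α, β}` vanishes. -/
def wordCls (a : V) (w : List (Letter V)) : C0 V k :=
  match reduce [] [] w with
  | none => 0
  | some r =>
    if h : walk a w = some a ∧
        ∃ z : ParPath V, z.src = a ∧ arrows z.bot = r.1 ∧ arrows z.top = r.2 then
      cls k h.2.choose
    else 0

/-! ### The operations -/

/-- The class of the parallel path `z` in the summand `C₀`. -/
def cls0 (z : ParPath V) : Csg V k := (cls k z, 0)

/-- The class `s⁻¹ z` in the summand `s⁻¹ C₀`. -/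
def cls1 (z : ParPath V) : Csg V k := (0, cls k z)

/-- The generators of `C₀ ⊕ s⁻¹ C₀`: parallel paths `z`, and `s⁻¹ x` where `x` has an arrow
`b0`. -/
inductive Gen (V : Type u) [Quiver.{v} V]
  | par (z : ParPath V)
  | shift (x : ParPathPos V)

namespace Gen

/-- The source vertex. -/
def src : Gen V → V
  | par z => z.src
  | shift x => x.src

/-- The arrows `α₁, …, α_m`. -/
def ups : Gen V → List (Quiver.Total V)
  | par z => arrows z.top
  | shift x => arrows x.top

/-- The arrows `β₁, …, β_p` (without `β₀`). -/
def downs : Gen V → List (Quiver.Total V)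
  | par z => arrows z.bot
  | shift x => arrows x.rest

/-- The arrow `β₀`, if present. -/
def special : Gen V → List (Letter V)
  | par _ => []
  | shift x => [.out ⟨_, _, x.b0⟩]

/-- The degree `m - p`. -/
def deg (g : Gen V) : ℤ := (g.ups.length : ℤ) - g.downs.length

/-- The class in the complex. -/
def cls : Gen V → Csg V k
  | par z => cls0 k z
  | shift x => cls1 k x.toPar

/-- Put a class of `C₀` into the summand which contains the generator. -/
def place : Gen V → C0 V k → Csg V k
  | par _, c => (c, 0)
  | shift _, c => (0, c)

end Gen

/-- The differential of a parallel path. -/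
def diff (z : ParPath V) : Csg V k :=
  (0, (∑ c : V, ∑ a : (z.tgt ⟶ c), cls k (z.post a))
    - ksign k ((z.top.length : ℤ) - z.bot.length) •
      ∑ c : V, ∑ b : (c ⟶ z.src), cls k (z.pre b))

/-- The cup product of two generators. -/
def cup : Gen V → Gen V → Csg V k
  | .par z, .par y => (wordCls k z.src (word z ++ word y), 0)
  | .shift x, .par y => (0, wordCls k x.src (word x.toPar ++ word y))
  | .par z, .shift y =>
      (0, wordCls k y.src ([.out ⟨_, _, y.b0⟩] ++ word z
        ++ (arrows y.rest).map .out ++ (arrows y.top).reverse.map .inn))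
  | .shift _, .shift _ => 0

/-- The degree of `s⁻¹ y`, minus one. -/
def shiftDeg (y : ParPath V) : ℤ := (y.top.length : ℤ) - y.bot.length

/-- The sequence obtained from the sequence of `x` by inserting, for `r < b`, the sequence of
the `r`-th of the `y` immediately before the rightward arrow at position `l r`, and, for `r < a`
with `a = n - b`, the sequence of the `y` number `n - 1 - r` immediately after the leftward arrow
`α` at position `i r`. All positions count from `0`. -/
def braceWord (x : Gen V) {n : ℕ} (y : Fin n → ParPath V) (b : Fin (n + 1))
    (l : Fin b → Fin x.downs.length) (i : Fin (n - b) → Fin x.ups.length) : List (Letter V) :=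
  x.special
  ++ ((List.finRange x.downs.length).flatMap fun j =>
      ((List.finRange b).flatMap fun r =>
        if l r = j then word (y ⟨r, by omega⟩) else []) ++ [.out (x.downs.get j)])
  ++ ((List.finRange x.ups.length).reverse.flatMap fun j =>
      .inn (x.ups.get j) :: ((List.finRange (n - b)).flatMap fun r =>
        if i r = j then word (y ⟨n - 1 - r, by omega⟩) else []))

/-- The exponent `ε + a` of the sign of a summand of the brace operation. -/
def braceExp (x : Gen V) {n : ℕ} (y : Fin n → ParPath V) (b : Fin (n + 1))
    (l : Fin b → Fin x.downs.length) (i : Fin (n - b) → Fin x.ups.length) : ℤ :=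
  ((n - b : ℕ) : ℤ)
  + ∑ r : Fin b, shiftDeg (y ⟨r, by omega⟩) *
      ((x.ups.length : ℤ) + x.downs.length - ((l r : ℕ) + 1 : ℤ) + 1)
  + ∑ r : Fin (n - b), shiftDeg (y ⟨n - 1 - r, by omega⟩) * (((i r : ℕ) + 1 : ℤ) - 1)

/-- The brace operation `x{s⁻¹ y₁, …, s⁻¹ y_n}`. -/
def brace (x : Gen V) {n : ℕ} (y : Fin n → ParPath V) : Csg V k :=
  ∑ b : Fin (n + 1),
    ∑ l : Fin b → Fin x.downs.length with Monotone l,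
      ∑ i : Fin (n - b) → Fin x.ups.length with StrictMono i,
        ksign k (braceExp x y b l i) • x.place k (wordCls k x.src (braceWord x y b l i))

/-- The operations on `C₀ ⊕ s⁻¹ C₀` are the combinatorial ones: `m_1` is the differential, `m_2`
is the cup product, and the braces are given by insertion of sequences. -/
structure IsCombinatorial (S : BInf.BInfty (CsgDeg V k)) : Prop where
  diff_par : ∀ z : ParPath V, S.m 1 ![cls0 k z] = diff k z
  diff_shift : ∀ c : C0 V k, S.m 1 ![(0, c)] = 0
  cup : ∀ x y : Gen V, S.m 2 ![x.cls k, y.cls k] = cup k x y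
  brace_par : ∀ (x : Csg V k) (n : ℕ) (y : Fin n → Csg V k), (∃ j, (y j).2 = 0) →
    S.mu 1 n ![x] y = 0
  brace : ∀ (x : Gen V) (n : ℕ) (y : Fin n → ParPath V), n ≠ 0 →
    S.toOps.brace x.deg (fun j => shiftDeg (y j) + 1) (x.cls k) (fun j => cls1 k (y j)) =
      brace k x y

end Comb

namespace Hoch

/-! ## Bimodules over a product of copies of the field -/

open scoped TensorProduct

universe w u

/-- A bimodule over the commutative semisimple algebra with basis a family of orthogonal
idempotents `e i` summing to one, given by the left and right actions `L i`, `R i` of the `e i`. -/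
structure EBim (k : Type*) [Field k] (I : Type*) [Fintype I] where
  carrier : Type w
  [grp : AddCommGroup carrier]
  [mod : Module k carrier]
  L : I → carrier →ₗ[k] carrier
  R : I → carrier →ₗ[k] carrier
  L_idem : ∀ i x, L i (L i x) = L i x
  R_idem : ∀ i x, R i (R i x) = R i x
  L_orth : ∀ i j x, i ≠ j → L i (L j x) = 0
  R_orth : ∀ i j x, i ≠ j → R i (R j x) = 0
  L_sum : ∀ x, ∑ i, L i x = x
  R_sum : ∀ x, ∑ i, R i x = x
  comm : ∀ i j x, L i (R j x) = R j (L i x)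

attribute [instance] EBim.grp EBim.mod

variable {k : Type*} [Field k] {I : Type*} [Fintype I]

instance : CoeSort (EBim.{w} k I) (Type w) := ⟨EBim.carrier⟩

variable (M N P M' N' : EBim.{w} k I)

/-- The space of bimodule homomorphisms. -/
def bhom : Submodule k (M →ₗ[k] N) where
  carrier := {f | (∀ i x, f (M.L i x) = N.L i (f x)) ∧ ∀ i x, f (M.R i x) = N.R i (f x)}
  add_mem' := by
    rintro f g ⟨h1, h2⟩ ⟨h3, h4⟩
    exact ⟨fun i x => by simp [h1, h3], fun i x => by simp [h2, h4]⟩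
  zero_mem' := ⟨fun i x => by simp, fun i x => by simp⟩
  smul_mem' := by
    rintro c f ⟨h1, h2⟩
    exact ⟨fun i x => by simp [h1], fun i x => by simp [h2]⟩

/-- The bimodule homomorphisms. -/
abbrev BHom : Type _ := ↥(bhom M N)

variable {M N P M' N'}

/-- Composition. -/
def BHom.comp (g : BHom N P) (f : BHom M N) : BHom M P :=
  ⟨g.1 ∘ₗ f.1, fun i x => by simp [f.2.1, g.2.1], fun i x => by simp [f.2.2, g.2.2]⟩

variable (M) in
/-- The identity. -/
def BHom.id : BHom M M := ⟨LinearMap.id, fun _ _ => rfl, fun _ _ => rfl⟩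

variable (M N P) in
/-- The relations `(x e_i) ⊗ y = x ⊗ (e_i y)`. -/
def bal : Submodule k (M ⊗[k] N) :=
  Submodule.span k {z | ∃ (i : I) (x : M) (y : N), z = M.R i x ⊗ₜ[k] y - x ⊗ₜ[k] N.L i y}

lemma bal_map {f : M →ₗ[k] M'} {g : N →ₗ[k] N'} (hf : ∀ i x, f (M.R i x) = M'.R i (f x))
    (hg : ∀ i x, g (N.L i x) = N'.L i (g x)) :
    bal M N ≤ (bal M' N').comap (TensorProduct.map f g) := by
  refine Submodule.span_le.2 ?_
  rintro _ ⟨i, x, y, rfl⟩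
  refine Submodule.subset_span ⟨i, f x, g y, ?_⟩
  simp [hf, hg]

/-- The map `f ⊗ g` on balanced tensor products. -/
def mapT (f : M →ₗ[k] M') (g : N →ₗ[k] N') (hf : ∀ i x, f (M.R i x) = M'.R i (f x))
    (hg : ∀ i x, g (N.L i x) = N'.L i (g x)) :
    (M ⊗[k] N) ⧸ bal M N →ₗ[k] (M' ⊗[k] N') ⧸ bal M' N' :=
  (bal M N).mapQ (bal M' N') (TensorProduct.map f g) (bal_map hf hg)

variable (M N) in
/-- The class of `x ⊗ y` as a bilinear map. -/
def tmk : M →ₗ[k] N →ₗ[k] (M ⊗[k] N) ⧸ bal M N :=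
  (TensorProduct.mk k M N).compr₂ (bal M N).mkQ

lemma quot_ind {Q : (M ⊗[k] N) ⧸ bal M N → Prop} (h0 : Q 0) (h1 : ∀ x y, Q (tmk M N x y))
    (h2 : ∀ a b, Q a → Q b → Q (a + b)) (z) : Q z := by
  obtain ⟨z, rfl⟩ := Submodule.mkQ_surjective _ z
  induction z with
  | zero => simpa using h0
  | tmul x y => exact h1 x y
  | add a b ha hb => simpa using h2 _ _ ha hb

@[simp] lemma mapT_tmk (f : M →ₗ[k] M') (g : N →ₗ[k] N') (hf hg) (x : M) (y : N) :
    mapT f g hf hg (tmk M N x y) = tmk M' N' (f x) (g y) := rfl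

lemma tmk_bal (i : I) (x : M) (y : N) : tmk M N (M.R i x) y = tmk M N x (N.L i y) :=
  (Submodule.Quotient.eq _).2 (Submodule.subset_span ⟨i, x, y, rfl⟩)

variable (M N) in
/-- The tensor product `M ⊗_E N`. -/
def tensor : EBim.{w} k I where
  carrier := (M ⊗[k] N) ⧸ bal M N
  L i := mapT (M.L i) LinearMap.id (fun j x => M.comm i j x) fun _ _ => rfl
  R i := mapT LinearMap.id (N.R i) (fun _ _ => rfl) fun j x => (N.comm j i x).symm
  L_idem i x := by
    induction x using quot_ind with
    | h0 => simp
    | h1 x y => simp [M.L_idem]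
    | h2 a b ha hb => simp [ha, hb]
  R_idem i x := by
    induction x using quot_ind with
    | h0 => simp
    | h1 x y => simp [N.R_idem]
    | h2 a b ha hb => simp [ha, hb]
  L_orth i j x h := by
    induction x using quot_ind with
    | h0 => simp
    | h1 x y => simp [M.L_orth _ _ _ h]
    | h2 a b ha hb => simp [ha, hb]
  R_orth i j x h := by
    induction x using quot_ind with
    | h0 => simp
    | h1 x y => simp [N.R_orth _ _ _ h]
    | h2 a b ha hb => simp [ha, hb]
  L_sum x := by
    induction x using quot_ind with
    | h0 => simp
    | h1 x y =>
      simp only [mapT_tmk, LinearMap.id_apply]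
      rw [← LinearMap.sum_apply, ← map_sum, M.L_sum]
    | h2 a b ha hb => simp [ha, hb, Finset.sum_add_distrib]
  R_sum x := by
    induction x using quot_ind with
    | h0 => simp
    | h1 x y =>
      simp only [mapT_tmk, LinearMap.id_apply]
      rw [← map_sum, N.R_sum]
    | h2 a b ha hb => simp [ha, hb, Finset.sum_add_distrib]
  comm i j x := by
    induction x using quot_ind with
    | h0 => simp
    | h1 x y => simp
    | h2 a b ha hb => simp [ha, hb]

variable (M N) in
/-- The element `x ⊗ y` of `M ⊗_E N`, as a bilinear map. -/
def tm : M →ₗ[k] N →ₗ[k] tensor M N := tmk M N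

lemma tensor_ind {Q : tensor M N → Prop} (h0 : Q 0) (h1 : ∀ x y, Q (tm M N x y))
    (h2 : ∀ a b, Q a → Q b → Q (a + b)) (z) : Q z := quot_ind h0 h1 h2 z

@[simp] lemma L_tm (i : I) (x : M) (y : N) :
    (tensor M N).L i (tm M N x y) = tm M N (M.L i x) y := rfl

@[simp] lemma R_tm (i : I) (x : M) (y : N) :
    (tensor M N).R i (tm M N x y) = tm M N x (N.R i y) := rfl

lemma tm_bal (i : I) (x : M) (y : N) : tm M N (M.R i x) y = tm M N x (N.L i y) := tmk_bal i x y

/-- A linear map on `M ⊗_E N` which is compatible with the actions on the elements `x ⊗ y`. -/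
def BHom.ofTensor (F : tensor M N →ₗ[k] P)
    (hL : ∀ i x y, F (tm M N (M.L i x) y) = P.L i (F (tm M N x y)))
    (hR : ∀ i x y, F (tm M N x (N.R i y)) = P.R i (F (tm M N x y))) : BHom (tensor M N) P := by
  refine ⟨F, fun i z => ?_, fun i z => ?_⟩
  · induction z using tensor_ind with
    | h0 => simp
    | h1 x y => simp [hL]
    | h2 a b ha hb => simp only [map_add, ha, hb]
  · induction z using tensor_ind with
    | h0 => simp
    | h1 x y => simp [hR]
    | h2 a b ha hb => simp only [map_add, ha, hb]

/-- The map on `M ⊗_E N` induced by a balanced bilinear map. -/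
def tlift {W : Type*} [AddCommGroup W] [Module k W] (f : M →ₗ[k] N →ₗ[k] W)
    (hb : ∀ i x y, f (M.R i x) y = f x (N.L i y)) : tensor M N →ₗ[k] W :=
  (bal M N).liftQ (TensorProduct.lift f) <| by
    refine Submodule.span_le.2 ?_
    rintro _ ⟨i, x, y, rfl⟩
    simp [hb]

@[simp] lemma tlift_tm {W : Type*} [AddCommGroup W] [Module k W] (f : M →ₗ[k] N →ₗ[k] W)
    (hb) (x : M) (y : N) : tlift f hb (tm M N x y) = f x y :=
  TensorProduct.lift.tmul x y

/-- The bimodule homomorphism `f ⊗ g`. -/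
def tmap (f : BHom M M') (g : BHom N N') : BHom (tensor M N) (tensor M' N') :=
  BHom.ofTensor (mapT f.1 g.1 f.2.2 g.2.1)
    (fun i x y => congrArg (fun z => tm M' N' z (g.1 y)) (f.2.1 i x))
    (fun i x y => congrArg (fun z => tm M' N' (f.1 x) z) (g.2.2 i y))

variable (M N P) in
/-- The canonical map `(M ⊗ N) ⊗ P → M ⊗ (N ⊗ P)`. -/
def assoc : BHom (tensor (tensor M N) P) (tensor M (tensor N P)) :=
  BHom.ofTensor
    (tlift
      (tlift (LinearMap.mk₂ k (fun m n => tm M (tensor N P) m ∘ₗ tm N P n)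
          (fun _ _ _ => by ext; simp) (fun _ _ _ => by ext; simp)
          (fun _ _ _ => by ext; simp) (fun _ _ _ => by ext; simp))
        (fun i x y => by ext p; simp [tm_bal]))
      (fun i x y => by
        induction x using tensor_ind with
        | h0 => simp
        | h1 m n => simp [tm_bal]
        | h2 a b ha hb => simp [ha, hb]))
    (fun i x y => by
      induction x using tensor_ind with
      | h0 => simp
      | h1 m n => simp
      | h2 a b ha hb => simp only [map_add, LinearMap.add_apply, ha, hb])
    (fun i x y => by
      induction x using tensor_ind with
      | h0 => simp
      | h1 m n => simp
      | h2 a b ha hb => simp only [map_add, LinearMap.add_apply, ha, hb])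

variable (M N P) in
/-- The canonical map `M ⊗ (N ⊗ P) → (M ⊗ N) ⊗ P`. -/
def assocInv : BHom (tensor M (tensor N P)) (tensor (tensor M N) P) :=
  BHom.ofTensor
    (tlift
      (tlift (LinearMap.mk₂ k (fun n p => (tm (tensor M N) P).flip p ∘ₗ (tm M N).flip n)
          (fun _ _ _ => by ext; simp) (fun _ _ _ => by ext; simp)
          (fun _ _ _ => by ext; simp) (fun _ _ _ => by ext; simp))
        (fun i x y => by ext m; simp [← tm_bal])).flip
      (fun i x y => by
        induction y using tensor_ind with
        | h0 => simp
        | h1 m n => simp [tm_bal]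
        | h2 a b ha hb => simp only [map_add, ha, hb]))
    (fun i x y => by
      induction y using tensor_ind with
      | h0 => simp
      | h1 m n => simp
      | h2 a b ha hb => simp only [map_add, ha, hb])
    (fun i x y => by
      induction y using tensor_ind with
      | h0 => simp
      | h1 m n => simp
      | h2 a b ha hb => simp only [map_add, ha, hb])

lemma assoc_tm (m : M) (n : N) (p : P) :
    (assoc M N P).1 (tm _ _ (tm M N m n) p) = tm M _ m (tm N P n p) := by
  simp [assoc, BHom.ofTensor]

lemma assocInv_tm (m : M) (n : N) (p : P) :
    (assocInv M N P).1 (tm M _ m (tm N P n p)) = tm _ _ (tm M N m n) p := by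
  simp [assocInv, BHom.ofTensor]

/-! ## The singular Hochschild cochain complex of an algebra with split semisimple subalgebra -/

open Classical in
/-- An algebra `Λ` with a subalgebra `E` spanned by orthogonal idempotents `e i` with sum `1`, and
an algebra homomorphism onto `E` (written in coordinates) which is the identity on `E`. -/
structure Split (k : Type*) [Field k] (I : Type*) [Fintype I] (Λ : Type w) [Ring Λ]
    [Algebra k Λ] where
  e : I → Λ
  idem : CompleteOrthogonalIdempotents e
  aug : Λ →ₐ[k] (I → k)
  aug_e : ∀ i j, aug (e i) j = if i = j then 1 else 0

namespace Split

variable {Λ : Type w} [Ring Λ] [Algebra k Λ] (S : Split k I Λ)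

lemma e_mul_self (i : I) : S.e i * S.e i = S.e i := S.idem.idem i

lemma e_mul_ne (i j : I) (h : i ≠ j) : S.e i * S.e j = 0 := S.idem.ortho h

lemma aug_proj (a : Λ) : S.aug (∑ i, S.aug a i • S.e i) = S.aug a := by
  classical
  ext j
  simp [S.aug_e, Finset.sum_apply]

lemma e_mul_proj (j : I) (a : Λ) :
    ∑ i, S.aug (S.e j * a) i • S.e i = S.e j * ∑ i, S.aug a i • S.e i := by
  classical
  rw [Finset.mul_sum]
  refine Finset.sum_congr rfl fun i _ => ?_
  by_cases h : j = i
  · subst h; simp [S.aug_e, S.e_mul_self]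
  · simp [S.aug_e, h, S.e_mul_ne j i h]

lemma proj_mul_e (j : I) (a : Λ) :
    ∑ i, S.aug (a * S.e j) i • S.e i = (∑ i, S.aug a i • S.e i) * S.e j := by
  classical
  rw [Finset.sum_mul]
  refine Finset.sum_congr rfl fun i _ => ?_
  by_cases h : j = i
  · subst h; simp [S.aug_e, S.e_mul_self]
  · simp [S.aug_e, h, S.e_mul_ne i j (Ne.symm h)]

/-- A subspace of `Λ` which is stable under multiplication with the `e i`, as a bimodule. -/
def sub (W : Submodule k Λ) (hl : ∀ i, ∀ x ∈ W, S.e i * x ∈ W)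
    (hr : ∀ i, ∀ x ∈ W, x * S.e i ∈ W) : EBim.{w} k I where
  carrier := W
  L i := (LinearMap.mulLeft k (S.e i)).restrict (hl i)
  R i := (LinearMap.mulRight k (S.e i)).restrict (hr i)
  L_idem i x := Subtype.ext <| by
    change S.e i * (S.e i * x.1) = S.e i * x.1
    rw [← mul_assoc, S.e_mul_self]
  R_idem i x := Subtype.ext <| by
    change x.1 * S.e i * S.e i = x.1 * S.e i
    rw [mul_assoc, S.e_mul_self]
  L_orth i j x h := Subtype.ext <| by
    change S.e i * (S.e j * x.1) = 0
    rw [← mul_assoc, S.e_mul_ne i j h, zero_mul]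
  R_orth i j x h := Subtype.ext <| by
    change x.1 * S.e j * S.e i = 0
    rw [mul_assoc, S.e_mul_ne j i h.symm, mul_zero]
  L_sum x := Subtype.ext <| by
    rw [Submodule.coe_sum]
    change ∑ i, S.e i * x.1 = x.1
    rw [← Finset.sum_mul, S.idem.complete, one_mul]
  R_sum x := Subtype.ext <| by
    rw [Submodule.coe_sum]
    change ∑ i, x.1 * S.e i = x.1
    rw [← Finset.mul_sum, S.idem.complete, mul_one]
  comm i j x := Subtype.ext (mul_assoc (S.e i) x.1 (S.e j)).symm

/-- `Λ` as a bimodule over `E`. -/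
def alg : EBim.{w} k I where
  carrier := Λ
  L i := LinearMap.mulLeft k (S.e i)
  R i := LinearMap.mulRight k (S.e i)
  L_idem i x := by simp [← mul_assoc, S.e_mul_self]
  R_idem i x := by simp [mul_assoc, S.e_mul_self]
  L_orth i j x h := by simp [← mul_assoc, S.e_mul_ne i j h]
  R_orth i j x h := by simp [mul_assoc, S.e_mul_ne j i h.symm]
  L_sum x := by simp [← Finset.sum_mul, S.idem.complete]
  R_sum x := by simp [← Finset.mul_sum, S.idem.complete]
  comm i j x := by simp [mul_assoc]

/-- The subspace `E`. -/
def Espan : Submodule k Λ := Submodule.span k (Set.range S.e)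

/-- `E` as a bimodule over itself. -/
def base : EBim.{w} k I := S.sub S.Espan
  (fun i x hx => by
    induction hx using Submodule.span_induction with
    | mem x hx =>
      obtain ⟨j, rfl⟩ := hx
      by_cases h : i = j
      · subst h; rw [S.e_mul_self]; exact Submodule.subset_span ⟨i, rfl⟩
      · rw [S.e_mul_ne i j h]; exact Submodule.zero_mem _
    | zero => simp
    | add x y _ _ hx hy => rw [mul_add]; exact Submodule.add_mem _ hx hy
    | smul c x _ hx => rw [mul_smul_comm]; exact Submodule.smul_mem _ _ hx)
  (fun i x hx => by
    induction hx using Submodule.span_induction with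
    | mem x hx =>
      obtain ⟨j, rfl⟩ := hx
      by_cases h : j = i
      · subst h; rw [S.e_mul_self]; exact Submodule.subset_span ⟨j, rfl⟩
      · rw [S.e_mul_ne j i h]; exact Submodule.zero_mem _
    | zero => simp
    | add x y _ _ hx hy => rw [add_mul]; exact Submodule.add_mem _ hx hy
    | smul c x _ hx => rw [smul_mul_assoc]; exact Submodule.smul_mem _ _ hx)

/-- The quotient `Λ/E`, identified with the kernel of the projection of `Λ` onto `E`. -/
def bar : EBim.{w} k I := S.sub (LinearMap.ker S.aug.toLinearMap)
  (fun i x hx => by simp_all) (fun i x hx => by simp_all)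

/-- The element `e i` of `E`. -/
def baseE (i : I) : S.base := ⟨S.e i, Submodule.subset_span ⟨i, rfl⟩⟩

/-- The inclusion of `E` into `Λ`. -/
def inclE : BHom S.base S.alg :=
  ⟨S.Espan.subtype, fun _ _ => rfl, fun _ _ => rfl⟩

/-- The inclusion of `Λ̄` into `Λ`. -/
def inclBar : BHom S.bar S.alg :=
  ⟨(LinearMap.ker S.aug.toLinearMap).subtype, fun _ _ => rfl, fun _ _ => rfl⟩

/-- The linear map `a ↦ a - ∑ aug(a)_i e_i`. -/
def projLin : Λ →ₗ[k] Λ :=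
  LinearMap.id - ∑ i, (LinearMap.proj i ∘ₗ S.aug.toLinearMap).smulRight (S.e i)

lemma projLin_apply (a : Λ) : S.projLin a = a - ∑ i, S.aug a i • S.e i := by
  simp [projLin]

/-- The projection of `Λ` onto `Λ̄` with kernel `E`. -/
def projBar : BHom S.alg S.bar := by
  refine ⟨LinearMap.codRestrict (LinearMap.ker S.aug.toLinearMap) S.projLin ?_, ?_, ?_⟩
  · intro (a : Λ)
    change S.aug (S.projLin a) = 0
    rw [projLin_apply, map_sub, S.aug_proj, sub_self]
  · intro i (x : Λ)
    refine Subtype.ext ?_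
    change S.projLin (S.e i * x) = S.e i * S.projLin x
    rw [projLin_apply, projLin_apply, S.e_mul_proj, mul_sub]
  · intro i (x : Λ)
    refine Subtype.ext ?_
    change S.projLin (x * S.e i) = S.projLin x * S.e i
    rw [projLin_apply, projLin_apply, S.proj_mul_e, sub_mul]

/-- The multiplication `Λ ⊗_E Λ → Λ`. -/
def mul : BHom (tensor S.alg S.alg) S.alg :=
  BHom.ofTensor (tlift (M := S.alg) (N := S.alg) (LinearMap.mul k Λ)
    (fun i (x y : Λ) => mul_assoc x (S.e i) y))
    (fun i (x y : Λ) => mul_assoc (S.e i) x y)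
    (fun i (x y : Λ) => (mul_assoc x y (S.e i)).symm)

/-- The multiplication `Λ̄ ⊗_E Λ̄ → Λ̄`, `ā ⊗ b̄ ↦ (ab)‾`. -/
def mulBar : BHom (tensor S.bar S.bar) S.bar :=
  S.projBar.comp (S.mul.comp (tmap S.inclBar S.inclBar))

variable (M N : EBim.{w} k I)

/-- `Λ̄ ⊗_E ⋯ ⊗_E Λ̄ ⊗_E M` with `n` factors `Λ̄`. -/
def pow : ℕ → EBim.{w} k I
  | 0 => M
  | n + 1 => tensor S.bar (pow n)

/-- The `n`-fold tensor power of `Λ̄` over `E` (with a redundant last factor `E`). -/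
abbrev T (n : ℕ) : EBim.{w} k I := S.pow S.base n

/-- The right noncommutative differential `p`-forms `Λ̄ ⊗_E ⋯ ⊗_E Λ̄ ⊗_E Λ`. -/
abbrev Om (p : ℕ) : EBim.{w} k I := S.pow S.alg p

variable {M N}

/-- The map `1 ⊗ f` with one more factor `Λ̄`. -/
def cons {a b : ℕ} (f : BHom (S.pow M a) (S.pow N b)) :
    BHom (S.pow M (a + 1)) (S.pow N (b + 1)) :=
  tmap (BHom.id S.bar) f

lemma cons_add {a b : ℕ} (f g : BHom (S.pow M a) (S.pow N b)) :
    S.cons (f + g) = S.cons f + S.cons g := by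
  refine Subtype.ext (LinearMap.ext fun z => ?_)
  change (tmap _ _).1 z = (tmap _ _).1 z + (tmap _ _).1 z
  induction z using tensor_ind with
  | h0 => simp
  | h1 x y => exact map_add (tm S.bar (S.pow N b) x) (f.1 y) (g.1 y)
  | h2 a b ha hb => rw [map_add, map_add, map_add, ha, hb]; abel

lemma cons_smul {a b : ℕ} (c : k) (f : BHom (S.pow M a) (S.pow N b)) :
    S.cons (c • f) = c • S.cons f := by
  refine Subtype.ext (LinearMap.ext fun z => ?_)
  change (tmap _ _).1 z = c • (tmap _ _).1 z
  induction z using tensor_ind with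
  | h0 => simp
  | h1 x y => exact map_smul (tm S.bar (S.pow N b) x) c (f.1 y)
  | h2 a b ha hb => rw [map_add, map_add, ha, hb, smul_add]

variable (M) in
/-- The map `ā ⊗ b̄ ⊗ x ↦ (ab)‾ ⊗ x`. -/
def merge (n : ℕ) : BHom (S.pow M (n + 2)) (S.pow M (n + 1)) :=
  (tmap S.mulBar (BHom.id (S.pow M n))).comp (assocInv S.bar S.bar (S.pow M n))

/-- The map `1^{⊗ n} ⊗ f`. -/
def powMap (f : BHom M N) : ∀ n, BHom (S.pow M n) (S.pow N n)
  | 0 => f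
  | n + 1 => tmap (BHom.id S.bar) (powMap f n)

variable (M)

/-- Regrouping of tensor factors. -/
def glue (n : ℕ) : ∀ m, BHom (S.pow (S.pow M n) m) (S.pow M (n + m))
  | 0 => BHom.id _
  | m + 1 => tmap (BHom.id S.bar) (glue n m)

/-- Regrouping of tensor factors. -/
def split (n : ℕ) : ∀ m, BHom (S.pow M (n + m)) (S.pow (S.pow M n) m)
  | 0 => BHom.id _
  | m + 1 => tmap (BHom.id S.bar) (split n m)

/-- The identity, if the numbers of tensor factors agree. -/
def recast (a b : ℕ) : BHom (S.pow M a) (S.pow M b) :=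
  if h : a = b then h ▸ BHom.id (S.pow M a) else 0

lemma one_mem : (1 : Λ) ∈ S.Espan := by
  rw [← S.idem.complete]
  exact Submodule.sum_mem _ fun i _ => Submodule.subset_span ⟨i, rfl⟩

/-- The unit element of `E`. -/
def baseOne : S.base := (⟨1, S.one_mem⟩ : S.Espan)

lemma baseOne_comm (i : I) : S.base.R i S.baseOne = S.base.L i S.baseOne :=
  Subtype.ext ((one_mul (S.e i)).trans (mul_one (S.e i)).symm)

/-- The canonical map `M → E ⊗_E M`. -/
def unitor : BHom M (tensor S.base M) := by
  refine ⟨tm S.base M S.baseOne, fun i x => ?_, fun i x => ?_⟩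
  · rw [← tm_bal, baseOne_comm, L_tm]
  · rw [R_tm]

/-- The canonical map `Λ̄^{⊗ n} ⊗_E M → (Λ̄^{⊗ n}) ⊗_E M`. -/
def detach : ∀ n, BHom (S.pow M n) (tensor (S.T n) M)
  | 0 => S.unitor M
  | n + 1 => (assocInv _ _ _).comp (tmap (BHom.id S.bar) (detach n))

variable (N) in
/-- The canonical map `(Λ̄^{⊗ n} ⊗_E N) ⊗_E M → Λ̄^{⊗ n} ⊗_E (N ⊗_E M)`. -/
def attach : ∀ n, BHom (tensor (S.pow N n) M) (S.pow (tensor N M) n)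
  | 0 => BHom.id _
  | n + 1 => (tmap (BHom.id S.bar) (attach n)).comp (assoc _ _ _)

variable {M}

/-- For `f : Λ̄^{⊗ n} → Λ̄^{⊗ q} ⊗ Λ` and `h : Λ ⊗ M → N`, the map
`(1^{⊗ q} ⊗ h)(f ⊗ 1) : Λ̄^{⊗ n} ⊗ M → Λ̄^{⊗ q} ⊗ N`. -/
def ext {n q : ℕ} (f : BHom (S.T n) (S.Om q)) (h : BHom (tensor S.alg M) N) :
    BHom (S.pow M n) (S.pow N q) :=
  (S.powMap h q).comp ((S.attach M S.alg q).comp ((tmap f (BHom.id M)).comp (S.detach M n)))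

/-! ### The cochain complex -/

/-- The cochains: bimodule homomorphisms from `Λ̄^{⊗ m}` to the differential `p`-forms; their
degree is `m - p`. -/
abbrev Coch (m p : ℕ) : Type _ := BHom (S.T m) (S.Om p)

/-- The map `f ↦ 1 ⊗ f`; evaluation on elements produces the Koszul sign `(-1)^{|f|}`. -/
def theta (m p : ℕ) : S.Coch m p →ₗ[k] S.Coch (m + 1) (p + 1) where
  toFun f := ksign k ((m : ℤ) - p) • S.cons f
  map_add' f g := by
    rw [← smul_add, S.cons_add]
  map_smul' c f := by
    rw [RingHom.id_apply, smul_comm c, S.cons_smul]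

/-- The underlying space of the singular Hochschild cochain complex. -/
abbrev CsgE : Type _ := SeqColim.Colim S.theta

/-- The part of degree `n`. -/
def CsgEDeg (n : ℤ) : Submodule k S.CsgE := SeqColim.piece S.theta n

/-- The class of a cochain. -/
def cls {m p : ℕ} (f : S.Coch m p) : S.CsgE := SeqColim.cl S.theta m p f

/-- The left action `a₀ ▸ (a₁ ⊗ ⋯ ⊗ a_p ⊗ a_{p+1})` of `Λ` on the differential forms, as a map on
`Ω^{p+1} = Λ̄ ⊗_E Ω^p`; it satisfies `a₀ ▸ (a₁ ⊗ ω) = (a₀ a₁)‾ ⊗ ω - a₀ ⊗ (a₁ ▸ ω)`. -/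
def lact : ∀ p, BHom (S.Om (p + 1)) (S.Om p)
  | 0 => S.mul.comp (tmap S.inclBar (BHom.id S.alg))
  | p + 1 => S.merge S.alg p - S.cons (lact p)

/-- The map `a₁ ⊗ ⋯ ⊗ a_{m+1} ↦ ∑ (-1)^{i-1} a₁ ⊗ ⋯ ⊗ (a_i a_{i+1})‾ ⊗ ⋯ ⊗ a_{m+1}`, where `i`
runs from `1` to `m`. -/
def contr : ∀ m, BHom (S.T (m + 1)) (S.T m)
  | 0 => 0
  | m + 1 => S.merge S.base m - S.cons (contr m)

/-- The map `a₁ ⊗ ⋯ ⊗ a_{m+1} ↦ f(a₁ ⊗ ⋯ ⊗ a_m) a_{m+1}`. -/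
def ract {m p : ℕ} (f : S.Coch m p) : BHom (S.T (m + 1)) (S.Om p) :=
  (S.ext f S.mul).comp ((S.powMap (S.mul.comp (tmap S.inclBar S.inclE)) m).comp
    ((S.split S.base 1 m).comp (S.recast S.base (m + 1) (1 + m))))

/-- The Hochschild differential. -/
def diff {m p : ℕ} (f : S.Coch m p) : S.Coch (m + 1) p :=
  -(ksign k ((m : ℤ) - p) • (S.lact p).comp (S.cons f))
  + ksign k ((m : ℤ) - p) • BHom.comp f (S.contr m)
  + ksign k ((m : ℤ) - p + m) • S.ract f

/-- The cup product
`(1^{⊗ (p + q)} ⊗ μ)(1^{⊗ q} ⊗ f ⊗ 1)(1^{⊗ m} ⊗ g)`; evaluation on elements produces the sign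
`(-1)^{mn + pq}`. -/
def cup {m p n q : ℕ} (f : S.Coch m p) (g : S.Coch n q) : S.Coch (n + m) (p + q) :=
  ksign k ((m : ℤ) * n + p * q) •
    ((S.glue S.alg p q).comp
      ((S.powMap (S.ext f S.mul) q).comp
        ((S.split S.alg m q).comp
          ((S.recast S.alg (q + m) (m + q)).comp
            ((S.glue S.alg q m).comp ((S.powMap g m).comp (S.split S.base n m)))))))

/-! ### The brace operation

The summands of the brace operation are compositions of maps which act on a row of strands, each
carrying a factor `Λ̄`, followed by a last strand carrying `Λ`. Since cochains are identified
with their images under `f ↦ 1 ⊗ f`, all compositions are taken with sufficiently many additional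
strands on the left. -/

/-- A cochain with its numbers of inputs and outputs. -/
structure Cochain where
  m : ℕ
  p : ℕ
  f : S.Coch m p

/-- A map from the row of `N` strands (without `Λ`) to the row of `A` strands followed by `Λ`. -/
structure State (N : ℕ) where
  A : ℕ
  F : BHom (S.T N) (S.Om A)

variable {S}

/-- Compose with `1^{⊗ L} ⊗ (1^{⊗ q} ⊗ π) y ⊗ 1^{⊗ R} ⊗ 1_Λ`, where `π : Λ → Λ̄` is the projection:
the cochain `y` is applied to the strands which have exactly `R` strands (and `Λ`) on their right.
-/
def State.inner {N : ℕ} (s : S.State N) (y : S.Cochain) (R : ℕ) : S.State N where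
  A := R + 1 + y.p + (s.A - (R + y.m))
  F := (S.glue S.alg (R + 1 + y.p) (s.A - (R + y.m))).comp
    ((S.powMap (S.glue S.alg (R + 1) y.p) (s.A - (R + y.m))).comp
      ((S.powMap (S.ext (M := S.pow S.alg R) (N := S.pow S.alg (R + 1)) y.f
          (tmap S.projBar (BHom.id (S.pow S.alg R)))) (s.A - (R + y.m))).comp
        ((S.powMap (S.split S.alg R y.m) (s.A - (R + y.m))).comp
          ((S.split S.alg (R + y.m) (s.A - (R + y.m))).comp
            ((S.recast S.alg s.A (R + y.m + (s.A - (R + y.m)))).comp s.F)))))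

/-- Compose with `1^{⊗ (L + p)} ⊗ μ` after `1^{⊗ L} ⊗ x ⊗ 1_Λ`: the cochain `x` is applied to the
last strands before `Λ`. -/
def State.outer {N : ℕ} (s : S.State N) (x : S.Cochain) : S.State N where
  A := x.p + (s.A - x.m)
  F := (S.glue S.alg x.p (s.A - x.m)).comp
    ((S.powMap (S.ext x.f S.mul) (s.A - x.m)).comp
      ((S.split S.alg x.m (s.A - x.m)).comp
        ((S.recast S.alg s.A (x.m + (s.A - x.m))).comp s.F)))

/-- The number `m + n_1 + ⋯ + n_c` of inputs. -/
def inputs (x : S.Cochain) {c : ℕ} (y : Fin c → S.Cochain) : ℕ := x.m + ∑ r, (y r).m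

/-- The number `p + q_1 + ⋯ + q_c + c` of outputs. -/
def outputs (x : S.Cochain) {c : ℕ} (y : Fin c → S.Cochain) : ℕ := x.p + (∑ r, (y r).p) + c

/-- A summand of the brace operation without sign. First the `c - b` last of the `y` are applied,
where the output of `y` number `c - 1 - r` is connected with the input of `x` at position `i r`
from the right; then `x` is applied; finally the `b` first of the `y` are applied, `y` number `r`
to the left of `l r` output strands of `x`. All positions count from `0`. -/
def braceTerm (x : S.Cochain) {c : ℕ} (y : Fin c → S.Cochain) (b : Fin (c + 1))
    (l : Fin b → Fin x.p) (i : Fin (c - b) → Fin x.m) : S.Coch (inputs x y) (outputs x y) :=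
  let s₀ : S.State (inputs x y) := ⟨inputs x y, S.powMap S.inclE _⟩
  let s₁ := (List.finRange (c - b)).foldl
    (fun s r => s.inner (y ⟨c - 1 - r, by omega⟩) (i r)) s₀
  let s₂ := s₁.outer x
  let s₃ := (List.finRange b).reverse.foldl (fun s r => s.inner (y ⟨r, by omega⟩) (l r)) s₂
  (S.recast S.alg s₃.A (outputs x y)).comp s₃.F

/-- The number `n' = n - q - 1`. -/
def pdeg (y : S.Cochain) : ℤ := (y.m : ℤ) - y.p - 1

/-- The exponent of the Koszul sign of a summand of the brace operation. -/
def braceExp (x : S.Cochain) {c : ℕ} (y : Fin c → S.Cochain) (b : Fin (c + 1))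
    (l : Fin b → Fin x.p) (i : Fin (c - b) → Fin x.m) : ℤ :=
  ((x.m : ℤ) - x.p + ∑ r, pdeg (y r)) * outputs x y + ((x.m : ℤ) - x.p) * x.p
  + (∑ r, pdeg (y r) * (y r).p) + (∑ r, ((y r).p : ℤ))
  + (∑ r : Fin b, ((∑ j ∈ Finset.univ.filter (fun j : Fin c => (j : ℕ) ≤ r), pdeg (y j)) + ((l r : ℕ) + 1 : ℤ) - 1)
      * pdeg (y ⟨r, by omega⟩))
  + ∑ r : Fin (c - b), ((∑ j ∈ Finset.univ.filter (fun j : Fin c => (j : ℕ) ≤ c - 1 - r), pdeg (y j))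
      + ((x.m : ℤ) - x.p) - ((i r : ℕ) + 1 : ℤ) - 1) * pdeg (y ⟨c - 1 - r, by omega⟩)

/-- The brace operation `x{y_1, …, y_c}`. -/
def brace (x : S.Cochain) {c : ℕ} (y : Fin c → S.Cochain) : S.Coch (inputs x y) (outputs x y) :=
  ∑ b : Fin (c + 1),
    ∑ l : Fin b → Fin x.p with Monotone l,
      ∑ i : Fin (c - b) → Fin x.m with StrictMono i,
        ksign k (b + braceExp x y b l i) • braceTerm x y b l i

variable (S)

/-- The operations on the singular Hochschild cochain complex: `m_1` is the Hochschild
differential, `m_2` the cup product, and the braces are the above ones. -/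
structure IsSingularHochschild (B : BInf.BInfty S.CsgEDeg) : Prop where
  diff : ∀ (m p : ℕ) (f : S.Coch m p), B.m 1 ![S.cls f] = S.cls (S.diff f)
  cup : ∀ (m p n q : ℕ) (f : S.Coch m p) (g : S.Coch n q),
    B.m 2 ![S.cls f, S.cls g] = S.cls (S.cup f g)
  brace : ∀ (x : S.Cochain) (c : ℕ) (y : Fin c → S.Cochain), c ≠ 0 →
    B.toOps.brace ((x.m : ℤ) - x.p) (fun j => ((y j).m : ℤ) - (y j).p) (S.cls x.f)
      (fun j => S.cls (y j).f) = S.cls (Split.brace x y)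

end Split

end Hoch

namespace PathAlgebra

/-! ## The path algebra and its quotient with radical square zero -/

universe w v u

variable (k : Type w) [Field k] (V : Type u) [Quiver.{v} V]

/-- A path in the quiver, with its source and its target. -/
abbrev TotalPath : Type _ := Σ a b : V, Quiver.Path a b

/-- The underlying space of the path algebra. -/
def PathAlg : Type _ := TotalPath V →₀ k

instance : AddCommGroup (PathAlg k V) := inferInstanceAs (AddCommGroup (TotalPath V →₀ k))
instance : Module k (PathAlg k V) := inferInstanceAs (Module k (TotalPath V →₀ k))

variable {V}

/-- A path as an element of the path algebra. -/
def ofPath {a b : V} (p : Quiver.Path a b) : PathAlg k V :=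
  Finsupp.single (⟨a, b, p⟩ : TotalPath V) (1 : k)

open Classical in
/-- The product of two paths `P`, `Q`: first along `Q`, then along `P`; zero if they are not
composable. -/
def pathMul (P Q : TotalPath V) : PathAlg k V :=
  if h : Q.2.1 = P.1 then ofPath k (Q.2.2.comp (P.2.2.cast h.symm rfl)) else 0

/-- The product of the path algebra. -/
def mulLin : PathAlg k V →ₗ[k] PathAlg k V →ₗ[k] PathAlg k V :=
  Finsupp.linearCombination k fun P => Finsupp.linearCombination k fun Q => pathMul k P Q

instance : Mul (PathAlg k V) := ⟨fun x y => mulLin k x y⟩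

lemma mulLin_ofPath {a b c d : V} (p : Quiver.Path a b) (q : Quiver.Path c d) :
    mulLin k (ofPath k p) (ofPath k q) = pathMul k ⟨a, b, p⟩ ⟨c, d, q⟩ := by
  simp only [mulLin, ofPath]
  erw [Finsupp.linearCombination_single, one_smul]
  erw [Finsupp.linearCombination_single, one_smul]

lemma ofPath_mul {a b c : V} (p : Quiver.Path b c) (q : Quiver.Path a b) :
    ofPath k p * ofPath k q = ofPath k (q.comp p) := by
  refine (mulLin_ofPath k p q).trans ?_
  simp [pathMul]

lemma ofPath_mul_ne {a b c d : V} (p : Quiver.Path a b) (q : Quiver.Path c d) (h : d ≠ a) :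
    ofPath k p * ofPath k q = 0 := by
  refine (mulLin_ofPath k p q).trans ?_
  simp [pathMul, h]

variable {k} in
lemma path_ind {Q : PathAlg k V → Prop} (h0 : Q 0)
    (h1 : ∀ (a b : V) (p : Quiver.Path a b), Q (ofPath k p))
    (h2 : ∀ x y, Q x → Q y → Q (x + y)) (h3 : ∀ (c : k) x, Q x → Q (c • x)) (x) : Q x := by
  refine Finsupp.induction_linear (motive := Q) x h0 (fun f g => h2 f g) ?_
  rintro ⟨a, b, p⟩ c
  have := h3 c _ (h1 a b p)
  rw [ofPath] at this
  erw [Finsupp.smul_single, smul_eq_mul, mul_one] at this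
  exact this

lemma mul_add' (x y z : PathAlg k V) : x * (y + z) = x * y + x * z := map_add (mulLin k x) y z
lemma add_mul' (x y z : PathAlg k V) : (x + y) * z = x * z + y * z :=
  LinearMap.map_add₂ (mulLin k) x y z
lemma mul_zero' (x : PathAlg k V) : x * 0 = 0 := map_zero (mulLin k x)
lemma zero_mul' (x : PathAlg k V) : 0 * x = 0 := LinearMap.map_zero₂ (mulLin k) x
lemma mul_smul' (c : k) (x y : PathAlg k V) : x * (c • y) = c • (x * y) :=
  map_smul (mulLin k x) c y
lemma smul_mul' (c : k) (x y : PathAlg k V) : (c • x) * y = c • (x * y) :=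
  LinearMap.map_smul₂ (mulLin k) c x y

lemma mul_assoc' (x y z : PathAlg k V) : x * y * z = x * (y * z) := by
  induction x using path_ind with
  | h0 => simp only [zero_mul']
  | h2 a b ha hb => simp only [add_mul', ha, hb]
  | h3 c a ha => simp only [smul_mul', ha]
  | h1 a b p =>
    induction y using path_ind with
    | h0 => simp only [zero_mul', mul_zero']
    | h2 a b ha hb => simp only [add_mul', mul_add', ha, hb]
    | h3 c a ha => simp only [smul_mul', mul_smul', ha]
    | h1 c d q =>
      induction z using path_ind with
      | h0 => simp only [mul_zero']
      | h2 a b ha hb => simp only [mul_add', ha, hb]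
      | h3 c a ha => simp only [mul_smul', ha]
      | h1 e f r =>
        by_cases h : d = a
        · subst h
          by_cases h' : f = c
          · subst h'
            simp only [ofPath_mul, Quiver.Path.comp_assoc]
          · rw [ofPath_mul, ofPath_mul_ne k _ _ h', ofPath_mul_ne k _ _ h', mul_zero']
        · rw [ofPath_mul_ne k _ _ h, zero_mul']
          by_cases h' : f = c
          · subst h'
            rw [ofPath_mul, ofPath_mul_ne k _ _ h]
          · rw [ofPath_mul_ne k _ _ h', mul_zero']

variable [Fintype V]

instance : One (PathAlg k V) := ⟨∑ a : V, ofPath k (Quiver.Path.nil : Quiver.Path a a)⟩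

lemma one_mul' (x : PathAlg k V) : 1 * x = x := by
  change (mulLin k (∑ a : V, ofPath k (Quiver.Path.nil : Quiver.Path a a))) x = x
  rw [map_sum, LinearMap.sum_apply]
  change ∑ a : V, ofPath k (Quiver.Path.nil : Quiver.Path a a) * x = x
  induction x using path_ind with
  | h0 => simp only [mul_zero', Finset.sum_const_zero]
  | h2 a b ha hb => simp only [mul_add', Finset.sum_add_distrib, ha, hb]
  | h3 c a ha => simp only [mul_smul', ← Finset.smul_sum, ha]
  | h1 a b p =>
    rw [Finset.sum_eq_single b]
    · rw [ofPath_mul, Quiver.Path.comp_nil]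
    · intro c _ h
      exact ofPath_mul_ne k _ _ h.symm
    · simp

lemma mul_one' (x : PathAlg k V) : x * 1 = x := by
  change (mulLin k x) (∑ a : V, ofPath k (Quiver.Path.nil : Quiver.Path a a)) = x
  rw [map_sum]
  change ∑ a : V, x * ofPath k (Quiver.Path.nil : Quiver.Path a a) = x
  induction x using path_ind with
  | h0 => simp only [zero_mul', Finset.sum_const_zero]
  | h2 a b ha hb => simp only [add_mul', Finset.sum_add_distrib, ha, hb]
  | h3 c a ha => simp only [smul_mul', ← Finset.smul_sum, ha]
  | h1 a b p =>
    rw [Finset.sum_eq_single a]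
    · rw [ofPath_mul, Quiver.Path.nil_comp]
    · intro c _ h
      exact ofPath_mul_ne k _ _ h
    · simp

instance : Ring (PathAlg k V) :=
  { (inferInstance : AddCommGroup (PathAlg k V)), (inferInstance : Mul (PathAlg k V)),
    (inferInstance : One (PathAlg k V)) with
    left_distrib := mul_add' k
    right_distrib := add_mul' k
    zero_mul := zero_mul' k
    mul_zero := mul_zero' k
    mul_assoc := mul_assoc' k
    one_mul := one_mul' k
    mul_one := mul_one' k }

instance : Algebra k (PathAlg k V) := Algebra.ofModule (smul_mul' k) (mul_smul' k)

/-- The coefficients at the trivial paths, as a linear map. -/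
def coeffLin : PathAlg k V →ₗ[k] (V → k) :=
  LinearMap.pi fun a => Finsupp.lapply (⟨a, a, Quiver.Path.nil⟩ : TotalPath V)

open Classical in
lemma coeffLin_ofPath {a b : V} (p : Quiver.Path a b) (c : V) :
    coeffLin k (ofPath k p) c =
      if (⟨a, b, p⟩ : TotalPath V) = ⟨c, c, Quiver.Path.nil⟩ then 1 else 0 :=
  Finsupp.single_apply

lemma coeffLin_mul (x y : PathAlg k V) :
    coeffLin k (x * y) = coeffLin k x * coeffLin k y := by
  classical
  induction x using path_ind with
  | h0 => simp
  | h2 a b ha hb => simp only [add_mul, map_add, ha, hb]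
  | h3 c a ha => simp only [map_smul, ha, smul_mul_assoc]
  | h1 a b p =>
    induction y using path_ind with
    | h0 => simp
    | h2 a b ha hb => simp only [mul_add, map_add, ha, hb]
    | h3 c a ha => simp only [map_smul, ha, mul_smul_comm]
    | h1 c d q =>
      ext i
      rw [Pi.mul_apply, coeffLin_ofPath, coeffLin_ofPath]
      by_cases h : d = a
      · subst h
        rw [ofPath_mul, coeffLin_ofPath]
        cases p with
        | cons p e => rw [if_neg (by rintro ⟨⟩), if_neg (by rintro ⟨⟩), zero_mul]
        | nil =>
          cases q with
          | cons q e =>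
            rw [if_neg (c := (⟨c, _, (q.cons e).comp Quiver.Path.nil⟩ : TotalPath V) = _)
              (by rintro ⟨⟩), if_neg (c := (⟨c, _, q.cons e⟩ : TotalPath V) = _)
              (by rintro ⟨⟩), mul_zero]
          | nil =>
            rw [Quiver.Path.comp_nil]
            split_ifs <;> simp
      · rw [ofPath_mul_ne k _ _ h, map_zero, Pi.zero_apply]
        by_cases h1 : (⟨a, b, p⟩ : TotalPath V) = ⟨i, i, Quiver.Path.nil⟩
        · rw [if_neg (c := (⟨c, d, q⟩ : TotalPath V) = _) (fun h2 => h ?_), mul_zero]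
          cases h1
          cases h2
          rfl
        · rw [if_neg h1, zero_mul]

lemma coeffLin_one : coeffLin k (1 : PathAlg k V) = 1 := by
  classical
  change coeffLin k (∑ a : V, ofPath k (Quiver.Path.nil : Quiver.Path a a)) = 1
  ext i
  rw [map_sum, Finset.sum_apply, Finset.sum_eq_single i]
  · rw [coeffLin_ofPath, if_pos rfl, Pi.one_apply]
  · intro c _ h
    rw [coeffLin_ofPath, if_neg]
    intro h'
    cases h'
    exact h rfl
  · simp

/-- The coefficients at the trivial paths, as an algebra homomorphism. -/
def coeff : PathAlg k V →ₐ[k] (V → k) :=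
  AlgHom.ofLinearMap (coeffLin k) (coeffLin_one k) (coeffLin_mul k)

variable (V) in
/-- The two-sided ideal `J` spanned by the paths of positive length. -/
def J : Ideal (PathAlg k V) := RingHom.ker (coeff (V := V) k)

instance : (J k V).IsTwoSided := inferInstanceAs (RingHom.ker (coeff (V := V) k)).IsTwoSided

/-- The elements of `J` are the linear combinations of paths of positive length. -/
lemma mem_J (x : PathAlg k V) :
    x ∈ J k V ↔ x ∈ Submodule.span k {y | ∃ (a b : V) (p : Quiver.Path a b),
      0 < p.length ∧ y = ofPath k p} := by
  classical
  constructor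
  · have key : ∀ x : PathAlg k V, x - ∑ i, coeffLin k x i • ofPath k (Quiver.Path.nil (a := i)) ∈
        Submodule.span k {y | ∃ (a b : V) (p : Quiver.Path a b),
          0 < p.length ∧ y = ofPath k p} := by
      intro x
      induction x using path_ind with
      | h0 => simp
      | h2 a b ha hb =>
        have := Submodule.add_mem _ ha hb
        simp only [map_add, Pi.add_apply, add_smul, Finset.sum_add_distrib]
        convert this using 1
        abel
      | h3 c a ha =>
        have := Submodule.smul_mem _ c ha
        simpa only [map_smul, Pi.smul_apply, smul_sub, Finset.smul_sum, smul_assoc] using this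
      | h1 a b p =>
        cases p with
        | nil =>
          rw [Finset.sum_eq_single a]
          · rw [coeffLin_ofPath, if_pos rfl, one_smul, sub_self]
            exact Submodule.zero_mem _
          · intro c _ h
            rw [coeffLin_ofPath, if_neg, zero_smul]
            intro h'
            cases h'
            exact h rfl
          · simp
        | cons p e =>
          rw [Finset.sum_eq_zero, sub_zero]
          · exact Submodule.subset_span ⟨_, _, p.cons e, Nat.succ_pos p.length, rfl⟩
          · intro c _
            rw [coeffLin_ofPath, if_neg, zero_smul]
            rintro ⟨⟩
    intro hx
    have h0 : coeffLin k x = 0 := hx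
    simpa [h0] using key x
  · intro hx
    change coeffLin k x = 0
    induction hx using Submodule.span_induction with
    | mem y hy =>
      obtain ⟨a, b, p, hp, rfl⟩ := hy
      ext c
      rw [coeffLin_ofPath, if_neg, Pi.zero_apply]
      intro h'
      cases h'
      exact absurd hp (lt_irrefl _)
    | zero => exact map_zero _
    | add y z _ _ hy hz => rw [map_add, hy, hz, add_zero]
    | smul c y _ hy => rw [map_smul, hy, smul_zero]

variable (V) in
/-- The algebra `Λ = kQ/J²`. -/
abbrev RadSqZero : Type _ := PathAlg k V ⧸ J k V ^ 2

/-- The class of a path in `Λ`. -/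
def pathCls {a b : V} (p : Quiver.Path a b) : RadSqZero k V := Ideal.Quotient.mk _ (ofPath k p)

variable (V) in
/-- `Λ` with the subalgebra `E` spanned by the classes of the trivial paths. -/
def radSplit : Hoch.Split k V (RadSqZero k V) where
  e a := pathCls k (Quiver.Path.nil : Quiver.Path a a)
  idem := by
    refine ⟨⟨fun a => ?_, fun a b h => ?_⟩, ?_⟩
    · change _ * _ = _
      rw [pathCls, ← map_mul, ofPath_mul, Quiver.Path.comp_nil]
    · change pathCls k _ * pathCls k _ = 0
      rw [pathCls, pathCls, ← map_mul, ofPath_mul_ne k _ _ (Ne.symm h), map_zero]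
    · change ∑ a : V, Ideal.Quotient.mk _ (ofPath k _) = 1
      rw [← map_sum]
      exact map_one _
  aug := Ideal.Quotient.liftₐ _ (coeff k) fun x hx => by
    have : x ∈ J k V := Ideal.pow_le_self two_ne_zero hx
    exact this
  aug_e i j := by
    classical
    have : coeffLin k (ofPath k (Quiver.Path.nil : Quiver.Path i i)) j = if i = j then 1 else 0 := by
      rw [coeffLin_ofPath]
      by_cases h : i = j
      · subst h; simp
      · rw [if_neg h, if_neg]
        intro h'
        cases h'
        exact h rfl
    exact this

/-- The class of an arrow in `Λ̄`. -/
def arrowCls {a b : V} (e : a ⟶ b) : (radSplit k V).bar :=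
  (⟨pathCls k e.toPath, by
    change coeffLin k (ofPath k e.toPath) = 0
    ext c
    rw [coeffLin_ofPath, if_neg, Pi.zero_apply]
    rintro ⟨⟩⟩ : LinearMap.ker (radSplit k V).aug.toLinearMap)

end PathAlgebra

namespace PathAlgebra

/-! ## The comparison map -/

open Comb

universe w v u

variable (k : Type w) [Field k] {V : Type u} [Quiver.{v} V] [Fintype V]

/-- The tensor `α_n ⊗ ⋯ ⊗ α_1 ⊗ x` for a path `α_n ⋯ α_1`. -/
def pathTensor (M : Hoch.EBim k V) (x : M) :
    ∀ {a b : V} (p : Quiver.Path a b), (radSplit k V).pow M p.length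
  | _, _, .nil => x
  | _, _, .cons p e => Hoch.tm (radSplit k V).bar ((radSplit k V).pow M p.length)
      (arrowCls k e) (pathTensor M x p)

/-- The tensor `α_m ⊗ ⋯ ⊗ α_1` in the tensor power of `Λ̄` over `E`; for `m = 0` this is the
idempotent of the source. -/
def monomial (P : TotalPath V) : (radSplit k V).T P.2.2.length :=
  pathTensor k (radSplit k V).base ((radSplit k V).baseE P.1) P.2.2

/-- The tensor `β_p ⊗ ⋯ ⊗ β_1 ⊗ λ` in the differential `p`-forms, where `λ` is the class of a
path `q`. -/
def form {a b c d : V} (p : Quiver.Path a b) (q : Quiver.Path c d) :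
    (radSplit k V).Om p.length :=
  pathTensor k (radSplit k V).alg (pathCls k q) p

/-- The cochain `f` sends the tensor of the path `P` to `y`, and the tensors of all other paths of
the same length to zero. -/
def IsDual (P : TotalPath V) {p : ℕ} (f : (radSplit k V).Coch P.2.2.length p)
    (y : (radSplit k V).Om p) : Prop :=
  f.1 (monomial k P) = y ∧
  ∀ P' : TotalPath V, P'.2.2.length = P.2.2.length → P' ≠ P →
    f.1 (((radSplit k V).recast (radSplit k V).base P'.2.2.length P.2.2.length).1
      (monomial k P')) = 0

/-- The exponent `(m - p) p + (m - p)(m - p + 1)/2`. -/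
def kappaExp (m p : ℕ) : ℤ :=
  ((m : ℤ) - p) * p + ((m : ℤ) - p) * ((m : ℤ) - p + 1) / 2

variable [∀ a b : V, Fintype (a ⟶ b)]

/-- The linear part of a morphism is the map `κ`. -/
structure IsKappa {B : BInf.BInfty (CsgDeg V k)} {B' : BInf.BInfty (radSplit k V).CsgEDeg}
    (F : BInf.BInftyHom B B') : Prop where
  par : ∀ z : ParPath V, ∃ f : (radSplit k V).Coch z.top.length z.bot.length,
    IsDual k ⟨z.src, z.tgt, z.top⟩ f
      (ksign k (kappaExp z.top.length z.bot.length) •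
        form k z.bot (Quiver.Path.nil : Quiver.Path z.src z.src)) ∧
    F.f 1 ![cls0 k z] = (radSplit k V).cls f
  shift : ∀ x : ParPathPos V, ∃ f : (radSplit k V).Coch x.top.length x.rest.length,
    IsDual k ⟨x.src, x.tgt, x.top⟩ f
      (ksign k (kappaExp x.top.length x.rest.length) • form k x.rest x.b0.toPath) ∧
    F.f 1 ![cls1 k x.toPar] = (radSplit k V).cls f

end PathAlgebra

end

noncomputable section

open Comb BInf PathAlgebra SeqColim
open Finset (sum_congr range sum_eq_zero smul_sum mem_range sum_eq_single mem_filter sum_add_distrib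
  mul_sum mem_univ sum_mul Icc sum_sub_distrib mem_Icc sum_range_succ' sum_filter sum_ite_eq'
  sum_range_one filter_true_of_mem)
open List (ofFn finRange map_cons length_cons length_map length_drop mem_cons_self length_take ofFn_succ
  map_ofFn take_zero take_append_drop drop_zero length_nil prod_cons map_append length_append
  mem_cons_of_mem length_singleton take_succ_cons drop_succ_cons nil_append cons_append)
open Submodule (smul_mem subset_span span span_induction mem_iSup_of_mem)
open Module.End (mul_apply)
open LinearMap (comp_apply)
open Quiver (Path)

universe w v u

set_option linter.unusedSectionVars false

/-! ### Colimits -/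

namespace SeqColim

open scoped DirectSum Classical

variable {k : Type*} [Field k] {G : ℕ → ℕ → Type*} [∀ m p, AddCommGroup (G m p)]
  [∀ m p, Module k (G m p)] {θ : ∀ m p, G m p →ₗ[k] G (m + 1) (p + 1)}
  {M : Type*} [AddCommGroup M] [Module k M]

lemma cl_succ (m p : ℕ) (x : G m p) : cl θ (m + 1) (p + 1) (θ m p x) = cl θ m p x :=
  ((Submodule.Quotient.eq (rel θ)).2 (subset_span ⟨m, p, x, rfl⟩)).symm

lemma colim_induction {Q : Colim θ → Prop} (h0 : Q 0) (h1 : ∀ m p x, Q (cl θ m p x))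
    (h2 : ∀ a b, Q a → Q b → Q (a + b)) (z) : Q z := by
  obtain ⟨z, rfl⟩ := Submodule.mkQ_surjective _ z
  induction z using DirectSum.induction_on with
  | zero => simpa using h0
  | of i x => exact h1 i.1 i.2 x
  | add a b ha hb => simpa using h2 _ _ ha hb

/-- The universal property of the colimit. -/
def colimLift (f : ∀ m p, G m p →ₗ[k] M) (hf : ∀ m p x, f (m + 1) (p + 1) (θ m p x) = f m p x) :
    Colim θ →ₗ[k] M :=
  (rel θ).liftQ (DirectSum.toModule k (ℕ × ℕ) M fun i => f i.1 i.2) <| by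
    refine Submodule.span_le.2 ?_; rintro _ ⟨m, p, x, rfl⟩; simp [hf]

@[simp] lemma colimLift_cl (f : ∀ m p, G m p →ₗ[k] M) (hf) (m p : ℕ) (x : G m p) :
    colimLift f hf (cl θ m p x) = f m p x := by
  change DirectSum.toModule k (ℕ × ℕ) M (fun i => f i.1 i.2)
    (DirectSum.lof k (ℕ × ℕ) (fun i => G i.1 i.2) (m, p) x) = _
  rw [DirectSum.toModule_lof]

lemma exists_cl_add {m p : ℕ} (x : G m p) (j : ℕ) : ∃ x', cl θ (m + j) (p + j) x' = cl θ m p x := by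
  induction j with
  | zero => exact ⟨x, rfl⟩
  | succ j ih => exact let ⟨x', h⟩ := ih; ⟨θ _ _ x', (cl_succ _ _ _).trans h⟩

lemma cl_mem_piece {m p : ℕ} (x : G m p) : cl θ m p x ∈ piece θ ((m : ℤ) - p) :=
  mem_iSup_of_mem m (mem_iSup_of_mem p (mem_iSup_of_mem rfl ⟨x, rfl⟩))

/-- Each homogeneous element of the colimit is the class of one element. -/
lemma exists_of_mem_piece {n : ℤ} {z : Colim θ} (hz : z ∈ piece θ n) :
    ∃ (m p : ℕ) (x : G m p), (m : ℤ) - p = n ∧ cl θ m p x = z := by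
  have key (i : ℕ × ℕ) (z) (hz : z ∈ (⨆ _ : (i.1 : ℤ) - i.2 = n, LinearMap.range (cl θ i.1 i.2))) :
      ∃ (m p : ℕ) (x : G m p), (m : ℤ) - p = n ∧ cl θ m p x = z := by
    by_cases h : (i.1 : ℤ) - i.2 = n
    · rw [iSup_pos h] at hz
      obtain ⟨x, rfl⟩ := hz
      exact ⟨_, _, x, h, rfl⟩
    · rw [iSup_neg h, Submodule.mem_bot] at hz
      exact hz ▸ ⟨n.toNat, (-n).toNat, 0, by omega, map_zero _⟩
  rw [piece, ← iSup_prod (f := fun i : ℕ × ℕ =>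
    ⨆ _ : (i.1 : ℤ) - i.2 = n, LinearMap.range (cl θ i.1 i.2))] at hz
  induction hz using Submodule.iSup_induction' with
  | mem i z hz => exact key i z hz
  | zero => exact key (n.toNat, (-n).toNat) 0 (zero_mem _)
  | add z z' _ _ h h' =>
    obtain ⟨m, p, x, hn, rfl⟩ := h
    obtain ⟨m', p', x', hn', rfl⟩ := h'
    rcases le_total m m' with h | h
    · obtain ⟨j, rfl⟩ := Nat.exists_eq_add_of_le h
      obtain rfl : p' = p + j := by push_cast at hn'; omega
      obtain ⟨x1, h1⟩ := exists_cl_add (θ := θ) x j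
      exact ⟨_, _, x1 + x', hn', by rw [map_add, h1]⟩
    · obtain ⟨j, rfl⟩ := Nat.exists_eq_add_of_le h
      obtain rfl : p = p' + j := by push_cast at hn; omega
      obtain ⟨x1, h1⟩ := exists_cl_add (θ := θ) x' j
      exact ⟨_, _, x + x1, hn, by rw [map_add, h1]⟩

lemma iSup_piece : ⨆ n, piece θ n = ⊤ := by
  refine eq_top_iff.2 fun z _ => ?_
  induction z using colim_induction with
  | h0 => exact zero_mem _
  | h1 m p x => exact mem_iSup_of_mem _ (cl_mem_piece x)
  | h2 a b ha hb => exact add_mem (ha trivial) (hb trivial)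

end SeqColim

/-! ### Graded embeddings -/

section Graded

open scoped Classical

variable {k : Type*} [Field k] {A M : Type*} [AddCommGroup A] [Module k A] [AddCommGroup M]
  [Module k M] {𝒜 : ℤ → Submodule k A} {D : ℤ → Submodule k M} {F : A →ₗ[k] M}

/-- Independence of a family of subspaces. -/
def GradInd (D : ℤ → Submodule k M) : Prop :=
  ∀ (s : Finset ℤ) (f : ℤ → M), (∀ d ∈ s, f d ∈ D d) → ∑ d ∈ s, f d = 0 → ∀ d ∈ s, f d = 0

lemma exists_sum_of_iSup (ht : ⨆ d, 𝒜 d = ⊤) (z : A) :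
    ∃ (s : Finset ℤ) (f : ℤ → A), (∀ d, f d ∈ 𝒜 d) ∧ ∑ d ∈ s, f d = z := by
  have hz : z ∈ ⨆ d, 𝒜 d := ht ▸ Submodule.mem_top
  obtain ⟨f, hf, h⟩ := (Submodule.mem_iSup_iff_exists_finsupp _ _).1 hz
  exact ⟨f.support, f, hf, h⟩

variable (ht : ⨆ d, 𝒜 d = ⊤) (hD : GradInd D) (hF : ∀ d, ∀ x ∈ 𝒜 d, F x ∈ D d)
  (hi : ∀ d, ∀ x ∈ 𝒜 d, F x = 0 → x = 0)

include ht hD hF hi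

lemma injective_of_graded : Function.Injective F := by
  refine (injective_iff_map_eq_zero F).2 fun z hz => ?_
  obtain ⟨s, f, hf, rfl⟩ := exists_sum_of_iSup ht z
  rw [map_sum] at hz
  exact sum_eq_zero fun d hd => hi d _ (hf d) (hD s _ (fun d _ => hF d _ (hf d)) hz d hd)

lemma mem_iff_of_graded (d : ℤ) (x : A) : x ∈ 𝒜 d ↔ F x ∈ D d := by
  refine ⟨hF d x, fun h => ?_⟩
  obtain ⟨s, f, hf, rfl⟩ := exists_sum_of_iSup ht x
  have h0 c (hc : c ∈ s) (hcd : c ≠ d) : f c = 0 := by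
    refine hi c _ (hf c) ?_
    have := hD (insert d s) (fun c => (if c ∈ s then F (f c) else 0) -
      if c = d then F (∑ d ∈ s, f d) else 0) ?_ ?_ c (Finset.mem_insert_of_mem hc)
    · simpa [hc, hcd] using this
    · refine fun c _ => sub_mem ?_ ?_ <;> split_ifs with hc
      exacts [hF _ _ (hf c), zero_mem _, hc ▸ h, zero_mem _]
    · rw [sum_sub_distrib, sum_ite_eq', if_pos (Finset.mem_insert_self _ _), map_sum,
        sub_eq_zero, Finset.sum_ite_mem, Finset.inter_eq_right.2 (Finset.subset_insert _ _)]
  refine sum_mem fun c hc => ?_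
  by_cases hcd : c = d
  · exact hcd ▸ hf c
  · rw [h0 c hc hcd]; exact zero_mem _

lemma isInternal_of_graded : DirectSum.IsInternal 𝒜 := by
  refine DirectSum.isInternal_submodule_of_iSupIndep_of_iSup_eq_top ?_ ht
  refine iSupIndep_of_dfinsupp_lsum_injective _ ((injective_iff_map_eq_zero _).2 fun f hf => ?_)
  refine DFinsupp.ext fun d => Subtype.ext ?_
  rw [DFinsupp.lsum_apply_apply, DFinsupp.sumAddHom_apply, DFinsupp.sum] at hf
  by_cases hd : d ∈ f.support
  · refine hi d _ (f d).2 (hD f.support (fun d => F (f d)) (fun d _ => hF d _ (f d).2) ?_ d hd)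
    rw [← map_sum]
    exact (congrArg F hf).trans (map_zero F)
  simp_all

end Graded

/-! ### Signs -/

section Signs

variable {k : Type*} [Field k]

lemma ksign_zero : ksign k 0 = 1 := by simp [ksign]

lemma ksign_add (a b : ℤ) : ksign k (a + b) = ksign k a * ksign k b := by
  simp [ksign, Int.negOnePow_add]

lemma ksign_one : ksign k 1 = -1 := by simp [ksign]

lemma ksign_even {a : ℤ} (h : Even a) : ksign k a = 1 := by
  simp [ksign, Int.negOnePow_even a h]

lemma ksign_odd {a : ℤ} (h : Odd a) : ksign k a = -1 := by
  simp [ksign, Int.negOnePow_odd a h]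

lemma ksign_congr {a b : ℤ} (h : (a : ZMod 2) = b) : ksign k a = ksign k b := by
  have h' : Even (a - b) := by
    have := (ZMod.intCast_zmod_eq_zero_iff_dvd (a - b) 2).1 (by rw [Int.cast_sub, h, sub_self])
    exact even_iff_two_dvd.2 (by exact_mod_cast this)
  have : a = b + (a - b) := by ring
  rw [this, ksign_add, ksign_even h', mul_one]

lemma ksign_mul_self (a : ℤ) : ksign k a * ksign k a = 1 := by
  rw [← ksign_add, ksign_even ⟨a, rfl⟩]

lemma ksign_smul_smul {M : Type*} [AddCommGroup M] [Module k M] (a b : ℤ) (x : M) :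
    ksign k a • ksign k b • x = ksign k (a + b) • x := by
  rw [smul_smul, ksign_add]

lemma ksign_smul_self {M : Type*} [AddCommGroup M] [Module k M] (a : ℤ) (x : M) :
    ksign k a • ksign k a • x = x := by
  rw [smul_smul, ksign_mul_self, one_smul]

lemma ksign_succ (a : ℤ) : ksign k (a + 1) = - ksign k a := by
  rw [ksign_add, ksign_one, mul_neg_one]

lemma ksign_ne_zero (a : ℤ) : ksign k a ≠ 0 := fun h => by
  have := ksign_mul_self (k := k) a
  simp [h] at this

end Signs

instance {V : Type u} [Quiver.{v} V] [Fintype V] [∀ a b : V, Fintype (a ⟶ b)] :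
    Fintype (Quiver.Total V) :=
  Fintype.ofEquiv (Σ a b : V, a ⟶ b)
    { toFun x := ⟨x.1, x.2.1, x.2.2⟩
      invFun x := ⟨x.left, x.right, x.hom⟩
      left_inv _ := rfl
      right_inv _ := rfl }

lemma sum_total {V : Type u} [Quiver.{v} V] [Fintype V] [∀ a b : V, Fintype (a ⟶ b)]
    {M : Type*} [AddCommMonoid M] (f : Quiver.Total V → M) :
    ∑ e, f e = ∑ a : V, ∑ b : V, ∑ e : (a ⟶ b), f ⟨a, b, e⟩ := by
  refine Eq.trans (Equiv.sum_comp (⟨fun x => ⟨x.1, x.2.1, x.2.2⟩, fun x => ⟨x.left, x.right, x.hom⟩,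
    fun _ => rfl, fun _ => rfl⟩ : (Σ a b : V, a ⟶ b) ≃ Quiver.Total V) f).symm ?_
  rw [Fintype.sum_sigma]
  exact sum_congr rfl fun a _ => Fintype.sum_sigma _

/-! ### The Leavitt algebra of the quiver -/

section Leavitt

open scoped Classical

variable (k : Type w) [Field k] (V : Type u) [Quiver.{v} V] [Fintype V]
  [∀ a b : V, Fintype (a ⟶ b)]

/-- A family of elements of an algebra satisfying the defining relations of the Leavitt path
algebra: the `out e` are the ghost arrows, the `inn e` the arrows. -/
structure LeavittFamily {S : Type*} [Ring S] (g : Letter V → S) : Prop where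
  vert_mul : ∀ a b, g (.vert a) * g (.vert b) = if a = b then g (.vert a) else 0
  sum_vert : ∑ a, g (.vert a) = 1
  vert_out : ∀ e : Quiver.Total V, g (.vert e.left) * g (.out e) = g (.out e)
  out_vert : ∀ e : Quiver.Total V, g (.out e) * g (.vert e.right) = g (.out e)
  vert_inn : ∀ e : Quiver.Total V, g (.vert e.right) * g (.inn e) = g (.inn e)
  inn_vert : ∀ e : Quiver.Total V, g (.inn e) * g (.vert e.left) = g (.inn e)
  inn_out : ∀ e f : Quiver.Total V, g (.inn e) * g (.out f) = if e = f then g (.vert e.right) else 0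
  sum_out_inn : ∑ e : Quiver.Total V, g (.out e) * g (.inn e) = 1

local notation "ι" => FreeAlgebra.ι k

/-- The defining relations of the Leavitt path algebra. -/
inductive LeavittRel : FreeAlgebra k (Letter V) → FreeAlgebra k (Letter V) → Prop
  | vert_mul (a b) : LeavittRel (ι (.vert a) * ι (.vert b)) (if a = b then ι (.vert a) else 0)
  | sum_vert : LeavittRel (∑ a, ι (.vert a)) 1
  | vert_out (e : Quiver.Total V) : LeavittRel (ι (.vert e.left) * ι (.out e)) (ι (.out e))
  | out_vert (e : Quiver.Total V) : LeavittRel (ι (.out e) * ι (.vert e.right)) (ι (.out e))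
  | vert_inn (e : Quiver.Total V) : LeavittRel (ι (.vert e.right) * ι (.inn e)) (ι (.inn e))
  | inn_vert (e : Quiver.Total V) : LeavittRel (ι (.inn e) * ι (.vert e.left)) (ι (.inn e))
  | inn_out (e f : Quiver.Total V) :
      LeavittRel (ι (.inn e) * ι (.out f)) (if e = f then ι (.vert e.right) else 0)
  | sum_out_inn : LeavittRel (∑ e : Quiver.Total V, ι (.out e) * ι (.inn e)) 1

/-- The Leavitt path algebra of the quiver (for a quiver without sinks). -/
def Leavitt : Type _ := RingQuot (LeavittRel k V)

namespace Leavitt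

instance : Ring (Leavitt k V) := inferInstanceAs (Ring (RingQuot (LeavittRel k V)))
instance : Algebra k (Leavitt k V) := inferInstanceAs (Algebra k (RingQuot (LeavittRel k V)))

variable {V}

/-- The projection from the free algebra. -/
def mk : FreeAlgebra k (Letter V) →ₐ[k] Leavitt k V := RingQuot.mkAlgHom k (LeavittRel k V)

/-- The generators. -/
def gen (x : Letter V) : Leavitt k V := mk k (ι x)

variable {k} in
lemma mk_rel {x y : FreeAlgebra k (Letter V)} (h : LeavittRel k V x y) : mk k x = mk k y :=
  RingQuot.mkAlgHom_rel k h

lemma family : LeavittFamily V (gen k (V := V)) where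
  vert_mul a b := (map_mul _ _ _).symm.trans <| (mk_rel (.vert_mul a b)).trans <| by
    split_ifs <;> simp [gen]
  sum_vert := by simpa [gen] using mk_rel (k := k) (.sum_vert (V := V))
  vert_out e := (map_mul _ _ _).symm.trans (mk_rel (.vert_out e))
  out_vert e := (map_mul _ _ _).symm.trans (mk_rel (.out_vert e))
  vert_inn e := (map_mul _ _ _).symm.trans (mk_rel (.vert_inn e))
  inn_vert e := (map_mul _ _ _).symm.trans (mk_rel (.inn_vert e))
  inn_out e f := (map_mul _ _ _).symm.trans <| (mk_rel (.inn_out e f)).trans <| by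
    split_ifs <;> simp [gen]
  sum_out_inn := by simpa [gen] using mk_rel (k := k) (.sum_out_inn (V := V))

variable {k}

/-- The universal property. -/
def lift {S : Type*} [Ring S] [Algebra k S] (g : Letter V → S) (h : LeavittFamily V g) :
    Leavitt k V →ₐ[k] S :=
  RingQuot.liftAlgHom k ⟨FreeAlgebra.lift k g, by
    intro x y r
    cases r <;> simp [h.vert_mul, h.sum_vert, h.vert_out, h.out_vert, h.vert_inn, h.inn_vert,
      h.inn_out, h.sum_out_inn, apply_ite (FreeAlgebra.lift k g)]⟩

@[simp] lemma lift_gen {S : Type*} [Ring S] [Algebra k S] (g : Letter V → S)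
    (h : LeavittFamily V g) (x : Letter V) : lift (k := k) g h (gen k x) = g x :=
  (RingQuot.liftAlgHom_mkAlgHom_apply ..).trans (FreeAlgebra.lift_ι_apply ..)

lemma induction {Q : Leavitt k V → Prop} (hg : ∀ x, Q (gen k x)) (ha : ∀ c, Q (algebraMap k _ c))
    (hm : ∀ x y, Q x → Q y → Q (x * y)) (hs : ∀ x y, Q x → Q y → Q (x + y)) (x) : Q x := by
  obtain ⟨x, rfl⟩ := RingQuot.mkAlgHom_surjective k (LeavittRel k V) x
  induction x using FreeAlgebra.induction with
  | grade0 c => rw [AlgHom.commutes]; exact ha c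
  | grade1 x => exact hg x
  | mul a b iha ihb => rw [map_mul]; exact hm _ _ iha ihb
  | add a b iha ihb => rw [map_add]; exact hs _ _ iha ihb

/-- A linear map between two representations is equivariant if it commutes with the action of
the vertices and of the arrows. -/
lemma intertwine {X Y : Type*} [AddCommGroup X] [Module k X] [AddCommGroup Y] [Module k Y]
    {A : Leavitt k V →ₐ[k] Module.End k X} {B : Leavitt k V →ₐ[k] Module.End k Y} {T : X →ₗ[k] Y}
    (hv : ∀ a x, T (A (gen k (.vert a)) x) = B (gen k (.vert a)) (T x))
    (hi : ∀ a x, T (A (gen k (.inn a)) x) = B (gen k (.inn a)) (T x)) (u : Leavitt k V) (x : X) :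
    T (A u x) = B u (T x) := by
  induction u using induction generalizing x with
  | hg u =>
    cases u with
    | vert a => exact hv a x
    | inn a => exact hi a x
    | out a =>
      have h1 : T (A (gen k (.out a)) x) = B (∑ e, gen k (.out e) * gen k (.inn e))
          (T (A (gen k (.out a)) x)) := by
        rw [(family k).sum_out_inn, map_one]; rfl
      have h2 : A (gen k (.inn a)) (A (gen k (.out a)) x) = A (gen k (.vert a.right)) x := by
        rw [← mul_apply, ← map_mul, (family k).inn_out, if_pos rfl]
      rw [h1, map_sum, LinearMap.sum_apply, sum_eq_single a]
      · rw [map_mul, mul_apply, ← hi, h2, hv, ← mul_apply, ← map_mul,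
          (family k).out_vert]
      · intro e _ he
        rw [map_mul, mul_apply, ← hi, ← mul_apply, ← map_mul,
          (family k).inn_out, if_neg he, map_zero]
        simp
      · simp
  | ha c => simp [Algebra.algebraMap_eq_smul_one]
  | hm u v hu hv => rw [map_mul, map_mul, mul_apply, mul_apply, hu, hv]
  | hs u v hu hv => simp [hu, hv]

variable (k)

/-- The element of the Leavitt algebra given by a sequence of letters. -/
def val (l : List (Letter V)) : Leavitt k V := (l.map (gen k)).prod

@[simp] lemma val_nil : val k ([] : List (Letter V)) = 1 := rfl
@[simp] lemma val_cons (x : Letter V) (l) : val k (x :: l) = gen k x * val k l := by simp [val]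
@[simp] lemma val_append (l l' : List (Letter V)) : val k (l ++ l') = val k l * val k l' := by
  simp [val]

/-! ### Grading -/

/-- The degree of a letter: an arrow has degree `1` and a ghost arrow has degree `-1`. -/
def ldeg : Letter V → ℤ
  | .vert _ => 0
  | .out _ => -1
  | .inn _ => 1

variable (V) in
/-- The elements of degree `d`. -/
def deg (d : ℤ) : Submodule k (Leavitt k V) :=
  span k {x | ∃ l : List (Letter V), (l.map ldeg).sum = d ∧ x = val k l}

variable {k}

lemma val_mem_deg (l : List (Letter V)) : val k l ∈ deg k V (l.map ldeg).sum :=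
  subset_span ⟨l, rfl, rfl⟩

lemma gen_mem_deg (x : Letter V) : gen k x ∈ deg k V (ldeg x) := by
  simpa using val_mem_deg [x]

lemma one_mem_deg : (1 : Leavitt k V) ∈ deg k V 0 := by
  simpa using val_mem_deg []

lemma mul_mem_deg {d e : ℤ} {x y : Leavitt k V} (hx : x ∈ deg k V d) (hy : y ∈ deg k V e) :
    x * y ∈ deg k V (d + e) := by
  induction hx, hy using Submodule.span_induction₂ with
  | mem_mem x y hx hy =>
    obtain ⟨l, rfl, rfl⟩ := hx
    obtain ⟨l', rfl, rfl⟩ := hy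
    rw [← val_append, ← List.sum_append, ← map_append]
    exact val_mem_deg _
  | zero_left y hy => rw [zero_mul]; exact zero_mem _
  | zero_right y hy => rw [mul_zero]; exact zero_mem _
  | add_left x y z _ _ _ h1 h2 => rw [add_mul]; exact add_mem h1 h2
  | add_right x y z _ _ _ h1 h2 => rw [mul_add]; exact add_mem h1 h2
  | smul_left r x y _ _ h => rw [smul_mul_assoc]; exact smul_mem _ _ h
  | smul_right r x y _ _ h => rw [mul_smul_comm]; exact smul_mem _ _ h

/-- The homomorphism which multiplies each letter with a given power of a unit. -/
lemma family_grade {S : Type*} [Ring S] (t : ℤ → S) (t0 : t 0 = 1)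
    (ta : ∀ a b, t (a + b) = t a * t b) (g : Letter V → S) (h : LeavittFamily V g)
    (hc : ∀ a x, t a * g x = g x * t a) : LeavittFamily V (fun x => t (ldeg x) * g x) := by
  have key : ∀ x y, t (ldeg x) * g x * (t (ldeg y) * g y) = t (ldeg x + ldeg y) * (g x * g y) := by
    intro x y
    rw [mul_assoc, ← mul_assoc (g x), ← hc, ta]; simp only [mul_assoc]
  constructor <;> intros <;> (try simp only [key]) <;>
    simp [ldeg, t0, h.vert_mul, h.sum_vert, h.vert_out, h.out_vert, h.vert_inn, h.inn_vert, h.inn_out,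
      h.sum_out_inn]

/-- The parity automorphism. -/
def parity : Leavitt k V →ₐ[k] Leavitt k V :=
  lift _ (family_grade (fun d => algebraMap k _ (ksign k d)) (by simp [ksign_zero])
    (fun a b => by rw [ksign_add, map_mul]) _ (family k) fun a x => Algebra.commutes _ _)

lemma parity_of_mem {d : ℤ} {x : Leavitt k V} (hx : x ∈ deg k V d) :
    parity x = ksign k d • x := by
  induction hx using span_induction with
  | mem x hx =>
    obtain ⟨l, rfl, rfl⟩ := hx
    induction l with
    | nil => simp [ksign_zero]
    | cons a l ih =>
      rw [val_cons, map_mul, ih, parity, lift_gen, map_cons, List.sum_cons, ksign_add,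
        mul_smul_comm, ← Algebra.smul_def, smul_mul_assoc, smul_smul, mul_comm (ksign k _)]
  | zero => simp
  | add x y _ _ h1 h2 => rw [map_add, h1, h2, smul_add]
  | smul c x _ h => rw [map_smul, h, smul_comm]

open AddMonoidAlgebra (single singleZeroRingHom single_mul_single smul_single) in
/-- The coaction recording the degree. -/
def coact : Leavitt k V →ₐ[k] AddMonoidAlgebra (Leavitt k V) ℤ :=
  lift _ (family_grade (S := AddMonoidAlgebra (Leavitt k V) ℤ)
    (fun d => single d 1) rfl
    (fun a b => by rw [single_mul_single, one_mul])
    (fun x => single 0 (gen k x))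
    (by
      have h := family k (V := V)
      have hm : ∀ x y, (single 0 x : AddMonoidAlgebra (Leavitt k V) ℤ) *
          single 0 y = single 0 (x * y) := fun x y => by
        rw [single_mul_single, add_zero]
      constructor <;> intros <;> (try simp only [hm])
      · rw [h.vert_mul]; split_ifs <;> simp
      · exact (map_sum singleZeroRingHom _ _).symm.trans (congrArg _ h.sum_vert)
      · rw [h.vert_out]
      · rw [h.out_vert]
      · rw [h.vert_inn]
      · rw [h.inn_vert]
      · rw [h.inn_out]; split_ifs <;> simp
      · exact (map_sum singleZeroRingHom _ _).symm.trans (congrArg _ h.sum_out_inn))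
    fun a x => by
      rw [single_mul_single, single_mul_single, add_comm,
        one_mul, mul_one])

open AddMonoidAlgebra (single single_mul_single smul_single) in
lemma coact_of_mem {d : ℤ} {x : Leavitt k V} (hx : x ∈ deg k V d) :
    coact x = single d x := by
  induction hx using span_induction with
  | mem x hx =>
    obtain ⟨l, rfl, rfl⟩ := hx
    induction l with
    | nil => rw [val_nil, map_one]; rfl
    | cons a l ih =>
      rw [val_cons, map_mul, ih, coact, lift_gen, map_cons, List.sum_cons,
        single_mul_single, single_mul_single, one_mul, add_zero]
  | zero => simp
  | add x y _ _ h1 h2 => rw [map_add, h1, h2]; simp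
  | smul c x _ h => rw [map_smul, h, smul_single]

/-- Independence of the graded pieces. -/
lemma eq_zero_of_sum_eq_zero (s : Finset ℤ) (f : ℤ → Leavitt k V) (hf : ∀ d ∈ s, f d ∈ deg k V d)
    (h : ∑ d ∈ s, f d = 0) (d : ℤ) (hd : d ∈ s) : f d = 0 := by
  have h1 := congrArg coact h
  rw [map_sum, sum_congr rfl fun d hd => coact_of_mem (hf d hd), map_zero] at h1
  simpa only [AddMonoidAlgebra.coeff_zero, Finsupp.coe_zero, Pi.zero_apply, AddMonoidAlgebra.coeff_sum, AddMonoidAlgebra.coeff_single, Finsupp.finsetSum_apply,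
    Finsupp.single_apply, sum_ite_eq', hd, if_true] using
    congrArg (fun z : AddMonoidAlgebra (Leavitt k V) ℤ => z.coeff d) h1

end Leavitt
end Leavitt

namespace Leavitt

open scoped Classical

variable {k : Type w} [Field k] {V : Type u} [Quiver.{v} V] [Fintype V]
  [∀ a b : V, Fintype (a ⟶ b)]

local notation "𝐋" => Leavitt k V
local notation "ε" => ksign k
local notation "𝐐" => Quiver.Total V
local notation "𝐒" => radSplit k V
local notation "𝔳" a:max => gen k (Letter.vert a)
local notation "𝔦" a:max => gen k (Letter.inn a)
local notation "𝔬" a:max => gen k (Letter.out a)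

/-! ### Insertion of words into elements of the Leavitt algebra -/

variable (k V) in
/-- The diagonal subalgebra `∏ e L e`, consisting of the elements commuting with the vertices. -/
def diag : Subalgebra k 𝐋 :=
  Subalgebra.centralizer k (Set.range fun a : V => 𝔳 a)

lemma mem_diag {x : 𝐋} : x ∈ diag k V ↔ ∀ a, 𝔳 a * x = x * 𝔳 a :=
  (Subalgebra.mem_centralizer_iff k).trans Set.forall_mem_range

section Operators

variable {ι : Type*} (p : ι → ℤ) (y : ι → diag k V)
  {M : Type*} [AddCommGroup M] [Module k M] (ρ : Leavitt k V →ₐ[k] Module.End k M)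

/-- The degree of a word. -/
def wt (c : List ι) : ℤ := (c.map p).sum

@[simp] lemma wt_nil : wt p [] = 0 := rfl
@[simp] lemma wt_cons (a : ι) (c) : wt p (a :: c) = p a + wt p c := by simp [wt]
@[simp] lemma wt_append (c c' : List ι) : wt p (c ++ c') = wt p c + wt p c' := by simp [wt]

lemma wt_take_drop {p : ι → ℤ} (c : List ι) (i : ℕ) :
    wt p c = wt p (c.take i) + wt p (c.drop i) := by
  rw [← wt_append, take_append_drop]

variable (k M) in
/-- The sign operator on functions of words. -/
def signOp : Module.End k (List ι → M) where
  toFun F c := ε (wt p c) • F c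
  map_add' _ _ := funext fun _ => smul_add _ _ _
  map_smul' _ _ := funext fun _ => smul_comm _ _ _

/-- The operator which multiplies with the first letter of a word. -/
def headOp : Module.End k (List ι → M) where
  toFun F c := match c with
    | [] => 0
    | a :: c => ρ (y a) (F c)
  map_add' F G := funext fun c => by cases c <;> simp
  map_smul' r F := funext fun c => by cases c <;> simp

/-- Auxiliary function for `geomOp`. -/
def geomAux (F : List ι → M) : List ι → M
  | [] => F []
  | a :: c => F (a :: c) + ρ (y a) (geomAux F c)

/-- The operator `∑ Yⁿ = (1 - Y)⁻¹`, where `Y` is multiplication with the first letter. -/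
def geomOp : Module.End k (List ι → M) where
  toFun F := geomAux y ρ F
  map_add' F G := funext fun c => by
    induction c with
    | nil => rfl
    | cons a c ih => simp only [geomAux, ih, Pi.add_apply, map_add]; abel
  map_smul' r F := funext fun c => by
    induction c with
    | nil => rfl
    | cons a c ih => simp only [geomAux, ih, Pi.smul_apply, map_smul, smul_add, RingHom.id_apply]

variable (ι) in
/-- The pointwise action on functions of words. -/
def ptwOp (x : 𝐋) : Module.End k (List ι → M) := (ρ x).compLeft (List ι)

variable {p y ρ}

@[simp] lemma signOp_apply (F : List ι → M) (c) : signOp k p M F c = ε (wt p c) • F c := rfl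
@[simp] lemma headOp_nil (F : List ι → M) : headOp y ρ F [] = 0 := rfl
@[simp] lemma headOp_cons (F : List ι → M) (a c) : headOp y ρ F (a :: c) = ρ (y a) (F c) := rfl
@[simp] lemma geomOp_nil (F : List ι → M) : geomOp y ρ F [] = F [] := rfl
@[simp] lemma geomOp_cons (F : List ι → M) (a c) :
    geomOp y ρ F (a :: c) = F (a :: c) + ρ (y a) (geomOp y ρ F c) := rfl
@[simp] lemma ptwOp_apply (x : 𝐋) (F : List ι → M) (c) : ptwOp ι ρ x F c = ρ x (F c) := rfl

lemma ptwOp_mul (x x' : 𝐋) : ptwOp ι ρ (x * x') = ptwOp ι ρ x * ptwOp ι ρ x' := by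
  ext; simp

lemma ptwOp_one : ptwOp ι ρ 1 = 1 := by ext; simp

lemma ptwOp_zero : ptwOp ι ρ 0 = 0 := by ext; simp

lemma ptwOp_sum {J : Type*} (s : Finset J) (f : J → 𝐋) :
    ptwOp ι ρ (∑ j ∈ s, f j) = ∑ j ∈ s, ptwOp ι ρ (f j) := by
  ext; simp

lemma signOp_signOp : signOp k p M * signOp k p M = 1 :=
  LinearMap.ext fun _ => funext fun _ => ksign_smul_self _ _

lemma signOp_ptwOp (x : 𝐋) : signOp k p M * ptwOp ι ρ x = ptwOp ι ρ x * signOp k p M := by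
  ext; simp

lemma headOp_geomOp : (1 - headOp y ρ) * geomOp y ρ = 1 :=
  LinearMap.ext fun F => funext fun c => by cases c <;> simp

lemma geomOp_headOp : geomOp y ρ * (1 - headOp y ρ) = 1 := by
  refine LinearMap.ext fun F => funext fun c => ?_
  induction c with
  | nil => simp
  | cons a c ih =>
    have ih' : geomOp y ρ ((1 - headOp y ρ) F) c = F c := ih
    change geomOp y ρ ((1 - headOp y ρ) F) (a :: c) = _
    rw [geomOp_cons, ih']
    simp

lemma headOp_ptwOp_vert (a : V) :
    headOp y ρ * ptwOp ι ρ (𝔳 a) = ptwOp ι ρ (𝔳 a) * headOp y ρ := by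
  refine LinearMap.ext fun F => funext fun c => ?_
  cases c with
  | nil => simp
  | cons b c =>
    change ρ _ (ρ _ _) = ρ _ (ρ _ _)
    rw [← mul_apply, ← mul_apply, ← map_mul, ← map_mul, mem_diag.1 (y b).2 a]

lemma geomOp_ptwOp_vert (a : V) :
    geomOp y ρ * ptwOp ι ρ (𝔳 a) = ptwOp ι ρ (𝔳 a) * geomOp y ρ := by
  have h : (1 - headOp y ρ) * ptwOp ι ρ (𝔳 a) =
      ptwOp ι ρ (𝔳 a) * (1 - headOp y ρ) := by
    rw [sub_mul, mul_sub, headOp_ptwOp_vert, one_mul, mul_one]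
  calc geomOp y ρ * ptwOp ι ρ (𝔳 a)
      = geomOp y ρ * (ptwOp ι ρ (𝔳 a) * (1 - headOp y ρ)) * geomOp y ρ := by
        rw [mul_assoc, mul_assoc, headOp_geomOp, mul_one]
    _ = ptwOp ι ρ (𝔳 a) * geomOp y ρ := by
        rw [← h, ← mul_assoc, geomOp_headOp, one_mul]

variable (p y ρ)

/-- The action of the letters on functions of words. -/
def insGen : Letter V → Module.End k (List ι → M)
  | .vert a => ptwOp ι ρ (𝔳 a)
  | .inn a => ptwOp ι ρ (𝔦 a) * signOp k p M * (1 - headOp y ρ)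
  | .out a => geomOp y ρ * ptwOp ι ρ (𝔬 a) * signOp k p M

lemma insGen_family : LeavittFamily V (insGen p y ρ) where
  vert_mul a b := by
    change ptwOp ι ρ _ * ptwOp ι ρ _ = if a = b then ptwOp ι ρ _ else 0
    rw [← ptwOp_mul, (family k).vert_mul]
    split_ifs <;> simp [ptwOp_zero]
  sum_vert := by
    change ∑ a, ptwOp ι ρ _ = _
    rw [← ptwOp_sum, (family k).sum_vert, ptwOp_one]
  vert_out e := by
    simp only [insGen]
    rw [← mul_assoc, ← mul_assoc, ← geomOp_ptwOp_vert, mul_assoc (geomOp _ _), ← ptwOp_mul,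
      (family k).vert_out]
  out_vert e := by
    simp only [insGen]
    rw [mul_assoc, signOp_ptwOp, ← mul_assoc, mul_assoc (geomOp _ _), ← ptwOp_mul,
      (family k).out_vert]
  vert_inn e := by
    simp only [insGen]
    rw [← mul_assoc, ← mul_assoc, ← ptwOp_mul, (family k).vert_inn]
  inn_vert e := by
    simp only [insGen]
    rw [mul_assoc, sub_mul, headOp_ptwOp_vert, one_mul]
    nth_rw 1 [← mul_one (ptwOp ι ρ (𝔳 e.left))]
    rw [← mul_sub, mul_assoc, ← mul_assoc (signOp k p M), signOp_ptwOp, mul_assoc, ← mul_assoc,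
      ← ptwOp_mul, (family k).inn_vert, mul_assoc]
  inn_out e f := by
    simp only [insGen]
    have : ptwOp ι ρ (𝔦 e) * signOp k p M * (1 - headOp y ρ) *
        (geomOp y ρ * ptwOp ι ρ (𝔬 f) * signOp k p M) =
        ptwOp ι ρ (𝔦 e) * (signOp k p M * ((1 - headOp y ρ) * geomOp y ρ)
          * ptwOp ι ρ (𝔬 f)) * signOp k p M := by simp only [mul_assoc]
    rw [this, headOp_geomOp, mul_one, signOp_ptwOp, ← mul_assoc, mul_assoc, signOp_signOp,
      mul_one, ← ptwOp_mul, (family k).inn_out]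
    split_ifs <;> simp [ptwOp_zero, insGen]
  sum_out_inn := by
    have : ∀ e : 𝐐, insGen p y ρ (.out e) * insGen p y ρ (.inn e) =
        geomOp y ρ * ptwOp ι ρ (𝔬 e * 𝔦 e) * (1 - headOp y ρ) := by
      intro e
      have : insGen p y ρ (.out e) * insGen p y ρ (.inn e) =
        geomOp y ρ * (ptwOp ι ρ (𝔬 e) * (signOp k p M * ptwOp ι ρ (𝔦 e))) *
          signOp k p M * (1 - headOp y ρ) := by simp only [insGen, mul_assoc]
      rw [this, signOp_ptwOp, ← mul_assoc (ptwOp _ _ _), ← ptwOp_mul, ← mul_assoc,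
        mul_assoc _ (signOp k p M) (signOp k p M), signOp_signOp, mul_one]
    rw [sum_congr rfl fun e _ => this e, ← sum_mul, ← mul_sum, ← ptwOp_sum,
      (family k).sum_out_inn, ptwOp_one, mul_one, geomOp_headOp]

/-- The action of the Leavitt algebra on functions of words: an element acts by inserting a part of
the word at all possible places. -/
def ins : 𝐋 →ₐ[k] Module.End k (List ι → M) := lift _ (insGen_family p y ρ)

variable {p y ρ}

lemma ins_vert' (a : V) : ins p y ρ (𝔳 a) = ptwOp ι ρ (𝔳 a) := lift_gen _ _ _

@[simp] lemma ins_vert (a : V) (F : List ι → M) (c) : ins p y ρ (𝔳 a) F c = ρ (𝔳 a) (F c) := by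
  rw [ins_vert']; rfl

lemma ins_inn (a : 𝐐) (F : List ι → M) :
    ins p y ρ (𝔦 a) F = ptwOp ι ρ (𝔦 a) (signOp k p M ((1 - headOp y ρ) F)) := by
  rw [ins, lift_gen]; rfl

lemma ins_out (a : 𝐐) (F : List ι → M) :
    ins p y ρ (𝔬 a) F = geomOp y ρ (ptwOp ι ρ (𝔬 a) (signOp k p M F)) := by
  rw [ins, lift_gen]; rfl

lemma sub_headOp_ins_out (a : 𝐐) (F : List ι → M) :
    (1 - headOp y ρ) (ins p y ρ (𝔬 a) F) = ptwOp ι ρ (𝔬 a) (signOp k p M F) := by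
  rw [ins_out, ← mul_apply, headOp_geomOp, Module.End.one_apply]

lemma ins_inn_apply (a : 𝐐) (F : List ι → M) (c) :
    ins p y ρ (𝔦 a) F c = ε (wt p c) • ρ (𝔦 a) ((1 - headOp y ρ) F c) := by
  rw [ins_inn, ptwOp_apply, signOp_apply, map_smul]

@[simp] lemma sub_headOp_nil (F : List ι → M) : (1 - headOp y ρ) F [] = F [] := by simp

@[simp] lemma sub_headOp_cons (F : List ι → M) (a c) :
    (1 - headOp y ρ) F (a :: c) = F (a :: c) - ρ (y a) (F c) := by simp

/-- Insertion of the empty word. -/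
lemma ins_nil (x : 𝐋) (F : List ι → M) : ins p y ρ x F [] = ρ x (F []) := by
  refine intertwine (A := ins p y ρ) (B := ρ) (T := LinearMap.proj []) ?_ ?_ x F
  · intro a F; simp
  · intro a F
    change ins p y ρ _ F [] = _
    rw [ins_inn_apply]; simp [ksign_zero]

/-- Functoriality in the module. -/
lemma ins_comp {M' : Type*} [AddCommGroup M'] [Module k M'] {ρ' : 𝐋 →ₐ[k] Module.End k M'}
    (f : M →ₗ[k] M') (hf : ∀ x m, f (ρ x m) = ρ' x (f m)) (x : 𝐋) (F : List ι → M) (c) :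
    f (ins p y ρ x F c) = ins p y ρ' x (fun c => f (F c)) c := by
  have := intertwine (A := ins p y ρ) (B := ins p y ρ') (T := f.compLeft (List ι)) ?_ ?_ x F
  · exact congrFun this c
  all_goals intro a F; ext c
  · simp [hf]
  · change f _ = _
    rw [ins_inn_apply, ins_inn_apply, map_smul, hf]
    cases c <;> simp [hf]

/-- Functoriality in the set of letters. -/
lemma ins_map {ι' : Type*} {p' : ι' → ℤ} {y' : ι' → diag k V} (f : ι → ι')
    (hp : ∀ a, p' (f a) = p a) (hy : ∀ a, y' (f a) = y a) (x : 𝐋) (F : List ι' → M)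
    (c : List ι) :
    ins p' y' ρ x F (c.map f) = ins p y ρ x (fun c => F (c.map f)) c := by
  have hw : ∀ c : List ι, wt p' (c.map f) = wt p c := fun c => by
    simp [wt, Function.comp_def, hp]
  have := intertwine (A := ins p' y' ρ) (B := ins p y ρ)
    (T := LinearMap.funLeft k M (List.map f)) ?_ ?_ x F
  · exact congrFun this c
  all_goals intro a F; ext c
  · simp [LinearMap.funLeft]
  · simp only [LinearMap.funLeft_apply]
    rw [ins_inn_apply, ins_inn_apply, hw]
    cases c <;> simp [hy, LinearMap.funLeft_apply]

end Operators

section Taylor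

variable {ι : Type*} (p : ι → ℤ) (y : ι → diag k V)

/-- The function of words with value `1` at the empty word and `0` elsewhere. -/
def unitFn (c : List ι) : 𝐋 := if c = [] then 1 else 0

@[simp] lemma unitFn_nil : unitFn ([] : List ι) = (1 : 𝐋) := rfl
@[simp] lemma unitFn_cons (a : ι) (c) : unitFn (a :: c) = (0 : 𝐋) := rfl

variable (k V) in
/-- The left regular representation. -/
abbrev reg : 𝐋 →ₐ[k] Module.End k 𝐋 := Algebra.lmul k 𝐋

/-- The sum over all insertions of the word `c` into `x`. -/
def phi (x : 𝐋) (c : List ι) : 𝐋 := ins p y (reg k V) x unitFn c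

/-- The sum over all insertions of the word `c` into the part of `x` to the right of the leftmost
ghost arrow. -/
def psi (x : 𝐋) (c : List ι) : 𝐋 :=
  (1 - headOp y (reg k V)) (ins p y (reg k V) x unitFn) c

variable {p y}

@[simp] lemma phi_nil (x : 𝐋) : phi p y x [] = x := by
  rw [phi, ins_nil]; simp

@[simp] lemma psi_nil (x : 𝐋) : psi p y x [] = x := by
  rw [psi, sub_headOp_nil, ins_nil]; simp

lemma psi_cons (x : 𝐋) (a c) :
    psi p y x (a :: c) = phi p y x (a :: c) - y a * phi p y x c := by
  rw [psi, sub_headOp_cons]; rfl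

lemma phi_add (x x' : 𝐋) (c) : phi p y (x + x') c = phi p y x c + phi p y x' c := by
  simp [phi]
lemma phi_smul (r : k) (x : 𝐋) (c) : phi p y (r • x) c = r • phi p y x c := by
  simp [phi]
lemma psi_add (x x' : 𝐋) (c) : psi p y (x + x') c = psi p y x c + psi p y x' c := by
  cases c with
  | nil => simp
  | cons a c => simp only [psi_cons, phi_add, mul_add]; abel
lemma psi_smul (r : k) (x : 𝐋) (c) : psi p y (r • x) c = r • psi p y x c := by
  cases c with
  | nil => simp
  | cons a c => simp only [psi_cons, phi_smul, mul_smul_comm, smul_sub]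

/-- The operators act from the left, so they commute with multiplications from the right. -/
lemma ins_mul_right (x u : 𝐋) (F : List ι → 𝐋) (c) :
    ins p y (reg k V) x (fun c => F c * u) c = ins p y (reg k V) x F c * u :=
  (ins_comp (ρ' := reg k V) (LinearMap.mulRight k u)
    (fun x m => mul_assoc x m u) x F c).symm

lemma phi_mem_diag {x : 𝐋} (hx : x ∈ diag k V) (c) : phi p y x c ∈ diag k V := by
  refine mem_diag.2 fun a => ?_
  have h1 : phi p y (𝔳 a * x) c = 𝔳 a * phi p y x c := by
    rw [phi, map_mul, mul_apply, ins_vert]; rfl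
  rw [← h1, mem_diag.1 hx a, phi, map_mul, mul_apply, ins_vert', phi, ← ins_mul_right]
  refine congrArg (fun F => ins p y (reg k V) x F c) (funext fun c => ?_)
  cases c <;> simp

lemma psi_mem_diag {x : 𝐋} (hx : x ∈ diag k V) (c) : psi p y x c ∈ diag k V := by
  cases c with
  | nil => simpa
  | cons a c =>
    rw [psi_cons]
    exact Subalgebra.sub_mem _ (phi_mem_diag hx _)
      (Subalgebra.mul_mem _ (y a).2 (phi_mem_diag hx _))

end Taylor

/-! ### Insertion into products -/

section Convolution

variable {ι : Type*} {p : ι → ℤ} {y : ι → diag k V}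
  {M : Type*} [AddCommGroup M] [Module k M] {ρ : Leavitt k V →ₐ[k] Module.End k M}

variable (p ρ) in
/-- The sum over all ways to cut a word into two parts, where an element of degree `d` passes the
second part. -/
def conv (d : ℤ) (F : List ι → 𝐋) (G : List ι → M) (c : List ι) : M :=
  ∑ i ∈ range (c.length + 1), ε (d * wt p (c.drop i)) • ρ (F (c.take i)) (G (c.drop i))

lemma conv_nil (d : ℤ) (F : List ι → 𝐋) (G : List ι → M) :
    conv p ρ d F G [] = ρ (F []) (G []) := by
  simp [conv, ksign_zero]

lemma conv_cons (d : ℤ) (F : List ι → 𝐋) (G : List ι → M) (a : ι) (c) :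
    conv p ρ d F G (a :: c) = ε (d * wt p (a :: c)) • ρ (F []) (G (a :: c))
      + conv p ρ d (fun c => F (a :: c)) G c := by
  rw [conv, length_cons, sum_range_succ', add_comm]
  simp [conv]

lemma conv_sub (d : ℤ) (F F' : List ι → 𝐋) (G : List ι → M) (c) :
    conv p ρ d (fun c => F c - F' c) G c = conv p ρ d F G c - conv p ρ d F' G c := by
  simp [conv, smul_sub]

lemma conv_mul_left (d : ℤ) (x : 𝐋) (F : List ι → 𝐋) (G : List ι → M) (c) :
    conv p ρ d (fun c => x * F c) G c = ρ x (conv p ρ d F G c) := by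
  simp [conv, map_sum]

lemma sub_headOp_conv (d : ℤ) (F : List ι → 𝐋) (G : List ι → M) :
    (1 - headOp y ρ) (conv p ρ d F G) = conv p ρ d ((1 - headOp y (reg k V)) F) G := by
  funext c
  cases c with
  | nil => simp [conv_nil]
  | cons a c =>
    have h : (fun c => (1 - headOp y (reg k V)) F (a :: c)) = fun c => F (a :: c) - y a * F c := by
      funext c; rw [sub_headOp_cons]; rfl
    rw [sub_headOp_cons, conv_cons, conv_cons, sub_headOp_nil, h, conv_sub, conv_mul_left,
      add_sub_assoc]

lemma ins_inn_conv (d : ℤ) (F : List ι → 𝐋) (G : List ι → M) (a : 𝐐) :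
    ins p y ρ (𝔦 a) (conv p ρ d F G) =
      conv p ρ (d + 1) (ins p y (reg k V) (𝔦 a) F) G := by
  funext c
  rw [ins_inn_apply, sub_headOp_conv]
  simp only [conv, map_sum, smul_sum]
  refine sum_congr rfl fun i _ => ?_
  rw [ins_inn_apply, wt_take_drop c i]
  simp only [map_smul, LinearMap.smul_apply, smul_smul, LinearMap.mul_apply_apply, map_mul,
    mul_apply, ← ksign_add, Algebra.coe_lmul_eq_mul]
  congr 2
  ring

lemma ins_out_conv (d : ℤ) (F : List ι → 𝐋) (G : List ι → M) (a : 𝐐) :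
    ins p y ρ (𝔬 a) (conv p ρ d F G) =
      conv p ρ (d - 1) (ins p y (reg k V) (𝔬 a) F) G := by
  have hinj : Function.Injective (1 - headOp y ρ : Module.End k (List ι → M)) := by
    refine Function.LeftInverse.injective (g := geomOp y ρ) fun H => ?_
    rw [← mul_apply, geomOp_headOp, Module.End.one_apply]
  apply hinj
  rw [sub_headOp_ins_out, sub_headOp_conv, sub_headOp_ins_out]
  funext c
  simp only [conv, map_sum, smul_sum, ptwOp_apply, signOp_apply]
  refine sum_congr rfl fun i _ => ?_
  rw [wt_take_drop c i]
  simp only [map_smul, LinearMap.smul_apply, smul_smul, ← ksign_add, Algebra.coe_lmul_eq_mul,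
    LinearMap.mul_apply_apply, map_mul, mul_apply]
  congr 1
  exact ksign_congr (by push_cast; grind)

/-- Insertion into `x` followed by something else. -/
lemma ins_eq_conv {d : ℤ} {x : 𝐋} (hx : x ∈ deg k V d) (G : List ι → M) (c) :
    ins p y ρ x G c = conv p ρ d (phi p y x) G c := by
  induction hx using span_induction with
  | mem x hx =>
    obtain ⟨l, rfl, rfl⟩ := hx
    suffices h : ins p y ρ (val k l) G = conv p ρ (l.map ldeg).sum (phi p y (val k l)) G from
      congrFun h c
    induction l with
    | nil =>
      funext c
      rw [val_nil, map_one, Module.End.one_apply, conv, sum_range_succ', sum_eq_zero]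
      · simp [ksign_zero]
      · intro i hi
        cases c with
        | nil => simp at hi
        | cons a c => simp [phi]
    | cons a l ih =>
      have h1 : ins p y ρ (val k (a :: l)) G = ins p y ρ (gen k a) (ins p y ρ (val k l) G) := by
        rw [val_cons, map_mul, mul_apply]
      have h2 : phi p y (val k (a :: l)) = ins p y (reg k V) (gen k a) (phi p y (val k l)) := by
        change ins p y _ _ _ = _
        rw [val_cons, map_mul, mul_apply]; rfl
      rw [h1, h2, ih, map_cons, List.sum_cons]
      cases a with
      | vert a =>
        funext c
        rw [ins_vert', ins_vert', ptwOp_apply, ← conv_mul_left, ldeg, zero_add]; rfl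
      | inn a => rw [ins_inn_conv, ldeg, add_comm]
      | out a => rw [ins_out_conv, ldeg, add_comm, sub_eq_add_neg]
  | zero => simp [conv, phi]
  | add x x' _ _ h1 h2 =>
    rw [map_add, LinearMap.add_apply, Pi.add_apply, h1, h2]
    simp only [conv, phi_add, map_add, LinearMap.add_apply, smul_add, sum_add_distrib]
  | smul r x _ h =>
    rw [map_smul, LinearMap.smul_apply, Pi.smul_apply, h]
    simp only [conv, phi_smul, map_smul, LinearMap.smul_apply, smul_sum]
    exact sum_congr rfl fun i _ => smul_comm _ _ _

lemma sub_headOp_ins_eq_conv {d : ℤ} {x : 𝐋} (hx : x ∈ deg k V d) (G : List ι → M) (c) :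
    (1 - headOp y ρ) (ins p y ρ x G) c = conv p ρ d (psi p y x) G c := by
  rw [funext (ins_eq_conv hx G), sub_headOp_conv]; rfl

lemma phi_mul {d : ℤ} {x : 𝐋} (hx : x ∈ deg k V d) (x' : 𝐋) (c : List ι) :
    phi p y (x * x') c = ∑ i ∈ range (c.length + 1),
      ε (d * wt p (c.drop i)) • (phi p y x (c.take i) * phi p y x' (c.drop i)) := by
  rw [phi, map_mul, mul_apply, ins_eq_conv hx]; rfl

lemma psi_mul {d : ℤ} {x : 𝐋} (hx : x ∈ deg k V d) (x' : 𝐋) (c : List ι) :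
    psi p y (x * x') c = ∑ i ∈ range (c.length + 1),
      ε (d * wt p (c.drop i)) • (psi p y x (c.take i) * phi p y x' (c.drop i)) := by
  rw [psi, map_mul, mul_apply, sub_headOp_ins_eq_conv hx]; rfl

end Convolution

/-! ### The shift endomorphism -/

section Shift

variable (k V) in
/-- The map `x ↦ ∑ e* x e`, the sum over all arrows `e`. -/
def shift : 𝐋 →ₗ[k] 𝐋 :=
  ∑ e : 𝐐, LinearMap.mulLeft k (𝔬 e) ∘ₗ LinearMap.mulRight k (𝔦 e)

lemma shift_apply (x : 𝐋) : shift k V x = ∑ e : 𝐐, 𝔬 e * (x * 𝔦 e) := by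
  simp [shift, LinearMap.sum_apply]

lemma inn_mul_shift {x : 𝐋} (hx : x ∈ diag k V) (e : 𝐐) :
    𝔦 e * shift k V x = x * 𝔦 e := by
  rw [shift_apply, mul_sum, sum_eq_single e]
  · rw [← mul_assoc, (family k).inn_out, if_pos rfl, ← mul_assoc, mem_diag.1 hx, mul_assoc,
      (family k).vert_inn]
  · intro f _ hf
    rw [← mul_assoc, (family k).inn_out, if_neg (Ne.symm hf), zero_mul]
  · simp

lemma shift_mul_out {x : 𝐋} (hx : x ∈ diag k V) (e : 𝐐) :
    shift k V x * 𝔬 e = 𝔬 e * x := by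
  rw [shift_apply, sum_mul, sum_eq_single e]
  · rw [mul_assoc, mul_assoc, (family k).inn_out, if_pos rfl, ← mem_diag.1 hx, ← mul_assoc,
      (family k).out_vert]
  · intro f _ hf
    rw [mul_assoc, mul_assoc, (family k).inn_out, if_neg hf, mul_zero, mul_zero]
  · simp

lemma shift_mul {x : 𝐋} (x' : 𝐋) (hx : x ∈ diag k V) :
    shift k V (x * x') = shift k V x * shift k V x' := by
  rw [shift_apply x', mul_sum, shift_apply]
  refine sum_congr rfl fun e _ => ?_
  simp only [← mul_assoc, shift_mul_out hx]

lemma shift_one : shift k V 1 = 1 := by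
  simp [shift_apply, (family k).sum_out_inn]

lemma shift_mem_diag {x : 𝐋} : shift k V x ∈ diag k V := by
  refine mem_diag.2 fun a => ?_
  rw [shift_apply, mul_sum, sum_mul]
  refine sum_congr rfl fun e _ => ?_
  rw [← (family k).vert_out, ← (family k).inn_vert]
  simp only [← mul_assoc]
  rw [(family k).vert_mul]
  conv_rhs => rw [mul_assoc, (family k).vert_mul]
  by_cases h : a = e.left
  · subst h; simp
  · rw [if_neg h, if_neg (Ne.symm h)]; simp

lemma shift_mem_deg {d : ℤ} {x : 𝐋} (hx : x ∈ deg k V d) : shift k V x ∈ deg k V d := by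
  rw [shift_apply]
  refine sum_mem fun e _ => ?_
  have := mul_mem_deg (gen_mem_deg (.out e)) (mul_mem_deg hx (gen_mem_deg (.inn e)))
  simpa [ldeg] using this

variable {ι : Type*} {p : ι → ℤ} {y : ι → diag k V}

lemma sub_headOp_ins_shift {d : ℤ} {x : 𝐋} (hx : x ∈ deg k V d) (F : List ι → 𝐋) (c) :
    (1 - headOp y (reg k V)) (ins p y (reg k V) (shift k V x) F) c =
      ∑ i ∈ range (c.length + 1), ε (wt p (c.take i) + d * wt p (c.drop i)) •
        (shift k V (phi p y x (c.take i)) * (1 - headOp y (reg k V)) F (c.drop i)) := by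
  rw [shift_apply, map_sum, LinearMap.sum_apply, map_sum, Finset.sum_apply]
  have key (e : 𝐐) : (1 - headOp y (reg k V)) (ins p y (reg k V) (𝔬 e * (x * 𝔦 e)) F) c =
      ∑ i ∈ range (c.length + 1), ε (wt p (c.take i) + d * wt p (c.drop i)) •
        (𝔬 e * (phi p y x (c.take i) * 𝔦 e) * (1 - headOp y (reg k V)) F (c.drop i)) := by
    rw [map_mul, map_mul, mul_apply, sub_headOp_ins_out, ptwOp_apply, signOp_apply,
      mul_apply, ins_eq_conv hx, conv, smul_sum, map_sum]
    refine sum_congr rfl fun i _ => ?_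
    rw [ins_inn_apply, wt_take_drop c i]
    simp only [map_smul, smul_smul, ← ksign_add, Algebra.coe_lmul_eq_mul, LinearMap.mul_apply_apply,
      mul_assoc]
    congr 1
    exact ksign_congr (by push_cast; grind)
  rw [sum_congr rfl fun e _ => key e, Finset.sum_comm]
  refine sum_congr rfl fun i _ => ?_
  rw [← smul_sum, ← sum_mul, ← shift_apply]

lemma psi_shift_mul {d : ℤ} {x : 𝐋} (hx : x ∈ deg k V d) (x' : 𝐋) (c : List ι) :
    psi p y (shift k V x * x') c = ∑ i ∈ range (c.length + 1),
      ε (wt p (c.take i) + d * wt p (c.drop i)) •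
        (shift k V (phi p y x (c.take i)) * psi p y x' (c.drop i)) := by
  rw [psi, map_mul, mul_apply, sub_headOp_ins_shift hx]; rfl

lemma parity_mem_diag {x : 𝐋} (hx : x ∈ diag k V) : parity x ∈ diag k V := by
  refine mem_diag.2 fun a => ?_
  have := congrArg parity (mem_diag.1 hx a)
  rwa [map_mul, map_mul, parity_of_mem (gen_mem_deg _), ldeg, ksign_zero, one_smul] at this

end Shift

section Degree

variable {ι : Type*} {p : ι → ℤ} {y : ι → diag k V}

lemma phi_mem_deg (hy : ∀ a, (y a : 𝐋) ∈ deg k V (p a)) {d : ℤ} {x : 𝐋}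
    (hx : x ∈ deg k V d) (c : List ι) : phi p y x c ∈ deg k V (d + wt p c) := by
  have cons (e : ℤ) (a c) {z : 𝐋} (hz : z ∈ deg k V (e + wt p c)) :
      y a * z ∈ deg k V (e + wt p (a :: c)) := by
    have := mul_mem_deg (hy a) hz
    rwa [add_left_comm, ← wt_cons] at this
  have sub : ∀ (e : ℤ) (F : List ι → 𝐋), (∀ c, F c ∈ deg k V (e + wt p c)) →
      ∀ c, (1 - headOp y (reg k V)) F c ∈ deg k V (e + wt p c) := by
    intro e F hF c
    cases c with
    | nil => simpa using hF []
    | cons a c =>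
      rw [sub_headOp_cons]
      exact sub_mem (hF _) (cons e a c (hF c))
  have geom : ∀ (e : ℤ) (F : List ι → 𝐋), (∀ c, F c ∈ deg k V (e + wt p c)) →
      ∀ c, geomOp y (reg k V) F c ∈ deg k V (e + wt p c) := by
    intro e F hF c
    induction c with
    | nil => exact hF []
    | cons a c ih =>
      rw [geomOp_cons]
      exact add_mem (hF _) (cons e a c ih)
  induction hx using span_induction with
  | mem x hx =>
    obtain ⟨l, rfl, rfl⟩ := hx
    induction l generalizing c with
    | nil =>
      cases c with
      | nil => simpa using one_mem_deg
      | cons a c => simp [phi]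
    | cons a l ih =>
      rw [phi, val_cons, map_mul, mul_apply]
      change ins p y (reg k V) (gen k a) (phi p y (val k l)) c ∈ _
      rw [map_cons, List.sum_cons, add_assoc]
      have hs : ∀ F : List ι → 𝐋, (∀ c, F c ∈ deg k V ((l.map ldeg).sum + wt p c)) →
          ∀ c, signOp k p _ F c ∈ deg k V ((l.map ldeg).sum + wt p c) := fun F hF c =>
        smul_mem _ _ (hF c)
      have hm : ∀ F : List ι → 𝐋, (∀ c, F c ∈ deg k V ((l.map ldeg).sum + wt p c)) →
          ∀ c, ptwOp ι (reg k V) (gen k a) F c ∈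
            deg k V (ldeg a + (l.map ldeg).sum + wt p c) := fun F hF c => by
        rw [add_assoc]; exact mul_mem_deg (gen_mem_deg a) (hF c)
      cases a with
      | vert a => rw [ins_vert', ← add_assoc]; exact hm _ ih c
      | inn a => rw [ins_inn, ← add_assoc]; exact hm _ (hs _ (sub _ _ ih)) c
      | out a => rw [ins_out, ← add_assoc]; exact geom _ _ (hm _ (hs _ ih)) c
  | zero => simp [phi]
  | add x x' _ _ h1 h2 => rw [phi_add]; exact add_mem h1 h2
  | smul r x _ h => rw [phi_smul]; exact smul_mem _ _ h

lemma psi_mem_deg (hy : ∀ a, (y a : 𝐋) ∈ deg k V (p a)) {d : ℤ} {x : 𝐋}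
    (hx : x ∈ deg k V d) (c : List ι) : psi p y x c ∈ deg k V (d + wt p c) := by
  cases c with
  | nil => simpa using hx
  | cons a c =>
    rw [psi_cons]
    refine sub_mem (phi_mem_deg hy hx _) ?_
    have := mul_mem_deg (hy a) (phi_mem_deg hy hx c)
    rwa [add_left_comm, ← wt_cons] at this

/-- Functoriality in the set of letters. -/
lemma phi_map {ι' : Type*} {p' : ι' → ℤ} {y' : ι' → diag k V} (f : ι → ι')
    (hp : ∀ a, p' (f a) = p a) (hy : ∀ a, y' (f a) = y a) (x : 𝐋) (c : List ι) :
    phi p' y' x (c.map f) = phi p y x c := by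
  rw [phi, ins_map f hp hy]
  exact congrFun (congrArg _ (funext fun c => by cases c <;> rfl)) c

lemma psi_map {ι' : Type*} {p' : ι' → ℤ} {y' : ι' → diag k V} (f : ι → ι')
    (hp : ∀ a, p' (f a) = p a) (hy : ∀ a, y' (f a) = y a) (x : 𝐋) (c : List ι) :
    psi p' y' x (c.map f) = psi p y x c := by
  cases c with
  | nil => simp
  | cons a c =>
    rw [psi_cons, map_cons, psi_cons, phi_map f hp hy, ← map_cons, phi_map f hp hy, hy]

end Degree

local postfix:max "♭" => List.map Subtype.val
local notation "𝐃" => diag k V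
local notation "𝔰" => shift k V

/-! ### Composition of insertions -/

section Composition

variable {ι ι₁ ι₂ : Type*} {p : ι → ℤ} {p₁ : ι₁ → ℤ} {p₂ : ι₂ → ℤ} {y : ι → diag k V}
  {y₁ : ι₁ → diag k V} {y₂ : ι₂ → diag k V} (j : ι₂ → ι) (b : ι₁ → List ι₂ → ι)
  {M : Type*} [AddCommGroup M] [Module k M]

variable (k p₁ p₂) in
/-- The sum over all ways to start with some letters of the second word, followed by the letter
`b l n'` obtained by inserting a piece `n'` of the second word into the letter `l`, and to proceed
with `r`. -/
def shufAux (r : List ι₂ → (List ι → M) → M) (l : ι₁) : List ι₂ → (List ι → M) → M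
  | [], F => r [] fun c => F (b l [] :: c)
  | n :: n', F => (∑ i ∈ range (n'.length + 2), ε (p₁ l * wt p₂ ((n :: n').drop i)) •
      r ((n :: n').drop i) fun c => F (b l ((n :: n').take i) :: c))
    + shufAux r l n' fun c => F (j n :: c)

variable (k p₁ p₂) in
/-- The sum of the values of `F` over all words obtained from two words by inserting disjoint pieces
of the second word into the letters of the first one; the order of the letters is kept. -/
def shuf : List ι₁ → List ι₂ → (List ι → M) → M
  | [], n, F => F (n.map j)
  | l :: l', n, F => shufAux k p₁ p₂ j b (shuf l') l n F

variable {j b}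

local notation "𝐬" => shuf k p₁ p₂ j b

lemma shuf_nil (n : List ι₂) (F : List ι → M) : 𝐬 [] n F = F (n.map j) := rfl

lemma shuf_cons_nil (l : ι₁) (l') (F : List ι → M) : 𝐬 (l :: l') [] F =
    𝐬 l' [] fun c => F (b l [] :: c) := rfl

lemma shuf_cons_cons (l : ι₁) (l') (n : ι₂) (n') (F : List ι → M) :
    𝐬 (l :: l') (n :: n') F =
      (∑ i ∈ range (n'.length + 2), ε (p₁ l * wt p₂ ((n :: n').drop i)) •
        𝐬 l' ((n :: n').drop i) fun c => F (b l ((n :: n').take i) :: c))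
      + 𝐬 (l :: l') n' fun c => F (j n :: c) := rfl

/-- Induction along the recursion of `shuf`. -/
lemma shuf_induction {Q : List ι₁ → List ι₂ → Prop} (h0 : ∀ n, Q [] n)
    (h1 : ∀ l l', (∀ n, Q l' n) → Q (l :: l') [])
    (h2 : ∀ l l' n n', (∀ n, Q l' n) → Q (l :: l') n' → Q (l :: l') (n :: n')) (l n) : Q l n := by
  induction l generalizing n with
  | nil => exact h0 n
  | cons l l' ih =>
    induction n with
    | nil => exact h1 l l' ih
    | cons n n' ih' => exact h2 l l' n n' ih ih'

lemma shuf_comp {M' : Type*} [AddCommGroup M'] [Module k M'] (f : M →ₗ[k] M') (l : List ι₁)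
    (n : List ι₂) (F : List ι → M) :
    f (𝐬 l n F) = 𝐬 l n fun c => f (F c) := by
  induction l, n using shuf_induction generalizing F with
  | h0 n => rfl
  | h1 l l' ih => rw [shuf_cons_nil, shuf_cons_nil, ih]
  | h2 l l' n n' ih ih' =>
    rw [shuf_cons_cons, shuf_cons_cons, map_add, map_sum, ih']
    simp only [map_smul, ih]

variable (k p₁ p₂ j b M) in
/-- `shuf` as a linear map. -/
def shufLin : (List ι → M) →ₗ[k] List ι₁ → List ι₂ → M where
  toFun F l n := 𝐬 l n F
  map_add' F G := by
    funext l n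
    induction l, n using shuf_induction generalizing F G with
    | h0 n => rfl
    | h1 l l' ih => exact ih [] (fun c => F (b l [] :: c)) fun c => G (b l [] :: c)
    | h2 l l' n n' ih ih' =>
      simp only [Pi.add_apply, shuf_cons_cons] at ih ih' ⊢
      simp only [Pi.add_def] at ih ih' ⊢
      simp only [ih, ih', smul_add, sum_add_distrib]
      abel
  map_smul' r F := funext₂ fun l n => (shuf_comp (LinearMap.lsmul k M r) l n F).symm

local notation "𝐒𝐋" => shufLin k p₁ p₂ j b

@[simp] lemma shufLin_apply (F : List ι → M) (l n) :
    𝐒𝐋 M F l n = 𝐬 l n F := rfl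

section

variable (hpj : ∀ n, p (j n) = p₂ n) (hpb : ∀ l n, p (b l n) = p₁ l + wt p₂ n)
include hpj hpb

lemma shuf_signOp (F : List ι → M) (l n) : 𝐬 l n (signOp k p M F) =
    ε (wt p₁ l + wt p₂ n) • 𝐬 l n F := by
  have hw : ∀ (a : ι) (F : List ι → M), (fun c => signOp k p M F (a :: c)) =
      ε (p a) • signOp k p M fun c => F (a :: c) := fun a F => by
    ext; simp [smul_smul, ← ksign_add]
  have hs : ∀ (r : k) (F : List ι → M) (l n), 𝐬 l n (r • F) =
      r • 𝐬 l n F := fun r F l n =>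
    congrFun (congrFun (map_smul (𝐒𝐋 M) r F) l) n
  induction l, n using shuf_induction generalizing F with
  | h0 n =>
    rw [shuf_nil, shuf_nil, signOp_apply, wt_nil, zero_add]
    congr 2
    simp [wt, Function.comp_def, hpj]
  | h1 l l' ih =>
    rw [shuf_cons_nil, shuf_cons_nil, hw, hs, ih, smul_smul, ← ksign_add, hpb]
    congr 2
    simp
  | h2 l l' n n' ih ih' =>
    rw [shuf_cons_cons, shuf_cons_cons, smul_add, hw, hs, ih', smul_smul, ← ksign_add, hpj,
      smul_sum]
    congr 1
    · refine sum_congr rfl fun i _ => ?_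
      rw [hw, hs, ih, smul_smul, smul_smul, smul_smul, ← ksign_add, ← ksign_add, ← ksign_add, hpb]
      congr 2
      rw [wt_take_drop (n :: n') i, wt_cons]
      ring
    · congr 2
      simp
      ring

end

variable {ρ : Leavitt k V →ₐ[k] Module.End k M}
  (hpj : ∀ n, p (j n) = p₂ n) (hpb : ∀ l n, p (b l n) = p₁ l + wt p₂ n)
  (hyj : ∀ n, y (j n) = y₂ n) (hd : ∀ l, (y₁ l : Leavitt k V) ∈ deg k V (p₁ l))
  (hyb : ∀ l n, (y (b l n) : Leavitt k V) = psi p₂ y₂ (y₁ l) n)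

include hyj hd hyb in
lemma shuf_sub_headOp (F : List ι → M) (l n) :
    𝐬 l n ((1 - headOp y ρ) F) =
      (1 - headOp y₂ ρ) ((1 - headOp y₁ (ins p₂ y₂ ρ)) (𝐒𝐋 M F) l) n := by
  have hsub : ∀ (F G : List ι → M) l n, 𝐬 l n (fun c => F c - G c) =
      𝐬 l n F - 𝐬 l n G := fun F G l n =>
    congrFun (congrFun (map_sub (𝐒𝐋 M) F G) l) n
  have hh : ∀ (a : ι) (F : List ι → M) l n, 𝐬 l n (fun c => ρ (y a) (F c)) =
      ρ (y a) (𝐬 l n F) := fun a F l n => (shuf_comp _ _ _ _).symm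
  have hs : ∀ (F : List ι → M) l n, 𝐬 l n ((1 - headOp y ρ) F) =
      𝐬 l n F - 𝐬 l n (headOp y ρ F) := fun F l n =>
    hsub F (headOp y ρ F) l n
  cases l with
  | nil =>
    rw [sub_headOp_nil, shuf_nil]
    cases n <;> simp [shuf_nil, hyj]
  | cons l l' =>
    rw [sub_headOp_cons]
    have hlin : (1 - headOp y₂ ρ) (𝐒𝐋 M F (l :: l') -
        ins p₂ y₂ ρ (y₁ l) (𝐒𝐋 M F l')) n =
        (1 - headOp y₂ ρ) (𝐒𝐋 M F (l :: l')) n -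
        (1 - headOp y₂ ρ) (ins p₂ y₂ ρ (y₁ l) (𝐒𝐋 M F l')) n := by
      rw [map_sub]; rfl
    rw [hlin, sub_headOp_ins_eq_conv (hd l), hs]
    cases n with
    | nil =>
      rw [sub_headOp_nil, conv_nil, shuf_cons_nil, shufLin_apply, shufLin_apply, shuf_cons_nil]
      simp only [headOp_cons, hh]
      simp only [hyb]
      rfl
    | cons n n' =>
      rw [sub_headOp_cons, shufLin_apply, shufLin_apply, shuf_cons_cons, shuf_cons_cons]
      simp only [headOp_cons, hh]
      simp only [hyb, hyj]
      rw [conv, length_cons, show n'.length + 1 + 1 = n'.length + 2 from rfl]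
      simp
      abel

include hpj hpb hyj hd hyb

lemma shuf_ins (x : 𝐋) (F : List ι → M) :
    𝐒𝐋 M (ins p y ρ x F) =
      ins p₁ y₁ (ins p₂ y₂ ρ) x (𝐒𝐋 M F) := by
  refine intertwine ?_ ?_ x F
  all_goals intro a F; funext l n
  · rw [ins_vert', ins_vert, ins_vert, shufLin_apply, shufLin_apply, shuf_comp]; rfl
  · rw [ins_inn_apply, shufLin_apply, ins_inn]
    change 𝐬 l n (fun c => ρ (𝔦 a) (signOp k p M ((1 - headOp y ρ) F) c)) = _
    rw [← shuf_comp, shuf_signOp hpj hpb, shuf_sub_headOp hyj hd hyb, Pi.smul_apply,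
      ins_inn_apply, smul_smul, map_smul, ← ksign_add]

/-- Successive insertion of two words. -/
lemma shuf_phi (x : 𝐋) (l n) :
    𝐬 l n (phi p y x) = phi p₂ y₂ (phi p₁ y₁ x l) n := by
  have h1 := shuf_ins (ρ := reg k V) hpj hpb hyj hd hyb x unitFn
  -- insertion into a fixed function is equivariant
  let ev : 𝐋 →ₗ[k] List ι₂ → 𝐋 :=
    (LinearMap.applyₗ (unitFn : List ι₂ → 𝐋)) ∘ₗ (ins p₂ y₂ (reg k V)).toLinearMap
  have hev : ∀ x m, ev (reg k V x m) = ins p₂ y₂ (reg k V) x (ev m) := fun x m => by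
    change ins p₂ y₂ (reg k V) (x * m) _ = _
    rw [map_mul]; rfl
  have h2 : 𝐒𝐋 _ (unitFn : List ι → 𝐋) = fun l => ev (unitFn l) := by
    funext l n
    rw [shufLin_apply]
    have hz (l n) : 𝐬 l n (fun _ : List ι => (0 : 𝐋)) = 0 :=
      congrFun (congrFun (map_zero (𝐒𝐋 𝐋)) l) n
    cases l with
    | nil =>
      rw [shuf_nil, unitFn_nil]
      change _ = ins p₂ y₂ (reg k V) 1 unitFn n
      rw [map_one, Module.End.one_apply]
      cases n <;> simp
    | cons l l' =>
      rw [unitFn_cons, map_zero]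
      induction n with
      | nil => rw [shuf_cons_nil]; simp; exact hz _ _
      | cons n n' => rw [shuf_cons_cons]; simp only [unitFn_cons, hz]; simp
  have h3 := congrFun (congrFun h1 l) n
  rw [h2, ← ins_comp ev hev] at h3
  exact h3

lemma shuf_psi (x : 𝐋) (l n) :
    𝐬 l n (psi p y x) = psi p₂ y₂ (psi p₁ y₁ x l) n := by
  refine (shuf_sub_headOp (ρ := reg k V) hyj hd hyb (phi p y x) l n).trans ?_
  have h2 : 𝐒𝐋 _ (phi p y x) = fun l n => phi p₂ y₂ (phi p₁ y₁ x l) n :=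
    funext fun l => funext fun n => shuf_phi hpj hpb hyj hd hyb x l n
  rw [h2]
  have h3 : (1 - headOp y₁ (ins p₂ y₂ (reg k V))) (fun l n => phi p₂ y₂ (phi p₁ y₁ x l) n) l =
      phi p₂ y₂ (psi p₁ y₁ x l) := by
    cases l with
    | nil =>
      rw [sub_headOp_nil]
      change _ = phi p₂ y₂ ((1 - headOp y₁ (reg k V)) (phi p₁ y₁ x) [])
      rw [sub_headOp_nil]
    | cons l l' =>
      rw [sub_headOp_cons, psi_cons]
      funext n
      change _ = ins p₂ y₂ (reg k V) (phi p₁ y₁ x (l :: l') - y₁ l * phi p₁ y₁ x l') unitFn n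
      rw [map_sub, LinearMap.sub_apply, Pi.sub_apply, map_mul]
      rfl
  rw [h3]
  rfl

end Composition

/-! ### Insertion and the differential on words -/

section Bar

variable {ι ι₁ : Type*} {p : ι → ℤ} {p₁ : ι₁ → ℤ} {y : ι → diag k V} {y₁ : ι₁ → diag k V}
  (z : ι₁ → diag k V) (j : ι₁ → ι) (m₁ : ι₁ → ι) (m₂ : ι₁ → ι₁ → ι)
  {M : Type*} [AddCommGroup M] [Module k M] {ρ : Leavitt k V →ₐ[k] Module.End k M}

/-- The value of `F` on the word obtained by applying `m₂` to the first two letters of a word with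
first letter `l`. -/
def barTwo (l : ι₁) : List ι₁ → (List ι → M) → M
  | [], _ => 0
  | l₂ :: l'', F => F (m₂ l l₂ :: l''.map j)

variable (k p₁) in
/-- The sum of the values of `F` over all words obtained by applying `m₁` to a letter or `m₂` to two
successive letters. -/
def bar : List ι₁ → (List ι → M) → M
  | [], _ => 0
  | l :: l', F => - F (m₁ l :: l'.map j) + ε (p₁ l) •
      (barTwo j m₂ l l' F + bar l' fun c => F (j l :: c))

variable {j m₁ m₂}

local notation "𝐛" => bar k p₁ j m₁ m₂

lemma bar_nil (F : List ι → M) : 𝐛 [] F = 0 := rfl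

lemma bar_cons (l : ι₁) (l') (F : List ι → M) : 𝐛 (l :: l') F =
    - F (m₁ l :: l'.map j) + ε (p₁ l) •
      (barTwo j m₂ l l' F + 𝐛 l' fun c => F (j l :: c)) := rfl

lemma barTwo_nil (l : ι₁) (F : List ι → M) : barTwo j m₂ l [] F = 0 := rfl

lemma barTwo_cons (l l₂ : ι₁) (l') (F : List ι → M) : barTwo j m₂ l (l₂ :: l') F =
    F (m₂ l l₂ :: l'.map j) := rfl

lemma bar_comp {M' : Type*} [AddCommGroup M'] [Module k M'] (f : M →ₗ[k] M') (l : List ι₁)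
    (F : List ι → M) : f (𝐛 l F) = 𝐛 l fun c => f (F c) := by
  induction l generalizing F with
  | nil => exact map_zero f
  | cons l l' ih =>
    rw [bar_cons, bar_cons, map_add, map_neg, map_smul, map_add, ih]
    cases l' with
    | nil => rw [barTwo_nil, barTwo_nil, map_zero]
    | cons l₂ l'' => rfl

variable (k p₁ j m₁ m₂ M) in
/-- `bar` as a linear map. -/
def barLin : (List ι → M) →ₗ[k] List ι₁ → M where
  toFun F l := 𝐛 l F
  map_add' F G := by
    funext l
    induction l generalizing F G with
    | nil => simp [bar_nil]
    | cons l l' ih =>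
      have h := ih (fun c => F (j l :: c)) (fun c => G (j l :: c))
      have h2 : barTwo j m₂ l l' (F + G) = barTwo j m₂ l l' F + barTwo j m₂ l l' G := by
        cases l' with
        | nil => simp [barTwo_nil]
        | cons l₂ l'' => rfl
      simp only [Pi.add_def] at h h2 ⊢
      simp only [bar_cons, h, h2, smul_add]
      abel
  map_smul' r F := funext fun l => (bar_comp (LinearMap.lsmul k M r) l F).symm

@[simp] lemma barLin_apply (F : List ι → M) (l) :
    barLin k p₁ j m₁ m₂ M F l = 𝐛 l F := rfl

variable (j) in
/-- The operator which multiplies with the component `z` of the first letter, transformed with a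
map `f`. -/
def headOp' (ρ : 𝐋 →ₐ[k] Module.End k M) (f : 𝐋 →ₗ[k] 𝐋) :
    (List ι → M) →ₗ[k] List ι₁ → M where
  toFun F l := match l with
    | [] => 0
    | l :: l' => ρ (f (z l)) (F (l'.map j))
  map_add' F G := funext fun c => by cases c <;> simp
  map_smul' r F := funext fun c => by cases c <;> simp

@[simp] lemma headOp'_nil (f : 𝐋 →ₗ[k] 𝐋) (F : List ι → M) :
    headOp' z j ρ f F [] = 0 := rfl
@[simp] lemma headOp'_cons (f : 𝐋 →ₗ[k] 𝐋) (F : List ι → M) (l l') :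
    headOp' z j ρ f F (l :: l') = ρ (f (z l)) (F (l'.map j)) := rfl

variable (hpj : ∀ l, p (j l) = p₁ l) (hyj : ∀ l, y (j l) = y₁ l)
  (hp1 : ∀ l, p (m₁ l) = p₁ l + 1) (hp2 : ∀ l l', p (m₂ l l') = p₁ l + p₁ l' + 1)
  (hy1 : ∀ l, (y (m₁ l) : Leavitt k V) = z l - shift k V (parity (z l)))
  (hy2 : ∀ l l', (y (m₂ l l') : Leavitt k V) = y₁ l * z l' + shift k V (z l) * y₁ l')
  (hz : ∀ l, parity (z l : Leavitt k V) = ksign k (p₁ l + 1) • (z l : Leavitt k V))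

include hpj hp1 hp2 in
lemma bar_signOp (F : List ι → M) (l) : 𝐛 l (signOp k p M F) =
    - (ε (wt p₁ l) • 𝐛 l F) := by
  have hw : ∀ l : List ι₁, wt p (l.map j) = wt p₁ l := fun l => by
    simp [wt, Function.comp_def, hpj]
  have hw' : ∀ (a : ι) (F : List ι → M), (fun c => signOp k p M F (a :: c)) =
      ε (p a) • signOp k p M fun c => F (a :: c) := fun a F => by
    ext; simp [smul_smul, ← ksign_add]
  have hs : ∀ (r : k) (F : List ι → M) (l), 𝐛 l (r • F) =
      r • 𝐛 l F := fun r F l =>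
    congrFun (map_smul (barLin k p₁ j m₁ m₂ M) r F) l
  induction l generalizing F with
  | nil => simp [bar_nil]
  | cons l l' ih =>
    rw [bar_cons, bar_cons, hw', hs, ih]
    simp only [signOp_apply, wt_cons, hw, hp1, hpj, smul_add, smul_neg]
    have e1 : ε (p₁ l + 1 + wt p₁ l') = - ε (p₁ l + wt p₁ l') := by
      rw [← ksign_succ]; congr 1; ring
    rw [e1, neg_smul, neg_neg]
    simp only [neg_add, neg_neg, smul_smul, ← ksign_add]
    congr 1
    cases l' with
    | nil => simp [barTwo_nil, bar_nil]
    | cons l₂ l'' =>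
      simp only [barTwo_cons, signOp_apply, wt_cons, hp2, hw, smul_smul, ← ksign_add]
      rw [show p₁ l + (p₁ l + p₁ l₂ + 1 + wt p₁ l'') =
        (p₁ l + (p₁ l₂ + wt p₁ l'') + p₁ l) + 1 by ring, ksign_succ, neg_smul]
      congr 3
      ring_nf

include hz in
lemma shift_parity_eq (l : ι₁) : 𝔰 (parity (z l : 𝐋)) = - (ε (p₁ l) • 𝔰 (z l)) := by
  rw [hz, map_smul, ksign_succ, neg_smul]

include hyj hy1 hy2 hz in
lemma bar_sub_headOp (F : List ι → M) (l) :
    𝐛 l ((1 - headOp y ρ) F) +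
      headOp' z j ρ (𝔰 ∘ₗ parity.toLinearMap) ((1 - headOp y ρ) F) l =
    ε (wt p₁ l) • (1 - headOp y₁ ρ) (signOp k p₁ M
      (barLin k p₁ j m₁ m₂ M F + headOp' z j ρ LinearMap.id F)) l := by
  have hsub : ∀ (F G : List ι → M) l, 𝐛 l (fun c => F c - G c) =
      𝐛 l F - 𝐛 l G := fun F G l =>
    congrFun (map_sub (barLin k p₁ j m₁ m₂ M) F G) l
  have hh : ∀ (a : ι) (F : List ι → M) l, 𝐛 l (fun c => ρ (y a) (F c)) =
      ρ (y a) (𝐛 l F) := fun a F l => (bar_comp _ _ _).symm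
  cases l with
  | nil => simp [bar_nil]
  | cons l l' =>
    obtain ⟨G, hG⟩ : ∃ G, G = (1 - headOp y ρ) F := ⟨_, rfl⟩
    have hG0 : G [] = F [] := by rw [hG, sub_headOp_nil]
    have hG1 a c : G (a :: c) = F (a :: c) - ρ (y a) (F c) := by rw [hG, sub_headOp_cons]
    have hc : (fun c => G (j l :: c)) = fun c => F (j l :: c) - ρ (y (j l)) (F c) := by simp [hG1]
    have hH c : signOp k p₁ M (barLin k p₁ j m₁ m₂ M F + headOp' z j ρ LinearMap.id F) c =
        ε (wt p₁ c) • (𝐛 c F + headOp' z j ρ LinearMap.id F c) := rfl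
    have hs : ε (p₁ l + wt p₁ l') * ε (wt p₁ l') = ε (p₁ l) := by
      rw [ksign_add, mul_assoc, ksign_mul_self, mul_one]
    rw [← hG, bar_cons, hc, hsub, hh, hyj, sub_headOp_cons, hH, hH, wt_cons, smul_sub,
      ksign_smul_self, map_smul, smul_smul, hs, bar_cons, hG1, hy1, headOp'_cons, headOp'_cons,
      comp_apply, AlgHom.toLinearMap_apply, LinearMap.id_apply, map_sub,
      LinearMap.sub_apply]
    cases l' with
    | nil =>
      rw [barTwo_nil, barTwo_nil, headOp'_nil, List.map_nil, hG0]
      simp only [smul_add, smul_sub, map_add, map_zero, smul_zero]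
      abel
    | cons l₂ l'' =>
      rw [barTwo_cons, barTwo_cons, headOp'_cons, map_cons, hG1, hG1, hy2, shift_parity_eq z hz, hyj]
      simp only [smul_add, smul_sub, map_add, map_sub, LinearMap.add_apply, map_mul,
        mul_apply, map_neg, LinearMap.neg_apply, map_smul, LinearMap.smul_apply,
        LinearMap.id_apply]
      abel

variable (ρ) in
/-- The differential on functions of words, up to a sign. -/
def barOp : (List ι → M) →ₗ[k] List ι₁ → M :=
  signOp k p₁ M ∘ₗ (barLin k p₁ j m₁ m₂ M + headOp' z j ρ LinearMap.id)

local notation "𝐁" => barOp (m₁ := m₁) (m₂ := m₂) (p₁ := p₁) (j := j) z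

include hpj hyj hp1 hp2 hy1 hy2 hz

lemma barOp_ins (x : 𝐋) (F : List ι → M) :
    𝐁 ρ (ins p y ρ x F) =
      ins p₁ y₁ ρ (parity x) (𝐁 ρ F) := by
  have hw : ∀ l : List ι₁, wt p (l.map j) = wt p₁ l := fun l => by
    simp [wt, Function.comp_def, hpj]
  refine intertwine (A := ins p y ρ) (B := (ins p₁ y₁ ρ).comp parity)
    (T := 𝐁 ρ) ?_ ?_ x F
  · intro a F
    rw [AlgHom.comp_apply, parity_of_mem (gen_mem_deg _), ldeg, ksign_zero, one_smul]
    funext l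
    rw [ins_vert', ins_vert, barOp, comp_apply, comp_apply, signOp_apply,
      signOp_apply, map_smul, LinearMap.add_apply, LinearMap.add_apply, Pi.add_apply,
      Pi.add_apply, map_add, barLin_apply, barLin_apply, bar_comp]
    congr 2
    cases l with
    | nil => simp
    | cons l l' =>
      simp only [headOp'_cons, LinearMap.id_apply, ptwOp_apply]
      rw [← mul_apply, ← mul_apply, ← map_mul, ← map_mul, mem_diag.1 (z l).2 a]
  · intro a F
    rw [AlgHom.comp_apply, parity_of_mem (gen_mem_deg _), ldeg, ksign_one, neg_one_smul]
    funext l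
    rw [map_neg, LinearMap.neg_apply, Pi.neg_apply, ins_inn_apply]
    have h1 : ins p y ρ (𝔦 a) F = fun c => ρ (𝔦 a) (signOp k p M ((1 - headOp y ρ) F) c) :=
      ins_inn a F
    have h2 : headOp' z j ρ LinearMap.id (ins p y ρ (𝔦 a) F) l =
        - (ε (wt p₁ l) • ρ (𝔦 a)
          (headOp' z j ρ (𝔰 ∘ₗ parity.toLinearMap) ((1 - headOp y ρ) F) l)) := by
      cases l with
      | nil => simp
      | cons l l' =>
        rw [headOp'_cons, headOp'_cons, ins_inn_apply, comp_apply,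
          AlgHom.toLinearMap_apply, hw, LinearMap.id_apply, map_smul, ← mul_apply,
          ← map_mul, ← inn_mul_shift (z l).2, map_mul, mul_apply, wt_cons,
          shift_parity_eq z hz, map_neg, LinearMap.neg_apply, map_neg, smul_neg, neg_neg, map_smul, LinearMap.smul_apply,
          map_smul, smul_smul, add_comm, ksign_add, mul_assoc, ksign_mul_self, mul_one]
    rw [barOp, comp_apply, signOp_apply, LinearMap.add_apply, Pi.add_apply, h2,
      barLin_apply, h1, ← bar_comp, bar_signOp hpj hp1 hp2]
    have h3 := bar_sub_headOp (ρ := ρ) (m₁ := m₁) (m₂ := m₂) z hyj hy1 hy2 hz F l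
    rw [eq_comm, ← comp_apply] at h3
    change ε (wt p₁ l) • (1 - headOp y₁ ρ)
      (𝐁 ρ F) l = _ at h3
    change _ = - (ε (wt p₁ l) • ρ _ ((1 - headOp y₁ ρ)
      (𝐁 ρ F) l))
    rw [← map_smul (ρ _) (ε (wt p₁ l)) ((1 - headOp y₁ ρ) _ l), h3]
    simp only [map_neg, map_smul, map_add, smul_neg, smul_add, ksign_smul_self, neg_add]

omit hpj hyj hp1 hp2 hy1 hy2 hz in
lemma barOp_unitFn_cons (l : ι₁) (l') :
    𝐁 (reg k V) unitFn (l :: l') =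
      if l' = [] then ε (p₁ l) • (z l : 𝐋) else 0 := by
  have h0 : 𝐛 (l :: l') (unitFn : List ι → 𝐋) = 0 := by
    have hz (l') : 𝐛 l' (fun c : List ι => (0 : 𝐋)) = 0 :=
      congrFun (map_zero (barLin k p₁ j m₁ m₂ 𝐋)) l'
    rw [bar_cons]
    simp only [unitFn_cons, hz]
    cases l' <;> simp [barTwo_nil, barTwo_cons]
  rw [barOp, comp_apply, signOp_apply, LinearMap.add_apply, Pi.add_apply, barLin_apply,
    h0, zero_add, headOp'_cons]
  cases l' <;> simp

omit hpj hyj hp1 hp2 hy1 hy2 hz in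
lemma conv_barOp_unitFn (d : ℤ) (F : List ι₁ → 𝐋) (l' : List ι₁) (l : ι₁) :
    conv p₁ (reg k V) d F
      (𝐁 (reg k V) unitFn) (l' ++ [l]) =
      ε (d * p₁ l + p₁ l) • (F l' * z l) := by
  induction l' generalizing F with
  | nil =>
    rw [nil_append, conv_cons, conv_nil, barOp_unitFn_cons, if_pos rfl]
    have : 𝐁 (reg k V) unitFn [] = 0 := by
      rw [barOp, comp_apply, signOp_apply, LinearMap.add_apply, Pi.add_apply,
        barLin_apply, bar_nil, headOp'_nil, add_zero, smul_zero]
    rw [this]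
    simp [ksign_add, smul_smul]
  | cons a l' ih =>
    rw [cons_append, conv_cons, barOp_unitFn_cons, if_neg (by simp), map_zero, smul_zero,
      zero_add, ih]

/-- The differential on words and insertion into elements of `C₀`. -/
lemma bar_phi {d : ℤ} {x : 𝐋} (hx : x ∈ deg k V d) (l' : List ι₁) (l : ι₁) :
    𝐛 (l' ++ [l]) (phi p y x) + headOp' z j (reg k V) LinearMap.id (phi p y x)
      (l' ++ [l]) = ε (wt p₁ l' + d * (p₁ l + 1)) • (phi p₁ y₁ x l' * z l) := by
  have h := congrFun (barOp_ins (ρ := reg k V) z hpj hyj hp1 hp2 hy1 hy2 hz x unitFn) (l' ++ [l])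
  rw [parity_of_mem hx, map_smul, LinearMap.smul_apply, Pi.smul_apply, ins_eq_conv hx,
    conv_barOp_unitFn, barOp, comp_apply, signOp_apply] at h
  have h' := congrArg (fun t => ε (wt p₁ (l' ++ [l])) • t) h
  simp only [ksign_smul_self, ksign_smul_smul] at h'
  refine h'.trans ?_
  congr 1
  apply ksign_congr
  simp only [wt_append, wt_cons, wt_nil]
  push_cast
  grind

/-- The differential on words and insertion into elements of `s⁻¹ C₀`. -/
lemma bar_psi {d : ℤ} {x : 𝐋} (hx : x ∈ deg k V d) (l' : List ι₁) (l : ι₁) :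
    𝐛 (l' ++ [l]) (psi p y x) +
      headOp' z j (reg k V) (𝔰 ∘ₗ parity.toLinearMap) (psi p y x) (l' ++ [l]) =
    ε (wt p₁ l' + d * (p₁ l + 1)) • (psi p₁ y₁ x l' * z l) := by
  refine (bar_sub_headOp (ρ := reg k V) (m₁ := m₁) (m₂ := m₂) z hyj hy1 hy2 hz
    (phi p y x) (l' ++ [l])).trans ?_
  change ε _ • (1 - headOp y₁ (reg k V))
    (barOp z (reg k V) (ins p y (reg k V) x unitFn)) _ = _
  rw [barOp_ins z hpj hyj hp1 hp2 hy1 hy2 hz, parity_of_mem hx, map_smul,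
    LinearMap.smul_apply, map_smul, Pi.smul_apply, sub_headOp_ins_eq_conv hx, conv_barOp_unitFn]
  simp only [ksign_smul_smul]
  congr 1
  apply ksign_congr
  simp only [wt_append, wt_cons, wt_nil]
  push_cast
  grind

end Bar

/-! ### Multilinearity -/

section Multilinear

variable {M : Type*} [AddCommGroup M] [Module k M] {F : List (ℤ × diag k V) → M}

variable (k V M) in
/-- The functions on words of labelled elements which, for fixed labels, are multilinear. -/
def multi : Submodule k (List (ℤ × 𝐃) → M) where
  carrier := {F | ∀ pre d post, (∀ y y', F (pre ++ (d, y + y') :: post) =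
    F (pre ++ (d, y) :: post) + F (pre ++ (d, y') :: post)) ∧
    ∀ (r : k) y, F (pre ++ (d, r • y) :: post) = r • F (pre ++ (d, y) :: post)}
  add_mem' hF hG pre d post :=
    ⟨fun y y' => by simp only [Pi.add_apply, (hF pre d post).1, (hG pre d post).1]; abel,
      fun r y => by simp only [Pi.add_apply, (hF pre d post).2, (hG pre d post).2, smul_add]⟩
  zero_mem' pre d post := by simp
  smul_mem' r F hF pre d post :=
    ⟨fun y y' => by simp only [Pi.smul_apply, (hF pre d post).1, smul_add],
      fun s y => by simp only [Pi.smul_apply, (hF pre d post).2, smul_comm r s]⟩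

lemma multi_cons (hF : F ∈ multi k V M) (a) :
    (fun c => F (a :: c)) ∈ multi k V M := fun pre d post => hF (a :: pre) d post

lemma multi_smul_cons (hF : F ∈ multi k V M) (r : k) (d y c) :
    F ((d, r • y) :: c) = r • F ((d, y) :: c) := (hF [] d c).2 r y

lemma multi_comp {M' : Type*} [AddCommGroup M'] [Module k M'] (f : M →ₗ[k] M')
    (hF : F ∈ multi k V M) : (fun c => f (F c)) ∈ multi k V M' := fun pre d post =>
  ⟨fun y y' => by simp only [(hF pre d post).1, map_add], fun r y => by simp only [(hF pre d post).2, map_smul]⟩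

/-- A function of words which depends only on the labels, as a factor. -/
lemma multi_label {s : List ℤ → k} (hF : F ∈ multi k V M) :
    (fun c => s (c.map Prod.fst) • F c) ∈ multi k V M := fun pre d post =>
  ⟨fun y y' => by simp only [(hF pre d post).1, map_append, map_cons, smul_add], fun r y => by simp only [(hF pre d post).2, map_append, map_cons, smul_comm r]⟩

lemma multi_prod {M' : Type*} [AddCommGroup M'] [Module k M']
    {G : List (ℤ × 𝐃) → M'} (hF : F ∈ multi k V M) (hG : G ∈ multi k V M') :
    (fun c => (F c, G c)) ∈ multi k V (M × M') := fun pre d post =>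
  ⟨fun y y' => by simp only [(hF pre d post).1, (hG pre d post).1, Prod.mk_add_mk], fun r y => by simp only [(hF pre d post).2, (hG pre d post).2, Prod.smul_mk]⟩

variable {ρ : Leavitt k V →ₐ[k] Module.End k M}

lemma signOp_mem_multi (hF : F ∈ multi k V M) :
    signOp k Prod.fst M F ∈ multi k V M :=
  multi_label (s := fun l => ε l.sum) hF

lemma headOp_mem_multi (hF : F ∈ multi k V M) :
    headOp Prod.snd ρ F ∈ multi k V M := by
  intro pre d post
  cases pre with
  | nil => exact ⟨fun y y' => by simp, fun r y => by simp⟩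
  | cons a pre => exact multi_comp (ρ a.2) hF pre d post

lemma geomOp_mem_multi (hF : F ∈ multi k V M) : geomOp Prod.snd ρ F ∈ multi k V M := by
  intro pre d post
  have h := hF pre d post
  induction pre with
  | nil =>
    simp only [nil_append, geomOp_cons] at h ⊢
    exact ⟨fun y y' => by rw [h.1]; simp; abel, fun r y => by rw [h.2]; simp⟩
  | cons a pre ih =>
    have ih := ih (hF pre d post)
    simp only [cons_append, geomOp_cons] at h ih ⊢
    exact ⟨fun y y' => by rw [h.1, ih.1, map_add]; abel,
      fun r y => by rw [h.2, ih.2, map_smul, smul_add]⟩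

lemma ins_mem_multi (x : 𝐋) (hF : F ∈ multi k V M) :
    ins Prod.fst Prod.snd ρ x F ∈ multi k V M := by
  induction x using induction generalizing F with
  | hg x =>
    cases x with
    | vert a => rw [ins_vert']; exact multi_comp (ρ _) hF
    | inn a =>
      rw [ins_inn]
      exact multi_comp (ρ _) (signOp_mem_multi (sub_mem hF (headOp_mem_multi hF)))
    | out a => rw [ins_out]; exact geomOp_mem_multi (multi_comp (ρ _) (signOp_mem_multi hF))
  | ha c => rw [AlgHom.commutes]; exact smul_mem _ c hF
  | hm x y hx hy => rw [map_mul]; exact hx (hy hF)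
  | hs x y hx hy => rw [map_add]; exact add_mem (hx hF) (hy hF)

lemma unitFn_mem_multi : (unitFn : List (ℤ × 𝐃) → 𝐋) ∈ multi k V _ := by
  intro pre d post
  cases pre <;> simp

lemma phi_mem_multi (x : 𝐋) :
    phi (ι := ℤ × 𝐃) Prod.fst Prod.snd x ∈ multi k V _ := ins_mem_multi x unitFn_mem_multi

lemma psi_mem_multi (x : 𝐋) :
    psi (ι := ℤ × 𝐃) Prod.fst Prod.snd x ∈ multi k V _ :=
  sub_mem (phi_mem_multi x) (headOp_mem_multi (phi_mem_multi x))

lemma ofFn_update {α : Type*} {n : ℕ} [DecidableEq (Fin n)] (f : Fin n → α) (i : Fin n) (a : α) :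
    ofFn (Function.update f i a) = (ofFn f).take i ++ a :: (ofFn f).drop (i + 1) := by
  have h : ofFn (Function.update f i a) = (ofFn f).set i a := by
    refine List.ext_getElem (by simp) fun j h1 h2 => ?_
    rw [List.getElem_set, List.getElem_ofFn, List.getElem_ofFn, Function.update_apply]
    simp [Fin.ext_iff, eq_comm]
  rw [h, List.set_eq_take_append_cons_drop, if_pos (by simp)]

lemma update_pair {α β ι : Type*} [DecidableEq ι] (d : ι → α) (y : ι → β) (i : ι) (c : β) :
    (fun j => (d j, Function.update y i c j)) = Function.update (fun j => (d j, y j)) i (d i, c) := by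
  funext j
  by_cases hj : j = i
  · subst hj; simp
  · simp [hj]

/-- The multilinear map given by a multilinear function of words and by fixed labels. -/
def multiMap (hF : F ∈ multi k V M) {n : ℕ} (d : Fin n → ℤ) :
    MultilinearMap k (fun _ : Fin n => 𝐃) M where
  toFun y := F (ofFn fun i => (d i, y i))
  map_update_add' y i a b := by
    simp only [update_pair, ofFn_update]
    exact (hF _ _ _).1 a b
  map_update_smul' y i r a := by
    simp only [update_pair, ofFn_update]
    exact (hF _ _ _).2 r a

end Multilinear

section Graded

variable {A : Type*} [AddCommGroup A] [Module k A] {𝒜 : ℤ → Submodule k A}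
  {N : Type*} [AddCommGroup N] [Module k N]

/-- Multilinear maps can be prescribed on homogeneous elements. -/
lemma exists_multilinear (h : DirectSum.IsInternal 𝒜) {n : ℕ}
    (f : (Fin n → ℤ) → MultilinearMap k (fun _ : Fin n => A) N) :
    ∃ g : MultilinearMap k (fun _ : Fin n => A) N,
      ∀ (d : Fin n → ℤ) (a : Fin n → A), (∀ i, a i ∈ 𝒜 (d i)) → g a = f d a := by
  let D := LinearEquiv.ofBijective (DirectSum.coeLinearMap 𝒜) h
  refine ⟨(MultilinearMap.fromDFinsuppEquiv (fun _ : Fin n => ℤ) k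
    (fun p => (f p).compLinearMap fun i => (𝒜 (p i)).subtype)).compLinearMap
      fun _ => D.symm.toLinearMap, fun d a ha => ?_⟩
  have h1 : ∀ i, D.symm (a i) = DFinsupp.single (d i) ⟨a i, ha i⟩ := fun i => by
    rw [LinearEquiv.symm_apply_eq]
    exact (DirectSum.coeLinearMap_lof 𝒜 (d i) ⟨a i, ha i⟩).symm
  simp only [MultilinearMap.compLinearMap_apply, LinearEquiv.coe_coe, h1]
  rw [MultilinearMap.fromDFinsuppEquiv_single]
  rfl

/-- Multilinear maps which agree on homogeneous elements are equal. -/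
lemma multilinear_ext (h : DirectSum.IsInternal 𝒜) {n : ℕ}
    {f g : MultilinearMap k (fun _ : Fin n => A) N}
    (hfg : ∀ (d : Fin n → ℤ) (a : Fin n → A), (∀ i, a i ∈ 𝒜 (d i)) → f a = g a) : f = g := by
  let D := LinearEquiv.ofBijective (DirectSum.coeLinearMap 𝒜) h
  have h1 : f.compLinearMap (fun _ => D.toLinearMap) = g.compLinearMap fun _ => D.toLinearMap := by
    refine MultilinearMap.dfinsupp_ext fun p => ?_
    ext x
    have h2 : ∀ i, D (DFinsupp.single (p i) (x i)) = x i := fun i =>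
      DirectSum.coeLinearMap_lof 𝒜 (p i) (x i)
    have := hfg p (fun i => x i) fun i => (x i).2
    simpa [h2] using this
  ext a
  have := congrArg (fun f => f fun i => D.symm (a i)) h1
  simpa using this

end Graded

/-! ### The model of the operations -/

/-- The exponent `∑ (n - i) d_i` of a list of degrees `d_1, …, d_n`. -/
def omg : List ℤ → ℤ
  | [] => 0
  | d :: c => c.length * d + omg c

@[simp] lemma omg_nil : omg [] = 0 := rfl
@[simp] lemma omg_cons (d : ℤ) (c) : omg (d :: c) = c.length * d + omg c := rfl

lemma omg_append (c c' : List ℤ) : omg (c ++ c') = omg c + c'.length * c.sum + omg c' := by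
  induction c with
  | nil => simp
  | cons d c ih =>
    simp only [cons_append, omg_cons, ih, length_append, List.sum_cons]
    push_cast
    ring

section Model

local notation "𝔭" d:max c:max => ofFn fun i => (d i, c i)

variable {A : Type*} [AddCommGroup A] [Module k A] {𝒜 : ℤ → Submodule k A}
  (e : A ≃ₗ[k] diag k V × diag k V)

/-- The component in `s⁻¹ C₀` of an element, with its degree as an element of `C₀`. -/
def toY (l : ℤ × A) : ℤ × 𝐃 := (l.1 - 1, (e l.2).2)

/-- Insertion of words of elements of `A` into an element of `C₀`. -/
def Phi (x : 𝐋) (c : List (ℤ × A)) : 𝐋 :=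
  phi Prod.fst Prod.snd x (c.map (toY e))

/-- Insertion of words of elements of `A` into an element of `s⁻¹ C₀`. -/
def Psi (x : 𝐋) (c : List (ℤ × A)) : 𝐋 :=
  psi Prod.fst Prod.snd x (c.map (toY e))

/-- The exponent `ω(c) + d |c|`. -/
def muExp (d : ℤ) (c : List (ℤ × A)) : ℤ := omg (c.map Prod.fst) + d * wdeg c

variable (𝒜) in
/-- The grading of `A` corresponds to the grading by the subspaces `deg`, where the second
component is shifted. -/
structure IsGraded : Prop where
  internal : DirectSum.IsInternal 𝒜
  mem : ∀ d x, x ∈ 𝒜 d ↔ ((e x).1 : 𝐋) ∈ deg k V d ∧ ((e x).2 : 𝐋) ∈ deg k V (d - 1)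

variable (𝒜) in
/-- The operations on `A` correspond to the operations on pairs of diagonal elements of the Leavitt
path algebra: the differential `(z, y) ↦ (0, z - σ (±z))`, the product
`(z, y) (w, x) = (z w, y w + σ(z) x)`, and insertion of words. -/
structure IsModel (O : Ops k A) : Prop where
  m_one_fst : ∀ a, (e (O.m 1 ![a])).1 = 0
  m_one_snd : ∀ a, ((e (O.m 1 ![a])).2 : 𝐋) = (e a).1 - 𝔰 (parity (e a).1)
  m_two_fst : ∀ a b, (e (O.m 2 ![a, b])).1 = (e a).1 * (e b).1
  m_two_snd : ∀ a b, ((e (O.m 2 ![a, b])).2 : 𝐋) =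
    (e a).2 * (e b).1 + 𝔰 (e a).1 * (e b).2
  m_ne : ∀ n, n ≠ 1 → n ≠ 2 → O.m n = 0
  mu_one_zero : ∀ a : Fin 1 → A, ∀ b : Fin 0 → A, O.mu 1 0 a b = a 0
  mu_zero_one : ∀ a : Fin 0 → A, ∀ b : Fin 1 → A, O.mu 0 1 a b = b 0
  mu_zero : ∀ n, n ≠ 1 → O.mu 0 n = 0
  mu_two : ∀ p q, 1 < p → O.mu p q = 0
  mu_fst : ∀ n d x (dc : Fin n → ℤ) (c : Fin n → A), x ∈ 𝒜 d → (∀ i, c i ∈ 𝒜 (dc i)) →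
    ((e (O.mu 1 n ![x] c)).1 : 𝐋) =
      ε (muExp d (𝔭 dc c)) • Phi e (e x).1 (𝔭 dc c)
  mu_snd : ∀ n d x (dc : Fin n → ℤ) (c : Fin n → A), x ∈ 𝒜 d → (∀ i, c i ∈ 𝒜 (dc i)) →
    ((e (O.mu 1 n ![x] c)).2 : 𝐋) =
      ε (muExp d (𝔭 dc c) + ∑ i, dc i + n) •
        Psi e (e x).2 (𝔭 dc c)

variable {e}

lemma vec_one {α : Type*} (a : Fin 1 → α) : ![a 0] = a := by
  ext i; rw [Subsingleton.elim i 0]; rfl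

/-- The operations of the model exist. -/
lemma exists_isModel (hg : IsGraded 𝒜 e) : ∃ O : Ops k A, IsModel 𝒜 e O := by
  -- the products
  let m1 : A →ₗ[k] A := e.symm.toLinearMap ∘ₗ LinearMap.inr k _ _ ∘ₗ
    LinearMap.codRestrict (Subalgebra.toSubmodule 𝐃)
      ((LinearMap.id - 𝔰 ∘ₗ parity.toLinearMap) ∘ₗ 𝐃.val.toLinearMap)
      (fun x => 𝐃.sub_mem x.2 shift_mem_diag) ∘ₗ LinearMap.fst k _ _ ∘ₗ e.toLinearMap
  let S : 𝐃 →ₗ[k] 𝐃 := LinearMap.codRestrict (Subalgebra.toSubmodule 𝐃)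
    (𝔰 ∘ₗ 𝐃.val.toLinearMap) fun x => shift_mem_diag
  let m2 : A → A → A := fun a b =>
    e.symm ((e a).1 * (e b).1, (e a).2 * (e b).1 + S (e a).1 * (e b).2)
  let m2' : A →ₗ[k] A →ₗ[k] A := LinearMap.mk₂ k m2
    (fun a a' b => e.injective <| by simp [m2, add_mul]; abel)
    (fun r a b => e.injective <| by simp [m2])
    (fun a b b' => e.injective <| by simp [m2, mul_add]; abel)
    (fun r a b => e.injective <| by simp [m2])
  -- the insertions
  have hmu : ∀ n : ℕ, ∃ g : MultilinearMap k (fun _ : Fin (n + 1) => A) A,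
      ∀ (d : ℤ) x (dc : Fin n → ℤ) (c : Fin n → A), x ∈ 𝒜 d → (∀ i, c i ∈ 𝒜 (dc i)) →
        ((e (g (Fin.cons x c))).1 : 𝐋) =
          ε (muExp d (𝔭 dc c)) • Phi e (e x).1 (𝔭 dc c) ∧
        ((e (g (Fin.cons x c))).2 : 𝐋) =
          ε (muExp d (𝔭 dc c) + ∑ i, dc i + n) •
            Psi e (e x).2 (𝔭 dc c) := by
    intro n
    let s : ℤ → List ℤ → ℤ := fun d l =>
      omg (l.map fun a => a + 1) + d * (l.map fun a => a + 1).sum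
    let F : ℤ → 𝐃 × 𝐃 → List (ℤ × 𝐃) → 𝐃 × 𝐃 := fun d x c =>
      (ε (s d (c.map Prod.fst)) • ⟨phi Prod.fst Prod.snd x.1 c, phi_mem_diag x.1.2 c⟩,
        ε (s d (c.map Prod.fst) + ((c.map Prod.fst).map fun a => a + 1).sum +
          (c.map Prod.fst).length) • ⟨psi Prod.fst Prod.snd x.2 c, psi_mem_diag x.2.2 c⟩)
    have hmem : ∀ F : List (ℤ × 𝐃) → 𝐃,
        (fun c => (F c : 𝐋)) ∈ multi k V _ → F ∈ multi k V _ := fun F hF pre d post =>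
      ⟨fun y y' => Subtype.ext ((hF pre d post).1 y y'), fun r y =>
        Subtype.ext ((hF pre d post).2 r y)⟩
    have hF : ∀ d x, F d x ∈ multi k V _ := fun d x =>
      multi_prod (multi_label (s := fun l => ε (s d l)) (hmem _ (phi_mem_multi _)))
        (multi_label (s := fun l => ε (s d l + (l.map fun a => a + 1).sum + l.length))
          (hmem _ (psi_mem_multi _)))
    let f : (Fin (n + 1) → ℤ) → MultilinearMap k (fun _ : Fin (n + 1) => A) A := fun d =>
      LinearMap.uncurryLeft
        { toFun := fun x => e.symm.toLinearMap.compMultilinearMap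
            ((multiMap (hF (d 0) (e x)) fun i => d i.succ - 1).compLinearMap
              fun _ => LinearMap.snd k _ _ ∘ₗ e.toLinearMap)
          map_add' := fun x x' => by
            ext c
            refine e.injective (Prod.ext (Subtype.ext ?_) (Subtype.ext ?_)) <;>
              simp [multiMap, F, phi_add, psi_add]
          map_smul' := fun r x => by
            ext c
            refine e.injective (Prod.ext (Subtype.ext ?_) (Subtype.ext ?_)) <;>
              simp [multiMap, F, phi_smul, psi_smul, smul_comm r] }
    obtain ⟨g, hg'⟩ := exists_multilinear hg.internal f
    refine ⟨g, fun d x dc c hx hc => ?_⟩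
    have h1 := hg' (Fin.cons d dc) (Fin.cons x c) (Fin.cases hx hc)
    have h2 : ((ofFn fun i => (dc i - 1, (e (c i)).2)).map Prod.fst).map (fun a => a + 1) =
        ofFn dc := by
      simp [map_ofFn, Function.comp_def]
    have h3 : (𝔭 dc c).map (toY e) =
        ofFn fun i => (dc i - 1, (e (c i)).2) := by
      simp [map_ofFn, Function.comp_def, toY]
    have h4 : ∀ c' : List (ℤ × 𝐃), c' = (ofFn fun i => (dc i - 1, (e (c i)).2)) →
        e (g (Fin.cons x c)) = F d (e x) c' := by
      rintro c' rfl
      simp [h1, f, multiMap]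
    rw [h4 _ rfl]
    have h5 : muExp d (𝔭 dc c) =
        s d ((ofFn fun i => (dc i - 1, (e (c i)).2)).map Prod.fst) := by
      simp only [s, h2]
      simp [muExp, wdeg, map_ofFn, Function.comp_def]
    constructor
    · simp only [F, Phi, h3, h5]; rfl
    · simp only [F, Psi, h3, h5, h2, length_map, List.length_ofFn, List.sum_ofFn]; rfl
  choose g hg' using hmu
  let O : Ops k A :=
    { m := fun n => match n with
        | 1 => MultilinearMap.ofSubsingleton k A A (0 : Fin 1) m1
        | 2 => LinearMap.uncurryLeft
            ((MultilinearMap.ofSubsingletonₗ k k A A (0 : Fin 1)).toLinearMap ∘ₗ m2')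
        | _ => 0
      mu := fun p q => match p, q with
        | 1, 0 => MultilinearMap.ofSubsingleton k A _ (0 : Fin 1)
            (MultilinearMap.constLinearEquivOfIsEmpty (R := k) (S := k)
              (M₁ := fun _ : Fin 0 => A) (M₂ := A)).toLinearMap
        | 1, n + 1 => MultilinearMap.ofSubsingleton k A _ (0 : Fin 1) (g (n + 1)).curryLeft
        | 0, 1 => MultilinearMap.constOfIsEmpty k _
            (MultilinearMap.ofSubsingleton k A A (0 : Fin 1) LinearMap.id)
        | _, _ => 0 }
  have hO1 a : O.m 1 ![a] = m1 a := rfl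
  have hO2 a b : O.m 2 ![a, b] = m2 a b := rfl
  have hO3 n x (c : Fin (n + 1) → A) : O.mu 1 (n + 1) ![x] c = g (n + 1) (Fin.cons x c) := rfl
  have hO4 x (c : Fin 0 → A) : O.mu 1 0 ![x] c = x := rfl
  refine ⟨O, ⟨fun a => ?_, fun a => ?_, fun a b => ?_, fun a b => ?_, fun n h1 h2 => ?_,
    fun a b => rfl, fun a b => rfl, fun n h => ?_, fun p q h => ?_, fun n d x dc c hx hc => ?_,
    fun n d x dc c hx hc => ?_⟩⟩
  · simp [hO1, m1]
  · simp [hO1, m1]; rfl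
  · simp [hO2, m2]
  · simp [hO2, m2]; rfl
  · obtain _ | _ | _ | n := n
    all_goals first | rfl | exact absurd rfl ‹_›
  · obtain _ | _ | n := n
    all_goals first | rfl | exact absurd rfl h
  · obtain _ | _ | p := p
    all_goals first | rfl | omega
  · cases n with
    | zero => simp [hO4, muExp, Phi, ksign_zero, wdeg]
    | succ n => rw [hO3]; exact (hg' (n + 1) d x dc c hx hc).1
  · cases n with
    | zero => simp [hO4, muExp, Psi, ksign_zero, wdeg]
    | succ n => rw [hO3]; exact (hg' (n + 1) d x dc c hx hc).2

end Model

/-! ### Operations on words -/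

section Words

variable {A : Type*} [AddCommGroup A] [Module k A] {𝒜 : ℤ → Submodule k A} (O : Ops k A)

local notation "𝐖" => List (ℤ × A)

omit [AddCommGroup A] in
lemma wdeg_nil : wdeg ([] : 𝐖) = 0 := rfl

omit [AddCommGroup A] in
lemma wdeg_cons (a : ℤ × A) (L) : wdeg (a :: L) = a.1 + wdeg L := by simp [wdeg]

omit [AddCommGroup A] in
lemma wdeg_append (L L' : 𝐖) : wdeg (L ++ L') = wdeg L + wdeg L' := by simp [wdeg]

lemma homog_nil : Homog 𝒜 [] := by simp [Homog]

lemma homog_cons {a : ℤ × A} {L} : Homog 𝒜 (a :: L) ↔ a.2 ∈ 𝒜 a.1 ∧ Homog 𝒜 L := by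
  simp [Homog]

lemma homog_append {L L' : 𝐖} : Homog 𝒜 (L ++ L') ↔ Homog 𝒜 L ∧ Homog 𝒜 L' := by
  simp only [Homog, List.mem_append]
  exact ⟨fun h => ⟨fun x hx => h x (.inl hx), fun x hx => h x (.inr hx)⟩,
    fun h x hx => hx.elim (h.1 x) (h.2 x)⟩

lemma homog_take {L : 𝐖} (h : Homog 𝒜 L) (n : ℕ) : Homog 𝒜 (L.take n) :=
  fun x hx => h x (List.mem_of_mem_take hx)

lemma homog_drop {L : 𝐖} (h : Homog 𝒜 L) (n : ℕ) : Homog 𝒜 (L.drop n) :=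
  fun x hx => h x (List.mem_of_mem_drop hx)

lemma mW_one (a : ℤ × A) : (O.mW [a]).2 = O.m 1 ![a.2] := by
  refine congrArg (O.m 1) (funext fun i => ?_)
  fin_cases i; rfl

lemma mW_two (a b : ℤ × A) : (O.mW [a, b]).2 = O.m 2 ![a.2, b.2] := by
  refine congrArg (O.m 2) (funext fun i => ?_)
  fin_cases i <;> rfl

lemma mW_eq_zero {L : 𝐖} {a : ℤ × A} (ha : a ∈ L) (h : a.2 = 0) : (O.mW L).2 = 0 := by
  obtain ⟨i, rfl⟩ := List.get_of_mem ha
  exact (O.m L.length).map_coord_zero i h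

lemma muW_eq_zero_left {K L : 𝐖} {a : ℤ × A} (ha : a ∈ K) (h : a.2 = 0) :
    (O.muW K L).2 = 0 := by
  obtain ⟨i, rfl⟩ := List.get_of_mem ha
  change O.mu _ _ _ _ = 0
  rw [(O.mu K.length L.length).map_coord_zero i h]; rfl

lemma muW_eq_zero_right {K L : 𝐖} {a : ℤ × A} (ha : a ∈ L) (h : a.2 = 0) :
    (O.muW K L).2 = 0 := by
  obtain ⟨i, rfl⟩ := List.get_of_mem ha
  exact (O.mu K.length L.length _).map_coord_zero i h

variable {O} {e : A ≃ₗ[k] diag k V × diag k V}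

section

variable (hO : IsModel 𝒜 e O)
include hO

lemma mW_ne (L : 𝐖) (h1 : L.length ≠ 1) (h2 : L.length ≠ 2) : (O.mW L).2 = 0 := by
  change O.m _ _ = 0
  rw [hO.m_ne _ h1 h2]; rfl

lemma muW_nil_one (a : ℤ × A) : (O.muW [] [a]).2 = a.2 := hO.mu_zero_one _ _

lemma muW_nil_one' (a : ℤ × A) : O.muW [] [a] = a :=
  Prod.ext (by simp [Ops.muW, wdeg]) (hO.mu_zero_one _ _)

lemma muW_nil_ne (L : 𝐖) (h : L.length ≠ 1) : (O.muW [] L).2 = 0 := by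
  change O.mu 0 _ _ _ = 0
  rw [hO.mu_zero _ h]; rfl

lemma muW_one_nil (a : ℤ × A) : O.muW [a] [] = a :=
  Prod.ext (by simp [Ops.muW, wdeg]) (hO.mu_one_zero _ _)

lemma muW_two (K L : 𝐖) (h : 1 < K.length) : (O.muW K L).2 = 0 := by
  change O.mu _ _ _ _ = 0
  rw [hO.mu_two _ _ h]; rfl

omit hO in
lemma muW_eq_mu (x : ℤ × A) (c : 𝐖) :
    (O.muW [x] c).2 = O.mu 1 c.length ![x.2] fun i => (c.get i).2 :=
  congrArg (fun v => O.mu 1 c.length v _) (vec_one _).symm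

omit [AddCommGroup A] hO in
lemma ofFn_get_pair (c : 𝐖) : ofFn (fun i => ((c.get i).1, (c.get i).2)) = c :=
  List.ofFn_get c

lemma muW_fst (x : ℤ × A) (hx : x.2 ∈ 𝒜 x.1) {c : 𝐖} (hc : Homog 𝒜 c) :
    ((e (O.muW [x] c).2).1 : 𝐋) = ε (muExp x.1 c) • Phi e (e x.2).1 c := by
  rw [muW_eq_mu, hO.mu_fst c.length x.1 x.2 (fun i => (c.get i).1) _ hx fun i => hc _ (c.get_mem i),
    ofFn_get_pair]

omit [AddCommGroup A] hO in
lemma sum_get_fst (c : 𝐖) : ∑ i, (c.get i).1 = wdeg c := by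
  rw [← List.sum_ofFn, wdeg]
  exact congrArg _ (map_ofFn.symm.trans (congrArg _ (ofFn_get_pair c)))

lemma muW_snd (x : ℤ × A) (hx : x.2 ∈ 𝒜 x.1) {c : 𝐖} (hc : Homog 𝒜 c) :
    ((e (O.muW [x] c).2).2 : 𝐋) =
      ε (muExp x.1 c + wdeg c + c.length) • Psi e (e x.2).2 c := by
  rw [muW_eq_mu, hO.mu_snd c.length x.1 x.2 (fun i => (c.get i).1) _ hx fun i => hc _ (c.get_mem i),
    ofFn_get_pair, sum_get_fst]

end

variable (hg : IsGraded 𝒜 e) (hO : IsModel 𝒜 e O)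

lemma wt_toY (c : 𝐖) : wt Prod.fst (c.map (toY e)) = wdeg c - c.length := by
  induction c with
  | nil => rfl
  | cons a c ih =>
    rw [map_cons, wt_cons, ih, wdeg_cons, toY, length_cons]
    push_cast
    ring

variable (𝒜) in
/-- Homogeneous letters. -/
abbrev Hletter : Type _ := {q : ℤ × A // q.2 ∈ 𝒜 q.1}

/-- The degree of the component in `s⁻¹ C₀` of a homogeneous letter. -/
def hdeg (q : Hletter 𝒜) : ℤ := q.1.1 - 1

lemma wt_hdeg (c : List (Hletter 𝒜)) : wt hdeg c = wdeg c♭ - c.length := by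
  induction c with
  | nil => rfl
  | cons a c ih =>
    rw [map_cons, wt_cons, ih, wdeg_cons, hdeg, length_cons]
    push_cast
    ring

lemma Phi_val (x : 𝐋) (c : List (Hletter 𝒜)) :
    Phi e x c♭ = phi hdeg (fun q => (toY e q.1).2) x c := by
  rw [Phi, List.map_map]
  exact phi_map (p := hdeg) (toY e ∘ Subtype.val) (fun _ => rfl) (fun _ => rfl) x c

lemma Psi_val (x : 𝐋) (c : List (Hletter 𝒜)) :
    Psi e x c♭ = psi hdeg (fun q => (toY e q.1).2) x c := by
  rw [Psi, List.map_map]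
  exact psi_map (p := hdeg) (toY e ∘ Subtype.val) (fun _ => rfl) (fun _ => rfl) x c

/-- Homogeneous words as words in a type of homogeneous letters. -/
lemma exists_lift {c : 𝐖} (hc : Homog 𝒜 c) :
    ∃ c' : List (Hletter 𝒜), c'♭ = c := by
  lift c to List (Hletter 𝒜) using hc
  exact ⟨c, rfl⟩

lemma homog_map (L : List (Hletter 𝒜)) : Homog 𝒜 L♭ := by
  intro x hx
  obtain ⟨q, _, rfl⟩ := List.mem_map.1 hx
  exact q.2

include hg

lemma snd_mem_deg (q : Hletter 𝒜) :
    ((toY e q.1).2 : 𝐋) ∈ deg k V (toY e q.1).1 := ((hg.mem _ _).1 q.2).2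

lemma Phi_mem_deg {d : ℤ} {x : 𝐋} (hx : x ∈ deg k V d) {c : 𝐖}
    (hc : Homog 𝒜 c) : Phi e x c ∈ deg k V (d + (wdeg c - c.length)) := by
  obtain ⟨c, rfl⟩ := exists_lift hc
  rw [Phi_val, length_map, ← wt_hdeg]
  exact phi_mem_deg (snd_mem_deg hg) hx c

lemma Psi_mem_deg {d : ℤ} {x : 𝐋} (hx : x ∈ deg k V d) {c : 𝐖}
    (hc : Homog 𝒜 c) : Psi e x c ∈ deg k V (d + (wdeg c - c.length)) := by
  obtain ⟨c, rfl⟩ := exists_lift hc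
  rw [Psi_val, length_map, ← wt_hdeg]
  exact psi_mem_deg (snd_mem_deg hg) hx c

include hO

lemma muW_mem (x : ℤ × A) (hx : x.2 ∈ 𝒜 x.1) {c : 𝐖} (hc : Homog 𝒜 c) :
    (O.muW [x] c).2 ∈ 𝒜 (O.muW [x] c).1 := by
  obtain ⟨h1, h2⟩ := (hg.mem _ _).1 hx
  rw [hg.mem, muW_fst hO x hx hc, muW_snd hO x hx hc]
  have hd : (O.muW [x] c).1 = x.1 + (wdeg c - c.length) := by
    simp [Ops.muW, wdeg]
    ring
  rw [hd]
  refine ⟨smul_mem _ _ (Phi_mem_deg hg h1 hc), smul_mem _ _ ?_⟩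
  convert Psi_mem_deg hg h2 hc using 2
  ring

lemma mW_one_mem (x : ℤ × A) (hx : x.2 ∈ 𝒜 x.1) : (O.mW [x]).2 ∈ 𝒜 (x.1 + 1) := by
  obtain ⟨h1, h2⟩ := (hg.mem _ _).1 hx
  rw [hg.mem, mW_one, hO.m_one_fst, hO.m_one_snd]
  refine ⟨zero_mem _, ?_⟩
  rw [parity_of_mem h1, map_smul, add_sub_cancel_right]
  exact sub_mem h1 (smul_mem _ _ (shift_mem_deg h1))

lemma mW_two_mem (x y : ℤ × A) (hx : x.2 ∈ 𝒜 x.1) (hy : y.2 ∈ 𝒜 y.1) :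
    (O.mW [x, y]).2 ∈ 𝒜 (x.1 + y.1) := by
  rw [hg.mem, mW_two, hO.m_two_fst, hO.m_two_snd]
  obtain ⟨h1, h2⟩ := (hg.mem _ _).1 hx
  obtain ⟨h3, h4⟩ := (hg.mem _ _).1 hy
  refine ⟨mul_mem_deg h1 h3, add_mem ?_ ?_⟩
  · convert mul_mem_deg h2 h3 using 2; ring
  · convert mul_mem_deg (shift_mem_deg h1) h4 using 2; ring

lemma model_m_deg (n : ℕ) (d : Fin n → ℤ) (a : Fin n → A) (ha : ∀ i, a i ∈ 𝒜 (d i)) :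
    O.m n a ∈ 𝒜 ((∑ i, d i) + 2 - n) := by
  by_cases h1 : n = 1
  · subst h1
    have h := mW_one_mem hg hO (d 0, a 0) (ha 0)
    rw [mW_one, vec_one] at h
    convert h using 2
    simp; ring
  by_cases h2 : n = 2
  · subst h2
    have h := mW_two_mem hg hO (d 0, a 0) (d 1, a 1) (ha 0) (ha 1)
    rw [mW_two] at h
    convert h using 2
    · simp
    · congr 1
      funext i
      fin_cases i <;> rfl
  rw [hO.m_ne n h1 h2]
  exact zero_mem _

lemma model_mu_deg (p q : ℕ) (d : Fin p → ℤ) (dc : Fin q → ℤ) (a : Fin p → A) (b : Fin q → A)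
    (ha : ∀ i, a i ∈ 𝒜 (d i)) (hb : ∀ i, b i ∈ 𝒜 (dc i)) :
    O.mu p q a b ∈ 𝒜 ((∑ i, d i) + (∑ i, dc i) + 1 - p - q) := by
  rcases lt_or_ge 1 p with h | h
  · rw [hO.mu_two p q h]; exact zero_mem _
  interval_cases p
  · by_cases h1 : q = 1
    · subst h1
      rw [hO.mu_zero_one]
      convert hb 0 using 2
      simp
    · rw [hO.mu_zero q h1]; exact zero_mem _
  · have hc : Homog 𝒜 (ofFn fun i => (dc i, b i)) := by
      intro x hx
      obtain ⟨i, rfl⟩ := List.mem_ofFn.1 hx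
      exact hb i
    have h1 := hO.mu_fst q (d 0) (a 0) dc b (ha 0) hb
    have h2 := hO.mu_snd q (d 0) (a 0) dc b (ha 0) hb
    rw [vec_one] at h1 h2
    obtain ⟨h3, h4⟩ := (hg.mem _ _).1 (ha 0)
    have h5 := Phi_mem_deg hg h3 hc
    have h6 := Psi_mem_deg hg h4 hc
    have h7 : wdeg (ofFn fun i => (dc i, b i)) = ∑ i, dc i := by
      simp [wdeg, map_ofFn, Function.comp_def, List.sum_ofFn]
    rw [h7, List.length_ofFn] at h5 h6
    rw [hg.mem, h1, h2]
    refine ⟨smul_mem _ _ ?_, smul_mem _ _ ?_⟩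
    · convert h5 using 2; simp; ring
    · convert h6 using 2; simp; ring

end Words

/-! ### The `A_∞`-relations -/

section AInfty

variable {A : Type*} [AddCommGroup A] [Module k A] {𝒜 : ℤ → Submodule k A} {O : Ops k A}
  {e : A ≃ₗ[k] diag k V × diag k V} (hg : IsGraded 𝒜 e) (hO : IsModel 𝒜 e O)

local notation "𝐖" => List (ℤ × A)

lemma model_ext {a b : A} (h1 : ((e a).1 : 𝐋) = (e b).1) (h2 : ((e a).2 : 𝐋) = (e b).2) : a = b :=
  e.injective (Prod.ext (Subtype.ext h1) (Subtype.ext h2))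

include hg hO

lemma model_a_infty (L : 𝐖) (hL : Homog 𝒜 L) :
    ∑ j ∈ range L.length, ∑ s ∈ Icc 1 (L.length - j),
      ε (j + s * ((L.length : ℤ) - j - s) + (2 - s) * wdeg (L.take j)) •
        (O.mW (L.take j ++ [O.mW ((L.drop j).take s)] ++ L.drop (j + s))).2 = 0 := by
  have hz : ∀ j s : ℕ, s ∈ Icc 1 (L.length - j) → s ≠ 1 → s ≠ 2 →
      (O.mW (L.take j ++ [O.mW ((L.drop j).take s)] ++ L.drop (j + s))).2 = 0 := by
    intro j s hs h1 h2
    have hl : ((L.drop j).take s).length = s := by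
      rw [length_take, length_drop]
      have := mem_Icc.1 hs
      omega
    exact mW_eq_zero O (a := O.mW ((L.drop j).take s)) (by simp)
      (mW_ne hO _ (by rwa [hl]) (by rwa [hl]))
  match L, hL with
  | [], _ => simp
  | [a], _ =>
    simp only [length_singleton, Finset.range_one, Finset.sum_singleton, Nat.sub_zero,
      Finset.Icc_self, take_zero, drop_zero, nil_append]
    have h : O.m 1 ![O.m 1 ![a.2]] = 0 := by
      refine model_ext (e := e) ?_ ?_
      · rw [hO.m_one_fst]; simp
      · rw [hO.m_one_snd, hO.m_one_fst]; simp
    rw [show [O.mW (List.take 1 [a])] ++ List.drop (0 + 1) [a] = [O.mW [a]] from rfl, mW_one,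
      mW_one, h, smul_zero]
  | [a, b], hL =>
    obtain ⟨ha, hb⟩ := homog_cons.1 hL
    replace hb := (homog_cons.1 hb).1
    simp only [length_cons, length_nil, Finset.sum_range_succ, Finset.sum_range_zero,
      zero_add]
    rw [show Icc 1 (1 + 1 - 0) = {1, 2} from rfl,
      show Icc 1 (1 + 1 - 1) = {1} from rfl, Finset.sum_pair (by norm_num),
      Finset.sum_singleton]
    suffices h : (-1 : k) • (O.mW [O.mW [a], b]).2 + (1 : k) • (O.mW [O.mW [a, b]]).2 +
        (- ε a.1) • (O.mW [a, O.mW [b]]).2 = 0 by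
      refine (congrArg₂ _ (congrArg₂ _ (congrArg₂ _ ?_ rfl) (congrArg₂ _ ?_ rfl))
        (congrArg₂ _ ?_ rfl)).trans h
      · simp [wdeg, ksign_one]
      · simp [wdeg, ksign_zero]
      · rw [← ksign_succ]
        exact ksign_congr (by simp [wdeg]; ring)
    obtain ⟨h1, h2⟩ := (hg.mem _ _).1 ha
    obtain ⟨h3, h4⟩ := (hg.mem _ _).1 hb
    refine model_ext (e := e) ?_ ?_
    · simp [mW_one, mW_two, hO.m_one_fst, hO.m_two_fst]
    · simp only [mW_one, mW_two, map_add, map_smul, Prod.snd_add, Prod.smul_snd,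
        Subalgebra.coe_add, Subalgebra.coe_smul, hO.m_one_snd, hO.m_two_snd, hO.m_one_fst,
        hO.m_two_fst, map_zero, Prod.snd_zero]
      rw [Subalgebra.coe_mul, map_mul, shift_mul _ (parity_mem_diag (e a.2).1.2),
        parity_of_mem h1]
      simp only [map_smul, Subalgebra.coe_zero, map_zero, zero_mul, mul_zero, zero_add, mul_sub, sub_mul,
        smul_mul_assoc, smul_sub, neg_smul, one_smul]
      abel
  | [a, b, c], hL =>
    simp only [length_cons, length_nil, Finset.sum_range_succ, Finset.sum_range_zero,
      zero_add]
    have h0 : ∀ j s : ℕ, s = 1 ∨ s = 3 → s ∈ Icc 1 ([a, b, c].length - j) →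
        (O.mW ([a, b, c].take j ++ [O.mW (([a, b, c].drop j).take s)] ++
          [a, b, c].drop (j + s))).2 = 0 := by
      intro j s hs hs'
      have := mem_Icc.1 hs'
      simp only [length_cons, length_nil] at this
      rcases hs with rfl | rfl
      · refine mW_ne hO _ ?_ ?_ <;> simp <;> omega
      · exact hz j 3 hs' (by norm_num) (by norm_num)
    rw [show Icc 1 (1 + 1 + 1 - 0) = {1, 2, 3} from rfl,
      show Icc 1 (1 + 1 + 1 - 1) = {1, 2} from rfl,
      show Icc 1 (1 + 1 + 1 - 2) = {1} from rfl,
      Finset.sum_insert (by simp), Finset.sum_pair (by norm_num), Finset.sum_pair (by norm_num),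
      Finset.sum_singleton, h0 0 1 (by simp) (by simp), h0 0 3 (by simp) (by simp),
      h0 1 1 (by simp) (by simp), h0 2 1 (by simp) (by simp)]
    suffices h : (1 : k) • (O.mW [O.mW [a, b], c]).2 + (-1 : k) • (O.mW [a, O.mW [b, c]]).2 = 0 by
      simp only [smul_zero, zero_add, add_zero]
      exact (congrArg₂ _ (congrArg₂ _ (ksign_even (by simp)) rfl)
        (congrArg₂ _ (ksign_odd (by simp)) rfl)).trans h
    rw [one_smul, neg_one_smul, ← sub_eq_add_neg, sub_eq_zero, mW_two, mW_two]
    refine model_ext (e := e) ?_ ?_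
    · simp [mW_two, hO.m_two_fst, mul_assoc]
    · simp only [mW_two, hO.m_two_fst, hO.m_two_snd, Subalgebra.coe_mul,
        shift_mul _ (e a.2).1.2, mul_add, add_mul, mul_assoc, add_assoc]
  | a :: b :: c :: d :: L, hL =>
    refine sum_eq_zero fun j _ => sum_eq_zero fun s hs => ?_
    by_cases h1 : s = 1 ∨ s = 2
    · rw [mW_ne hO, smul_zero] <;>
      · have := mem_Icc.1 hs
        simp at this ⊢
        omega
    · rw [hz j s hs (fun h => h1 (.inl h)) (fun h => h1 (.inr h)), smul_zero]

end AInfty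

/-! ### Sums over partitions of words into blocks -/

section Blocks

variable {A : Type*}

local notation "𝐖" => List (ℤ × A)
local notation "𝔠" i:max c:max => (Fin.cons i c : Fin (_ + 1) → ℕ)

lemma sum_parts_zero {M : Type*} [AddCommMonoid M] (n : ℕ) (f : (Fin 0 → ℕ) → M) :
    ∑ c ∈ parts n 0, f c = if n = 0 then f ![] else 0 := by
  cases n <;> simp [parts]

lemma sum_parts_succ {M : Type*} [AddCommMonoid M] (n r : ℕ) (f : (Fin (r + 1) → ℕ) → M) :
    ∑ c ∈ parts n (r + 1), f c =
      ∑ i ∈ range (n + 1), ∑ c ∈ parts (n - i) r, f (Fin.cons i c) := by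
  rw [Finset.sum_sigma']
  refine Finset.sum_nbij' (fun c => ⟨c 0, Fin.tail c⟩) (fun p => Fin.cons p.1 p.2) ?_ ?_ ?_ ?_ ?_
  · intro c hc
    simp only [parts, Finset.Nat.mem_antidiagonalTuple, Finset.mem_sigma, mem_range,
      Fin.sum_univ_succ] at hc ⊢
    refine ⟨by omega, ?_⟩
    change ∑ i, c (Fin.succ i) = _
    omega
  · rintro ⟨i, c⟩ hc
    simp only [parts, Finset.Nat.mem_antidiagonalTuple, Finset.mem_sigma, mem_range,
      Fin.sum_univ_succ, Fin.cons_zero, Fin.cons_succ] at hc ⊢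
    omega
  · exact fun c _ => Fin.cons_self_tail c
  · exact fun _ _ => rfl
  · exact fun c _ => by rw [Fin.cons_self_tail]

lemma sum_filter_lt_succ {M : Type*} [AddCommMonoid M] {r : ℕ} (i : Fin r) (f : Fin (r + 1) → M) :
    ∑ j with j < i.succ, f j = f 0 + ∑ j with j < i, f j.succ := by
  simp [sum_filter, Fin.sum_univ_succ]

lemma sum_filter_succ_lt {M : Type*} [AddCommMonoid M] {r : ℕ} (i : Fin r) (f : Fin (r + 1) → M) :
    ∑ j with i.succ < j, f j = ∑ j with i < j, f j.succ := by
  simp [sum_filter, Fin.sum_univ_succ]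

lemma sum_filter_zero_lt {M : Type*} [AddCommMonoid M] {r : ℕ} (f : Fin (r + 1) → M) :
    ∑ j with 0 < j, f j = ∑ j : Fin r, f j.succ := by
  simp [sum_filter, Fin.sum_univ_succ]

lemma block_zero {r : ℕ} (i : ℕ) (c : Fin r → ℕ) (L : 𝐖) :
    block (𝔠 i c) 0 L = L.take i := by
  simp [block]

lemma block_succ {r : ℕ} (i : ℕ) (c : Fin r → ℕ) (j : Fin r) (L : 𝐖) :
    block (𝔠 i c) j.succ L = block c j (L.drop i) := by
  simp [block, sum_filter_lt_succ, List.drop_drop]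

lemma sum_wdeg_block {r : ℕ} (c : Fin r → ℕ) (L : 𝐖) (h : ∑ i, c i = L.length) :
    ∑ i, wdeg (block c i L) = wdeg L := by
  induction r generalizing L with
  | zero =>
    rw [List.eq_nil_of_length_eq_zero (l := L) (by simpa using h.symm)]
    simp [wdeg]
  | succ r ih =>
    obtain ⟨i, c, rfl⟩ : ∃ i c', c = Fin.cons i c' := ⟨c 0, Fin.tail c, (Fin.cons_self_tail c).symm⟩
    rw [Fin.sum_univ_succ] at h ⊢
    simp only [Fin.cons_zero, Fin.cons_succ] at h
    simp only [block_zero, block_succ]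
    rw [ih c (L.drop i) (by rw [length_drop]; omega)]
    conv_rhs => rw [← take_append_drop i L]
    simp [wdeg]

lemma tauExp_cons {r : ℕ} (i j : ℕ) (ks ls : Fin r → ℕ) (K L : 𝐖)
    (h : ∑ a, ks a = (K.drop i).length) :
    tauExp (𝔠 i ks) (𝔠 j ls) K L =
      wdeg (L.take j) * wdeg (K.drop i) + tauExp ks ls (K.drop i) (L.drop j) := by
  rw [tauExp, Fin.sum_univ_succ, tauExp]
  simp only [block_zero, block_succ, sum_filter_zero_lt, sum_filter_succ_lt]
  rw [sum_wdeg_block _ _ h]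

lemma kosExp_cons {r : ℕ} (i j : ℕ) (ks ls : Fin r → ℕ) (K L : 𝐖) :
    kosExp (𝔠 i ks) (𝔠 j ls) K L =
      ((r : ℤ) - (∑ a, (ks a : ℤ)) - ∑ a, (ls a : ℤ)) * (wdeg (K.take i) + wdeg (L.take j)) +
        kosExp ks ls (K.drop i) (L.drop j) := by
  rw [kosExp, Fin.sum_univ_succ, kosExp]
  simp only [block_zero, block_succ, sum_filter_lt_succ, Fin.cons_succ, mul_add,
    sum_add_distrib, ← sum_mul, sum_sub_distrib]
  simp
  ring

lemma bexp_cons {r : ℕ} (i j : ℕ) (ks ls : Fin r → ℕ) (c : ℕ) :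
    bexp (𝔠 i ks) (𝔠 j ls) c =
      ((i : ℤ) + j - 1) * (c + r) + j * (∑ a, (ks a : ℤ)) + bexp ks ls c := by
  rw [bexp, Fin.sum_univ_succ, Fin.sum_univ_succ, bexp]
  simp only [sum_filter_zero_lt, sum_filter_succ_lt, Fin.cons_succ, Fin.cons_zero]
  have : ∀ a : Fin r, ((ks a : ℤ) + ls a - 1) * ((c : ℤ) + ((r + 1 : ℕ) : ℤ) -
      (((a.succ : Fin (r + 1)) : ℕ) + 1 : ℤ)) =
      ((ks a : ℤ) + ls a - 1) * ((c : ℤ) + r - ((a : ℕ) + 1 : ℤ)) := fun a => by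
    rw [Fin.val_succ]
    push_cast
    ring
  simp only [this]
  simp
  ring

variable [AddCommGroup A] [Module k A] (O : Ops k A)

lemma muWords_cons {r : ℕ} (i j : ℕ) (ks ls : Fin r → ℕ) (K L : 𝐖) :
    O.muWords (𝔠 i ks) (𝔠 j ls) K L =
      O.muW (K.take i) (L.take j) :: O.muWords ks ls (K.drop i) (L.drop j) := by
  rw [Ops.muWords, ofFn_succ, Ops.muWords]
  simp only [block_zero, block_succ]

variable {M : Type*} [AddCommGroup M] [Module k M]

/-- The signed sum of the values of a function over all words of `r` letters which arise from two
words by applying the operations `μ` to `r` pairs of successive blocks. -/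
def blockSum (r : ℕ) (K L : 𝐖) (G : 𝐖 → M) : M :=
  ∑ ks ∈ parts K.length r, ∑ ls ∈ parts L.length r,
    ε (bexp ks ls 0 + tauExp ks ls K L + kosExp ks ls K L) • G (O.muWords ks ls K L)

variable {O}

lemma blockSum_zero (K L : 𝐖) (G : 𝐖 → M) :
    blockSum O 0 K L G = if K = [] ∧ L = [] then G [] else 0 := by
  rw [blockSum, sum_parts_zero]
  simp only [sum_parts_zero]
  cases K <;> cases L <;> simp [bexp, tauExp, kosExp, Ops.muWords, ksign_zero]

/-- Splitting off the first pair of blocks. -/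
lemma blockSum_succ (r : ℕ) (K L : 𝐖) (G : 𝐖 → M) :
    blockSum O (r + 1) K L G = ∑ i ∈ range (K.length + 1), ∑ j ∈ range (L.length + 1),
      ε (((i : ℤ) + j - 1) * r + j * ((K.length : ℤ) - i) +
        wdeg (L.take j) * wdeg (K.drop i) + ((r : ℤ) - ((K.length : ℤ) - i) - ((L.length : ℤ) - j)) *
          (wdeg (K.take i) + wdeg (L.take j))) •
        blockSum O r (K.drop i) (L.drop j) fun W => G (O.muW (K.take i) (L.take j) :: W) := by
  rw [blockSum, sum_parts_succ]
  refine sum_congr rfl fun i hi => ?_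
  simp only [sum_parts_succ]
  rw [Finset.sum_comm]
  refine sum_congr rfl fun j hj => ?_
  rw [blockSum, length_drop, length_drop, smul_sum]
  refine sum_congr rfl fun ks hks => ?_
  rw [smul_sum]
  refine sum_congr rfl fun ls hls => ?_
  simp only [parts, Finset.Nat.mem_antidiagonalTuple] at hks hls
  simp at hi hj
  rw [muWords_cons, ksign_smul_smul, bexp_cons, kosExp_cons, tauExp_cons _ _ _ _ _ _
    (by rw [hks, length_drop])]
  congr 2
  have h1 : (∑ a, (ks a : ℤ)) = (K.length : ℤ) - i := by
    rw [← Nat.cast_sum, hks, Nat.cast_sub (by omega)]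
  have h2 : (∑ a, (ls a : ℤ)) = (L.length : ℤ) - j := by
    rw [← Nat.cast_sum, hls, Nat.cast_sub (by omega)]
  rw [h1, h2]
  push_cast
  ring

lemma blockSum_congr (r : ℕ) (K L : 𝐖) {G G' : 𝐖 → M}
    (h : ∀ W, W.length = r → G W = G' W) :
    blockSum O r K L G = blockSum O r K L G' := by
  refine sum_congr rfl fun ks _ => sum_congr rfl fun ls _ => ?_
  rw [h _ (by simp [Ops.muWords])]

lemma blockSum_eq_zero (r : ℕ) (K L : 𝐖) {G : 𝐖 → M}
    (h : ∀ W, W.length = r → G W = 0) : blockSum O r K L G = 0 :=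
  sum_eq_zero fun ks _ => sum_eq_zero fun ls _ => by
    rw [h _ (by simp [Ops.muWords]), smul_zero]

lemma blockSum_smul (r : ℕ) (K L : 𝐖) (c : k) (G : 𝐖 → M) :
    blockSum O r K L (fun W => c • G W) = c • blockSum O r K L G := by
  rw [blockSum, blockSum, smul_sum]
  refine sum_congr rfl fun ks _ => ?_
  rw [smul_sum]
  exact sum_congr rfl fun ls _ => smul_comm _ _ _

lemma blockSum_one (K L : 𝐖) (G : 𝐖 → M) :
    blockSum O 1 K L G = G [O.muW K L] := by
  rw [blockSum_succ, sum_eq_single K.length, sum_eq_single L.length]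
  · rw [blockSum_zero, if_pos (by simp)]
    simp [ksign_zero, wdeg]
  · intro j hj hj'
    have := mem_range.1 hj
    rw [blockSum_zero, if_neg (by simp only [List.drop_eq_nil_iff]; omega), smul_zero]
  · simp
  · intro i hi hi'
    refine sum_eq_zero fun j _ => ?_
    have := mem_range.1 hi
    rw [blockSum_zero, if_neg (by simp only [List.drop_eq_nil_iff]; omega), smul_zero]
  · simp

end Blocks

/-! ### The associativity of the insertions -/

section Model

variable {A : Type*} [AddCommGroup A] [Module k A] {𝒜 : ℤ → Submodule k A} {O : Ops k A}
  {e : A ≃ₗ[k] diag k V × diag k V} {M : Type*} [AddCommGroup M] [Module k M]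
  (hg : IsGraded 𝒜 e) (hO : IsModel 𝒜 e O)

local notation "𝐖" => List (ℤ × A)
local notation "𝔪" L:max i:max s:max => List.take i L ++ [O.mW (List.take s (List.drop i L))] ++
  List.drop (i + s) L
variable (e) in
/-- A multilinear function on words of diagonal elements, as a function on words of elements of `A`
with the sign by which the braces and the operations `μ_{1, n}` differ. -/
def brc (F : List (ℤ × 𝐃) → M) (W : 𝐖) : M :=
  ε (omg (W.map Prod.fst)) • F (W.map (toY e))

lemma brc_cons (F : List (ℤ × 𝐃) → M) (a : ℤ × A) (W : 𝐖) :
    brc e F (a :: W) = ε (W.length * a.1) • brc e (fun c => F (toY e a :: c)) W := by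
  rw [brc, brc, ksign_smul_smul, map_cons, map_cons, omg_cons, length_map]

lemma multi_zero_cons {F : List (ℤ × 𝐃) → M} (hF : F ∈ multi k V M) (d : ℤ) (c) :
    F ((d, 0) :: c) = 0 := by
  have := multi_smul_cons hF 0 d 0 c
  rwa [zero_smul, zero_smul] at this

lemma brc_zero {F : List (ℤ × 𝐃) → M} (hF : F ∈ multi k V M) {a : ℤ × A} (h : a.2 = 0) (W : 𝐖) :
    brc e (fun c => F (toY e a :: c)) W = 0 := by
  rw [brc, toY, h, map_zero, Prod.snd_zero, multi_zero_cons hF, smul_zero]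

/-- Splitting off the first pair of blocks; there is no dependence of the sign on the number of
blocks. -/
lemma blockSum_brc_succ (r : ℕ) (K L : 𝐖) (F : List (ℤ × 𝐃) → M) :
    blockSum O (r + 1) K L (brc e F) =
      ∑ i ∈ range (K.length + 1), ∑ j ∈ range (L.length + 1),
        ε (j * ((K.length : ℤ) - i) + wdeg (L.take j) * wdeg (K.drop i) +
          (((K.length : ℤ) - i) + ((L.length : ℤ) - j)) * (wdeg (K.take i) + wdeg (L.take j))) •
        blockSum O r (K.drop i) (L.drop j)
          (brc e fun c => F (toY e (O.muW (K.take i) (L.take j)) :: c)) := by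
  rw [blockSum_succ]
  refine sum_congr rfl fun i hi => sum_congr rfl fun j hj => ?_
  rw [blockSum_congr r (K.drop i) (L.drop j) (G' := fun W => ε (r *
    (O.muW (K.take i) (L.take j)).1) •
    (brc e fun c => F (toY e (O.muW (K.take i) (L.take j)) :: c)) W)
    (fun W hW => by rw [brc_cons, hW]), blockSum_smul, ksign_smul_smul]
  congr 1
  have h1 : (O.muW (K.take i) (L.take j)).1 = wdeg (K.take i) + wdeg (L.take j) + 1 - i - j := by
    simp only [Ops.muW, length_take]
    rw [min_eq_left (by have := mem_range.1 hi; omega),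
      min_eq_left (by have := mem_range.1 hj; omega)]
  rw [h1]
  apply ksign_congr
  push_cast
  generalize (i : ZMod 2) = i, (j : ZMod 2) = j, (r : ZMod 2) = r, (K.length : ZMod 2) = a,
    (L.length : ZMod 2) = b, (wdeg (K.take i) : ZMod 2) = x, (wdeg (L.take j) : ZMod 2) = y,
    (wdeg (K.drop i) : ZMod 2) = z
  have h2 : (2 : ZMod 2) = 0 := rfl
  linear_combination (r * (x + y) - ((a - i) + (b - j)) * (x + y)) * h2

include hO in
/-- The pairs of blocks which contribute when there are no letters on the left. -/
lemma blockSum_brc_nil (r : ℕ) (L : 𝐖) {F : List (ℤ × 𝐃) → M} (hF : F ∈ multi k V M) :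
    blockSum O r [] L (brc e F) = if r = L.length then brc e F L else 0 := by
  induction L generalizing r F with
  | nil =>
    cases r with
    | zero => simp [blockSum_zero]
    | succ r =>
      rw [blockSum_brc_succ, if_neg (by simp)]
      refine sum_eq_zero fun i hi => sum_eq_zero fun j hj => ?_
      rw [blockSum_eq_zero _ _ _ fun W _ => brc_zero hF
        (by rw [List.take_nil, List.take_nil, muW_nil_ne hO _ (by simp)]) W, smul_zero]
  | cons a L ih =>
    cases r with
    | zero => simp [blockSum_zero]
    | succ r =>
      rw [blockSum_brc_succ]
      simp only [length_nil, zero_add, sum_range_one, take_zero, drop_zero]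
      rw [sum_eq_single 1]
      · simp only [take_succ_cons, take_zero, drop_succ_cons, drop_zero]
        rw [muW_nil_one' hO, ih r (multi_cons hF _), brc_cons]
        simp only [length_cons, add_left_inj]
        split_ifs
        · congr 2
          simp [wdeg]
        · rw [smul_zero]
      · intro j hj hj1
        rw [blockSum_eq_zero _ _ _ fun W _ => brc_zero hF (muW_nil_ne hO _ ?_) W, smul_zero]
        have := mem_range.1 hj
        rw [length_take]; omega
      · simp

/-- The pairs of blocks which contribute when there is a letter on the left. -/
lemma blockSum_brc_cons (r : ℕ) (l : ℤ × A) (K L : 𝐖) {F : List (ℤ × 𝐃) → M}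
    (hO : IsModel 𝒜 e O) (hF : F ∈ multi k V M) :
    blockSum O (r + 1) (l :: K) L (brc e F) =
      (∑ j ∈ range (L.length + 1),
        ε (j * K.length + wdeg (L.take j) * wdeg K +
          (K.length + ((L.length : ℤ) - j)) * (l.1 + wdeg (L.take j))) •
        blockSum O r K (L.drop j) (brc e fun c => F (toY e (O.muW [l] (L.take j)) :: c))) +
      match L with
      | [] => 0
      | n :: L => ε (K.length + 1 + n.1 * (l.1 + wdeg K) + (K.length + 1 + L.length) * n.1) •
          blockSum O r (l :: K) L (brc e fun c => F (toY e n :: c)) := by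
  rw [blockSum_brc_succ, length_cons, sum_range_succ', sum_range_succ']
  have hz : ∀ i j, j < L.length + 1 → (i = 0 ∧ j ≠ 1 ∨ 2 ≤ i ∧ i ≤ K.length + 1) →
      ∀ K' L', blockSum O r K' L'
        (brc e fun c => F (toY e (O.muW ((l :: K).take i) (L.take j)) :: c)) = 0 := by
    intro i j hj h K' L'
    refine blockSum_eq_zero _ _ _ fun W _ => brc_zero hF ?_ W
    rcases h with ⟨rfl, h⟩ | h
    · exact muW_nil_ne hO _ (by rw [length_take]; omega)
    · exact muW_two hO _ _ (by rw [length_take, length_cons]; omega)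
  rw [sum_eq_zero, zero_add]
  · congr 1
    · refine sum_congr rfl fun j _ => ?_
      simp only [zero_add, take_succ_cons, take_zero, drop_succ_cons, drop_zero]
      congr 2
      simp [wdeg]
    · cases L with
      | nil =>
        refine sum_eq_zero fun j hj => ?_
        have := mem_range.1 hj
        rw [hz _ _ this (by left; simp at this; simp [this]), smul_zero]
      | cons n L =>
        rw [sum_eq_single 1]
        · simp only [take_succ_cons, take_zero, drop_succ_cons, drop_zero,
            muW_nil_one' hO]
          congr 2
          simp [wdeg]
        · intro j hj h
          rw [hz _ _ (mem_range.1 hj) (.inl ⟨rfl, h⟩), smul_zero]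
        · simp
  · intro i hi
    refine sum_eq_zero fun j hj => ?_
    rw [hz _ _ (mem_range.1 hj) (.inr (by have := mem_range.1 hi; omega)), smul_zero]

variable (e) in
/-- Insertion of a word into the component in `s⁻¹ C₀` of a letter. -/
def hins (q : Hletter 𝒜) (c : List (Hletter 𝒜)) : ℤ × 𝐃 :=
  (hdeg q + wt hdeg c, ⟨Psi e (e q.1.2).2 c♭, psi_mem_diag (e q.1.2).2.2 _⟩)

local notation "𝔟" => bar k hdeg (fun q => toY e (Subtype.val q)) (fun q => toY e (O.mW [Subtype.val q]))
  (fun q q' => toY e (O.mW [Subtype.val q, Subtype.val q']))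
local notation "𝔣" => shuf k hdeg hdeg (fun q => toY e (Subtype.val q)) (hins e)

include hO in
lemma toY_muW (q : Hletter 𝒜) (c : List (Hletter 𝒜)) :
    toY e (O.muW [q.1] c♭) =
      ((hins e q c).1, ε (muExp q.1.1 c♭ + wdeg c♭ + c.length) • (hins e q c).2) := by
  refine Prod.ext ?_ (Subtype.ext ?_)
  · simp [toY, hins, wt_hdeg, hdeg, Ops.muW, wdeg]
    ring
  · change ((e _).2 : 𝐋) = _
    rw [muW_snd hO _ q.2 (homog_map c), length_map]; rfl

/-- The sign by which sums over pairs of blocks differ from `shuf`. -/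
def shufExp (L N : 𝐖) : ℤ :=
  omg (L.map Prod.fst) + omg (N.map Prod.fst) + wdeg N * (wdeg L + L.length) + N.length * L.length

include hO in
lemma sum_blockSum_brc {F : List (ℤ × 𝐃) → M} (hF : F ∈ multi k V M)
    (L N : List (Hletter 𝒜)) (B : ℕ) (hB : L.length + N.length < B) :
    ∑ r ∈ range B, blockSum O r L♭ N♭ (brc e F) =
      ε (shufExp L♭ N♭) • 𝔣 L N F := by
  have hstep : ∀ (l : Hletter 𝒜) (L N : List (Hletter 𝒜)),
      (∀ N' : List (Hletter 𝒜), ∀ {F : List (ℤ × 𝐃) → M}, F ∈ multi k V M → ∀ B,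
        L.length + N'.length < B →
        ∑ r ∈ range B, blockSum O r L♭ N'♭ (brc e F) =
          ε (shufExp L♭ N'♭) • 𝔣 L N' F) →
      ∀ {F : List (ℤ × 𝐃) → M}, F ∈ multi k V M → ∀ B, L.length + N.length < B →
      ∀ j ∈ range (N.length + 1), ∑ r ∈ range B,
        ε (j * L♭.length + wdeg (N♭.take j) * wdeg L♭ +
          (L♭.length + ((N♭.length : ℤ) - j)) * (l.1.1 + wdeg (N♭.take j))) •
        blockSum O r L♭ (N♭.drop j)
          (brc e fun c => F (toY e (O.muW [l.1] (N♭.take j)) :: c)) =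
      ε (shufExp (l :: L)♭ N♭) •
        ε (hdeg l * wt hdeg (N.drop j)) • 𝔣 L (N.drop j) fun c => F (hins e l (N.take j) :: c) := by
    intro l L N ih F hF B hB j hj
    have hj' : j ≤ N.length := by have := mem_range.1 hj; omega
    rw [← smul_sum, ← List.map_drop, ih _ (multi_cons hF _) B
      (by rw [length_drop]; omega), ← List.map_take, toY_muW hO]
    simp only [multi_smul_cons hF]
    rw [show 𝔣 L (N.drop j)
      (fun c => ε (muExp l.1.1 (N.take j)♭ +
        wdeg (N.take j)♭ + (N.take j).length) • F (((hins e l (N.take j)).1,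
          (hins e l (N.take j)).2) :: c)) = _ from
      (shuf_comp (LinearMap.lsmul k M _) L (N.drop j) _).symm, LinearMap.lsmul_apply]
    simp only [ksign_smul_smul]
    refine congrArg₂ _ ?_ rfl
    apply ksign_congr
    rw [wt_hdeg]
    have e2 : N♭ = (N.take j)♭ ++ (N.drop j)♭ := by rw [← map_append, take_append_drop]
    have e3 : ((N.take j).length : ZMod 2) = j := by rw [length_take, min_eq_left hj']
    have e4 : (N.length : ZMod 2) = j + (N.drop j).length := by
      rw [length_drop, Nat.cast_sub hj']; ring
    simp only [shufExp, muExp, hdeg, length_map, map_cons, wdeg_cons, omg_cons,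
      length_cons]
    rw [e2]
    simp only [map_append, omg_append, wdeg_append, length_map]
    have e5 : ((N.take j)♭.map Prod.fst).sum = wdeg (N.take j)♭ := rfl
    rw [e5]
    push_cast
    rw [e3, e4]
    grind
  induction L, N using shuf_induction generalizing F B with
  | h0 N =>
    rw [shuf_nil, List.map_nil]
    simp only [blockSum_brc_nil hO _ _ hF]
    rw [sum_ite_eq', if_pos (by simpa using hB), brc]
    congr 2
    · simp [shufExp, wdeg]
    · exact List.map_map
  | h1 l L ih =>
    obtain ⟨B, rfl⟩ : ∃ B', B = B' + 1 := ⟨B - 1, by omega⟩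
    rw [sum_range_succ', blockSum_zero, if_neg (by simp), add_zero]
    simp only [map_cons, blockSum_brc_cons _ _ _ _ hO hF, List.map_nil, add_zero]
    rw [Finset.sum_comm]
    have := fun j hj => hstep l L [] (fun N {F} hF B hB => ih N hF B hB) hF B
      (by simp at hB ⊢; omega) j hj
    simp only [List.map_nil] at this
    refine (sum_congr rfl this).trans ?_
    simp [shuf_cons_nil, ksign_zero]
  | h2 l L n N ih ih' =>
    obtain ⟨B, rfl⟩ : ∃ B', B = B' + 1 := ⟨B - 1, by omega⟩
    rw [sum_range_succ', blockSum_zero, if_neg (by simp), add_zero]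
    simp only [map_cons, blockSum_brc_cons _ _ _ _ hO hF]
    rw [sum_add_distrib, Finset.sum_comm]
    have := fun j hj => hstep l L (n :: N) (fun N {F} hF B hB => ih N hF B hB) hF B
      (by simp at hB ⊢; omega) j hj
    simp only [map_cons] at this
    have hl : (n.1 :: N♭).length + 1 = (n :: N).length + 1 := by simp
    rw [hl, sum_congr rfl this, ← smul_sum, shuf_cons_cons, smul_add]
    congr 1
    rw [← smul_sum]
    have h3 := ih' (multi_cons hF (toY e n.1)) B (by simp at hB ⊢; omega)
    simp at h3
    rw [h3, ksign_smul_smul]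
    congr 1
    apply ksign_congr
    simp only [shufExp, map_cons, wdeg_cons, omg_cons, length_cons, length_map]
    push_cast
    grind

variable (e) in
/-- The first component of an element of the model. -/
def pr1 : A →ₗ[k] 𝐋 := 𝐃.val.toLinearMap ∘ₗ LinearMap.fst k _ _ ∘ₗ e.toLinearMap

variable (e) in
/-- The second component of an element of the model. -/
def pr2 : A →ₗ[k] 𝐋 := 𝐃.val.toLinearMap ∘ₗ LinearMap.snd k _ _ ∘ₗ e.toLinearMap

lemma pr1_apply (a : A) : pr1 e a = (e a).1 := rfl
lemma pr2_apply (a : A) : pr2 e a = (e a).2 := rfl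

lemma pr_ext {a b : A} (h1 : pr1 e a = pr1 e b) (h2 : pr2 e a = pr2 e b) : a = b :=
  model_ext h1 h2

lemma blockSum_map {M' : Type*} [AddCommGroup M'] [Module k M'] (f : M →ₗ[k] M') (r : ℕ)
    (K L : 𝐖) (G : 𝐖 → M) :
    f (blockSum O r K L G) = blockSum O r K L fun W => f (G W) := by
  simp only [blockSum, map_sum, map_smul]

omit [AddCommGroup A] [Module k A] in
lemma sum_blocks {r : ℕ} {ks : Fin r → ℕ} {n : ℕ} (h : ks ∈ parts n r) : ∑ i, (ks i : ℤ) = n := by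
  rw [← Nat.cast_sum, Finset.Nat.mem_antidiagonalTuple.1 h]

omit [AddCommGroup A] in
lemma length_block {r : ℕ} {ks : Fin r → ℕ} {L : 𝐖} (h : ks ∈ parts L.length r)
    (i : Fin r) : (block ks i L).length = ks i := by
  rw [block, length_take, length_drop, min_eq_left]
  have h1 : (∑ j with j < i, ks j) + ks i ≤ ∑ j, ks j := by
    rw [← Finset.sum_filter_add_sum_filter_not Finset.univ (· < i)]
    gcongr
    exact Finset.single_le_sum (fun _ _ => Nat.zero_le _) (by simp)
  rw [Finset.Nat.mem_antidiagonalTuple.1 h] at h1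
  omega

lemma homog_block {L : 𝐖} (hL : Homog 𝒜 L) {r : ℕ} (ks : Fin r → ℕ) (i : Fin r) :
    Homog 𝒜 (block ks i L) := homog_take (homog_drop hL _) _

lemma model_muW_mem (hg : IsGraded 𝒜 e) (hO : IsModel 𝒜 e O) {K L : 𝐖}
    (hK : Homog 𝒜 K) (hL : Homog 𝒜 L) : (O.muW K L).2 ∈ 𝒜 (O.muW K L).1 := by
  have := model_mu_deg hg hO K.length L.length (fun i => (K.get i).1) (fun i => (L.get i).1)
    (fun i => (K.get i).2) (fun i => (L.get i).2) (fun i => hK _ (K.get_mem i))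
    (fun i => hL _ (L.get_mem i))
  rwa [sum_get_fst, sum_get_fst] at this

/-- The words in a sum over pairs of blocks are homogeneous, of known degree. -/
lemma blockSum_congr_homog (hg : IsGraded 𝒜 e) (hO : IsModel 𝒜 e O) (r : ℕ) {K L : 𝐖}
    (hK : Homog 𝒜 K) (hL : Homog 𝒜 L) {G G' : 𝐖 → M}
    (h : ∀ W, W.length = r → wdeg W = wdeg K + wdeg L + r - K.length - L.length → Homog 𝒜 W →
      G W = G' W) :
    blockSum O r K L G = blockSum O r K L G' := by
  refine sum_congr rfl fun ks hks => sum_congr rfl fun ls hls => ?_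
  rw [h _ (by simp [Ops.muWords])]
  · have h1 : ∀ i, (O.muW (block ks i K) (block ls i L)).1 = wdeg (block ks i K) +
        wdeg (block ls i L) + 1 - ks i - ls i := fun i => by
      change _ + _ + 1 - ((block ks i K).length : ℤ) - ((block ls i L).length : ℤ) = _
      rw [length_block hks, length_block hls]
    rw [wdeg, Ops.muWords, map_ofFn, List.sum_ofFn]
    simp only [Function.comp_apply, h1, sum_sub_distrib, sum_add_distrib]
    rw [sum_wdeg_block _ _ (Finset.Nat.mem_antidiagonalTuple.1 hks),
      sum_wdeg_block _ _ (Finset.Nat.mem_antidiagonalTuple.1 hls), sum_blocks hks, sum_blocks hls]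
    simp
  · intro x hx
    obtain ⟨i, rfl⟩ := List.mem_ofFn.1 hx
    exact model_muW_mem hg hO (homog_block hK _ _) (homog_block hL _ _)

lemma bexp_length {r : ℕ} (ks ls : Fin r → ℕ) (c : ℕ) :
    bexp ks ls c = bexp ks ls 0 + c * ((∑ i, (ks i : ℤ)) + (∑ i, (ls i : ℤ)) - r) := by
  have h : (∑ i, (ks i : ℤ)) + (∑ i, (ls i : ℤ)) - r = ∑ i, ((ks i : ℤ) + ls i - 1) := by
    simp [sum_add_distrib, sum_sub_distrib]
  rw [h, mul_sum]
  simp only [bexp, ← sum_add_distrib]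
  refine sum_congr rfl fun i _ => ?_
  push_cast
  ring

lemma Phi_smul (r : k) (x : 𝐋) (c : 𝐖) : Phi e (r • x) c = r • Phi e x c := phi_smul r x _

lemma Psi_smul (r : k) (x : 𝐋) (c : 𝐖) : Psi e (r • x) c = r • Psi e x c := psi_smul r x _

include hO in
lemma muW_brc_fst (x : ℤ × A) (hx : x.2 ∈ 𝒜 x.1) {W : 𝐖} (hW : Homog 𝒜 W) :
    pr1 e (O.muW [x] W).2 =
      ε (x.1 * wdeg W) • brc e (phi Prod.fst Prod.snd ((e x.2).1 : 𝐋)) W := by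
  rw [pr1_apply, muW_fst hO x hx hW, muExp, brc, ksign_smul_smul, add_comm]; rfl

include hO in
lemma muW_brc_snd (x : ℤ × A) (hx : x.2 ∈ 𝒜 x.1) {W : 𝐖} (hW : Homog 𝒜 W) :
    pr2 e (O.muW [x] W).2 = ε ((x.1 + 1) * wdeg W + W.length) •
      brc e (psi Prod.fst Prod.snd ((e x.2).2 : 𝐋)) W := by
  rw [pr2_apply, muW_snd hO x hx hW, muExp, brc, ksign_smul_smul, Psi]
  congr 2
  ring

section

include hg

/-- Insertion of two words, one after the other. -/
lemma shuf_hins_phi (x : 𝐋) (L N : List (Hletter 𝒜)) :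
    𝔣 L N (phi Prod.fst Prod.snd x) = Phi e (Phi e x L♭) N♭ := by
  rw [Phi_val, Phi_val]
  exact shuf_phi (p := Prod.fst) (y := Prod.snd) (b := hins e) (fun n => rfl) (fun l n => rfl) (fun n => rfl)
    (snd_mem_deg hg) (fun l n => Psi_val _ _) x L N

lemma shuf_hins_psi (x : 𝐋) (L N : List (Hletter 𝒜)) :
    𝔣 L N (psi Prod.fst Prod.snd x) = Psi e (Psi e x L♭) N♭ := by
  rw [Psi_val, Psi_val]
  exact shuf_psi (p := Prod.fst) (y := Prod.snd) (b := hins e) (fun n => rfl) (fun l n => rfl) (fun n => rfl)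
    (snd_mem_deg hg) (fun l n => Psi_val _ _) x L N

include hO

lemma sum_blockSum_muW (x : ℤ × A) (hx : x.2 ∈ 𝒜 x.1) {L N : 𝐖} (hL : Homog 𝒜 L)
    (hN : Homog 𝒜 N) :
    ∑ r ∈ range (L.length + N.length + 1), ε (((r : ℤ) - L.length - N.length) * x.1) •
        blockSum O r L N (fun W => (O.muW [x] W).2) =
      ε (N.length * L.length) • (O.muW [O.muW [x] L] N).2 := by
  have hxL := muW_mem hg hO x hx hL
  have hd : (O.muW [x] L).1 = x.1 + wdeg L - L.length := by
    simp [Ops.muW, wdeg]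
  refine pr_ext (e := e) ?_ ?_
  · have h (r : ℕ) : ε (((r : ℤ) - L.length - N.length) * x.1) •
        blockSum O r L N (fun W => pr1 e (O.muW [x] W).2) = ε (x.1 * (wdeg L + wdeg N)) •
          blockSum O r L N (brc e (phi Prod.fst Prod.snd (e x.2).1)) := by
      rw [← blockSum_smul, ← blockSum_smul]
      refine blockSum_congr_homog hg hO r hL hN fun W hr hw hW => ?_
      rw [muW_brc_fst hO x hx hW, hw, ksign_smul_smul]
      exact congrArg₂ _ (ksign_congr (by push_cast; grind)) rfl
    simp only [map_sum, map_smul, blockSum_map, h]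
    rw [← smul_sum]
    obtain ⟨L, rfl⟩ := exists_lift hL
    obtain ⟨N, rfl⟩ := exists_lift hN
    rw [sum_blockSum_brc hO (phi_mem_multi _) L N _ (by simp), shuf_hins_phi hg, pr1_apply,
      muW_fst hO _ hxL hN, muW_fst hO x hx hL, Phi_smul]
    simp only [ksign_smul_smul]
    refine congrArg₂ _ (ksign_congr ?_) rfl
    simp only [shufExp, muExp, hd, length_map]
    push_cast
    grind
  · have h (r : ℕ) : ε (((r : ℤ) - L.length - N.length) * x.1) •
        blockSum O r L N (fun W => pr2 e (O.muW [x] W).2) = ε ((x.1 + 1) * (wdeg L + wdeg N) + L.length + N.length) •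
          blockSum O r L N (brc e (psi Prod.fst Prod.snd (e x.2).2)) := by
      rw [← blockSum_smul, ← blockSum_smul]
      refine blockSum_congr_homog hg hO r hL hN fun W hr hw hW => ?_
      rw [muW_brc_snd hO x hx hW, hw, hr, ksign_smul_smul]
      exact congrArg₂ _ (ksign_congr (by push_cast; grind)) rfl
    simp only [map_sum, map_smul, blockSum_map, h]
    rw [← smul_sum]
    obtain ⟨L, rfl⟩ := exists_lift hL
    obtain ⟨N, rfl⟩ := exists_lift hN
    rw [sum_blockSum_brc hO (psi_mem_multi _) L N _ (by simp), shuf_hins_psi hg, pr2_apply,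
      muW_snd hO _ hxL hN, muW_snd hO x hx hL, Psi_smul]
    simp only [ksign_smul_smul]
    refine congrArg₂ _ (ksign_congr ?_) rfl
    simp only [shufExp, muExp, hd, length_map]
    push_cast
    grind

lemma model_assoc (K L N : 𝐖) (hK : Homog 𝒜 K) (hL : Homog 𝒜 L) (hN : Homog 𝒜 N) :
    ∑ r ∈ range (L.length + N.length + 1),
      ∑ ls ∈ parts L.length r, ∑ ns ∈ parts N.length r,
        ε (bexp ls ns 0 + tauExp ls ns L N + kosExp ls ns L N
            + (∑ i, (1 - (ls i : ℤ) - ns i)) * wdeg K) •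
          (O.muW K (O.muWords ls ns L N)).2 =
    ∑ s ∈ range (K.length + L.length + 1),
      ∑ ks ∈ parts K.length s, ∑ ls ∈ parts L.length s,
        ε (bexp ks ls N.length + tauExp ks ls K L + kosExp ks ls K L) •
          (O.muW (O.muWords ks ls K L) N).2 := by
  have hl : ∀ r : ℕ, ∑ ls ∈ parts L.length r, ∑ ns ∈ parts N.length r,
        ε (bexp ls ns 0 + tauExp ls ns L N + kosExp ls ns L N
            + (∑ i, (1 - (ls i : ℤ) - ns i)) * wdeg K) •
          (O.muW K (O.muWords ls ns L N)).2 =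
      ε (((r : ℤ) - L.length - N.length) * wdeg K) •
        blockSum O r L N (fun W => (O.muW K W).2) := fun r => by
    rw [blockSum, smul_sum]
    refine sum_congr rfl fun ls hls => ?_
    rw [smul_sum]
    refine sum_congr rfl fun ns hns => ?_
    rw [ksign_smul_smul, sum_sub_distrib, sum_sub_distrib, sum_blocks hls,
      sum_blocks hns, add_comm (_ * wdeg K)]
    simp
  have hr : ∀ s : ℕ, ∑ ks ∈ parts K.length s, ∑ ls ∈ parts L.length s,
        ε (bexp ks ls N.length + tauExp ks ls K L + kosExp ks ls K L) •
          (O.muW (O.muWords ks ls K L) N).2 =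
      ε (N.length * ((K.length : ℤ) + L.length - s)) •
        blockSum O s K L (fun W => (O.muW W N).2) := fun s => by
    rw [blockSum, smul_sum]
    refine sum_congr rfl fun ks hks => ?_
    rw [smul_sum]
    refine sum_congr rfl fun ls hls => ?_
    rw [ksign_smul_smul, bexp_length, sum_blocks hks, sum_blocks hls]
    congr 2
    ring
  simp only [hl, hr]
  have hs : ∀ s ≠ 1, (K = [] → L ≠ []) → blockSum O s K L (fun W => (O.muW W N).2) = 0 := by
    rintro (_ | s) h1 h
    · rw [blockSum_zero, if_neg fun h' => h h'.1 h'.2]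
    · exact blockSum_eq_zero _ _ _ fun W hW => muW_two hO _ _ (by omega)
  match K, hK with
  | [], _ =>
    have hl : ∀ r : ℕ, r ≠ 1 → blockSum O r L N (fun W => (O.muW [] W).2) = 0 := fun r h =>
      blockSum_eq_zero _ _ _ fun W hW => muW_nil_ne hO _ (by omega)
    have hL : ∑ r ∈ range (L.length + N.length + 1),
        ε (((r : ℤ) - L.length - N.length) * wdeg ([] : 𝐖)) •
          blockSum O r L N (fun W => (O.muW [] W).2) = (O.muW L N).2 := by
      rw [sum_eq_single 1 (fun r _ h => by rw [hl r h, smul_zero]), blockSum_one,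
        muW_nil_one hO, wdeg_nil, mul_zero, ksign_zero, one_smul]
      intro h
      have h1 : L.length = 0 ∧ N.length = 0 := by simp at h; simp [h]
      rw [List.length_eq_zero_iff, List.length_eq_zero_iff] at h1
      rw [h1.1, h1.2, blockSum_one, muW_nil_one hO, muW_nil_ne hO _ (by simp), smul_zero]
    rw [hL, length_nil, zero_add]
    by_cases h1 : L.length = 0
    · rw [h1, zero_add, sum_range_one, List.eq_nil_of_length_eq_zero h1, blockSum_zero,
        if_pos ⟨rfl, rfl⟩]
      simp [ksign_zero]
    rw [sum_eq_single 1 (fun r _ h => ?_) (fun h => absurd (mem_range.2 (by omega)) h)]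
    · rw [blockSum_one]
      by_cases h2 : L.length = 1
      · obtain ⟨a, rfl⟩ := List.length_eq_one_iff.1 h2
        rw [muW_nil_one' hO]
        simp [ksign_zero]
      · rw [muW_eq_zero_left O mem_cons_self (muW_nil_ne hO _ h2), smul_zero,
          muW_two hO _ _ (by omega)]
    · rw [hs r h fun _ => by rintro rfl; exact h1 rfl, smul_zero]
  | [x], hK =>
    simp only [wdeg_cons, wdeg_nil, add_zero]
    rw [sum_blockSum_muW hg hO x (homog_cons.1 hK).1 hL hN, sum_eq_single 1, blockSum_one]
    · simp
    · intro s _ h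
      rw [hs s h (by simp), smul_zero]
    · simp
  | x :: x' :: K, hK =>
    rw [sum_eq_zero, sum_eq_zero]
    · intro s _
      by_cases h1 : s = 1
      · rw [h1, blockSum_one, muW_eq_zero_left O mem_cons_self (muW_two hO _ _ (by simp)),
          smul_zero]
      rw [hs s h1 (by simp), smul_zero]
    · intro r _
      rw [blockSum_eq_zero, smul_zero]
      exact fun W _ => muW_two hO _ _ (by simp)

end

/-! ### The Leibniz rule -/

lemma brc_cons_val (F : List (ℤ × 𝐃) → M) (a : ℤ × A) (L : List (Hletter 𝒜)) :
    brc e F (a :: L♭) =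
      ε (L.length * a.1 + omg (L♭.map Prod.fst)) • F (toY e a :: L.map fun q => toY e q.1) := by
  rw [brc, map_cons, map_cons, omg_cons, length_map, length_map,
    show L♭.map (toY e) = L.map _ from List.map_map]; rfl

/-- Applying the operations `m_1` and `m_2` inside a word, as a sum over positions. -/
lemma sum_mW_brc {F : List (ℤ × 𝐃) → M} (hF : F ∈ multi k V M) (L : List (Hletter 𝒜)) :
    (∑ i ∈ range L.length, ε (L.length + wdeg (L♭.take i)) • brc e F (𝔪 L♭ i 1)) +
      (∑ i ∈ range (L.length - 1), ε (1 + i) • brc e F (𝔪 L♭ i 2)) =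
      ε (omg (L♭.map Prod.fst)) • 𝔟 L F := by
  induction L generalizing F with
  | nil => simp [bar_nil]
  | cons l L ih =>
    have h := ih (multi_cons hF (toY e l.1))
    rw [bar_cons, length_cons, sum_range_succ', Nat.add_sub_cancel]
    have h1 : ∀ i ∈ range L.length, ε (((L.length + 1 : ℕ) : ℤ) +
        wdeg ((l :: L)♭.take (i + 1))) • brc e F (𝔪 (l :: L)♭ (i + 1) 1) =
        ε (1 + (L.length + 1) * l.1.1) • ε (L.length + wdeg (L♭.take i)) •
          brc e (fun c => F (toY e l.1 :: c)) (𝔪 L♭ i 1) := by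
      intro i hi
      have := mem_range.1 hi
      simp only [map_cons, take_succ_cons, drop_succ_cons, cons_append]
      rw [brc_cons, ksign_smul_smul, ksign_smul_smul, wdeg_cons]
      refine congrArg₂ _ (congrArg _ ?_) rfl
      simp only [length_append, length_take, length_drop, length_map, length_cons, length_nil]
      rw [min_eq_left this.le, show i + (0 + 1) + (L.length - (i + 1)) = L.length by omega]
      push_cast
      ring
    have h2 : ∀ i ∈ range (L.length - 1), ε (1 + ((i + 1 : ℕ) : ℤ)) •
          brc e F (𝔪 (l :: L)♭ (i + 1) 2) =
        ε (1 + (L.length + 1) * l.1.1) • ε (1 + i) •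
          brc e (fun c => F (toY e l.1 :: c)) (𝔪 L♭ i 2) := by
      intro i hi
      have := mem_range.1 hi
      simp only [map_cons, take_succ_cons, drop_succ_cons, cons_append]
      rw [brc_cons, ksign_smul_smul, ksign_smul_smul]
      refine congrArg₂ _ ?_ rfl
      simp only [length_append, length_take, length_drop, length_map, length_cons, length_nil]
      rw [min_eq_left (by omega), show i + (0 + 1) + (L.length - (i + 2)) = L.length - 1 by omega]
      apply ksign_congr
      rw [Nat.cast_sub (by omega)]
      push_cast
      grind
    rw [sum_congr rfl h1]
    cases L with
    | nil =>
      simp [bar_nil, barTwo_nil]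
      rw [brc_cons]
      simp [brc, ksign_one, ksign_zero, wdeg]
    | cons l₂ L' =>
      have h5 := sum_range_succ' (fun i => ε (1 + (i : ℤ)) •
        brc e F (𝔪 (l :: l₂ :: L')♭ i 2)) L'.length
      rw [length_cons, Nat.add_sub_cancel] at h2 h
      rw [sum_congr rfl h2] at h5
      rw [length_cons, h5]
      rw [← smul_sum, ← smul_sum, add_add_add_comm, ← smul_add, h]
      simp only [take_zero, drop_zero, nil_append, map_cons, zero_add,
        take_succ_cons, drop_succ_cons, cons_append]
      rw [← map_cons (f := Subtype.val), brc_cons_val, brc_cons_val, barTwo_cons]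
      simp only [smul_add, smul_neg, ksign_smul_smul, ← neg_smul, ← ksign_succ]
      rw [add_comm, add_assoc]
      refine congrArg₂ _ (congrArg₂ _ ?_ rfl) (congrArg₂ _ (congrArg₂ _ ?_ rfl)
        (congrArg₂ _ ?_ rfl))
      all_goals
        apply ksign_congr
        simp only [wdeg_nil, map_cons, omg_cons, length_cons, hdeg, length_map, length_nil,
          Ops.mW, wdeg_cons]
        push_cast
        grind

lemma blockSum_two (K L : 𝐖) (G : 𝐖 → M) :
    blockSum O 2 K L G = ∑ i ∈ range (K.length + 1), ∑ j ∈ range (L.length + 1),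
      ε (((i : ℤ) + j - 1) + j * ((K.length : ℤ) - i) +
        wdeg (L.take j) * wdeg (K.drop i) + (1 - ((K.length : ℤ) - i) - ((L.length : ℤ) - j)) *
          (wdeg (K.take i) + wdeg (L.take j))) •
        G [O.muW (K.take i) (L.take j), O.muW (K.drop i) (L.drop j)] := by
  rw [blockSum_succ]
  simp only [blockSum_one, Nat.cast_one, mul_one]

/-- A sum over arities and positions in which only the arities `1` and `2` contribute. -/
lemma sum_arity (n : ℕ) (g : ℕ → ℕ → M) (h : ∀ s i, 3 ≤ s → i + s ≤ n → g s i = 0) :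
    ∑ s ∈ Icc 1 n, ∑ i ∈ range (n - s + 1), g s i =
      (∑ i ∈ range n, g 1 i) + ∑ i ∈ range (n - 1), g 2 i := by
  match n with
  | 0 => simp
  | 1 => simp
  | n + 2 =>
    have h1 : ({1, 2} : Finset ℕ) ⊆ Icc 1 (n + 2) := by
      intro i hi
      simp only [Finset.mem_insert, Finset.mem_singleton] at hi
      rw [mem_Icc]
      omega
    rw [← Finset.sum_subset h1, Finset.sum_pair (by norm_num)]
    · rw [show n + 2 - 1 + 1 = n + 2 by omega, show n + 2 - 2 + 1 = n + 2 - 1 by omega]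
    · intro s hs hs'
      refine sum_eq_zero fun i hi => ?_
      simp only [Finset.mem_insert, Finset.mem_singleton, not_or] at hs'
      have := mem_Icc.1 hs
      have := mem_range.1 hi
      exact h s i (by omega) (by omega)

lemma Phi_mul {d : ℤ} {x : 𝐋} (hx : x ∈ deg k V d) (x' : 𝐋) (c : 𝐖) :
    Phi e (x * x') c = ∑ i ∈ range (c.length + 1),
      ε (d * (wdeg (c.drop i) - (c.drop i).length)) • (Phi e x (c.take i) * Phi e x' (c.drop i)) := by
  rw [Phi, phi_mul hx, length_map]
  simp only [← List.map_drop, ← List.map_take, wt_toY]; rfl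

lemma Psi_mul {d : ℤ} {x : 𝐋} (hx : x ∈ deg k V d) (x' : 𝐋) (c : 𝐖) :
    Psi e (x * x') c = ∑ i ∈ range (c.length + 1),
      ε (d * (wdeg (c.drop i) - (c.drop i).length)) • (Psi e x (c.take i) * Phi e x' (c.drop i)) := by
  rw [Psi, psi_mul hx, length_map]
  simp only [← List.map_drop, ← List.map_take, wt_toY]; rfl

lemma Psi_shift_mul {d : ℤ} {x : 𝐋} (hx : x ∈ deg k V d) (x' : 𝐋) (c : 𝐖) :
    Psi e (𝔰 x * x') c = ∑ i ∈ range (c.length + 1),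
      ε (wdeg (c.take i) - (c.take i).length + d * (wdeg (c.drop i) - (c.drop i).length)) •
        (𝔰 (Phi e x (c.take i)) * Psi e x' (c.drop i)) := by
  rw [Psi, psi_shift_mul hx, length_map]
  simp only [← List.map_drop, ← List.map_take, wt_toY]; rfl

lemma Psi_cons (x : 𝐋) (a : ℤ × A) (c) :
    Psi e x (a :: c) = Phi e x (a :: c) - (e a.2).2 * Phi e x c := psi_cons x _ _

/-- Insertion into the shift of an element. -/
lemma Psi_shift {d : ℤ} {x : 𝐋} (hx : x ∈ deg k V d) (c : 𝐖) (a : ℤ × A) :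
    Psi e (𝔰 x) (c ++ [a]) =
      ε (wdeg (c ++ [a]) - (c ++ [a]).length) • 𝔰 (Phi e x (c ++ [a])) -
      ε (wdeg c - c.length + d * (a.1 - 1)) • (𝔰 (Phi e x c) * (e a.2).2) := by
  have h1 (a : ℤ × A) : Psi e (1 : 𝐋) [a] = - (e a.2).2 := by simp [Psi_cons, Phi, phi]
  have h2 (a b : ℤ × A) c : Psi e (1 : 𝐋) (a :: b :: c) = 0 := by simp [Psi_cons, Phi, phi]
  have h3 : Psi e (1 : 𝐋) ([] : 𝐖) = 1 := psi_nil _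
  rw [← mul_one (𝔰 x), Psi_shift_mul hx, length_append, length_singleton,
    Finset.sum_range_succ, Finset.sum_range_succ, sum_eq_zero, zero_add]
  · rw [List.take_left, List.drop_left, h1, List.take_of_length_le (by simp),
      List.drop_of_length_le (by simp), h3, mul_one, mul_neg, smul_neg, neg_add_eq_sub]
    simp [wdeg]
  · intro i hi
    have := mem_range.1 hi
    rw [List.drop_append_of_le_length this.le]
    obtain ⟨b, c', hc⟩ : ∃ b c', c.drop i = b :: c' :=
      List.exists_cons_of_ne_nil (by rw [Ne, List.drop_eq_nil_iff]; omega)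
    rw [hc]
    cases c' <;> simp [h2]

section

include hg hO

lemma homog_mW {L : 𝐖} (hL : Homog 𝒜 L) : Homog 𝒜 [O.mW L] := by
  rw [homog_cons]
  refine ⟨?_, homog_nil⟩
  have := model_m_deg hg hO L.length (fun i => (L.get i).1) (fun i => (L.get i).2)
    (fun i => hL _ (L.get_mem i))
  rwa [sum_get_fst] at this

lemma homog_take_mW_drop {L : 𝐖} (hL : Homog 𝒜 L) (i s : ℕ) :
    Homog 𝒜 (𝔪 L i s) :=
  homog_append.2 ⟨homog_append.2 ⟨homog_take hL i, homog_mW hg hO (homog_take (homog_drop hL i) s)⟩,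
    homog_drop hL _⟩

/-- The operations `m_1` and `m_2` inside the second argument of `μ_{1, n}`. -/
lemma sum_muW_mW (x : ℤ × A) (hx : x.2 ∈ 𝒜 x.1) (L : List (Hletter 𝒜)) {L' : 𝐖}
    (hL' : L' = L♭) {y : A}
    (hy : y = (∑ i ∈ range L'.length,
        ε (1 * ((L'.length : ℤ) - i - 1) + 1 + i + (x.1 + wdeg (L'.take i))) •
        (O.muW [x] (𝔪 L' i 1)).2) +
      ∑ i ∈ range (L'.length - 1), ε (1 + i) • (O.muW [x] (𝔪 L' i 2)).2) :
    pr1 e y = ε (x.1 * wdeg L' + omg (L'.map Prod.fst)) • 𝔟 L (phi Prod.fst Prod.snd ((e x.2).1 : 𝐋)) ∧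
    pr2 e y = ε ((x.1 + 1) * wdeg L' + L'.length + 1 + omg (L'.map Prod.fst)) •
      𝔟 L (psi Prod.fst Prod.snd ((e x.2).2 : 𝐋)) := by
  have hL : Homog 𝒜 L' := by rw [hL']; exact homog_map L
  have hw {s i : ℕ} (hi : i + s ≤ L'.length) : wdeg (𝔪 L' i s) = wdeg L' + 2 - s := by
    have h1 : wdeg L' = wdeg (L'.take i) + wdeg ((L'.drop i).take s) + wdeg (L'.drop (i + s)) := by
      rw [← wdeg_append, ← List.take_add, ← wdeg_append, take_append_drop]
    have h2 : ((L'.drop i).take s).length = s := by rw [length_take, length_drop]; omega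
    rw [h1, wdeg_append, wdeg_append, wdeg_cons, wdeg_nil]
    change _ + (_ + 2 - (((L'.drop i).take s).length : ℤ) + 0) + _ = _
    rw [h2]
    ring
  have hl {s i : ℕ} (hi : i + s ≤ L'.length) : (𝔪 L' i s).length = L'.length + 1 - s := by
    simp; omega
  have hlen : L.length = L'.length := by rw [hL', length_map]
  subst hy
  constructor
  · rw [ksign_add, ← smul_smul, hL', ← sum_mW_brc (phi_mem_multi _), smul_add, smul_sum,
      smul_sum, map_add, map_sum, map_sum, ← hL', hlen]
    congr 1 <;> refine sum_congr rfl fun i hi => ?_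
    all_goals
      have hi := mem_range.1 hi
      rw [map_smul, muW_brc_fst hO x hx (homog_take_mW_drop hg hO hL i _), hw (by omega),
        ksign_smul_smul, ksign_smul_smul]
      refine congrArg₂ _ (ksign_congr ?_) rfl
      push_cast
      grind
  · rw [ksign_add, ← smul_smul, hL', ← sum_mW_brc (psi_mem_multi _), smul_add, smul_sum,
      smul_sum, map_add, map_sum, map_sum, ← hL', hlen]
    congr 1 <;> refine sum_congr rfl fun i hi => ?_
    all_goals
      have hi := mem_range.1 hi
      rw [map_smul, muW_brc_snd hO x hx (homog_take_mW_drop hg hO hL i _), hw (by omega),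
        hl (by omega), ksign_smul_smul, ksign_smul_smul]
      refine congrArg₂ _ (ksign_congr ?_) rfl
      push_cast [Nat.add_sub_cancel, show L'.length + 1 - 2 = L'.length - 1 by omega,
        Nat.cast_sub (show 1 ≤ L'.length by omega)]
      grind

end

lemma Phi_zero (c : 𝐖) : Phi e (0 : 𝐋) c = 0 := by
  have := Phi_smul (e := e) 0 (0 : 𝐋) c
  rwa [zero_smul, zero_smul] at this

lemma Psi_sub (x x' : 𝐋) (c : 𝐖) : Psi e (x - x') c = Psi e x c - Psi e x' c := by
  have h : Psi e (x - x' + x') c = Psi e (x - x') c + Psi e x' c := psi_add _ _ _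
  rw [sub_add_cancel] at h
  rw [h, add_sub_cancel_right]

section
section

include hO

lemma pr1_mW_one (a : ℤ × A) : pr1 e (O.mW [a]).2 = 0 := by
  rw [mW_one, pr1_apply, hO.m_one_fst]; rfl

lemma pr2_mW_one (a : ℤ × A) : pr2 e (O.mW [a]).2 = pr1 e a.2 - 𝔰 (parity (pr1 e a.2)) := by
  rw [mW_one, pr2_apply, hO.m_one_snd]; rfl

lemma pr1_mW_two (a b : ℤ × A) : pr1 e (O.mW [a, b]).2 = pr1 e a.2 * pr1 e b.2 := by
  rw [mW_two, pr1_apply, hO.m_two_fst]; rfl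

lemma pr2_mW_two (a b : ℤ × A) : pr2 e (O.mW [a, b]).2 =
    pr2 e a.2 * pr1 e b.2 + 𝔰 (pr1 e a.2) * pr2 e b.2 := by
  rw [mW_two, pr2_apply, hO.m_two_snd]; rfl

lemma pr1_muW {x : ℤ × A} (hx : x.2 ∈ 𝒜 x.1) {c : 𝐖} (hc : Homog 𝒜 c) :
    pr1 e (O.muW [x] c).2 = ε (x.1 * wdeg c + omg (c.map Prod.fst)) • Phi e (pr1 e x.2) c := by
  rw [pr1_apply, muW_fst hO x hx hc, muExp, add_comm]; rfl

lemma pr2_muW {x : ℤ × A} (hx : x.2 ∈ 𝒜 x.1) {c : 𝐖} (hc : Homog 𝒜 c) :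
    pr2 e (O.muW [x] c).2 = ε ((x.1 + 1) * wdeg c + omg (c.map Prod.fst) + c.length) •
      Psi e (pr2 e x.2) c := by
  rw [pr2_apply, muW_snd hO x hx hc, muExp]
  exact congrArg₂ _ (congrArg _ (by ring)) rfl

end

include hg hO

/-- The Leibniz rule for `μ_{1, n}` with `n ≥ 1`. -/
lemma leibniz_single {x : ℤ × A} (hx : x.2 ∈ 𝒜 x.1) {q₁ q : Hletter 𝒜}
    {T D : List (Hletter 𝒜)} (h : q₁ :: T = D ++ [q]) {y : A}
    (hy1 : pr1 e y = ε (x.1 * wdeg (D ++ [q])♭ + omg ((D ++ [q])♭.map Prod.fst)) •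
      𝔟 (D ++ [q]) (phi Prod.fst Prod.snd (pr1 e x.2)))
    (hy2 : pr2 e y = ε ((x.1 + 1) * wdeg (D ++ [q])♭ + (D ++ [q])♭.length + 1 +
      omg ((D ++ [q])♭.map Prod.fst)) • 𝔟 (D ++ [q]) (psi Prod.fst Prod.snd (pr2 e x.2))) :
    (O.mW [O.muW [x] (D ++ [q])♭]).2 +
        (ε (1 + q₁.1.1 * x.1 + D.length * q₁.1.1) •
          (O.mW [q₁.1, O.muW [x] T♭]).2 +
        ε D.length • (O.mW [O.muW [x] D♭, q.1]).2) =
      ε (D.length + 1) • (O.muW [O.mW [x]] (D ++ [q])♭).2 + y := by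
  have hLh := homog_map (D ++ [q])
  have hDh := homog_map D
  have hTh := homog_map T
  have hmx1 : (O.mW [x]).1 = x.1 + 1 := by simp [Ops.mW, wdeg]; ring
  have hmx : (O.mW [x]).2 ∈ 𝒜 (O.mW [x]).1 := hmx1 ▸ mW_one_mem hg hO x hx
  have hx1 : pr1 e x.2 ∈ deg k V x.1 := ((hg.mem _ _).1 hx).1
  have hx2 : pr2 e x.2 ∈ deg k V (x.1 - 1) := ((hg.mem _ _).1 hx).2
  have hTD : T.length = D.length := by simpa using congrArg List.length h
  -- the degrees of the whole word in terms of those of its parts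
  have hw1 : wdeg (D ++ [q])♭ = wdeg D♭ + q.1.1 := by simp [wdeg_append, wdeg]
  have hw2 : wdeg (D ++ [q])♭ = q₁.1.1 + wdeg T♭ := by rw [← h, map_cons, wdeg_cons]
  have ho1 : omg ((D ++ [q])♭.map Prod.fst) = omg (D♭.map Prod.fst) + wdeg D♭ := by
    rw [map_append, map_append, omg_append]; simp [wdeg]
  have ho2 : omg ((D ++ [q])♭.map Prod.fst) = D.length * q₁.1.1 + omg (T♭.map Prod.fst) := by
    rw [← h, map_cons, map_cons, omg_cons, length_map, length_map, hTD]
  have hl : (D ++ [q])♭.length = D.length + 1 := by simp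
  have hbar {d : ℤ} {x : 𝐋} (hx : x ∈ deg k V d) :
      𝔟 (D ++ [q]) (phi Prod.fst Prod.snd x) = ε (wdeg D♭ - D.length + d * q.1.1) •
          (Phi e x D♭ * pr1 e q.1.2) - pr1 e q₁.1.2 * Phi e x T♭ ∧
      𝔟 (D ++ [q]) (psi Prod.fst Prod.snd x) = ε (wdeg D♭ - D.length + d * q.1.1) •
          (Psi e x D♭ * pr1 e q.1.2) - ε q₁.1.1 • (𝔰 (pr1 e q₁.1.2) * Psi e x T♭) := by
    have c1 (q : Hletter 𝒜) : (toY e (O.mW [q.1])).1 = hdeg q + 1 := by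
      simp [toY, Ops.mW, hdeg, wdeg]; ring
    have c2 (q q' : Hletter 𝒜) : (toY e (O.mW [q.1, q'.1])).1 = hdeg q + hdeg q' + 1 := by
      simp [toY, Ops.mW, hdeg, wdeg]; ring
    have c3 (q : Hletter 𝒜) : ((toY e (O.mW [q.1])).2 : 𝐋) =
        (e q.1.2).1 - 𝔰 (parity (e q.1.2).1) := pr2_mW_one hO q.1
    have c4 (q q' : Hletter 𝒜) : ((toY e (O.mW [q.1, q'.1])).2 : 𝐋) =
        (toY e q.1).2 * (e q'.1.2).1 + 𝔰 (e q.1.2).1 * (toY e q'.1).2 := pr2_mW_two hO q.1 q'.1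
    have c5 (q : Hletter 𝒜) : parity ((e q.1.2).1 : 𝐋) = ε (hdeg q + 1) • ((e q.1.2).1 : 𝐋) := by
      rw [parity_of_mem ((hg.mem _ _).1 q.2).1, hdeg, sub_add_cancel]
    have b1 := bar_phi (p := Prod.fst) (y := Prod.snd) (p₁ := hdeg)
      (j := fun q => toY e (Subtype.val q)) (fun q : Hletter 𝒜 => (e q.1.2).1)
      (fun _ => rfl) (fun _ => rfl) c1 c2 c3 c4 c5 hx D q
    have b2 := bar_psi (p := Prod.fst) (y := Prod.snd) (p₁ := hdeg)
      (j := fun q => toY e (Subtype.val q)) (fun q : Hletter 𝒜 => (e q.1.2).1)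
      (fun _ => rfl) (fun _ => rfl) c1 c2 c3 c4 c5 hx D q
    have hh (f : 𝐋 →ₗ[k] 𝐋) (F : List (ℤ × 𝐃) → 𝐋) :
        headOp' (fun q : Hletter 𝒜 => (e q.1.2).1) (fun q : Hletter 𝒜 => toY e q.1) (reg k V) f F
          (D ++ [q]) = f (e q₁.1.2).1 * F (T♭.map (toY e)) := by
      rw [← h, headOp'_cons, List.map_map]; rfl
    rw [hh, ← eq_sub_iff_add_eq, ← Phi_val, wt_hdeg, hdeg, sub_add_cancel] at b1
    rw [hh, ← eq_sub_iff_add_eq, ← Psi_val, wt_hdeg, hdeg, sub_add_cancel] at b2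
    refine ⟨b1, b2.trans ?_⟩
    congr 1
    rw [comp_apply, AlgHom.toLinearMap_apply, c5, hdeg, sub_add_cancel, map_smul,
      smul_mul_assoc]; rfl
  refine pr_ext (e := e) ?_ ?_
  · rw [map_add, map_add, map_add, map_smul, map_smul, map_smul, hy1, (hbar hx1).1,
      pr1_mW_one hO, pr1_mW_two hO, pr1_mW_two hO, pr1_muW hO hx hDh, pr1_muW hO hx hTh,
      pr1_muW hO hmx hLh, pr1_mW_one hO, Phi_zero, smul_zero, smul_zero, zero_add, zero_add,
      smul_sub, mul_smul_comm, smul_mul_assoc, ksign_smul_smul, ksign_smul_smul, ksign_smul_smul,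
      sub_eq_add_neg, ← neg_smul, ← ksign_succ, add_comm]
    refine congrArg₂ _ (congrArg₂ _ (ksign_congr ?_) rfl) (congrArg₂ _ (ksign_congr ?_) rfl)
    · rw [hw1, ho1]; push_cast; grind
    · rw [hw2, ho2]; push_cast; grind
  · have hA : parity (Phi e (pr1 e x.2) (D ++ [q])♭) =
        ε (x.1 + (wdeg (D ++ [q])♭ - (D.length + 1))) • Phi e (pr1 e x.2) (D ++ [q])♭ := by
      rw [parity_of_mem (Phi_mem_deg hg hx1 hLh), hl]; push_cast; rfl
    have h1 : Psi e (pr1 e x.2) (D ++ [q])♭ =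
        Phi e (pr1 e x.2) (D ++ [q])♭ - pr2 e q₁.1.2 * Phi e (pr1 e x.2) T♭ := by
      rw [← h, map_cons, Psi_cons]; rfl
    have h2 : Psi e (𝔰 (pr1 e x.2)) (D ++ [q])♭ = ε (wdeg (D ++ [q])♭ - (D.length + 1)) •
        𝔰 (Phi e (pr1 e x.2) (D ++ [q])♭) - ε (wdeg D♭ - D.length + x.1 * (q.1.1 - 1)) •
        (𝔰 (Phi e (pr1 e x.2) D♭) * pr2 e q.1.2) := by
      have h2 := Psi_shift (e := e) hx1 D♭ q.1
      rw [show D♭ ++ [q.1] = (D ++ [q])♭ by simp, hl, length_map] at h2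
      push_cast at h2; exact h2
    rw [map_add, map_add, map_add, map_smul, map_smul, map_smul, hy2, (hbar hx2).2,
      pr2_mW_one hO, pr2_mW_two hO, pr2_mW_two hO, pr1_muW hO hx hDh, pr1_muW hO hx hTh,
      pr2_muW hO hx hDh, pr2_muW hO hx hTh, pr2_muW hO hmx hLh, pr1_muW hO hx hLh,
      pr2_mW_one hO, Psi_sub, parity_of_mem hx1,
      show 𝔰 (ε x.1 • pr1 e x.2) = ε x.1 • 𝔰 (pr1 e x.2) from map_smul _ _ _, Psi_smul, h1, h2, map_smul parity, hA]
    simp only [map_smul, smul_add, mul_smul_comm, smul_mul_assoc, ksign_smul_smul,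
      sub_eq_add_neg, ← neg_smul, ← ksign_succ, neg_add, hmx1, hl, length_map, hTD]
    rw [smul_neg, ← neg_smul, ← ksign_succ]
    have habel (a b c d f g : 𝐋) : a + b + (c + d + (f + g)) = a + c + (b + g) + (f + d) := by abel
    rw [habel]
    refine congrArg₂ _ (congrArg₂ _ (congrArg₂ _ ?_ ?_) (congrArg₂ _ ?_ ?_)) (congrArg₂ _ ?_ ?_)
    all_goals
      refine congrArg₂ _ (ksign_congr ?_) rfl
      replace hw1 := congrArg (Int.cast (R := ZMod 2)) hw1
      replace hw2 := congrArg (Int.cast (R := ZMod 2)) hw2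
      replace ho1 := congrArg (Int.cast (R := ZMod 2)) ho1
      replace ho2 := congrArg (Int.cast (R := ZMod 2)) ho2
      push_cast at hw1 hw2 ho1 ho2 ⊢
      have sq : ∀ d : ZMod 2, d * d = d := by decide
      have := sq x.1
      grind

end

variable (O) in
/-- The sign of a pair of blocks. -/
def pairExp (i j : ℕ) (K L : 𝐖) : ℤ :=
  ((i : ℤ) + j - 1) + j * ((K.length : ℤ) - i) +
    wdeg (L.take j) * wdeg (K.drop i) + (1 - ((K.length : ℤ) - i) - ((L.length : ℤ) - j)) *
    (wdeg (K.take i) + wdeg (L.take j))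

section

include hO

/-- Only the sums over one block and over pairs of blocks contribute to the Leibniz rule. -/
lemma sum_blockSum_mW (K L : 𝐖) :
    ∑ r ∈ Icc 1 (K.length + L.length), blockSum O r K L (fun W => (O.mW W).2) =
      (O.mW [O.muW K L]).2 + ∑ i ∈ range (K.length + 1), ∑ j ∈ range (L.length + 1),
        ε (pairExp i j K L) •
          (O.mW [O.muW (K.take i) (L.take j), O.muW (K.drop i) (L.drop j)]).2 := by
  have h0 : (O.muW [] []).2 = 0 := muW_nil_ne hO [] (by simp)
  have h2 (r) (hr : r ∉ ({1, 2} : Finset ℕ)) : blockSum O r K L (fun W => (O.mW W).2) = 0 := by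
    simp only [Finset.mem_insert, Finset.mem_singleton, not_or] at hr
    exact blockSum_eq_zero _ _ _ fun W hW => mW_ne hO W (by omega) (by omega)
  have h1 : ∀ r ∈ ({1, 2} : Finset ℕ), r ∉ Icc 1 (K.length + L.length) →
      blockSum O r K L (fun W => (O.mW W).2) = 0 := by
    intro r hr hr'
    simp only [Finset.mem_insert, Finset.mem_singleton] at hr
    rw [mem_Icc] at hr'
    rcases hr with rfl | rfl
    · rw [blockSum_one, List.eq_nil_of_length_eq_zero (l := K) (by omega),
        List.eq_nil_of_length_eq_zero (l := L) (by omega), mW_eq_zero O mem_cons_self h0]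
    · rw [blockSum_two]
      refine sum_eq_zero fun i hi => sum_eq_zero fun j hj => ?_
      rw [mem_range] at hi hj
      by_cases h : i + j = 0
      · rw [mW_eq_zero O mem_cons_self, smul_zero]
        rw [show i = 0 by omega, show j = 0 by omega, take_zero, take_zero, h0]
      · rw [mW_eq_zero O (mem_cons_of_mem _ mem_cons_self), smul_zero]
        rw [List.drop_of_length_le (by omega), List.drop_of_length_le (by omega), h0]
  calc _ = ∑ r ∈ Icc 1 (K.length + L.length) ∪ {1, 2}, blockSum O r K L (fun W => (O.mW W).2) :=
        Finset.sum_subset Finset.subset_union_left fun r _ hr' =>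
          if h : r ∈ ({1, 2} : Finset ℕ) then h1 r h hr' else h2 r h
    _ = ∑ r ∈ {1, 2}, blockSum O r K L (fun W => (O.mW W).2) :=
        (Finset.sum_subset Finset.subset_union_right fun r _ hr' => h2 r hr').symm
    _ = _ := by rw [Finset.sum_pair (by norm_num), blockSum_one, blockSum_two]; rfl

lemma leibniz_nil (L : 𝐖) :
    (O.mW [O.muW [] L]).2 + ∑ j ∈ range (L.length + 1),
      ε (pairExp 0 j ([] : 𝐖) L) • (O.mW [O.muW [] (L.take j), O.muW [] (L.drop j)]).2 = (O.mW L).2 := by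
  have h0 : ∀ j, j ∈ range (L.length + 1) → (j ≠ 1 ∨ L.length ≠ 2) →
      (O.mW [O.muW [] (L.take j), O.muW [] (L.drop j)]).2 = 0 := by
    intro j hj h
    rw [mem_range] at hj
    by_cases h1 : j = 1
    · exact mW_eq_zero O (mem_cons_of_mem _ mem_cons_self)
        (muW_nil_ne hO _ (by rw [length_drop]; omega))
    · exact mW_eq_zero O mem_cons_self (muW_nil_ne hO _ (by rw [length_take]; omega))
  have h1 : L.length ≠ 1 → (O.mW [O.muW [] L]).2 = 0 := fun h =>
    mW_eq_zero O mem_cons_self (muW_nil_ne hO _ h)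
  by_cases h2 : L.length = 2
  · obtain ⟨a, b, rfl⟩ := List.length_eq_two.1 h2
    rw [h1 (by simp), zero_add, sum_eq_single 1]
    · simp [muW_nil_one' hO, pairExp, wdeg, ksign_zero]
    · exact fun j hj hj' => by rw [h0 j hj (.inl hj'), smul_zero]
    · simp
  rw [sum_eq_zero fun j hj => by rw [h0 j hj (.inr h2), smul_zero], add_zero]
  by_cases h3 : L.length = 1
  · obtain ⟨a, rfl⟩ := List.length_eq_one_iff.1 h3
    rw [muW_nil_one' hO]
  · rw [h1 h3, mW_ne hO _ h3 h2]

include hg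

lemma leibniz_pair {x x' : ℤ × A} (hx : x.2 ∈ 𝒜 x.1) (hx' : x'.2 ∈ 𝒜 x'.1) {L : 𝐖}
    (hL : Homog 𝒜 L) :
    ∑ j ∈ range (L.length + 1), ε (pairExp 1 j [x, x'] L) •
        (O.mW [O.muW [x] (L.take j), O.muW [x'] (L.drop j)]).2 =
      (O.muW [O.mW [x, x']] L).2 := by
  have hx1 : pr1 e x.2 ∈ deg k V x.1 := ((hg.mem _ _).1 hx).1
  have hx2 : pr2 e x.2 ∈ deg k V (x.1 - 1) := ((hg.mem _ _).1 hx).2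
  have hm1 : (O.mW [x, x']).1 = x.1 + x'.1 := by simp [Ops.mW, wdeg]
  have hm : (O.mW [x, x']).2 ∈ 𝒜 (O.mW [x, x']).1 := by
    rw [hm1]; exact mW_two_mem hg hO x x' hx hx'
  have hw j : wdeg L = wdeg (L.take j) + wdeg (L.drop j) := by
    rw [← wdeg_append, take_append_drop]
  have ho j : omg (L.map Prod.fst) = omg ((L.take j).map Prod.fst) +
      (L.drop j).length * wdeg (L.take j) + omg ((L.drop j).map Prod.fst) := by
    conv_lhs => rw [← take_append_drop j L, map_append, omg_append, length_map]
    rfl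
  have hl j (hj : j ∈ range (L.length + 1)) : (j : ZMod 2) + ((L.drop j).length : ZMod 2) =
      L.length ∧ (L.take j).length = j := by
    rw [mem_range] at hj
    rw [← Nat.cast_add, length_drop, length_take]
    exact ⟨congrArg _ (by omega), by omega⟩
  refine pr_ext (e := e) ?_ ?_
  · rw [map_sum, pr1_muW hO hm hL, pr1_mW_two hO, Phi_mul hx1, smul_sum]
    refine sum_congr rfl fun j hj => ?_
    obtain ⟨hj1, hj2⟩ := hl j hj
    rw [map_smul, pr1_mW_two hO, pr1_muW hO hx (homog_take hL j), pr1_muW hO hx' (homog_drop hL j),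
      smul_mul_assoc, mul_smul_comm, ksign_smul_smul, ksign_smul_smul, ksign_smul_smul]
    refine congrArg₂ _ (ksign_congr ?_) rfl
    rw [hm1, hw j, ho j]
    simp only [pairExp, length_cons, length_nil, drop_succ_cons, drop_zero, take_succ_cons,
      take_zero, wdeg_cons, wdeg_nil]
    push_cast; rw [← hj1]; grind
  · rw [map_sum, pr2_muW hO hm hL, pr2_mW_two hO, show Psi e (pr2 e x.2 * pr1 e x'.2 +
      𝔰 (pr1 e x.2) * pr2 e x'.2) L = Psi e (pr2 e x.2 * pr1 e x'.2) L +
      Psi e (𝔰 (pr1 e x.2) * pr2 e x'.2) L from psi_add _ _ _, Psi_mul hx2,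
      Psi_shift_mul hx1, ← sum_add_distrib, smul_sum]
    refine sum_congr rfl fun j hj => ?_
    obtain ⟨hj1, hj2⟩ := hl j hj
    rw [map_smul, pr2_mW_two hO, pr1_muW hO hx (homog_take hL j), pr1_muW hO hx' (homog_drop hL j),
      pr2_muW hO hx (homog_take hL j), pr2_muW hO hx' (homog_drop hL j), map_smul,
      smul_mul_assoc, smul_mul_assoc, mul_smul_comm, mul_smul_comm, smul_add, smul_add]
    simp only [ksign_smul_smul]
    refine congrArg₂ _ (congrArg₂ _ (ksign_congr ?_) rfl) (congrArg₂ _ (ksign_congr ?_) rfl)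
    all_goals
      rw [hm1, hw j, ho j, hj2]
      simp only [pairExp, length_cons, length_nil, drop_succ_cons, drop_zero, take_succ_cons,
        take_zero, wdeg_cons, wdeg_nil]
      push_cast; rw [← hj1]; grind

lemma model_leibniz (K L : 𝐖) (hK : Homog 𝒜 K) (hL : Homog 𝒜 L) :
    ∑ r ∈ Icc 1 (K.length + L.length),
      ∑ ks ∈ parts K.length r, ∑ ls ∈ parts L.length r,
        ε (bexp ks ls 0 + tauExp ks ls K L + kosExp ks ls K L) •
          (O.mW (O.muWords ks ls K L)).2 =
    (∑ r ∈ Icc 1 K.length, ∑ i ∈ range (K.length - r + 1),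
      ε (r * ((K.length : ℤ) - r - i + L.length) + i + (2 - r) * wdeg (K.take i)) •
        (O.muW (𝔪 K i r) L).2) +
    ∑ s ∈ Icc 1 L.length, ∑ i ∈ range (L.length - s + 1),
      ε (s * ((L.length : ℤ) - i - s) + K.length + i +
        (2 - s) * (wdeg K + wdeg (L.take i))) • (O.muW K (𝔪 L i s)).2 := by
  refine (sum_blockSum_mW hO K L).trans ?_
  have h3 (L : 𝐖) (s i : ℕ) (hs : 3 ≤ s) (hi : i + s ≤ L.length) :
      (O.mW ((L.drop i).take s)).2 = 0 := by
    refine mW_ne hO _ ?_ ?_ <;> rw [length_take, length_drop] <;> omega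
  rw [sum_arity K.length _ fun s i hs hi => by
      rw [muW_eq_zero_left O (by simp) (h3 K s i hs hi), smul_zero],
    sum_arity L.length _ fun s i hs hi => by
      rw [muW_eq_zero_right O (by simp) (h3 L s i hs hi), smul_zero]]
  have hk1 i (hi : i ∈ range K.length) (h : 1 < K.length) : (O.muW (𝔪 K i 1) L).2 = 0 := by
    rw [mem_range] at hi
    exact muW_two hO _ _ (by simp; omega)
  match K, hK with
  | [], _ =>
    rw [length_nil, zero_add, sum_range_one]
    refine (leibniz_nil hO L).trans ?_
    simp only [Nat.zero_sub, Finset.range_zero, Finset.sum_empty, zero_add]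
    have hz1 i (hi : i ∈ range L.length) (h : L.length ≠ 1) : (O.muW [] (𝔪 L i 1)).2 = 0 := by
      rw [mem_range] at hi
      exact muW_nil_ne hO _ (by simp; omega)
    have hz2 i (hi : i ∈ range (L.length - 1)) (h : L.length ≠ 2) :
        (O.muW [] (𝔪 L i 2)).2 = 0 := by
      rw [mem_range] at hi
      exact muW_nil_ne hO _ (by simp; omega)
    by_cases h1 : L.length = 1
    · obtain ⟨a, rfl⟩ := List.length_eq_one_iff.1 h1
      simp [wdeg, ksign_zero, muW_nil_one hO]
    rw [sum_eq_zero fun i hi => by rw [hz1 i hi h1, smul_zero], zero_add]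
    by_cases h2 : L.length = 2
    · obtain ⟨a, b, rfl⟩ := List.length_eq_two.1 h2
      simp [wdeg, ksign_zero, muW_nil_one hO]
    rw [sum_eq_zero fun i hi => by rw [hz2 i hi h2, smul_zero], mW_ne hO _ h1 h2]
  | [x], hK =>
    have hx := (homog_cons.1 hK).1
    simp only [length_singleton, sum_range_one, Nat.sub_self, Finset.range_zero, Finset.sum_empty,
      add_zero, take_zero, drop_zero, nil_append, show List.take 1 [x] = [x] from rfl,
      show List.drop (0 + 1) [x] = [] from rfl, List.append_nil, Finset.sum_range_succ _ 1,
      show List.drop 1 [x] = [] from rfl]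
    by_cases hn : L = []
    · subst hn
      simp [muW_one_nil hO, ksign_zero, wdeg]
      have h0 : (O.muW [] []).2 = 0 := muW_nil_ne hO [] (by simp)
      simp [mW_eq_zero O mem_cons_self h0, mW_eq_zero O (mem_cons_of_mem _ mem_cons_self) h0]
    obtain ⟨L', hL'⟩ := exists_lift hL
    have hn' : L' ≠ [] := by rintro rfl; exact hn (by rw [← hL']; rfl)
    obtain ⟨q₁, T, hT⟩ := List.exists_cons_of_ne_nil hn'
    obtain ⟨D, q, hD⟩ : ∃ D q, L' = D ++ [q] :=
      ⟨L'.dropLast, L'.getLast hn', (List.dropLast_append_getLast hn').symm⟩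
    have hLD : L = D♭ ++ [q.1] := by rw [← hL', hD]; simp
    have hLT : L = q₁.1 :: T♭ := by rw [← hL', hT]; simp
    have hlen : L.length = D.length + 1 := by rw [hLD]; simp
    rw [sum_eq_single (s := range (L.length + 1)) 1,
      sum_eq_single (s := range (L.length + 1)) D.length]
    · have hy := sum_muW_mW hg hO x hx L' hL'.symm rfl
      rw [← hL', hD] at hy
      have h := leibniz_single hg hO hx (hT.symm.trans hD) hy.1 hy.2
      have ht : L.take D.length = D♭ := by rw [hLD]; exact List.take_left' (by simp)
      have hd : L.drop D.length = [q.1] := by rw [hLD]; exact List.drop_left' (by simp)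
      have ht1 : L.take 1 = [q₁.1] := by rw [hLT]; rfl
      have hd1 : L.drop 1 = T♭ := by rw [hLT]; rfl
      rw [ht, hd, ht1, hd1, muW_nil_one' hO, muW_nil_one' hO]
      rw [← hD, hL'] at h
      convert h using 1
      · congr 2 <;> refine congrArg₂ _ (ksign_congr ?_) rfl
        · simp only [pairExp, ht1, hlen, length_singleton, drop_zero, take_zero, wdeg_cons, wdeg_nil]
          push_cast; grind
        · simp only [pairExp, ht, hlen, length_singleton, wdeg_cons, wdeg_nil,
            show List.drop 1 [x] = [] from rfl, show List.take 1 [x] = [x] from rfl]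
          push_cast; ring
      · congr 1
        · refine congrArg₂ _ (ksign_congr ?_) rfl
          rw [hlen, wdeg_nil]; push_cast; ring
        · congr 1 <;> refine sum_congr rfl fun i _ => congrArg₂ _ (ksign_congr ?_) rfl <;>
            (rw [wdeg_cons, wdeg_nil]; push_cast; grind)
    · intro j hj hj'
      rw [mem_range] at hj
      rw [mW_eq_zero O (mem_cons_of_mem _ mem_cons_self) (muW_nil_ne hO _ ?_), smul_zero]
      rw [length_drop]; omega
    · exact fun h => absurd (mem_range.2 (by omega)) h
    · intro j hj hj'
      rw [mem_range] at hj
      rw [mW_eq_zero O mem_cons_self (muW_nil_ne hO _ ?_), smul_zero]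
      rw [length_take]; omega
    · exact fun h => absurd (mem_range.2 (by omega)) h
  | [x, x'], hK =>
    obtain ⟨hx, hx'⟩ := homog_cons.1 hK
    replace hx' := (homog_cons.1 hx').1
    have h1 : (O.mW [O.muW [x, x'] L]).2 = 0 :=
      mW_eq_zero O mem_cons_self (muW_two hO _ _ (by simp))
    have hz : ∀ i j, i ≠ 1 → (O.mW [O.muW ([x, x'].take i) (L.take j),
        O.muW ([x, x'].drop i) (L.drop j)]).2 = 0 := by
      intro i j hi
      rcases lt_or_ge i 1 with h | h
      · exact mW_eq_zero O (mem_cons_of_mem _ mem_cons_self) (muW_two hO _ _ (by simp; omega))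
      · exact mW_eq_zero O mem_cons_self (muW_two hO _ _ (by simp; omega))
    rw [h1, zero_add, sum_eq_single 1, show [x, x'].take 1 = [x] from rfl,
      show [x, x'].drop 1 = [x'] from rfl, leibniz_pair hg hO hx hx' hL,
      sum_eq_zero (fun i hi => by rw [hk1 i hi (by simp), smul_zero]), zero_add,
      sum_eq_zero (s := range L.length)
        (fun i _ => by rw [muW_two hO _ _ (by simp), smul_zero]), zero_add,
      sum_eq_zero (s := range (L.length - 1))
        (fun i _ => by rw [muW_two hO _ _ (by simp), smul_zero]), add_zero]
    · rw [show [x, x'].length - 1 = 1 from rfl, sum_range_one]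
      have : ε (((2 : ℕ) : ℤ) * ((([x, x'].length : ℕ) : ℤ) - ((2 : ℕ) : ℤ) - ((0 : ℕ) : ℤ) +
          L.length) + ((0 : ℕ) : ℤ) + (2 - ((2 : ℕ) : ℤ)) * wdeg ([x, x'].take 0)) = 1 :=
        ksign_even (by simp)
      rw [this, one_smul]; rfl
    · exact fun i _ hi => sum_eq_zero fun j _ => by rw [hz i j hi, smul_zero]
    · simp
  | x :: x' :: x'' :: K, hK =>
    rw [mW_eq_zero O mem_cons_self (muW_two hO _ _ (by simp)), zero_add,
      sum_eq_zero (fun i hi => sum_eq_zero fun j _ => ?_),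
      sum_eq_zero (fun i hi => by rw [hk1 i hi (by simp), smul_zero]), zero_add,
      sum_eq_zero (fun i hi => ?_), zero_add,
      sum_eq_zero (fun i _ => by rw [muW_two hO _ _ (by simp), smul_zero]), zero_add,
      sum_eq_zero (fun i _ => by rw [muW_two hO _ _ (by simp), smul_zero])]
    · rw [mem_range, length_cons, length_cons, length_cons] at hi
      rw [muW_two hO _ _ (by simp; omega), smul_zero]
    · rcases lt_or_ge i 2 with h | h
      · rw [mW_eq_zero O (mem_cons_of_mem _ mem_cons_self) (muW_two hO _ _ (by simp; omega)),
          smul_zero]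
      · rw [mem_range, length_cons, length_cons, length_cons] at hi
        rw [mW_eq_zero O mem_cons_self (muW_two hO _ _ (by simp; omega)), smul_zero]

end
end Model

/-! ### The model as a `B_∞`-algebra -/

local notation "𝐖" A:max => List (ℤ × A)

section Package

variable {A : Type*} [AddCommGroup A] [Module k A] {𝒜 : ℤ → Submodule k A} {O : Ops k A}
  {e : A ≃ₗ[k] diag k V × diag k V}

/-- The `B_∞`-algebra defined by the operations of the model. -/
def modelBInfty (hg : IsGraded 𝒜 e) (hO : IsModel 𝒜 e O) : BInfty 𝒜 where
  toOps := O
  internal := hg.internal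
  m_zero := hO.m_ne 0 (by norm_num) (by norm_num)
  m_deg := model_m_deg hg hO
  mu_deg := model_mu_deg hg hO
  a_infty := model_a_infty hg hO
  mu_one_zero := hO.mu_one_zero
  mu_zero_one := hO.mu_zero_one
  mu_left_zero p hp := by
    rcases Nat.lt_or_ge 1 p with h | h
    · exact hO.mu_two p 0 h
    · exact (show p = 0 by omega) ▸ hO.mu_zero 0 (by norm_num)
  mu_right_zero := hO.mu_zero
  assoc := model_assoc hg hO
  leibniz := model_leibniz hg hO

lemma modelBInfty_isBrace (hg : IsGraded 𝒜 e) (hO : IsModel 𝒜 e O) :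
    (modelBInfty hg hO).IsBrace :=
  ⟨fun n hn => hO.m_ne n (by omega) (by omega), hO.mu_two⟩

/-- Operations which agree with the model are determined. -/
lemma IsModel.unique {O' : Ops k A} (hg : IsGraded 𝒜 e) (hO : IsModel 𝒜 e O)
    (hO' : IsModel 𝒜 e O') : O = O' := by
  have hm : O.m = O'.m := by
    funext n
    by_cases h1 : n = 1
    · subst h1
      ext a
      rw [← vec_one a]
      exact model_ext (e := e) (by rw [hO.m_one_fst, hO'.m_one_fst])
        (by rw [hO.m_one_snd, hO'.m_one_snd])
    by_cases h2 : n = 2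
    · subst h2
      ext a
      rw [show a = ![a 0, a 1] by funext i; fin_cases i <;> rfl]
      exact model_ext (e := e) (by rw [hO.m_two_fst, hO'.m_two_fst])
        (by rw [hO.m_two_snd, hO'.m_two_snd])
    rw [hO.m_ne n h1 h2, hO'.m_ne n h1 h2]
  have hmu : O.mu = O'.mu := by
    funext p q
    rcases Nat.lt_or_ge 1 p with h | h
    · rw [hO.mu_two p q h, hO'.mu_two p q h]
    interval_cases p
    · by_cases hq : q = 1
      · subst hq
        ext a b
        rw [hO.mu_zero_one, hO'.mu_zero_one]
      · rw [hO.mu_zero q hq, hO'.mu_zero q hq]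
    · refine multilinear_ext hg.internal fun d x hx => multilinear_ext hg.internal fun dc c hc => ?_
      have h1 := hO.mu_fst q (d 0) (x 0) dc c (hx 0) hc
      have h2 := hO'.mu_fst q (d 0) (x 0) dc c (hx 0) hc
      have h3 := hO.mu_snd q (d 0) (x 0) dc c (hx 0) hc
      have h4 := hO'.mu_snd q (d 0) (x 0) dc c (hx 0) hc
      rw [vec_one] at h1 h2 h3 h4
      exact model_ext (e := e) (h1.trans h2.symm) (h3.trans h4.symm)
  cases O; cases O'
  simp only at hm hmu
  rw [hm, hmu]

lemma BInfty.ext_ops {B B' : BInfty 𝒜} (h : B.toOps = B'.toOps) : B = B' := by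
  cases B; cases B'
  simp only at h
  subst h; rfl

end Package

/-! ### Strict isomorphisms -/

section Strict

variable {A : Type*} [AddCommGroup A] [Module k A] {A' : Type*} [AddCommGroup A'] [Module k A']

/-- The family of multilinear maps with linear part `φ` and no other components. -/
def strictMap (φ : A →ₗ[k] A') : ∀ n : ℕ, MultilinearMap k (fun _ : Fin n => A) A'
  | 1 => MultilinearMap.ofSubsingleton k A A' (0 : Fin 1) φ
  | _ => 0

lemma strictMap_one (φ : A →ₗ[k] A') (a : Fin 1 → A) : strictMap φ 1 a = φ (a 0) := rfl

lemma strictMap_ne (φ : A →ₗ[k] A') {n : ℕ} (h : n ≠ 1) : strictMap φ n = 0 := by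
  match n with
  | 0 => rfl
  | 1 => exact absurd rfl h
  | n + 2 => rfl

lemma fW_strictMap_one (φ : A →ₗ[k] A') (a : ℤ × A) : fW (strictMap φ) [a] = (a.1, φ a.2) :=
  Prod.ext (by simp [fW, wdeg]) rfl

lemma fW_strictMap_ne (φ : A →ₗ[k] A') {L : 𝐖 A} (h : L.length ≠ 1) :
    (fW (strictMap φ) L).2 = 0 := by
  change strictMap φ L.length _ = 0
  rw [strictMap_ne φ h]; rfl

lemma sum_posParts_of_strict {M : Type*} [AddCommMonoid M] (n r : ℕ) (g : (Fin r → ℕ) → M)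
    (h : ∀ c ∈ posParts n r, (∃ i, c i ≠ 1) → g c = 0) :
    ∑ c ∈ posParts n r, g c = if r = n then g (fun _ => 1) else 0 := by
  have hmem : (fun _ => 1 : Fin r → ℕ) ∈ posParts n r ↔ r = n := by
    simp [posParts, parts, Finset.Nat.mem_antidiagonalTuple]
  have hz : ∀ c ∈ posParts n r, c ≠ (fun _ => 1) → g c = 0 := by grind
  split_ifs with hr
  · exact sum_eq_single _ hz fun h => absurd (hmem.2 hr) h
  · exact sum_eq_zero fun c hc => hz c hc fun h => hr (hmem.1 (h ▸ hc))

lemma exists_fWords_eq_zero (φ : A →ₗ[k] A') {r : ℕ} {c : Fin r → ℕ} {L : 𝐖 A}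
    (hc : c ∈ posParts L.length r) (h : ∃ i, c i ≠ 1) :
    ∃ a ∈ fWords (strictMap φ) c L, a.2 = 0 := by
  obtain ⟨i, hi⟩ := h
  refine ⟨fW (strictMap φ) (block c i L), List.mem_ofFn.2 ⟨i, rfl⟩, fW_strictMap_ne φ ?_⟩
  rwa [length_block (mem_filter.1 hc).1]

lemma fWords_ones (φ : A →ₗ[k] A') (L : 𝐖 A) :
    fWords (strictMap φ) (fun _ : Fin L.length => 1) L = L.map fun a => (a.1, φ a.2) := by
  rw [fWords]
  refine List.ext_get (by simp) fun n h1 h2 => ?_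
  simp only [List.get_eq_getElem, List.getElem_ofFn, List.getElem_map]
  have hn : n < L.length := by simpa using h1
  have : block (fun _ : Fin L.length => 1) ⟨n, hn⟩ L = [L[n]] := by
    have hs : (∑ j : Fin L.length with j < ⟨n, hn⟩, 1) = n := by
      rw [Finset.sum_const, smul_eq_mul, mul_one]
      refine Eq.trans ?_ (Fin.card_Iio (⟨n, hn⟩ : Fin L.length))
      congr 1; ext j; simp
    rw [block, hs, List.drop_eq_getElem_cons hn]; rfl
  rw [this, fW_strictMap_one]

lemma mW_of_length {O : Ops k A} (W : 𝐖 A) {n : ℕ} (h : W.length = n) :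
    (O.mW W).2 = O.m n fun i => (W.get (Fin.cast h.symm i)).2 := by
  subst h; rfl

lemma muW_of_length {O : Ops k A} (K L : 𝐖 A) {p q : ℕ} (hp : K.length = p)
    (hq : L.length = q) : (O.muW K L).2 = O.mu p q (fun i => (K.get (Fin.cast hp.symm i)).2)
      fun i => (L.get (Fin.cast hq.symm i)).2 := by
  subst hp hq; rfl

lemma mW_map {O : Ops k A} {O' : Ops k A'} {φ : A →ₗ[k] A'}
    (hm : ∀ n a, φ (O.m n a) = O'.m n fun i => φ (a i)) (L : 𝐖 A) :
    (O'.mW (L.map fun a => (a.1, φ a.2))).2 = φ (O.mW L).2 := by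
  rw [mW_of_length _ (length_map _)]
  simp only [List.get_eq_getElem, List.getElem_map]
  exact (hm _ _).symm

lemma muW_map {O : Ops k A} {O' : Ops k A'} {φ : A →ₗ[k] A'}
    (hmu : ∀ p q a b, φ (O.mu p q a b) = O'.mu p q (fun i => φ (a i)) fun i => φ (b i))
    (K L : 𝐖 A) :
    (O'.muW (K.map fun a => (a.1, φ a.2)) (L.map fun a => (a.1, φ a.2))).2 = φ (O.muW K L).2 := by
  rw [muW_of_length _ _ (length_map _) (length_map _)]
  simp only [List.get_eq_getElem, List.getElem_map]
  exact (hmu _ _ _ _).symm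

lemma homExp_ones (r d : ℕ) : homExp (fun _ : Fin r => 1) d = 0 := by simp [homExp]

omit [AddCommGroup A] [Module k A] in
lemma kosExpHom_ones {r : ℕ} (L : 𝐖 A) : kosExpHom (fun _ : Fin r => 1) L = 0 := by
  simp [kosExpHom]

variable {𝒜 : ℤ → Submodule k A} {𝒜' : ℤ → Submodule k A'}

/-- A linear map which is compatible with all operations is a strict morphism. -/
def strictHom (B : BInfty 𝒜) (B' : BInfty 𝒜') (φ : A →ₗ[k] A') (hd : ∀ n, ∀ a ∈ 𝒜 n, φ a ∈ 𝒜' n)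
    (hm : ∀ n a, φ (B.m n a) = B'.m n fun i => φ (a i))
    (hmu : ∀ p q a b, φ (B.mu p q a b) = B'.mu p q (fun i => φ (a i)) fun i => φ (b i)) :
    BInftyHom B B' where
  f := strictMap φ
  f_zero := rfl
  f_deg n d a ha := by
    by_cases h : n = 1
    · subst h
      rw [strictMap_one]
      convert hd _ _ (ha 0) using 2; simp
    · rw [strictMap_ne φ h]; exact zero_mem _
  map_m L hL := by
    by_cases hn : L = []
    · subst hn; simp
    have hpos : 0 < L.length := List.length_pos_iff.2 hn
    rw [sum_eq_single 0, sum_eq_single L.length, sum_eq_single L.length,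
      sum_posParts_of_strict, if_pos rfl, fWords_ones, mW_map hm, homExp_ones, kosExpHom_ones]
    · simp [fW_strictMap_one, ksign_zero, wdeg]
    · exact fun c hc h => let ⟨_, ha, ha'⟩ := exists_fWords_eq_zero φ hc h
        by rw [mW_eq_zero _ ha ha', smul_zero]
    · intro r _ hr
      rw [sum_posParts_of_strict, if_neg hr]
      exact fun c hc h => let ⟨_, ha, ha'⟩ := exists_fWords_eq_zero φ hc h
        by rw [mW_eq_zero _ ha ha', smul_zero]
    · exact fun h => absurd (mem_Icc.2 ⟨hpos, le_rfl⟩) h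
    · intro s hs hs'
      rw [mem_Icc] at hs
      rw [fW_strictMap_ne _ (by simp; omega), smul_zero]
    · exact fun h => absurd (mem_Icc.2 ⟨hpos, le_rfl⟩) h
    · refine fun j hj hj' => sum_eq_zero fun s hs => ?_
      rw [mem_Icc] at hs
      rw [mem_range] at hj
      rw [fW_strictMap_ne _ (by simp; omega), smul_zero]
    · exact fun h => absurd (mem_range.2 hpos) h
  map_mu K L hK hL := by
    have hr t : ∑ ks ∈ parts K.length t, ∑ ls ∈ parts L.length t,
        ε (bexp ks ls 0 + tauExp ks ls K L + kosExp ks ls K L) •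
          (fW (strictMap φ) (B.muWords ks ls K L)).2 =
        if t = 1 then φ (B.muW K L).2 else 0 := by
      change blockSum B.toOps t K L (fun W => (fW (strictMap φ) W).2) = _
      split_ifs with h
      · rw [h, blockSum_one, fW_strictMap_one]
      · exact blockSum_eq_zero _ _ _ fun W hW => fW_strictMap_ne φ (by rwa [hW])
    simp only [hr, sum_ite_eq']
    have hs r s : (∑ c ∈ posParts K.length r, ∑ c' ∈ posParts L.length s,
        ε (homExp c s + homExp c' 0 + kosExpHom c K + kosExpHom c' L
            + (∑ i, (1 - (c' i : ℤ))) * wdeg K) •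
          (B'.muW (fWords (strictMap φ) c K) (fWords (strictMap φ) c' L)).2) =
        if r = K.length then if s = L.length then φ (B.muW K L).2 else 0 else 0 := by
      rw [sum_posParts_of_strict]
      · split_ifs with h1 h2
        · subst h1
          rw [sum_posParts_of_strict, if_pos h2]
          · subst h2
            rw [fWords_ones, fWords_ones, muW_map hmu, homExp_ones, homExp_ones, kosExpHom_ones,
              kosExpHom_ones]
            simp [ksign_zero]
          · exact fun c hc h => let ⟨_, ha, ha'⟩ := exists_fWords_eq_zero φ hc h
              by rw [muW_eq_zero_right _ ha ha', smul_zero]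
        · rw [sum_posParts_of_strict, if_neg h2]
          exact fun c hc h => let ⟨_, ha, ha'⟩ := exists_fWords_eq_zero φ hc h
            by rw [muW_eq_zero_right _ ha ha', smul_zero]
        · rfl
      · exact fun c hc h => let ⟨_, ha, ha'⟩ := exists_fWords_eq_zero φ hc h
          sum_eq_zero fun c' _ => by rw [muW_eq_zero_left _ ha ha', smul_zero]
    simp only [hs, sum_ite_eq', Finset.sum_ite_irrel, Finset.sum_const_zero]
    rw [if_pos (by simp), if_pos (by simp)]
    split_ifs with h
    · rfl
    · rw [mem_Icc] at h
      obtain rfl := List.eq_nil_of_length_eq_zero (l := K) (by omega)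
      obtain rfl := List.eq_nil_of_length_eq_zero (l := L) (by omega)
      change φ (B.mu 0 0 _ _) = 0
      rw [B.mu_right_zero 0 (by norm_num)]; exact map_zero φ

lemma compW_strictMap {A'' : Type*} [AddCommGroup A''] [Module k A''] (φ : A →ₗ[k] A')
    (ψ : A' →ₗ[k] A'') (L : 𝐖 A) :
    compW (strictMap ψ) (strictMap φ) L = (fW (strictMap (ψ ∘ₗ φ)) L).2 := by
  have h r : ∑ c ∈ posParts L.length r, ε (homExp c 0 + kosExpHom c L) •
      (fW (strictMap ψ) (fWords (strictMap φ) c L)).2 =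
      if r = L.length then (fW (strictMap (ψ ∘ₗ φ)) L).2 else 0 := by
    rw [sum_posParts_of_strict]
    · split_ifs with h
      · subst h
        rw [fWords_ones, homExp_ones, kosExpHom_ones]
        by_cases h1 : L.length = 1
        · obtain ⟨a, rfl⟩ := List.length_eq_one_iff.1 h1
          simp [fW_strictMap_one, ksign_zero]
        · rw [fW_strictMap_ne _ (by simpa using h1), fW_strictMap_ne _ h1, smul_zero]
      · rfl
    · rintro c hc ⟨i, hi⟩
      by_cases h1 : r = 1
      · subst h1
        rw [fW, show strictMap ψ (fWords (strictMap φ) c L).length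
          (fun i => ((fWords (strictMap φ) c L).get i).2) = 0 from ?_, smul_zero]
        refine MultilinearMap.map_coord_zero _ ⟨0, by simp [fWords]⟩ ?_
        simp only [fWords, List.get_eq_getElem, List.getElem_ofFn]
        apply fW_strictMap_ne
        rw [length_block (mem_filter.1 hc).1]
        rwa [Subsingleton.elim i 0] at hi
      · rw [fW_strictMap_ne _ (by simpa [fWords] using h1), smul_zero]
  rw [compW]
  simp only [h, sum_ite_eq']
  split_ifs with h1
  · rfl
  · rw [mem_Icc] at h1
    rw [fW_strictMap_ne _ (by omega)]

lemma fW_strictMap_id (L : 𝐖 A) :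
    (fW (strictMap (LinearMap.id : A →ₗ[k] A)) L).2 = idW L := by
  rw [idW]
  split_ifs with h
  · obtain ⟨a, rfl⟩ := List.length_eq_one_iff.1 h; rfl
  · exact fW_strictMap_ne _ h

/-- A linear isomorphism which is compatible with all operations is a strict isomorphism. -/
lemma exists_strict_iso (B : BInfty 𝒜) (B' : BInfty 𝒜') (φ : A ≃ₗ[k] A')
    (hd : ∀ n a, φ a ∈ 𝒜' n ↔ a ∈ 𝒜 n)
    (hm : ∀ n a, φ (B.m n a) = B'.m n fun i => φ (a i))
    (hmu : ∀ p q a b, φ (B.mu p q a b) = B'.mu p q (fun i => φ (a i)) fun i => φ (b i)) :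
    ∃ F : BInftyHom B B', F.IsStrict ∧ F.IsIso ∧ ∀ a, F.f 1 ![a] = φ a := by
  let F := strictHom B B' φ.toLinearMap (fun n a ha => (hd n a).2 ha) hm hmu
  let G := strictHom B' B φ.symm.toLinearMap
    (fun n a ha => (hd n _).1 ((φ.apply_symm_apply a).symm ▸ ha))
    (fun n a => (φ.symm_apply_eq).2 (by simp [hm]))
    (fun p q a b => (φ.symm_apply_eq).2 (by simp [hmu]))
  refine ⟨F, fun n hn => strictMap_ne _ hn, ⟨G, fun L _ => ?_, fun L _ => ?_⟩, fun a => rfl⟩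
  · refine (compW_strictMap φ.toLinearMap φ.symm.toLinearMap L).trans ?_
    rw [← fW_strictMap_id (k := k)]
    congr 3; ext; simp
  · refine (compW_strictMap φ.symm.toLinearMap φ.toLinearMap L).trans ?_
    rw [← fW_strictMap_id (k := k)]
    congr 3; ext; simp

end Strict

section Compare

variable {A : Type*} [AddCommGroup A] [Module k A] {𝒜 : ℤ → Submodule k A}
  {e : A ≃ₗ[k] diag k V × diag k V} {A' : Type*} [AddCommGroup A'] [Module k A']
  {𝒜' : ℤ → Submodule k A'} {e' : A' ≃ₗ[k] diag k V × diag k V}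

lemma toY_of_eq {φ : A ≃ₗ[k] A'} (he : ∀ a, e' (φ a) = e a) {n : ℕ} (dc : Fin n → ℤ)
    (c : Fin n → A) : (ofFn fun i => (dc i, φ (c i))).map (toY e') =
      (ofFn fun i => (dc i, c i)).map (toY e) := by
  simp only [map_ofFn]
  congr 1; funext i; simp [toY, he]

lemma muExp_map (φ : A → A') (d : ℤ) {n : ℕ} (dc : Fin n → ℤ) (c : Fin n → A) :
    muExp d (ofFn fun i => (dc i, φ (c i))) = muExp d (ofFn fun i => (dc i, c i)) := by
  simp [muExp, wdeg, map_ofFn, Function.comp_def]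

/-- The operations on `A` which correspond to given operations on `A'`. -/
def pullOps (φ : A ≃ₗ[k] A') (O : Ops k A') : Ops k A where
  m n := φ.symm.toLinearMap.compMultilinearMap ((O.m n).compLinearMap fun _ => φ.toLinearMap)
  mu p q := LinearMap.compMultilinearMap
    { toFun := fun f => φ.symm.toLinearMap.compMultilinearMap
        (f.compLinearMap fun _ => φ.toLinearMap)
      map_add' := fun f g => by ext; simp
      map_smul' := fun r f => by ext; simp }
    ((O.mu p q).compLinearMap fun _ => φ.toLinearMap)

lemma pullOps_m (φ : A ≃ₗ[k] A') (O : Ops k A') (n a) :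
    (pullOps φ O).m n a = φ.symm (O.m n fun i => φ (a i)) := rfl

lemma pullOps_mu (φ : A ≃ₗ[k] A') (O : Ops k A') (p q a b) :
    (pullOps φ O).mu p q a b = φ.symm (O.mu p q (fun i => φ (a i)) fun i => φ (b i)) := rfl

lemma map_vec_one {α β : Type*} (f : α → β) (a : α) : (fun i => f (![a] i)) = ![f a] := by
  funext i; fin_cases i; rfl

lemma map_vec_two {α β : Type*} (f : α → β) (a b : α) :
    (fun i => f (![a, b] i)) = ![f a, f b] := by
  funext i; fin_cases i <;> rfl

lemma IsModel.pull {φ : A ≃ₗ[k] A'} (he : ∀ a, e' (φ a) = e a)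
    (hd : ∀ n a, φ a ∈ 𝒜' n ↔ a ∈ 𝒜 n) {O : Ops k A'} (hO : IsModel 𝒜' e' O) :
    IsModel 𝒜 e (pullOps φ O) := by
  have he' a : e (φ.symm a) = e' a := by rw [← he, φ.apply_symm_apply]
  constructor
  · exact fun a => by rw [pullOps_m, he', map_vec_one, hO.m_one_fst]
  · exact fun a => by rw [pullOps_m, he', map_vec_one, hO.m_one_snd, he]
  · exact fun a b => by rw [pullOps_m, he', map_vec_two, hO.m_two_fst, he, he]
  · exact fun a b => by rw [pullOps_m, he', map_vec_two, hO.m_two_snd, he, he]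
  · intro n h1 h2
    ext a
    rw [pullOps_m, hO.m_ne n h1 h2]; exact map_zero _
  · exact fun a b => by rw [pullOps_mu, hO.mu_one_zero, φ.symm_apply_apply]
  · exact fun a b => by rw [pullOps_mu, hO.mu_zero_one, φ.symm_apply_apply]
  · intro n hn
    ext a b
    rw [pullOps_mu, hO.mu_zero n hn]; exact map_zero _
  · intro p q hp
    ext a b
    rw [pullOps_mu, hO.mu_two p q hp]; exact map_zero _
  · intro n d x dc c hx hc
    rw [pullOps_mu, he', map_vec_one,
      hO.mu_fst n d (φ x) dc (fun i => φ (c i)) ((hd _ _).2 hx) fun i => (hd _ _).2 (hc i),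
      muExp_map, Phi, Phi, toY_of_eq he, he]
  · intro n d x dc c hx hc
    rw [pullOps_mu, he', map_vec_one,
      hO.mu_snd n d (φ x) dc (fun i => φ (c i)) ((hd _ _).2 hx) fun i => (hd _ _).2 (hc i),
      muExp_map, Psi, Psi, toY_of_eq he, he]

/-- Two `B_∞`-algebras with the same model are isomorphic. -/
lemma exists_iso_of_isModel (hg : IsGraded 𝒜 e) (hg' : IsGraded 𝒜' e') (B : BInfty 𝒜)
    (B' : BInfty 𝒜') (hB : IsModel 𝒜 e B.toOps) (hB' : IsModel 𝒜' e' B'.toOps) :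
    ∃ F : BInftyHom B B', F.IsStrict ∧ F.IsIso ∧ ∀ a, F.f 1 ![a] = e'.symm (e a) := by
  let φ : A ≃ₗ[k] A' := e.trans e'.symm
  have he : ∀ a, e' (φ a) = e a := fun a => by simp [φ]
  have hd : ∀ n a, φ a ∈ 𝒜' n ↔ a ∈ 𝒜 n := fun n a => by rw [hg'.mem, hg.mem, he]
  have h : B.toOps = pullOps φ B'.toOps := hB.unique hg (hB'.pull he hd)
  refine exists_strict_iso B B' φ hd (fun n a => ?_) fun p q a b => ?_
  · rw [h, pullOps_m, φ.apply_symm_apply]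
  · rw [h, pullOps_mu, φ.apply_symm_apply]

end Compare

/-! ### Insertion in terms of the shift -/

section Products

variable (k) in
/-- The product of the ghost arrows of a list. -/
def outL (D : List 𝐐) : 𝐋 := val k (D.map .out)

variable (k) in
/-- The product of the arrows of a list, in reverse order. -/
def innL (U : List 𝐐) : 𝐋 := val k (U.reverse.map .inn)

@[simp] lemma outL_nil : outL k ([] : List 𝐐) = 1 := rfl
@[simp] lemma outL_cons (e : 𝐐) (D) : outL k (e :: D) = 𝔬 e * outL k D := by
  simp [outL]
@[simp] lemma outL_append (D D' : List 𝐐) :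
    outL k (D ++ D') = outL k D * outL k D' := by simp [outL]
@[simp] lemma innL_nil : innL k ([] : List 𝐐) = 1 := rfl
@[simp] lemma innL_cons (e : 𝐐) (U) : innL k (e :: U) = innL k U * 𝔦 e := by
  simp [innL]
@[simp] lemma innL_append (U U' : List 𝐐) :
    innL k (U ++ U') = innL k U' * innL k U := by simp [innL]

lemma outL_mem_deg (D : List 𝐐) : outL k D ∈ deg k V (-D.length) := by
  induction D with
  | nil => exact one_mem_deg
  | cons e D ih =>
    rw [outL_cons]
    convert mul_mem_deg (gen_mem_deg (.out e)) ih using 2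
    simp [ldeg]

lemma innL_mem_deg (U : List 𝐐) : innL k U ∈ deg k V U.length := by
  induction U with
  | nil => exact one_mem_deg
  | cons e U ih =>
    rw [innL_cons]
    convert mul_mem_deg ih (gen_mem_deg (.inn e)) using 2
    simp [ldeg]

lemma shift_pow_mem_diag {y : 𝐋} (hy : y ∈ 𝐃) (n : ℕ) :
    (𝔰 ^ n) y ∈ 𝐃 := by
  cases n with
  | zero => simpa
  | succ n => rw [pow_succ', mul_apply]; exact shift_mem_diag

lemma shift_pow_mul {y y' : 𝐋} (hy : y ∈ 𝐃) (n : ℕ) :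
    (𝔰 ^ n) (y * y') = (𝔰 ^ n) y * (𝔰 ^ n) y' := by
  induction n with
  | zero => simp
  | succ n ih =>
    simp only [pow_succ', mul_apply, ih]
    exact shift_mul _ (shift_pow_mem_diag hy n)

lemma shift_pow_one (n : ℕ) : (𝔰 ^ n) 1 = 1 := by
  induction n with
  | zero => simp
  | succ n ih => rw [pow_succ', mul_apply, ih, shift_one]

lemma shift_pow_mul_outL {y : 𝐋} (hy : y ∈ 𝐃) (D : List 𝐐) :
    (𝔰 ^ D.length) y * outL k D = outL k D * y := by
  induction D with
  | nil => simp
  | cons e D ih =>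
    rw [outL_cons, length_cons, pow_succ', mul_apply, ← mul_assoc,
      shift_mul_out (shift_pow_mem_diag hy _), mul_assoc, ih, mul_assoc]

lemma innL_mul_shift_pow {y : 𝐋} (hy : y ∈ 𝐃) (U : List 𝐐) :
    innL k U * (𝔰 ^ U.length) y = y * innL k U := by
  induction U with
  | nil => simp
  | cons e U ih =>
    rw [innL_cons, length_cons, pow_succ', mul_apply, mul_assoc,
      inn_mul_shift (shift_pow_mem_diag hy _), ← mul_assoc, ih, mul_assoc]

variable (k V) in
/-- The span of the elements `β₁* ⋯ β_p* α_m ⋯ α₁`. -/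
def typ (m p : ℕ) : Submodule k 𝐋 :=
  span k {x | ∃ (D U : List 𝐐) (a : V), D.length = p ∧ U.length = m ∧
    x = outL k D * (𝔳 a * innL k U)}

end Products

section Sums

variable {ι : Type*} (p : ι → ℤ) (y : ι → diag k V)

/-- The sum over all insertions of a word into a product of `n` ghost arrows, which may take place
before each of them, divided by that product. -/
def outSum : ℕ → List ι → 𝐋
  | _, [] => 1
  | 0, _ :: _ => 0
  | n + 1, b :: c => ε (wt p (b :: c)) • 𝔰 (outSum n (b :: c)) + y b * outSum (n + 1) c
termination_by n c => (n, c)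

/-- The sum over all insertions of a word into a product of `n` arrows, at most one letter
after each of them, divided by that product. -/
def inSum : ℕ → List ι → 𝐋
  | _, [] => 1
  | 0, _ :: _ => 0
  | n + 1, b :: c => ε (wt p (b :: c)) •
      (inSum n (b :: c) - (𝔰 ^ n) (y b) * inSum n c)

variable {p y}

@[simp] lemma outSum_nil (n : ℕ) : outSum p y n [] = 1 := by unfold outSum; rfl
@[simp] lemma outSum_zero_cons (b c) : outSum p y 0 (b :: c) = 0 := by unfold outSum; rfl
lemma outSum_succ_cons (n : ℕ) (b c) : outSum p y (n + 1) (b :: c) =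
    ε (wt p (b :: c)) • 𝔰 (outSum p y n (b :: c)) + y b * outSum p y (n + 1) c := by
  rw [outSum]
@[simp] lemma inSum_nil (n : ℕ) : inSum p y n [] = 1 := by unfold inSum; rfl
@[simp] lemma inSum_zero_cons (b c) : inSum p y 0 (b :: c) = 0 := by unfold inSum; rfl
lemma inSum_succ_cons (n : ℕ) (b c) : inSum p y (n + 1) (b :: c) = ε (wt p (b :: c)) •
    (inSum p y n (b :: c) - (𝔰 ^ n) (y b) * inSum p y n c) := by
  rw [inSum]

lemma outSum_mem_diag (n : ℕ) (c) : outSum p y n c ∈ 𝐃 := by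
  induction n generalizing c with
  | zero => cases c <;> simp
  | succ n ih =>
    induction c with
    | nil => simp
    | cons b c ihc =>
      rw [outSum_succ_cons]
      exact add_mem (Subalgebra.smul_mem _ shift_mem_diag _) (mul_mem (y b).2 ihc)

lemma phi_outL (D : List 𝐐) (c : List ι) :
    phi p y (outL k D) c = outSum p y D.length c * outL k D := by
  induction D generalizing c with
  | nil =>
    rw [outL_nil, phi, map_one]
    cases c <;> simp
  | cons e D ih =>
    have h1 : ∀ c, phi p y (outL k (e :: D)) c =
        ins p y (reg k V) (𝔬 e) (phi p y (outL k D)) c := fun c => by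
      rw [outL_cons, phi, map_mul, mul_apply]; rfl
    induction c with
    | nil => simp
    | cons b c ihc =>
      rw [h1, ins_out, geomOp_cons, ← ins_out, ← h1, ihc, ptwOp_apply, signOp_apply, ih,
        length_cons, outSum_succ_cons, add_mul, smul_mul_assoc, outL_cons,
        ← mul_assoc (𝔰 _), shift_mul_out (outSum_mem_diag _ _)]
      simp [mul_assoc]

lemma phi_innL (U : List 𝐐) (c : List ι) :
    phi p y (innL k U) c = innL k U * inSum p y U.length c := by
  induction U using List.reverseRecOn generalizing c with
  | nil =>
    rw [innL_nil, phi, map_one]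
    cases c <;> simp
  | append_singleton U e ih =>
    have h1 : phi p y (innL k (U ++ [e])) c =
        ins p y (reg k V) (𝔦 e) (phi p y (innL k U)) c := by
      rw [innL_append, phi, innL_cons, innL_nil, one_mul, map_mul, mul_apply]; rfl
    cases c with
    | nil => simp
    | cons b c =>
      rw [h1, ins_inn_apply, sub_headOp_cons, ih, ih]
      simp only [Algebra.lmul, AlgHom.coe_mk]
      rw [length_append, length_singleton, inSum_succ_cons, innL_append, innL_cons,
        innL_nil, one_mul, mul_smul_comm, mul_assoc, mul_sub (innL k U), ← mul_assoc (innL k U),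
        innL_mul_shift_pow (y b).2]
      simp [mul_assoc]

/-- Insertion into an element of `typ k V m n`. -/
lemma phi_of_typ {m n : ℕ} {x : 𝐋} (hx : x ∈ typ k V m n) (c : List ι) :
    phi p y x c = ∑ i ∈ range (c.length + 1), ε (n * wt p (c.drop i)) •
      (outSum p y n (c.take i) * x * inSum p y m (c.drop i)) := by
  induction hx using span_induction with
  | mem x hx =>
    obtain ⟨D, U, a, rfl, rfl, rfl⟩ := hx
    rw [phi_mul (outL_mem_deg D)]
    refine sum_congr rfl fun i _ => ?_
    have h1 : phi p y (𝔳 a * innL k U) (c.drop i) = 𝔳 a * phi p y (innL k U) (c.drop i) := by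
      rw [phi, map_mul, mul_apply, ins_vert]; rfl
    rw [phi_outL, h1, phi_innL]
    refine congrArg₂ _ (ksign_congr ?_) ?_
    · push_cast; grind
    · simp [mul_assoc]
  | zero => simp [phi]
  | add x x' _ _ h h' => simp only [phi_add, h, h', mul_add, add_mul, smul_add, sum_add_distrib]
  | smul r x _ h =>
    simp only [phi_smul, h, smul_sum, mul_smul_comm, smul_mul_assoc]
    exact sum_congr rfl fun i _ => smul_comm _ _ _

lemma psi_out_mul (e : 𝐐) (x : 𝐋) (c : List ι) :
    psi p y (𝔬 e * x) c = ε (wt p c) • (𝔬 e * phi p y x c) := by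
  rw [psi, map_mul, mul_apply, sub_headOp_ins_out, ptwOp_apply, signOp_apply, ← mul_smul_comm]; rfl

@[elab_as_elim]
lemma typ_succ_induction {m n : ℕ} {Q : 𝐋 → Prop} (h : ∀ e, ∀ x ∈ typ k V m n, Q (𝔬 e * x))
    (h0 : Q 0) (h1 : ∀ x x', Q x → Q x' → Q (x + x')) (h2 : ∀ (r : k) x, Q x → Q (r • x))
    {x : 𝐋} (hx : x ∈ typ k V m (n + 1)) : Q x := by
  induction hx using span_induction with
  | mem x hx =>
    obtain ⟨D, U, a, hD, rfl, rfl⟩ := hx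
    obtain ⟨e, D, rfl⟩ := List.exists_cons_of_length_eq_add_one hD
    rw [outL_cons, mul_assoc]
    exact h e _ (subset_span ⟨D, U, a, by simpa using hD, rfl, rfl⟩)
  | zero => exact h0
  | add x x' _ _ hx hx' => exact h1 x x' hx hx'
  | smul r x _ hx => exact h2 r x hx

end Sums

section Sums

variable {ι : Type*} {p : ι → ℤ} {y : ι → diag k V}

lemma sum_filter_bij {α β M : Type*} [AddCommMonoid M] [Fintype α] [Fintype β] {P : α → Prop}
    {Q : β → Prop} [DecidablePred P] [DecidablePred Q] {f : α → M} {g : β → M} (i : ∀ a, P a → β) (j : ∀ b, Q b → α)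
    (hi : ∀ a h, Q (i a h)) (hj : ∀ b h, P (j b h)) (hji : ∀ a h, j (i a h) (hi a h) = a)
    (hij : ∀ b h, i (j b h) (hj b h) = b) (hfg : ∀ b h, f (j b h) = g b) :
    ∑ a with P a, f a = ∑ b with Q b, g b :=
  (Finset.sum_bij' (fun b h => j b (mem_filter.1 h).2) (fun a h => i a (mem_filter.1 h).2)
    (fun b _ => mem_filter.2 ⟨mem_univ _, hj b _⟩) (fun a _ => mem_filter.2 ⟨mem_univ _, hi a _⟩)
    (fun b _ => hij b _) (fun a _ => hji a _) fun b _ => (hfg b _).symm).symm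

/-- A monotone sequence either has no entry `0` or starts with `0`. -/
lemma sum_monotone_succ {M : Type*} [AddCommMonoid M] (m n : ℕ)
    (G : (Fin (n + 1) → Fin (m + 1)) → M) :
    ∑ l : Fin (n + 1) → Fin (m + 1) with Monotone l, G l =
      (∑ l : Fin (n + 1) → Fin m with Monotone l, G fun r => (l r).succ) +
      ∑ l : Fin n → Fin (m + 1) with Monotone l, G (Fin.cons 0 l) := by
  rw [← Finset.sum_filter_add_sum_filter_not _ (fun l => l 0 ≠ 0), Finset.filter_filter,
    Finset.filter_filter]
  congr 1
  · have hne : ∀ l : Fin (n + 1) → Fin (m + 1), Monotone l ∧ l 0 ≠ 0 → ∀ r, l r ≠ 0 :=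
      fun l hl r h => hl.2 (le_antisymm ((hl.1 (Fin.zero_le r)).trans h.le) (Fin.zero_le _))
    exact sum_filter_bij (fun l h r => (l r).pred (hne l h r)) (fun l _ r => (l r).succ)
      (fun l h r s hrs => Fin.pred_le_pred_iff.2 (h.1 hrs))
      (fun l h => ⟨fun r s hrs => Fin.succ_le_succ_iff.2 (h hrs), Fin.succ_ne_zero _⟩)
      (by simp) (by simp) (by simp)
  · refine sum_filter_bij (fun l _ => Fin.tail l) (fun l _ => Fin.cons 0 l)
      (fun l h r s hrs => h.1 (Fin.succ_le_succ_iff.2 hrs)) (fun l h => ⟨fun r s hrs => ?_, by simp⟩)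
      (fun l h => by rw [← not_not.1 h.2, Fin.cons_self_tail]) (by simp) (by simp)
    cases r using Fin.cases with
    | zero => simp
    | succ r =>
      cases s using Fin.cases with
      | zero => exact absurd hrs (by simp)
      | succ s => simpa using h (Fin.succ_le_succ_iff.1 hrs)

/-- A strictly decreasing sequence either does not contain the maximal entry or starts with it. -/
lemma sum_strictAnti_succ {M : Type*} [AddCommMonoid M] (m n : ℕ)
    (G : (Fin (n + 1) → Fin (m + 1)) → M) :
    ∑ l : Fin (n + 1) → Fin (m + 1) with StrictAnti l, G l =
      (∑ l : Fin (n + 1) → Fin m with StrictAnti l, G fun r => (l r).castSucc) +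
      ∑ l : Fin n → Fin m with StrictAnti l, G (Fin.cons (Fin.last m) fun r => (l r).castSucc) := by
  rw [← Finset.sum_filter_add_sum_filter_not _ (fun l => l 0 ≠ Fin.last m), Finset.filter_filter,
    Finset.filter_filter]
  congr 1
  · have hne : ∀ l : Fin (n + 1) → Fin (m + 1), StrictAnti l ∧ l 0 ≠ Fin.last m →
        ∀ r, l r ≠ Fin.last m := fun l hl r h =>
      hl.2 (le_antisymm (Fin.le_last _) (h.ge.trans (hl.1.antitone (Fin.zero_le r))))
    exact sum_filter_bij (fun l h r => (l r).castPred (hne l h r)) (fun l _ r => (l r).castSucc)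
      (fun l h r s hrs => Fin.castPred_lt_castPred_iff.2 (h.1 hrs))
      (fun l h => ⟨fun r s hrs => Fin.castSucc_lt_castSucc_iff.2 (h hrs), Fin.castSucc_ne_last _⟩)
      (by simp) (by simp) (by simp)
  · refine sum_filter_bij
      (fun l h r => (l r.succ).castPred ((h.1 (Fin.succ_pos r)).trans_le (Fin.le_last _)).ne)
      (fun l _ => Fin.cons (Fin.last m) fun r => (l r).castSucc)
      (fun l h r s hrs => Fin.castPred_lt_castPred_iff.2 (h.1 (Fin.succ_lt_succ_iff.2 hrs)))
      (fun l h => ⟨fun r s hrs => ?_, by simp⟩) (fun l h => funext fun r => ?_) (by simp) (by simp)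
    · cases s using Fin.cases with
      | zero => exact absurd hrs (Fin.not_lt_zero _)
      | succ s =>
        cases r using Fin.cases with
        | zero => simp [Fin.castSucc_lt_last]
        | succ r => simpa using h (Fin.succ_lt_succ_iff.1 hrs)
    · cases r using Fin.cases <;> simp [not_not.1 h.2]

lemma wt_ofFn {n : ℕ} (a : Fin n → ι) : wt p (ofFn a) = ∑ r, p (a r) := by
  rw [wt, map_ofFn, List.sum_ofFn]; rfl

lemma shift_prod_ofFn {n : ℕ} (z : Fin n → 𝐋) (hz : ∀ r, z r ∈ 𝐃) :
    𝔰 (ofFn z).prod = (ofFn fun r => 𝔰 (z r)).prod := by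
  induction n with
  | zero => simp [shift_one]
  | succ n ih =>
    rw [ofFn_succ, ofFn_succ, prod_cons, prod_cons, shift_mul _ (hz 0),
      ih _ fun r => hz _]

lemma outSum_ofFn (m n : ℕ) (a : Fin n → ι) :
    outSum p y m (ofFn a) = ∑ l : Fin n → Fin m with Monotone l,
      ε (∑ r, (l r : ℕ) * p (a r)) •
        (ofFn fun r => (𝔰 ^ (l r : ℕ)) (y (a r) : 𝐋)).prod := by
  induction n generalizing m with
  | zero => rw [filter_true_of_mem fun l _ r => r.elim0]; simp [ksign_zero]
  | succ n ihn =>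
    induction m with
    | zero => rw [ofFn_succ, outSum_zero_cons, sum_eq_zero fun l _ => (l 0).elim0]
    | succ m ihm =>
      rw [ofFn_succ, outSum_succ_cons, ihn, ← ofFn_succ, ihm, sum_monotone_succ]
      congr 1
      · rw [map_sum, smul_sum]
        refine sum_congr rfl fun l _ => ?_
        rw [map_smul, smul_smul, ← ksign_add, shift_prod_ofFn _ fun r => shift_pow_mem_diag (y _).2 _,
          wt_ofFn, ← sum_add_distrib]
        refine congrArg₂ _ (congrArg _ (sum_congr rfl fun r _ => ?_)) ?_
        · rw [Fin.val_succ]; push_cast; ring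
        · simp only [Fin.val_succ, pow_succ', mul_apply]
      · rw [mul_sum]
        refine sum_congr rfl fun l _ => ?_
        rw [mul_smul_comm, Fin.sum_univ_succ, ofFn_succ, prod_cons]
        simp

lemma inSum_ofFn (m n : ℕ) (a : Fin n → ι) :
    inSum p y m (ofFn a) = ∑ l : Fin n → Fin m with StrictAnti l,
      ε ((∑ r, (m - (l r : ℕ)) * p (a r)) + n) •
        (ofFn fun r => (𝔰 ^ (l r : ℕ)) (y (a r) : 𝐋)).prod := by
  induction n generalizing m with
  | zero => rw [filter_true_of_mem fun l _ r => r.elim0]; simp [ksign_zero]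
  | succ n ihn =>
    induction m with
    | zero => rw [ofFn_succ, inSum_zero_cons, sum_eq_zero fun l _ => (l 0).elim0]
    | succ m ihm =>
      rw [ofFn_succ, inSum_succ_cons, ihn, ← ofFn_succ, ihm, sum_strictAnti_succ, smul_sub,
        sub_eq_add_neg]
      congr 1
      · rw [smul_sum]
        refine sum_congr rfl fun l _ => ?_
        rw [smul_smul, ← ksign_add, wt_ofFn, ← add_assoc, ← sum_add_distrib]
        refine congrArg₂ _ (congrArg _ (congrArg₂ _ (sum_congr rfl fun r _ => ?_) rfl)) rfl
        rw [Fin.val_castSucc]; push_cast; ring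
      · rw [mul_sum, smul_sum, ← Finset.sum_neg_distrib]
        refine sum_congr rfl fun l _ => ?_
        rw [mul_smul_comm, smul_smul, ← ksign_add, ← neg_smul, ← ksign_succ]
        refine congrArg₂ _ (congrArg _ ?_) ?_
        · rw [wt_ofFn, Fin.sum_univ_succ, Fin.sum_univ_succ]
          simp only [Fin.cons_zero, Fin.cons_succ, Fin.val_last, Fin.val_castSucc]
          have : ∑ i : Fin n, (((m + 1 : ℕ) : ℤ) - (l i : ℕ)) * p (a i.succ) =
              ∑ i : Fin n, ((m : ℤ) - (l i : ℕ)) * p (a i.succ) + ∑ i : Fin n, p (a i.succ) := by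
            rw [← sum_add_distrib]
            exact sum_congr rfl fun r _ => by push_cast; ring
          rw [this]; push_cast; ring
        · rw [ofFn_succ, prod_cons]
          simp

end Sums

section Sums

/-- The product `σ^{l_1}(z_1) ⋯ σ^{l_b}(z_b) x σ^{i_{N - b}}(z_{b + 1}) ⋯ σ^{i_1}(z_N)`. -/
def insVal {N : ℕ} (z : Fin N → 𝐋) (x : 𝐋) (b : Fin (N + 1)) (l : Fin b → ℕ)
    (i : Fin (N - b) → ℕ) : 𝐋 :=
  (ofFn fun r : Fin b => (𝔰 ^ l r) (z ⟨r, by omega⟩)).prod * x *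
    (ofFn fun r : Fin (N - b) => (𝔰 ^ i r) (z ⟨N - 1 - r, by omega⟩)).reverse.prod

/-- The exponent of the sign of a summand of the brace operation, for arguments of degrees `q`. -/
def insExp {N : ℕ} (q : Fin N → ℤ) (m n : ℤ) (b : Fin (N + 1)) (l : Fin b → ℕ)
    (i : Fin (N - b) → ℕ) : ℤ :=
  ((N - b : ℕ) : ℤ) + ∑ r : Fin b, q ⟨r, by omega⟩ * (m + n - l r)
    + ∑ r : Fin (N - b), q ⟨N - 1 - r, by omega⟩ * i r

variable {ι : Type*} {p : ι → ℤ} {y : ι → diag k V}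

lemma take_ofFn_cast {α : Type*} {N : ℕ} (a : Fin N → α) (b : Fin (N + 1)) :
    (ofFn a).take b = ofFn fun r : Fin b => a ⟨r, by omega⟩ :=
  List.ext_getElem (by simp; omega) fun i h h' => by simp

lemma drop_ofFn_cast {α : Type*} {N : ℕ} (a : Fin N → α) (b : Fin (N + 1)) :
    (ofFn a).drop b = ofFn fun r : Fin (N - b) => a ⟨b + r, by omega⟩ :=
  List.ext_getElem (by simp) fun i h h' => by simp

lemma reverse_ofFn' {α : Type*} {n : ℕ} (f : Fin n → α) :
    (ofFn f).reverse = ofFn fun r => f r.rev := by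
  refine List.ext_getElem (by simp) fun i h h' => ?_
  simp only [List.getElem_reverse, List.getElem_ofFn]
  congr 1; ext; simp; omega

lemma sum_strictAnti_rev {M : Type*} [AddCommMonoid M] (m n : ℕ) (G : (Fin n → Fin m) → M) :
    ∑ l : Fin n → Fin m with StrictAnti l, G l =
      ∑ i : Fin n → Fin m with StrictMono i, G fun r => i r.rev :=
  sum_filter_bij (fun l _ r => l r.rev) (fun l _ r => l r.rev)
    (fun l h r s hrs => h (Fin.rev_lt_rev.2 hrs)) (fun l h r s hrs => h (Fin.rev_lt_rev.2 hrs))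
    (by simp) (by simp) (by simp)

lemma inSum_drop {N : ℕ} (m : ℕ) (a : Fin N → ι) (b : Fin (N + 1)) :
    inSum p y m ((ofFn a).drop b) = ∑ i : Fin (N - b) → Fin m with StrictMono i,
      ε ((∑ r : Fin (N - b), (m - (i r : ℕ)) * p (a ⟨N - 1 - r, by omega⟩)) + (N - b : ℕ)) •
        (ofFn fun r : Fin (N - b) => (𝔰 ^ (i r : ℕ))
          (y (a ⟨N - 1 - r, by omega⟩) : 𝐋)).reverse.prod := by
  rw [drop_ofFn_cast, inSum_ofFn, sum_strictAnti_rev]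
  have hr : ∀ r : Fin (N - b), (⟨b + (r.rev : Fin (N - b)), by omega⟩ : Fin N) =
      ⟨N - 1 - r, by omega⟩ := fun r => by
    ext; simp only [Fin.val_rev]; omega
  refine sum_congr rfl fun i _ => congrArg₂ _ (congrArg _ (congrArg₂ _ ?_ rfl)) ?_
  · rw [← Equiv.sum_comp Fin.revPerm]
    refine sum_congr rfl fun r _ => ?_
    simp only [Fin.revPerm_apply, Fin.rev_rev, hr]
  · rw [reverse_ofFn']
    refine congrArg _ (congrArg _ (funext fun r => ?_))
    rw [show (⟨b + r, by omega⟩ : Fin N) = ⟨N - 1 - r.rev, by omega⟩ from ?_]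
    ext; simp only [Fin.val_rev]; omega

lemma wt_drop_ofFn {N : ℕ} (a : Fin N → ι) (b : Fin (N + 1)) :
    wt p ((ofFn a).drop b) = ∑ r : Fin (N - b), p (a ⟨N - 1 - r, by omega⟩) := by
  rw [drop_ofFn_cast, wt_ofFn, ← Equiv.sum_comp Fin.revPerm]
  refine sum_congr rfl fun r _ => congrArg p (congrArg a ?_)
  ext; simp only [Fin.revPerm_apply, Fin.val_rev]; omega

lemma smul_sum_mul_sum {α β : Type*} (s : Finset α) (t : Finset β) (c c' : k)
    (f : α → 𝐋) (x : 𝐋) (g : β → 𝐋) :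
    c • c' • ((∑ l ∈ s, f l) * x * ∑ i ∈ t, g i) =
      ∑ l ∈ s, ∑ i ∈ t, c • c' • (f l * x * g i) := by
  simp only [sum_mul, mul_sum, smul_sum]
  exact Finset.sum_comm

/-- The brace operation on a parallel path. -/
lemma phi_ofFn {m n : ℕ} {x : 𝐋} (hx : x ∈ typ k V m n) {N : ℕ} (a : Fin N → ι) :
    ε ((m - n) * ∑ r, p (a r)) • phi p y x (ofFn a) =
      ∑ b : Fin (N + 1), ∑ l : Fin b → Fin n with Monotone l,
        ∑ i : Fin (N - b) → Fin m with StrictMono i,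
          ε (insExp (fun r => p (a r)) m n b (fun r => l r) fun r => i r) •
            insVal (fun r => (y (a r) : 𝐋)) x b (fun r => l r) fun r => i r := by
  rw [phi_of_typ hx, List.length_ofFn, Finset.sum_range, smul_sum]
  refine sum_congr rfl fun b _ => ?_
  have h1 := (wt_take_drop (p := p) (ofFn a) b).symm
  rw [wt_ofFn] at h1
  rw [← h1, take_ofFn_cast, outSum_ofFn, inSum_drop, wt_drop_ofFn, wt_ofFn]
  rw [smul_sum_mul_sum]
  refine sum_congr rfl fun l _ => sum_congr rfl fun i _ => ?_
  simp only [smul_mul_assoc, mul_smul_comm, smul_smul, ← ksign_add]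
  refine congrArg₂ _ (ksign_congr ?_) rfl
  simp only [insExp, mul_add, sub_mul, mul_sub, sum_add_distrib,
    sum_sub_distrib, ← mul_sum, ← sum_mul]
  simp only [mul_comm (p _)]
  push_cast
  grind

lemma out_mul_insVal {N : ℕ} {z : Fin N → 𝐋} (hz : ∀ r, z r ∈ 𝐃) (e : 𝐐) (x : 𝐋) (b l i) :
    𝔬 e * insVal z x b l i = insVal z (𝔬 e * x) b (fun r => l r + 1) i := by
  simp only [insVal, ← mul_assoc, pow_succ', mul_apply]
  rw [← shift_prod_ofFn _ fun r => shift_pow_mem_diag (hz _) _, ← shift_mul_out]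
  exact list_prod_mem (by simpa [List.mem_ofFn] using fun r => shift_pow_mem_diag (hz _) _)

/-- The brace operation on a parallel path with a marked arrow. -/
lemma psi_ofFn {m n : ℕ} {x : 𝐋} (hx : x ∈ typ k V m (n + 1)) {N : ℕ} (a : Fin N → ι) :
    ε ((m - n) * ∑ r, p (a r) + ∑ r, p (a r)) • psi p y x (ofFn a) =
      ∑ b : Fin (N + 1), ∑ l : Fin b → Fin n with Monotone l,
        ∑ i : Fin (N - b) → Fin m with StrictMono i,
          ε (insExp (fun r => p (a r)) m n b (fun r => l r) fun r => i r) •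
            insVal (fun r => (y (a r) : 𝐋)) x b (fun r => l r + 1) fun r => i r := by
  refine typ_succ_induction (fun e x hx => ?_) ?_ (fun x x' h h' => ?_) (fun r x h => ?_) hx
  · rw [psi_out_mul, wt_ofFn, ksign_smul_smul, ← mul_smul_comm,
      ksign_congr (b := (m - n) * ∑ r, p (a r)) (by push_cast; grind), phi_ofFn hx]
    simp only [mul_sum, mul_smul_comm, out_mul_insVal fun r => (y (a r)).2]
  · simp [psi, insVal]
  · simp only [psi_add, smul_add, h, h', insVal, mul_add, add_mul, sum_add_distrib]
  · simp only [psi_smul, smul_comm _ r, h, insVal, mul_smul_comm, smul_mul_assoc, smul_sum]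

end Sums

/-! ### Vertices do not vanish -/

section Nonzero

variable (V) in
/-- The infinite paths of the quiver. -/
abbrev InfPath : Type _ := {x : ℕ → 𝐐 // ∀ i, (x i).right = (x (i + 1)).left}

/-- The action of a letter on functions of infinite paths. -/
def infGen : Letter V → Module.End k (InfPath V → k)
  | .vert a =>
    { toFun := fun F x => if (x.1 0).left = a then F x else 0
      map_add' := fun F G => funext fun x => by simp only [Pi.add_apply]; split_ifs <;> simp
      map_smul' := fun r F => funext fun x => by simp }
  | .out e =>
    { toFun := fun F x => if x.1 0 = e then F ⟨fun i => x.1 (i + 1), fun i => x.2 (i + 1)⟩ else 0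
      map_add' := fun F G => funext fun x => by simp only [Pi.add_apply]; split_ifs <;> simp
      map_smul' := fun r F => funext fun x => by simp }
  | .inn e =>
    { toFun := fun F x => if h : e.right = (x.1 0).left then
        F ⟨fun i => Nat.casesOn i e x.1, fun i => by cases i; exacts [h, x.2 _]⟩ else 0
      map_add' := fun F G => funext fun x => by simp only [Pi.add_apply]; split_ifs <;> simp
      map_smul' := fun r F => funext fun x => by simp }

lemma infGen_vert (a : V) (F : InfPath V → k) (x) :
    infGen (.vert a) F x = if (x.1 0).left = a then F x else 0 := rfl
lemma infGen_out (e : 𝐐) (F : InfPath V → k) (x) : infGen (.out e) F x =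
    if x.1 0 = e then F ⟨fun i => x.1 (i + 1), fun i => x.2 (i + 1)⟩ else 0 := rfl
lemma infGen_inn (e : 𝐐) (F : InfPath V → k) (x) : infGen (.inn e) F x =
    if h : e.right = (x.1 0).left then
      F ⟨fun i => Nat.casesOn i e x.1, fun i => by cases i; exacts [h, x.2 _]⟩ else 0 := rfl

lemma infGen_family : LeavittFamily V (infGen (k := k) (V := V)) := by
  have hext {f g : Module.End k (InfPath V → k)} (h : ∀ F x, f F x = g F x) : f = g :=
    LinearMap.ext fun F => funext (h F)
  refine ⟨fun a b => hext fun F x => ?_, hext fun F x => ?_, fun e => hext fun F x => ?_,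
    fun e => hext fun F x => ?_, fun e => hext fun F x => ?_, fun e => hext fun F x => ?_,
    fun e f => hext fun F x => ?_, hext fun F x => ?_⟩
  · rw [mul_apply, infGen_vert, infGen_vert]
    by_cases h : a = b
    · subst h; simp only [if_true, infGen_vert]; split_ifs <;> rfl
    · rw [if_neg h, LinearMap.zero_apply, Pi.zero_apply]
      split_ifs with h1 h2
      exacts [absurd (h1.symm.trans h2) h, rfl, rfl]
  · simp only [LinearMap.sum_apply, Finset.sum_apply, infGen_vert, Finset.sum_ite_eq,
      mem_univ, if_true]; rfl
  · rw [mul_apply, infGen_vert, infGen_out]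
    split_ifs with h1 h2 h2
    exacts [rfl, rfl, absurd (h2 ▸ rfl) h1, rfl]
  · rw [mul_apply, infGen_out, infGen_out, infGen_vert]
    split_ifs with h1 h2
    exacts [rfl, absurd ((x.2 0).symm.trans (h1 ▸ rfl)) h2, rfl]
  · rw [mul_apply, infGen_vert, infGen_inn]
    split_ifs with h1 h2 h2
    exacts [rfl, rfl, absurd h2.symm h1, rfl]
  · rw [mul_apply, infGen_inn, infGen_inn]
    split_ifs with h1
    exacts [if_pos rfl, rfl]
  · rw [mul_apply, infGen_inn]
    by_cases h : e = f
    · subst h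
      rw [if_pos rfl, infGen_vert]
      split_ifs with h1 h2 h2
      exacts [if_pos rfl, absurd h1.symm h2, absurd h2.symm h1, rfl]
    · rw [if_neg h]
      split_ifs
      exacts [if_neg h, rfl]
  · simp only [LinearMap.sum_apply, Finset.sum_apply, mul_apply, infGen_out,
      Finset.sum_ite_eq, mem_univ, if_true]
    rw [infGen_inn, dif_pos (x.2 0)]
    exact congrArg F (Subtype.ext (funext fun i => by cases i <;> rfl))

/-- In a quiver without sinks, each vertex is the start of an infinite path. -/
lemma exists_infPath (no_sinks : ∀ a : V, ∃ b : V, Nonempty (a ⟶ b)) (a : V) :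
    ∃ x : InfPath V, (x.1 0).left = a := by
  choose t ht using no_sinks
  exact ⟨⟨fun i => ⟨t^[i] a, t (t^[i] a), (ht _).some⟩,
    fun i => (Function.iterate_succ_apply' t i a).symm⟩, rfl⟩

lemma vert_ne_zero (no_sinks : ∀ a : V, ∃ b : V, Nonempty (a ⟶ b)) (a : V) : 𝔳 a ≠ 0 := fun h => by
  obtain ⟨x, hx⟩ := exists_infPath no_sinks a
  have h1 := congrArg (fun z => lift infGen infGen_family z (fun _ => (1 : k)) x) h
  simp [lift_gen, infGen_vert, hx] at h1

end Nonzero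

/-! ### Paths in the Leavitt algebra -/

section Paths

lemma vert_out_ite (a : V) (e : 𝐐) : 𝔳 a * 𝔬 e = if a = e.left then 𝔬 e else 0 := by
  rw [← (family k).vert_out, ← mul_assoc, (family k).vert_mul]
  split_ifs with h <;> simp [h]

lemma out_vert_ite (a : V) (e : 𝐐) : 𝔬 e * 𝔳 a = if e.right = a then 𝔬 e else 0 := by
  rw [← (family k).out_vert, mul_assoc, (family k).vert_mul]
  split_ifs <;> simp

lemma vert_inn_ite (a : V) (e : 𝐐) : 𝔳 a * 𝔦 e = if a = e.right then 𝔦 e else 0 := by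
  rw [← (family k).vert_inn, ← mul_assoc, (family k).vert_mul]
  split_ifs with h <;> simp [h]

lemma inn_vert_ite (a : V) (e : 𝐐) : 𝔦 e * 𝔳 a = if e.left = a then 𝔦 e else 0 := by
  rw [← (family k).inn_vert, mul_assoc, (family k).vert_mul]
  split_ifs <;> simp

lemma vert_mul_self (a : V) : 𝔳 a * 𝔳 a = 𝔳 a := by rw [(family k).vert_mul, if_pos rfl]

variable (k) in
/-- A path as a product of ghost arrows. -/
def pout {a b : V} (p : Path a b) : 𝐋 := 𝔳 a * outL k (arrows p)

variable (k) in
/-- A path as a product of arrows. -/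
def pin {a b : V} (p : Path a b) : 𝐋 := 𝔳 b * innL k (arrows p)

@[simp] lemma pout_nil (a : V) : pout k (.nil : Path a a) = 𝔳 a := mul_one _

@[simp] lemma pin_nil (a : V) : pin k (.nil : Path a a) = 𝔳 a := mul_one _

@[simp] lemma pout_cons {a b c : V} (p : Path a b) (e : b ⟶ c) :
    pout k (p.cons e) = pout k p * gen k (.out ⟨_, _, e⟩) := by
  simp [pout, arrows, mul_assoc]

@[simp] lemma pin_cons {a b c : V} (p : Path a b) (e : b ⟶ c) :
    pin k (p.cons e) = gen k (.inn ⟨_, _, e⟩) * pin k p := by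
  simp [pin, arrows, ← mul_assoc, vert_inn_ite, inn_vert_ite]

lemma vert_pout {a b : V} (p : Path a b) : 𝔳 a * pout k p = pout k p := by
  rw [pout, ← mul_assoc, vert_mul_self]

lemma pout_vert {a b : V} (p : Path a b) : pout k p * 𝔳 b = pout k p := by
  cases p with
  | nil => rw [pout_nil, vert_mul_self]
  | cons p e => rw [pout_cons, mul_assoc, out_vert_ite, if_pos rfl]

lemma vert_pin {a b : V} (p : Path a b) : 𝔳 b * pin k p = pin k p := by
  rw [pin, ← mul_assoc, vert_mul_self]

lemma pin_vert {a b : V} (p : Path a b) : pin k p * 𝔳 a = pin k p := by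
  induction p with
  | nil => rw [pin_nil, vert_mul_self]
  | cons p e ih => rw [pin_cons, mul_assoc, ih]

lemma pout_comp {a b c : V} (e : a ⟶ b) (p : Path b c) :
    pout k (e.toPath.comp p) = gen k (.out ⟨_, _, e⟩) * pout k p := by
  induction p with
  | nil => simp [Quiver.Hom.toPath, vert_out_ite, out_vert_ite]
  | cons p f ih => rw [Path.comp_cons, pout_cons, ih, pout_cons, mul_assoc]

lemma pin_comp {a b c : V} (e : a ⟶ b) (p : Path b c) :
    pin k (e.toPath.comp p) = pin k p * gen k (.inn ⟨_, _, e⟩) := by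
  induction p with
  | nil => simp [Quiver.Hom.toPath, vert_inn_ite, inn_vert_ite]
  | cons p f ih => rw [Path.comp_cons, pin_cons, ih, pin_cons, mul_assoc]

/-- Paths of the same length are dual to each other. -/
lemma pin_mul_pout {a b a' b' : V} (p : Path a b) (p' : Path a' b')
    (h : p.length = p'.length) : pin k p * pout k p' =
      if (⟨a, b, p⟩ : TotalPath V) = ⟨a', b', p'⟩ then 𝔳 b else 0 := by
  induction p generalizing b' with
  | nil =>
    cases p' with
    | nil =>
      rw [pin_nil, pout_nil, (family k).vert_mul]
      exact if_congr ⟨fun h => h ▸ rfl, fun h => congrArg Sigma.fst h⟩ rfl rfl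
    | cons p' e' => exact absurd h (by simp)
  | @cons b c p e ih =>
    cases p' with
    | nil => exact absurd h (by simp)
    | @cons b' c' p' e' =>
      rw [pin_cons, pout_cons, mul_assoc, ← mul_assoc (pin k p), ih p' (by simpa using h)]
      by_cases h1 : (⟨a, b, p⟩ : TotalPath V) = ⟨a', b', p'⟩
      · cases h1
        rw [if_pos rfl, vert_out_ite, if_pos rfl, (family k).inn_out]
        exact if_congr ⟨fun h => by cases h; rfl, fun h => by cases h; rfl⟩ rfl rfl
      · rw [if_neg h1, zero_mul, mul_zero, if_neg]
        rintro ⟨⟩; exact h1 rfl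

lemma sum_out_inn_vert (a : V) :
    ∑ b : V, ∑ e : (a ⟶ b), gen k (.out ⟨_, _, e⟩) * gen k (.inn ⟨_, _, e⟩) = 𝔳 a := by
  have h := congrArg (fun x => 𝔳 a * x) (family k (V := V)).sum_out_inn
  simp only [mul_one, mul_sum] at h
  refine Eq.trans (Eq.symm ?_) h
  rw [sum_total, sum_eq_single a]
  · refine sum_congr rfl fun b _ => sum_congr rfl fun e _ => ?_
    rw [← mul_assoc, vert_out_ite, if_pos rfl]
  · intro c _ hc
    refine sum_eq_zero fun b _ => sum_eq_zero fun e _ => ?_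
    rw [← mul_assoc, vert_out_ite, if_neg hc.symm, zero_mul]
  · simp

variable (k) in
/-- The element of the Leavitt algebra given by a parallel path. -/
def parVal (z : ParPath V) : 𝐋 := pout k z.bot * pin k z.top

lemma val_word (z : ParPath V) : val k (word z) = parVal k z := by
  rw [parVal, pin, ← mul_assoc, pout_vert]
  simp [word, pout, outL, innL, mul_assoc]

lemma sum_parVal_post (z : ParPath V) :
    ∑ c : V, ∑ a : (z.tgt ⟶ c), parVal k (z.post a) = parVal k z := by
  have (c : V) (a : z.tgt ⟶ c) : parVal k (z.post a) = pout k z.bot *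
      ((gen k (.out ⟨_, _, a⟩) * gen k (.inn ⟨_, _, a⟩)) * pin k z.top) := by
    simp [parVal, ParPath.post, mul_assoc]
  simp only [this, ← mul_sum, ← sum_mul]
  rw [sum_out_inn_vert, vert_pin, parVal]

lemma vert_parVal (z : ParPath V) (a : V) :
    𝔳 a * parVal k z = if a = z.src then parVal k z else 0 := by
  rw [parVal, ← vert_pout, ← mul_assoc, ← mul_assoc, (family k).vert_mul]
  split_ifs with h <;> simp [h]

lemma parVal_vert (z : ParPath V) (a : V) : parVal k z * 𝔳 a =
    if a = z.src then parVal k z else 0 := by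
  rw [parVal, ← pin_vert, mul_assoc, mul_assoc, (family k).vert_mul]
  by_cases h : a = z.src
  · rw [if_pos h, if_pos h.symm]
  · rw [if_neg h, if_neg (Ne.symm h), mul_zero, mul_zero]

lemma parVal_mem_diag (z : ParPath V) : parVal k z ∈ 𝐃 :=
  mem_diag.2 fun a => by rw [vert_parVal, parVal_vert]

lemma sum_parVal_pre (z : ParPath V) :
    ∑ c : V, ∑ b : (c ⟶ z.src), parVal k (z.pre b) = 𝔰 (parVal k z) := by
  rw [shift_apply, sum_total]
  refine sum_congr rfl fun c _ => ?_
  rw [sum_eq_single z.src]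
  · refine sum_congr rfl fun b _ => ?_
    simp only [parVal, ParPath.pre, pout_comp, pin_comp, mul_assoc]
  · intro d _ hd
    refine sum_eq_zero fun e _ => ?_
    rw [← mul_assoc, ← out_vert_ite d ⟨c, d, e⟩ |>.trans (if_pos rfl), mul_assoc (gen k _),
      vert_parVal, if_neg hd, mul_zero, zero_mul]
  · simp

lemma length_arrows {a b : V} (p : Path a b) : (arrows p).length = p.length := by
  induction p with
  | nil => rfl
  | cons p e ih => simp [arrows, ih]

lemma vert_mul_mem_typ {m p : ℕ} {x : 𝐋} (hx : x ∈ typ k V m p) (b : V) :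
    𝔳 b * x ∈ typ k V m p := by
  induction hx using span_induction with
  | mem x hx =>
    obtain ⟨D, U, a, rfl, rfl, rfl⟩ := hx
    have hx : outL k D * (𝔳 a * innL k U) ∈ typ k V U.length D.length :=
      subset_span ⟨D, U, a, rfl, rfl, rfl⟩
    cases D with
    | nil =>
      rw [outL_nil, one_mul, ← mul_assoc, (family k).vert_mul]
      split_ifs with h
      · subst h; rwa [outL_nil, one_mul] at hx
      · simp
    | cons e D =>
      rw [outL_cons, mul_assoc, ← mul_assoc, vert_out_ite]
      split_ifs
      · rwa [outL_cons, mul_assoc] at hx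
      · simp
  | smul => simp_all [add_mem, smul_mem]
  | _ => simp_all [add_mem, mul_add, add_mul]

lemma pout_mul_pin_mem_typ {a b c : V} (p : Path a b) (q : Path c b) :
    pout k p * pin k q ∈ typ k V q.length p.length := by
  rw [pout, mul_assoc]
  exact vert_mul_mem_typ
    (subset_span ⟨arrows p, arrows q, b, length_arrows p, length_arrows q, rfl⟩) a

lemma pout_mul_pin_mem_deg {a b c : V} (p : Path a b) (q : Path c b) :
    pout k p * pin k q ∈ deg k V ((q.length : ℤ) - p.length) := by
  have h := mul_mem_deg (mul_mem_deg (gen_mem_deg (k := k) (.vert a)) (outL_mem_deg (arrows p)))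
    (mul_mem_deg (gen_mem_deg (k := k) (.vert b)) (innL_mem_deg (arrows q)))
  rw [pout, pin]
  convert h using 2
  simp [length_arrows, ldeg]; ring

lemma parVal_mem_deg (z : ParPath V) :
    parVal k z ∈ deg k V ((z.top.length : ℤ) - z.bot.length) := pout_mul_pin_mem_deg _ _

end Paths

/-! ### Parallel paths and the diagonal of the Leavitt algebra -/

section Span

/-- The Leavitt algebra is spanned by the elements `β₁* ⋯ β_p* α_m ⋯ α₁`. -/
lemma iSup_typ : ⨆ i : ℕ × ℕ, typ k V i.1 i.2 = ⊤ := by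
  set S := ⨆ i : ℕ × ℕ, typ k V i.1 i.2 with hS
  have hmem (D U : List 𝐐) (a : V) : outL k D * (𝔳 a * innL k U) ∈ S :=
    mem_iSup_of_mem (U.length, D.length) (subset_span ⟨D, U, a, rfl, rfl, rfl⟩)
  have hv (b) (D U : List 𝐐) (a : V) : 𝔳 b * (outL k D * (𝔳 a * innL k U)) ∈ S :=
    mem_iSup_of_mem (U.length, D.length)
      (vert_mul_mem_typ (subset_span ⟨D, U, a, rfl, rfl, rfl⟩) b)
  have hg (g s) (hs : s ∈ S) : gen k g * s ∈ S := by
    induction hs using Submodule.iSup_induction' with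
    | mem i s hs =>
      induction hs using span_induction with
      | mem s hs =>
        obtain ⟨D, U, a, -, -, rfl⟩ := hs
        cases g with
        | vert b => exact hv b D U a
        | out e =>
          have := hmem (e :: D) U a
          rwa [outL_cons, mul_assoc] at this
        | inn e =>
          cases D with
          | nil =>
            rw [outL_nil, one_mul, ← mul_assoc, inn_vert_ite]
            split_ifs with h
            · have := hmem [] (U ++ [e]) e.right
              rwa [outL_nil, one_mul, innL_append, innL_cons, innL_nil, one_mul, ← mul_assoc,
                vert_inn_ite, if_pos rfl] at this
            · simp
          | cons f D =>
            rw [outL_cons, mul_assoc, ← mul_assoc, (family k).inn_out]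
            split_ifs with h
            · exact hv _ D U a
            · simp
      | zero => simp
      | add x y _ _ hx hy => rw [mul_add]; exact add_mem hx hy
      | smul r x _ hx => rw [mul_smul_comm]; exact smul_mem _ _ hx
    | zero => simp
    | add x y _ _ hx hy => rw [mul_add]; exact add_mem hx hy
  have hm (x : 𝐋) : ∀ s ∈ S, x * s ∈ S := by
    induction x using induction with
    | hg g => exact hg g
    | ha c => exact fun s hs => Algebra.smul_def c s ▸ smul_mem _ _ hs
    | hm x y hx hy => exact fun s hs => by rw [mul_assoc]; exact hx _ (hy _ hs)
    | hs x y hx hy => exact fun s hs => by rw [add_mul]; exact add_mem (hx _ hs) (hy _ hs)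
  refine eq_top_iff.2 fun x _ => ?_
  rw [← mul_one x, ← (family k).sum_vert]
  refine hm x _ (sum_mem fun a _ => ?_)
  simpa using hmem [] [] a

lemma vert_outL_vert (a b : V) (D : List 𝐐) :
    𝔳 a * outL k D * 𝔳 b = 0 ∨ ∃ p : Path a b, arrows p = D := by
  induction D using List.reverseRecOn generalizing b with
  | nil =>
    rw [outL_nil, mul_one, (family k).vert_mul]
    by_cases h : a = b
    exacts [.inr (h ▸ ⟨.nil, rfl⟩), .inl (if_neg h)]
  | append_singleton D e ih =>
    rw [outL_append, outL_cons, outL_nil, mul_one, mul_assoc, mul_assoc, out_vert_ite]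
    by_cases h : e.right = b
    · subst h
      rcases ih e.left with h | ⟨p, hp⟩
      · exact .inl (by rw [if_pos rfl, ← (family k).vert_out, ← mul_assoc, ← mul_assoc, h, zero_mul])
      · exact .inr ⟨p.cons e.hom, by rw [arrows, hp]⟩
    · exact .inl (by rw [if_neg h, mul_zero, mul_zero])

lemma vert_innL_vert (a b : V) (U : List 𝐐) :
    𝔳 b * innL k U * 𝔳 a = 0 ∨ ∃ p : Path a b, arrows p = U := by
  induction U using List.reverseRecOn generalizing b with
  | nil =>
    rw [innL_nil, mul_one, (family k).vert_mul]
    by_cases h : b = a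
    exacts [.inr (h ▸ ⟨.nil, rfl⟩), .inl (if_neg h)]
  | append_singleton U e ih =>
    rw [innL_append, innL_cons, innL_nil, one_mul, ← mul_assoc, vert_inn_ite]
    by_cases h : b = e.right
    · subst h
      rcases ih e.left with h | ⟨p, hp⟩
      · left
        rw [mul_assoc] at h
        rw [if_pos rfl, ← (family k).inn_vert, mul_assoc, mul_assoc, h, mul_zero]
      · exact .inr ⟨p.cons e.hom, by rw [arrows, hp]⟩
    · exact .inl (by rw [if_neg h, zero_mul, zero_mul])

/-- A composable product of ghost arrows and arrows is a pair of paths. -/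
lemma vert_mul_mul_vert (a b c : V) (D U : List 𝐐) :
    𝔳 a * (outL k D * (𝔳 b * innL k U)) * 𝔳 c = 0 ∨
      ∃ (p : Path a b) (q : Path c b), arrows p = D ∧ arrows q = U ∧
        𝔳 a * (outL k D * (𝔳 b * innL k U)) * 𝔳 c = pout k p * pin k q := by
  have h0 : 𝔳 a * (outL k D * (𝔳 b * innL k U)) * 𝔳 c =
      (𝔳 a * outL k D * 𝔳 b) * (𝔳 b * innL k U * 𝔳 c) := by
    conv_lhs => rw [← vert_mul_self b]
    simp only [mul_assoc]
  rw [h0]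
  rcases vert_outL_vert (k := k) a b D with h | ⟨p, rfl⟩
  · exact .inl (by rw [h, zero_mul])
  rcases vert_innL_vert (k := k) c b U with h | ⟨q, rfl⟩
  · exact .inl (by rw [h, mul_zero])
  exact .inr ⟨p, q, rfl, rfl, by rw [← pout, pout_vert, ← pin, pin_vert]⟩

end Span

section Embedding

variable (k V) in
/-- The map from the colimit of the spaces of parallel paths to the Leavitt algebra. -/
def emb : C0 V k →ₗ[k] 𝐋 :=
  colimLift (fun m p => Finsupp.linearCombination k fun z : ParIdx V m p => parVal k z.1)
    fun m p x => by
      induction x using Finsupp.induction_linear with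
      | zero => simp
      | add x y hx hy => simp only [map_add, hx, hy]
      | single z r => simp [Comb.theta, map_sum, sum_parVal_post]

lemma emb_cl (m p : ℕ) (x : ParIdx V m p →₀ k) : emb k V (cl (Comb.theta (V := V) k) m p x) =
    Finsupp.linearCombination k (fun z : ParIdx V m p => parVal k z.1) x := colimLift_cl _ _ _ _ _

@[simp] lemma emb_cls (z : ParPath V) : emb k V (cls k z) = parVal k z := by
  rw [cls, emb_cl, Finsupp.linearCombination_single, one_smul]

lemma c0_induction {Q : C0 V k → Prop} (h0 : Q 0) (h1 : ∀ z, Q (cls k z))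
    (h2 : ∀ a b, Q a → Q b → Q (a + b)) (h3 : ∀ (r : k) a, Q a → Q (r • a)) (x) : Q x := by
  induction x using colim_induction with
  | h0 => exact h0
  | h2 a b ha hb => exact h2 a b ha hb
  | h1 m p x =>
    induction x using Finsupp.induction_linear with
    | zero => simpa
    | add x y hx hy => rw [map_add]; exact h2 _ _ hx hy
    | single z r =>
      obtain ⟨z, rfl, rfl⟩ := z
      rw [← mul_one r, ← smul_eq_mul, ← Finsupp.smul_single, map_smul]
      exact h3 _ _ (h1 z)

lemma emb_mem_diag (x : C0 V k) : emb k V x ∈ 𝐃 := by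
  induction x using c0_induction with
  | h0 => simp
  | h1 z => rw [emb_cls]; exact parVal_mem_diag z
  | h2 a b ha hb => rw [map_add]; exact add_mem ha hb
  | h3 r a ha => rw [map_smul]; exact Subalgebra.smul_mem _ ha r

lemma gradInd_deg : GradInd (deg k V) := fun s f hf h d hd => eq_zero_of_sum_eq_zero s f hf h d hd

lemma emb_mem_deg (n : ℤ) (x : C0 V k) (hx : x ∈ C0deg V k n) : emb k V x ∈ deg k V n := by
  obtain ⟨m, p, x, rfl, rfl⟩ := exists_of_mem_piece hx
  rw [emb_cl]
  refine sum_mem fun z _ => smul_mem _ _ ?_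
  obtain ⟨z, rfl, rfl⟩ := z
  exact parVal_mem_deg z

lemma diag_eq_sum {x : 𝐋} (hx : x ∈ 𝐃) : x = ∑ a : V, 𝔳 a * x * 𝔳 a := by
  conv_lhs => rw [← one_mul x, ← (family k).sum_vert, sum_mul]
  refine sum_congr rfl fun a _ => ?_
  rw [mem_diag.1 hx, mul_assoc, vert_mul_self]

lemma exists_emb {x : 𝐋} (hx : x ∈ 𝐃) : ∃ z, emb k V z = x := by
  suffices h : ∀ (a : V) (x : 𝐋), 𝔳 a * x * 𝔳 a ∈ (emb k V).range by
    rw [diag_eq_sum hx]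
    exact sum_mem fun a _ => h a x
  intro a x
  have hx : x ∈ ⨆ i : ℕ × ℕ, typ k V i.1 i.2 := iSup_typ (k := k) (V := V) ▸ Submodule.mem_top
  induction hx using Submodule.iSup_induction' with
  | mem i s hs =>
    induction hs using span_induction with
    | mem s hs =>
      obtain ⟨D, U, b, -, -, rfl⟩ := hs
      rcases vert_mul_mul_vert (k := k) a b a D U with h | ⟨p, q, -, -, h⟩
      · simp [h]
      · exact h ▸ ⟨cls k ⟨a, b, q, p⟩, emb_cls _⟩
    | zero => simp
    | add x y _ _ hx hy => rw [mul_add, add_mul]; exact add_mem hx hy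
    | smul r x _ hx => rw [mul_smul_comm, smul_mul_assoc]; exact smul_mem _ _ hx
  | zero => simp
  | add x y _ _ hx hy => rw [mul_add, add_mul]; exact add_mem hx hy

variable (no_sinks : ∀ a : V, ∃ b : V, Nonempty (a ⟶ b))

include no_sinks

/-- Parallel paths of fixed lengths are linearly independent in the Leavitt algebra. -/
lemma emb_eq_zero (n : ℤ) (x : C0 V k) (hx : x ∈ C0deg V k n) (h : emb k V x = 0) : x = 0 := by
  obtain ⟨m, p, x, rfl, rfl⟩ := exists_of_mem_piece hx
  rw [emb_cl] at h
  suffices x = 0 by rw [this, map_zero]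
  ext z
  have h1 := congrArg (fun y => pin k z.1.bot * (y * pout k z.1.top)) h
  simp only [zero_mul, mul_zero, Finsupp.linearCombination_apply, Finsupp.sum, sum_mul,
    mul_sum] at h1
  rw [sum_eq_single z] at h1
  · rw [smul_mul_assoc, mul_smul_comm, parVal, mul_assoc, ← mul_assoc, pin_mul_pout _ _ rfl,
      pin_mul_pout _ _ rfl, if_pos rfl, if_pos rfl, vert_mul_self] at h1
    exact (smul_eq_zero.1 h1).resolve_right (vert_ne_zero no_sinks _)
  · intro y _ hy
    rw [smul_mul_assoc, mul_smul_comm, parVal, mul_assoc, ← mul_assoc,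
      pin_mul_pout _ _ (z.2.2.trans y.2.2.symm), pin_mul_pout _ _ (y.2.1.trans z.2.1.symm)]
    split_ifs with h2 h3
    · refine absurd (Subtype.ext ?_) hy
      obtain ⟨⟨s, t, top, bot⟩, hz⟩ := z
      obtain ⟨⟨s', t', top', bot'⟩, hy⟩ := y
      dsimp only at h2 h3
      cases h2; cases h3; rfl
    all_goals simp
  · intro hz
    rw [Finsupp.notMem_support_iff.1 hz, zero_smul, zero_mul, mul_zero]

lemma emb_injective : Function.Injective (emb k V) :=
  injective_of_graded iSup_piece gradInd_deg emb_mem_deg (emb_eq_zero no_sinks)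

lemma mem_C0deg_iff (n : ℤ) (x : C0 V k) : x ∈ C0deg V k n ↔ emb k V x ∈ deg k V n :=
  mem_iff_of_graded iSup_piece gradInd_deg emb_mem_deg (emb_eq_zero no_sinks) n x

/-- The colimit of the spaces of parallel paths is the diagonal of the Leavitt algebra. -/
def embEquiv : C0 V k ≃ₗ[k] 𝐃 :=
  LinearEquiv.ofBijective
    (LinearMap.codRestrict (Subalgebra.toSubmodule 𝐃) (emb k V) emb_mem_diag)
    ⟨fun x y h => emb_injective no_sinks (congrArg Subtype.val h), fun x =>
      let ⟨z, hz⟩ := exists_emb x.2; ⟨z, Subtype.ext hz⟩⟩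

/-- The identification of the combinatorial complex with pairs of diagonal elements. -/
def combEquiv : Csg V k ≃ₗ[k] 𝐃 × 𝐃 := (embEquiv no_sinks).prodCongr (embEquiv no_sinks)

lemma combEquiv_fst (x : Csg V k) : ((combEquiv no_sinks x).1 : 𝐋) = emb k V x.1 := rfl
lemma combEquiv_snd (x : Csg V k) : ((combEquiv no_sinks x).2 : 𝐋) = emb k V x.2 := rfl

lemma mem_CsgDeg_iff (d : ℤ) (x : Csg V k) : x ∈ CsgDeg V k d ↔
    ((combEquiv no_sinks x).1 : 𝐋) ∈ deg k V d ∧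
      ((combEquiv no_sinks x).2 : 𝐋) ∈ deg k V (d - 1) :=
  and_congr (mem_C0deg_iff no_sinks d x.1) (mem_C0deg_iff no_sinks (d - 1) x.2)

end Embedding

section PairGrading

/-- Independence of the grading of pairs. -/
lemma gradInd_pair : GradInd (M := 𝐋 × 𝐋)
    (fun d => (deg k V d).prod (deg k V (d - 1))) := by
  intro s f hf h d hd
  refine Prod.ext ?_ ?_
  · exact gradInd_deg s (fun d => (f d).1) (fun d hd => (hf d hd).1)
      (by have := congrArg Prod.fst h; rwa [Prod.fst_sum] at this) d hd
  · have h1 := gradInd_deg (s.map ⟨fun d => d - 1, sub_left_injective⟩) (fun d => (f (d + 1)).2)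
      (fun d hd => ?_) ?_ (d - 1) (Finset.mem_map_of_mem _ hd)
    · simpa using h1
    · obtain ⟨c, hc, rfl⟩ := Finset.mem_map.1 hd
      simpa using (hf c hc).2
    · have := congrArg Prod.snd h
      rw [Prod.snd_sum] at this
      simpa [Finset.sum_map] using this

end PairGrading

/-! ### Ordered products over fibres -/

section Lists

lemma flatMap_filter_monotone {P b : ℕ} {l : Fin b → Fin P} (hl : Monotone l) :
    (finRange P).flatMap (fun j => (finRange b).filter fun r => l r = j) = finRange b := by
  have h1 : ((finRange P).flatMap
      fun j => (finRange b).filter fun r => l r = j).Pairwise (· < ·) := by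
    refine List.pairwise_flatMap.2 ⟨fun j _ => (List.pairwise_lt_finRange b).filter _, ?_⟩
    refine (List.pairwise_lt_finRange P).imp fun {j j'} h r hr s hs => ?_
    simp only [List.mem_filter, decide_eq_true_eq] at hr hs
    by_contra hsr
    have := hl (not_lt.1 hsr)
    rw [hr.2, hs.2] at this
    exact absurd h (not_lt.2 this)
  refine List.Perm.eq_of_pairwise (le := (· < ·)) (fun a b _ _ h h' => absurd h (lt_asymm h')) h1
    (List.pairwise_lt_finRange b) ?_
  exact (List.perm_ext_iff_of_nodup (h1.imp fun h => h.ne) (List.nodup_finRange b)).2 fun r => by simp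

lemma flatMap_filter_strictMono {P b : ℕ} {l : Fin b → Fin P} (hl : StrictMono l) :
    (finRange P).reverse.flatMap (fun j => (finRange b).filter fun r => l r = j) =
      (finRange b).reverse := by
  have h1 : ((finRange P).reverse.flatMap
      fun j => (finRange b).filter fun r => l r = j).Pairwise (· > ·) := by
    refine List.pairwise_flatMap.2 ⟨fun j _ => ?_, ?_⟩
    · refine ((List.pairwise_lt_finRange b).filter _).imp_of_mem fun {r s} hr hs h => ?_
      simp only [List.mem_filter, decide_eq_true_eq] at hr hs
      exact absurd (hl.injective (hr.2.trans hs.2.symm)) h.ne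
    · refine (List.pairwise_reverse.2 (List.pairwise_lt_finRange P)).imp fun {j j'} h r hr s hs => ?_
      simp only [List.mem_filter, decide_eq_true_eq] at hr hs
      rw [← hr.2, ← hs.2] at h
      exact hl.lt_iff_lt.1 h
  refine List.Perm.eq_of_pairwise (le := (· > ·)) (fun a b _ _ h h' => absurd h (lt_asymm h')) h1
    (List.pairwise_reverse.2 (List.pairwise_lt_finRange b)) ?_
  exact (List.perm_ext_iff_of_nodup (h1.imp fun h => h.ne')
    (List.nodup_reverse.2 (List.nodup_finRange b))).2 fun r => by simp

lemma prod_map_ite {M α : Type*} [Monoid M] (q : α → Prop) [DecidablePred q] (g : α → M) (L : List α) :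
    (L.map fun r => if q r then g r else 1).prod = ((L.filter fun r => q r).map g).prod := by
  induction L with
  | nil => rfl
  | cons r L ih => by_cases h : q r <;> simp [h, ih]

lemma prod_map_flatMap {M α β : Type*} [Monoid M] (f : α → List β) (g : β → M) (L : List α) :
    ((L.flatMap f).map g).prod = (L.map fun j => ((f j).map g).prod).prod := by
  induction L with
  | nil => rfl
  | cons r L ih => simp [ih]

lemma prod_fibres_monotone {M : Type*} [Monoid M] {P b : ℕ} {l : Fin b → Fin P} (hl : Monotone l)
    (g : Fin b → M) :
    ((finRange P).map fun j =>
      ((finRange b).map fun r => if l r = j then g r else 1).prod).prod = (ofFn g).prod := by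
  simp only [prod_map_ite]
  rw [← prod_map_flatMap, flatMap_filter_monotone hl, List.ofFn_eq_map]

lemma prod_fibres_strictMono {M : Type*} [Monoid M] {P b : ℕ} {l : Fin b → Fin P}
    (hl : StrictMono l) (g : Fin b → M) :
    ((finRange P).reverse.map fun j =>
      ((finRange b).map fun r => if l r = j then g r else 1).prod).prod =
      (ofFn g).reverse.prod := by
  simp only [prod_map_ite]
  rw [← prod_map_flatMap, flatMap_filter_strictMono hl, List.ofFn_eq_map, List.map_reverse]

end Lists

/-! ### The value of a sequence -/

section Words

lemma val_flatMap {α : Type*} (f : α → List (Letter V)) (L : List α) :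
    val k (L.flatMap f) = (L.map fun j => val k (f j)).prod := prod_map_flatMap f _ L

lemma shift_pow_list_prod (n : ℕ) (L : List 𝐋) (h : ∀ x ∈ L, x ∈ 𝐃) :
    (𝔰 ^ n) L.prod = (L.map (𝔰 ^ n)).prod := by
  induction L with
  | nil => exact shift_pow_one n
  | cons x L ih =>
    rw [prod_cons, shift_pow_mul (h x mem_cons_self), ih fun y hy =>
      h y (mem_cons_of_mem _ hy), map_cons, prod_cons]

lemma prod_shift_mem_diag {n : ℕ} (L : List (Fin n)) {W : Fin n → 𝐋} (hW : ∀ j, W j ∈ 𝐃) :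
    (L.map fun j : Fin n => (𝔰 ^ (j : ℕ)) (W j)).prod ∈ 𝐃 :=
  list_prod_mem fun x hx => by
    obtain ⟨j, -, rfl⟩ := List.mem_map.1 hx
    exact shift_pow_mem_diag (hW _) _

lemma prod_shift_succ {n : ℕ} (L : List (Fin n)) {W : Fin n → 𝐋} (hW : ∀ j, W j ∈ 𝐃) :
    (L.map fun j : Fin n => (𝔰 ^ ((j : ℕ) + 1)) (W j)).prod =
      𝔰 (L.map fun j : Fin n => (𝔰 ^ (j : ℕ)) (W j)).prod := by
  induction L with
  | nil => exact shift_one.symm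
  | cons j L ih =>
    rw [map_cons, map_cons, prod_cons, prod_cons, ih,
      shift_mul _ (shift_pow_mem_diag (hW j) _), pow_succ', mul_apply]

lemma prod_mul_out (D : List 𝐐) (W : Fin D.length → 𝐋) (hW : ∀ j, W j ∈ 𝐃) :
    ((finRange D.length).map fun j => W j * 𝔬 (D.get j)).prod =
      ((finRange D.length).map fun j : Fin D.length => (𝔰 ^ (j : ℕ)) (W j)).prod * outL k D := by
  induction D with
  | nil => simp
  | cons e D ih =>
    have h1 : ((finRange D.length).map fun j : Fin D.length =>
        W j.succ * gen k (.out ((e :: D).get j.succ))).prod = _ :=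
      ih (fun j => W j.succ) fun j => hW _
    simp only [length_cons, List.finRange_succ, map_cons, List.map_map, prod_cons,
      Function.comp_def, Fin.val_zero, pow_zero, Module.End.one_apply, Fin.val_succ,
      outL_cons]
    rw [h1, prod_shift_succ _ fun j => hW _, mul_assoc, mul_assoc (W _), ← mul_assoc (𝔰 _),
      shift_mul_out (prod_shift_mem_diag _ fun j => hW _)]
    simp [mul_assoc]

lemma prod_inn_mul (U : List 𝐐) (W : Fin U.length → 𝐋) (hW : ∀ j, W j ∈ 𝐃) :
    ((finRange U.length).reverse.map fun j => 𝔦 (U.get j) * W j).prod =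
      innL k U * ((finRange U.length).reverse.map
        fun j : Fin U.length => (𝔰 ^ (j : ℕ)) (W j)).prod := by
  induction U with
  | nil => simp
  | cons e U ih =>
    have h1 : ((finRange U.length).reverse.map fun j : Fin U.length =>
        gen k (.inn ((e :: U).get j.succ)) * W j.succ).prod = _ :=
      ih (fun j => W j.succ) fun j => hW _
    simp only [length_cons, List.finRange_succ, List.reverse_cons, map_append,
      List.prod_append, map_cons, List.map_nil, List.prod_singleton, ← List.map_reverse,
      List.map_map, Function.comp_def, Fin.val_zero, pow_zero, Module.End.one_apply, Fin.val_succ,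
      innL_cons]
    rw [h1, prod_shift_succ _ fun j => hW _, mul_assoc, ← mul_assoc _ _ (W _),
      ← inn_mul_shift (prod_shift_mem_diag _ fun j => hW _)]
    simp [mul_assoc]

/-- The value of a composable sequence of letters is the reduced sequence. -/
lemma reduce_val (w : List (Letter V)) (outs ins : List 𝐐) {c d : V}
    (h : walk c w = some d) :
    outL k outs * innL k ins * 𝔳 c * val k w = match reduce outs ins w with
      | none => 0
      | some r => outL k r.1 * innL k r.2 * 𝔳 d := by
  induction w generalizing outs ins c with
  | nil =>
    rw [walk, Option.some.injEq] at h
    simp [h, reduce]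
  | cons x w ih =>
    cases x with
    | vert b =>
      rw [walk] at h; split_ifs at h with hb; subst hb
      rw [reduce, ← ih outs ins h, val_cons, ← mul_assoc, mul_assoc _ _ (gen k _), vert_mul_self]
    | out e =>
      rw [walk] at h; split_ifs at h with hb; subst hb
      rw [val_cons, ← mul_assoc, mul_assoc _ _ (gen k _), (family k).vert_out]
      cases ins with
      | nil =>
        rw [reduce, ← ih _ _ h]
        simp only [innL_nil, mul_one, outL_append, outL_cons, outL_nil]
        rw [mul_assoc (outL k outs) _ (𝔳 _), (family k).out_vert]
      | cons f ins =>
        rw [reduce, innL_cons, mul_assoc _ _ (𝔬 e), mul_assoc _ _ (𝔬 e),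
          (family k).inn_out]
        split_ifs with hf
        · subst hf
          rw [← ih _ _ h, ← mul_assoc]
        · simp
    | inn e =>
      rw [walk] at h; split_ifs at h with hb; subst hb
      rw [reduce, ← ih _ _ h, val_cons, ← mul_assoc, mul_assoc _ _ (gen k _), (family k).vert_inn,
        innL_cons, mul_assoc _ _ (𝔳 e.left), mul_assoc _ _ (𝔳 e.left),
        (family k).inn_vert]
      simp [mul_assoc]

lemma vert_mul_val (w : List (Letter V)) (c : V) : 𝔳 c * val k w =
    match walk c w with
    | none => 0
    | some d => 𝔳 c * val k w * 𝔳 d := by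
  induction w generalizing c with
  | nil => simp [walk, vert_mul_self]
  | cons x w ih =>
    cases x with
    | vert b =>
      rw [walk, val_cons, ← mul_assoc, (family k).vert_mul]
      split_ifs with hb
      · exact hb ▸ ih c
      · simp
    | out e =>
      rw [walk, val_cons, ← mul_assoc, vert_out_ite]
      split_ifs with hb
      · rw [← (family k).out_vert, mul_assoc (gen k _), ih]
        cases walk e.right w with
        | none => simp
        | some d => simp only [mul_assoc, vert_mul_self]
      · simp
    | inn e =>
      rw [walk, val_cons, ← mul_assoc, vert_inn_ite]
      split_ifs with hb
      · rw [← (family k).inn_vert, mul_assoc (gen k _), ih]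
        cases walk e.left w with
        | none => simp
        | some d => simp only [mul_assoc, vert_mul_self]
      · simp

lemma emb_wordCls (a : V) (w : List (Letter V)) :
    emb k V (wordCls k a w) = 𝔳 a * val k w * 𝔳 a := by
  by_cases hw : walk a w = some a
  · have h1 := reduce_val (k := k) w [] [] hw
    rw [outL_nil, innL_nil, mul_one, one_mul] at h1
    have h1' : 𝔳 a * val k w * 𝔳 a = 𝔳 a * val k w := by
      have := vert_mul_val (k := k) w a
      rw [hw] at this; exact this.symm
    rw [h1', wordCls]
    cases hr : reduce [] [] w with
    | none => rw [h1, hr]; exact map_zero _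
    | some r =>
      rw [hr] at h1
      dsimp only at h1 ⊢
      have h2 : 𝔳 a * val k w = ∑ b : V, 𝔳 a * (outL k r.1 * (𝔳 b * innL k r.2)) * 𝔳 a := by
        conv_lhs => rw [← vert_mul_self, mul_assoc, h1]
        simp only [← sum_mul, ← mul_sum, (family k).sum_vert, one_mul, mul_assoc]
      split_ifs with h
      · have hz := h.2.choose_spec
        rw [emb_cls]
        generalize h.2.choose = z at hz ⊢
        obtain ⟨⟨s, t, top, bot⟩, hs⟩ : ∃ z', z' = z := ⟨z, rfl⟩
        subst hs
        obtain ⟨rfl, hz2, hz3⟩ := hz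
        dsimp only at hz2 hz3
        rw [← vert_mul_self, mul_assoc, h1, ← hz2, ← hz3, parVal, ← mul_assoc, ← mul_assoc, ← pout, ← pout_vert, mul_assoc _ _ (innL k _), ← pin,
          mul_assoc, vert_pin, mul_assoc, pin_vert]
      · rw [map_zero, h2, sum_eq_zero]
        intro b _
        rcases vert_mul_mul_vert (k := k) a b a r.1 r.2 with h3 | ⟨p, q, hp, hq, h3⟩
        exacts [h3, absurd ⟨hw, ⟨a, b, q, p⟩, rfl, hp, hq⟩ h]
  · have h1 : 𝔳 a * val k w * 𝔳 a = 0 := by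
      rw [vert_mul_val]
      cases hd : walk a w with
      | none => exact zero_mul _
      | some d =>
        dsimp only
        rw [mul_assoc, (family k).vert_mul, if_neg, mul_zero]
        rintro rfl; exact hw hd
    rw [h1, wordCls]
    cases reduce [] [] w with
    | none => exact map_zero _
    | some r =>
      dsimp only
      rw [dif_neg fun h => hw h.1, map_zero]

end Words

/-! ### Braces of the model -/

section Brace

variable {A : Type*} [AddCommGroup A] [Module k A] {𝒜 : ℤ → Submodule k A} {O : Ops k A}
  {e : A ≃ₗ[k] diag k V × diag k V}

lemma omg_ofFn {n : ℕ} (d : Fin n → ℤ) :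
    omg (ofFn d) = ∑ i : Fin n, ((n : ℤ) - ((i : ℕ) + 1 : ℤ)) * d i := by
  induction n with
  | zero => simp
  | succ n ih =>
    rw [ofFn_succ, omg_cons, ih, Fin.sum_univ_succ, List.length_ofFn]; simp

lemma map_toY_ofFn {n : ℕ} (dc : Fin n → ℤ) (c : Fin n → A) :
    (ofFn fun i => (dc i, c i)).map (toY e) = ofFn fun i => (dc i - 1, (e (c i)).2) := map_ofFn ..

lemma brace_sign {n : ℕ} (d : ℤ) (dc : Fin n → ℤ) (c : Fin n → A) :
    ε (n * d + ∑ i : Fin n, ((n : ℤ) - ((i : ℕ) + 1 : ℤ)) * dc i) *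
      ε (muExp d (ofFn fun i => (dc i, c i))) = ε (d * ∑ r, (dc r - 1)) := by
  rw [← ksign_add, muExp, map_ofFn]
  simp only [Function.comp_def, wdeg, map_ofFn, List.sum_ofFn, omg_ofFn]
  refine ksign_congr ?_
  rw [sum_sub_distrib, Finset.sum_const, Finset.card_univ, Fintype.card_fin, nsmul_eq_mul]
  push_cast; grind

lemma IsModel.brace_fst (hO : IsModel 𝒜 e O) {m n : ℕ} {x : A} (hx : x ∈ 𝒜 ((m : ℤ) - n))
    (ht : ((e x).1 : 𝐋) ∈ typ k V m n) {N : ℕ} (dc : Fin N → ℤ) (c : Fin N → A)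
    (hc : ∀ r, c r ∈ 𝒜 (dc r)) :
    ((e (O.brace ((m : ℤ) - n) dc x c)).1 : 𝐋) =
      ∑ b : Fin (N + 1), ∑ l : Fin b → Fin n with Monotone l,
        ∑ i : Fin (N - b) → Fin m with StrictMono i,
          ε (insExp (fun r => dc r - 1) m n b (fun r => l r) fun r => i r) •
            insVal (fun r => ((e (c r)).2 : 𝐋)) (e x).1 b (fun r => l r) fun r => i r := by
  have h := phi_ofFn (p := Prod.fst) (y := Prod.snd) ht fun r => (dc r - 1, (e (c r)).2)
  rw [← h, Ops.brace, map_smul, Prod.smul_fst, Subalgebra.coe_smul, ← vec_one fun _ => x,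
    hO.mu_fst N _ x dc c hx hc, smul_smul, brace_sign, Phi, map_toY_ofFn]

lemma IsModel.brace_snd (hO : IsModel 𝒜 e O) {m n : ℕ} {x : A} (hx : x ∈ 𝒜 ((m : ℤ) - n))
    (ht : ((e x).2 : 𝐋) ∈ typ k V m (n + 1)) {N : ℕ} (dc : Fin N → ℤ) (c : Fin N → A)
    (hc : ∀ r, c r ∈ 𝒜 (dc r)) :
    ((e (O.brace ((m : ℤ) - n) dc x c)).2 : 𝐋) =
      ∑ b : Fin (N + 1), ∑ l : Fin b → Fin n with Monotone l,
        ∑ i : Fin (N - b) → Fin m with StrictMono i,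
          ε (insExp (fun r => dc r - 1) m n b (fun r => l r) fun r => i r) •
            insVal (fun r => ((e (c r)).2 : 𝐋)) (e x).2 b (fun r => l r + 1) fun r => i r := by
  have h := psi_ofFn (p := Prod.fst) (y := Prod.snd) ht fun r => (dc r - 1, (e (c r)).2)
  rw [← h, Ops.brace, map_smul, Prod.smul_snd, Subalgebra.coe_smul, ← vec_one fun _ => x,
    hO.mu_snd N _ x dc c hx hc, smul_smul, add_assoc, ksign_add (muExp _ _), ← mul_assoc,
    brace_sign, ← ksign_add, Psi, map_toY_ofFn]
  refine congrArg₂ _ (ksign_congr ?_) rfl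
  rw [sum_sub_distrib, Finset.sum_const, Finset.card_univ, Fintype.card_fin, nsmul_eq_mul]
  push_cast; grind

lemma insVal_zero {N : ℕ} (z : Fin N → 𝐋) (b : Fin (N + 1)) (l : Fin b → ℕ)
    (i : Fin (N - b) → ℕ) : insVal z 0 b l i = 0 := by simp [insVal]

/-- Operations which are determined on spanning sets. -/
lemma multilinear_ext_span {N : Type*} [AddCommGroup N] [Module k N] {S : Set A}
    (hS : span k S = ⊤) {n : ℕ} {f g : MultilinearMap k (fun _ : Fin n => A) N}
    (h : ∀ a : Fin n → A, (∀ i, a i ∈ S) → f a = g a) : f = g := by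
  suffices H : ∀ s : Finset (Fin n), ∀ a : Fin n → A, (∀ i ∉ s, a i ∈ S) → f a = g a by
    exact MultilinearMap.ext fun a => H Finset.univ a fun i hi => absurd (mem_univ i) hi
  intro s
  induction s using Finset.induction_on with
  | empty => exact fun a ha => h a fun i => ha i (Finset.notMem_empty i)
  | insert j s hj ih =>
    intro a ha
    have key : ∀ x ∈ span k S, f (Function.update a j x) = g (Function.update a j x) := by
      intro x hx
      induction hx using span_induction with
      | mem x hx => grind
      | zero => simp
      | add x y _ _ hx hy => simp [hx, hy]
      | smul r x _ hx => simp [hx]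
    have := key (a j) (hS ▸ Submodule.mem_top)
    rwa [Function.update_eq_self] at this

/-- A brace `B_∞`-algebra is determined by its differential, its product and its braces on
spanning sets. -/
lemma brace_ext {B B' : BInfty 𝒜} (hB : B.IsBrace) (hB' : B'.IsBrace) {S T : Set A}
    (hS : span k S = ⊤) (hT : span k T = ⊤)
    (h1 : ∀ a ∈ S, B.m 1 ![a] = B'.m 1 ![a])
    (h2 : ∀ a ∈ S, ∀ b ∈ S, B.m 2 ![a, b] = B'.m 2 ![a, b])
    (hmu : ∀ n, n ≠ 0 → ∀ a ∈ S, ∀ b : Fin n → A, (∀ i, b i ∈ T) →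
      B.mu 1 n ![a] b = B'.mu 1 n ![a] b) : B = B' := by
  refine BInfty.ext_ops ?_
  have hm : B.m = B'.m := by
    funext n
    rcases Nat.lt_or_ge 2 n with h | h
    · rw [hB.1 n h, hB'.1 n h]
    interval_cases n
    · rw [B.m_zero, B'.m_zero]
    · exact multilinear_ext_span hS fun a ha => vec_one a ▸ h1 _ (ha 0)
    · refine multilinear_ext_span hS fun a ha => ?_
      rw [show a = ![a 0, a 1] by funext i; fin_cases i <;> rfl]
      exact h2 _ (ha 0) _ (ha 1)
  have hmu : B.mu = B'.mu := by
    funext p q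
    rcases Nat.lt_or_ge 1 p with h | h
    · rw [hB.2 p q h, hB'.2 p q h]
    interval_cases p
    · by_cases hq : q = 1
      · subst hq
        ext a b
        rw [B.mu_zero_one, B'.mu_zero_one]
      · rw [B.mu_right_zero q hq, B'.mu_right_zero q hq]
    · by_cases hq : q = 0
      · subst hq
        ext a b
        rw [B.mu_one_zero, B'.mu_one_zero]
      · exact multilinear_ext_span hS fun a ha => multilinear_ext_span hT fun b hb =>
          vec_one a ▸ hmu q hq _ (ha 0) b hb
  change (⟨B.m, B.mu⟩ : Ops k A) = ⟨B'.m, B'.mu⟩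
  rw [hm, hmu]

end Brace

/-! ### The combinatorial operations -/

section Combinatorial

lemma val_map_out (D : List 𝐐) : val k (D.map .out) = outL k D := rfl
lemma val_map_inn (U : List 𝐐) : val k (U.reverse.map .inn) = innL k U := rfl

lemma arrows_comp {a b c : V} (e : a ⟶ b) (p : Path b c) :
    arrows (e.toPath.comp p) = ⟨_, _, e⟩ :: arrows p := by
  induction p with
  | nil => rfl
  | cons p f ih => rw [Path.comp_cons, arrows, ih, arrows]; rfl

lemma val_ite_word {n : ℕ} {P : ℕ} (l : Fin n → Fin P) (y : Fin n → ParPath V) (j : Fin P) :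
    val k ((finRange n).flatMap fun r => if l r = j then word (y r) else []) =
      ((finRange n).map fun r => if l r = j then parVal k (y r) else 1).prod := by
  rw [val_flatMap]
  congr 2; funext r; split_ifs
  exacts [val_word _, rfl]

lemma prod_ite_mem_diag {n : ℕ} {P : ℕ} (l : Fin n → Fin P) (y : Fin n → ParPath V) (j : Fin P) :
    ((finRange n).map fun r => if l r = j then parVal k (y r) else 1).prod ∈ 𝐃 := by
  refine list_prod_mem fun x hx => ?_
  obtain ⟨r, -, rfl⟩ := List.mem_map.1 hx
  split_ifs
  exacts [parVal_mem_diag _, one_mem _]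

lemma shift_pow_prod_ite {n : ℕ} {P : ℕ} (l : Fin n → Fin P) (y : Fin n → ParPath V) (j : Fin P) :
    (𝔰 ^ (j : ℕ)) ((finRange n).map fun r => if l r = j then parVal k (y r) else 1).prod =
    ((finRange n).map fun r =>
      if l r = j then (𝔰 ^ (l r : ℕ)) (parVal k (y r)) else 1).prod := by
  rw [shift_pow_list_prod, List.map_map]
  · congr 2; funext r
    simp only [Function.comp_apply]
    split_ifs with h
    exacts [by rw [h], shift_pow_one _]
  · intro x hx
    obtain ⟨r, -, rfl⟩ := List.mem_map.1 hx
    split_ifs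
    exacts [parVal_mem_diag _, one_mem _]

lemma val_downs (D : List 𝐐) {n : ℕ} (l : Fin n → Fin D.length) (hl : Monotone l)
    (y : Fin n → ParPath V) :
    val k ((finRange D.length).flatMap fun j =>
      ((finRange n).flatMap fun r => if l r = j then word (y r) else []) ++ [.out (D.get j)]) =
    (ofFn fun r => (𝔰 ^ (l r : ℕ)) (parVal k (y r))).prod * outL k D := by
  rw [val_flatMap]
  simp only [val_append, val_ite_word, val_cons, val_nil, mul_one]
  rw [prod_mul_out _ _ fun j => prod_ite_mem_diag l y j]
  simp only [shift_pow_prod_ite, prod_fibres_monotone hl]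

lemma val_ups (U : List 𝐐) {n : ℕ} (i : Fin n → Fin U.length) (hi : StrictMono i)
    (y : Fin n → ParPath V) :
    val k ((finRange U.length).reverse.flatMap fun j =>
      .inn (U.get j) :: ((finRange n).flatMap fun r => if i r = j then word (y r) else [])) =
    innL k U * (ofFn fun r => (𝔰 ^ (i r : ℕ)) (parVal k (y r))).reverse.prod := by
  rw [val_flatMap]
  simp only [val_ite_word, val_cons]
  rw [prod_inn_mul _ _ fun j => prod_ite_mem_diag i y j]
  simp only [shift_pow_prod_ite, prod_fibres_strictMono hi]

lemma ofFn_prod_mem_diag {n : ℕ} (l : Fin n → ℕ) (y : Fin n → ParPath V) :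
    (ofFn fun r => (𝔰 ^ l r) (parVal k (y r))).prod ∈ 𝐃 := by
  refine list_prod_mem fun x hx => ?_
  obtain ⟨r, rfl⟩ := (List.mem_ofFn' _ _).1 hx
  exact shift_pow_mem_diag (parVal_mem_diag _) _

lemma ofFn_reverse_prod_mem_diag {n : ℕ} (l : Fin n → ℕ) (y : Fin n → ParPath V) :
    (ofFn fun r => (𝔰 ^ l r) (parVal k (y r))).reverse.prod ∈ 𝐃 := by
  refine list_prod_mem fun x hx => ?_
  obtain ⟨r, rfl⟩ := (List.mem_ofFn' _ _).1 (List.mem_reverse.1 hx)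
  exact shift_pow_mem_diag (parVal_mem_diag _) _

lemma vert_mul_parts (z : ParPath V) {P Q : 𝐋} (hP : P ∈ 𝐃) (hQ : Q ∈ 𝐃) :
    𝔳 z.src * (P * outL k (arrows z.bot) * (innL k (arrows z.top) * Q)) * 𝔳 z.src =
      P * parVal k z * Q := by
  have h1 : parVal k z = 𝔳 z.src * outL k (arrows z.bot) *
      (innL k (arrows z.top) * 𝔳 z.src) := by
    rw [← pout, ← pout_vert, mul_assoc, ← mul_assoc (𝔳 z.tgt), ← pin, pin_vert, parVal]
  rw [h1]
  simp only [← mul_assoc, mem_diag.1 hP z.src]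
  simp only [mul_assoc, mem_diag.1 hQ z.src]

/-- The value of a summand of the brace operation on a parallel path. -/
lemma emb_braceWord_par (z : ParPath V) {n : ℕ} (y : Fin n → ParPath V) (b : Fin (n + 1))
    (l : Fin b → Fin (Gen.par z).downs.length) (hl : Monotone l)
    (i : Fin (n - b) → Fin (Gen.par z).ups.length) (hi : StrictMono i) :
    emb k V (wordCls k z.src (braceWord (Gen.par z) y b l i)) =
      insVal (fun r => parVal k (y r)) (parVal k z) b (fun r => l r) fun r => i r := by
  rw [emb_wordCls, braceWord, val_append, val_append, Gen.special, val_nil, one_mul,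
    val_downs _ l hl fun r => y ⟨r, by omega⟩, val_ups _ i hi fun r => y ⟨n - 1 - r, by omega⟩]
  exact vert_mul_parts z (ofFn_prod_mem_diag _ _) (ofFn_reverse_prod_mem_diag _ _)

/-- The value of a summand of the brace operation on a parallel path with a marked arrow. -/
lemma emb_braceWord_shift (x : ParPathPos V) {n : ℕ} (y : Fin n → ParPath V) (b : Fin (n + 1))
    (l : Fin b → Fin (Gen.shift x).downs.length) (hl : Monotone l)
    (i : Fin (n - b) → Fin (Gen.shift x).ups.length) (hi : StrictMono i) :
    emb k V (wordCls k x.src (braceWord (Gen.shift x) y b l i)) =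
      insVal (fun r => parVal k (y r)) (parVal k x.toPar) b (fun r => l r + 1) fun r => i r := by
  rw [emb_wordCls, braceWord, val_append, val_append, Gen.special, val_cons, val_nil, mul_one,
    val_downs _ l hl fun r => y ⟨r, by omega⟩, val_ups _ i hi fun r => y ⟨n - 1 - r, by omega⟩,
    ← mul_assoc (𝔬 _), ← shift_mul_out (ofFn_prod_mem_diag _ _),
    mul_assoc (𝔰 _), shift_prod_ofFn _ fun r => shift_pow_mem_diag (parVal_mem_diag _) _]
  have h := vert_mul_parts (k := k) x.toPar
    (ofFn_prod_mem_diag (fun r => (l r : ℕ) + 1) fun r : Fin b => y ⟨r, by omega⟩)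
    (ofFn_reverse_prod_mem_diag (fun r => (i r : ℕ))
      fun r : Fin (n - b) => y ⟨n - 1 - r, by omega⟩)
  rw [ParPathPos.toPar] at h
  dsimp only at h
  rw [arrows_comp, outL_cons] at h
  simp only [← mul_apply, ← pow_succ']
  exact h

lemma parVal_toPar (x : ParPathPos V) : parVal k x.toPar =
    gen k (.out ⟨_, _, x.b0⟩) * (pout k x.rest * pin k x.top) := by
  rw [parVal, ParPathPos.toPar]
  dsimp only
  rw [pout_comp, mul_assoc]

lemma parity_parVal (z : ParPath V) : parity (parVal k z) =
    ε ((z.top.length : ℤ) - z.bot.length) • parVal k z := parity_of_mem (parVal_mem_deg z)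

lemma parVal_mul_vert (z : ParPath V) : parVal k z * 𝔳 z.src = parVal k z := by
  rw [parVal_vert, if_pos rfl]

lemma vert_mul_parVal (z : ParPath V) : 𝔳 z.src * parVal k z = parVal k z := by
  rw [vert_parVal, if_pos rfl]

lemma combEquiv_diff (z : ParPath V) : (emb k V (Comb.diff k z).2) =
    parVal k z - 𝔰 (parity (parVal k z)) := by
  rw [Comb.diff]
  simp only [map_sub, map_sum, map_smul, emb_cls, sum_parVal_post, sum_parVal_pre, parity_parVal]

lemma cls0_mem (z : ParPath V) : cls0 k z ∈ CsgDeg V k ((z.top.length : ℤ) - z.bot.length) :=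
  ⟨cl_mem_piece _, zero_mem _⟩

lemma cls1_mem (z : ParPath V) : cls1 k z ∈ CsgDeg V k ((z.top.length : ℤ) - z.bot.length + 1) :=
  ⟨zero_mem _, by rw [add_sub_cancel_right]; exact cl_mem_piece _⟩

lemma csg_eq_top {S : Submodule k (Csg V k)} (h : ∀ z, cls0 k z ∈ S ∧ cls1 k z ∈ S) : S = ⊤ := by
  refine eq_top_iff.2 fun x _ => ?_
  have h' (c : C0 V k) : ((c, 0) : Csg V k) ∈ S ∧ ((0, c) : Csg V k) ∈ S := by
    induction c using c0_induction with
    | h0 => exact ⟨zero_mem _, zero_mem _⟩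
    | h1 z => exact h z
    | h2 a b ha hb => exact ⟨by simpa using add_mem ha.1 hb.1, by simpa using add_mem ha.2 hb.2⟩
    | h3 r a ha => exact ⟨by simpa using smul_mem _ r ha.1, by simpa using smul_mem _ r ha.2⟩
  simpa using add_mem (h' x.1).1 (h' x.2).2

lemma iSup_CsgDeg : ⨆ n, CsgDeg V k n = ⊤ :=
  csg_eq_top fun z => ⟨mem_iSup_of_mem _ (cls0_mem z), mem_iSup_of_mem _ (cls1_mem z)⟩

lemma cls1_eq_sum (z : ParPath V) :
    cls1 k z = ∑ c : V, ∑ a : (z.tgt ⟶ c), cls1 k (z.post a) := by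
  have h : cls k z = ∑ c : V, ∑ a : (z.tgt ⟶ c), cls k (z.post a) := by
    rw [cls, ← cl_succ]
    simp only [Comb.theta, Finsupp.linearCombination_single, one_smul, map_sum]
    rfl
  simp only [cls1, h, Prod.ext_iff, Prod.fst_sum, Prod.snd_sum, Finset.sum_const_zero, true_and]

lemma exists_toPar (z : ParPath V) (hz : 0 < z.bot.length) : ∃ x : ParPathPos V, x.toPar = z := by
  obtain ⟨s, t, top, bot⟩ := z
  suffices ∀ {t : V} (bot : Path s t), 0 < bot.length →
      ∃ (m : V) (e : s ⟶ m) (p : Path m t), e.toPath.comp p = bot by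
    obtain ⟨m, e, p, rfl⟩ := this bot hz
    exact ⟨⟨s, m, t, top, e, p⟩, rfl⟩
  intro t bot
  induction bot with
  | nil => intro h; exact absurd h (lt_irrefl _)
  | @cons b c bot e ih =>
    intro _
    rcases Nat.eq_zero_or_pos bot.length with h | h
    · cases bot with
      | nil => exact ⟨_, e, .nil, rfl⟩
      | cons p f => exact absurd h (by simp)
    · obtain ⟨m, f, p, rfl⟩ := ih h
      exact ⟨m, f, p.cons e, rfl⟩

lemma span_gen : span k (Set.range fun x : Gen V => x.cls k) = ⊤ := by
  refine csg_eq_top fun z => ⟨subset_span ⟨.par z, rfl⟩, ?_⟩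
  rw [cls1_eq_sum]
  refine sum_mem fun c _ => sum_mem fun a _ => ?_
  obtain ⟨x, hx⟩ := exists_toPar (z.post a) (Nat.succ_pos _)
  exact subset_span ⟨.shift x, congrArg (cls1 k) hx⟩

end Combinatorial

section Graded

variable {A : Type*} [AddCommGroup A] [Module k A] {𝒜 : ℤ → Submodule k A}
  {e : A ≃ₗ[k] diag k V × diag k V}

lemma isGraded_of_mem (ht : ⨆ d, 𝒜 d = ⊤)
    (h : ∀ d x, x ∈ 𝒜 d ↔ ((e x).1 : 𝐋) ∈ deg k V d ∧ ((e x).2 : 𝐋) ∈ deg k V (d - 1)) : IsGraded 𝒜 e where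
  internal := by
    let F : A →ₗ[k] 𝐋 × 𝐋 := (𝐃.val.toLinearMap.prodMap 𝐃.val.toLinearMap) ∘ₗ e.toLinearMap
    refine isInternal_of_graded (F := F) ht gradInd_pair (fun d x hx => (h d x).1 hx)
      fun d x _ hx => e.injective ?_
    rw [map_zero]
    exact Prod.ext (Subtype.ext (congrArg Prod.fst hx)) (Subtype.ext (congrArg Prod.snd hx))
  mem := h

lemma mu_eq_iff_brace {O O' : Ops k A} {n : ℕ} {d : ℤ} {dc : Fin n → ℤ} {x : A} {c : Fin n → A} :
    O.brace d dc x c = O'.brace d dc x c ↔ O.mu 1 n ![x] c = O'.mu 1 n ![x] c := by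
  rw [Ops.brace, Ops.brace, smul_right_inj (ksign_ne_zero _), ← vec_one fun _ => x]

lemma insVal_eq_zero {N : ℕ} (z : Fin N → 𝐋) (x : 𝐋) (b : Fin (N + 1))
    (l : Fin b → ℕ) (i : Fin (N - b) → ℕ) (j : Fin N) (hj : z j = 0) : insVal z x b l i = 0 := by
  rw [insVal]
  by_cases h : (j : ℕ) < b
  · rw [List.prod_eq_zero, zero_mul, zero_mul]
    refine (List.mem_ofFn' _ _).2 ⟨⟨j, h⟩, ?_⟩
    exact (congrArg _ hj).trans (map_zero _)
  · rw [List.prod_eq_zero (l := List.reverse _), mul_zero]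
    refine List.mem_reverse.2 ((List.mem_ofFn' _ _).2 ⟨⟨N - 1 - j, by omega⟩, ?_⟩)
    have : (⟨N - 1 - (N - 1 - j), by omega⟩ : Fin N) = j := by ext; simp only; omega
    simp only [this, hj, map_zero]

end Graded

/-! ### The combinatorial complex -/

section CombModel

variable (no_sinks : ∀ a : V, ∃ b : V, Nonempty (a ⟶ b))

lemma combGraded : IsGraded (CsgDeg V k) (combEquiv no_sinks) :=
  isGraded_of_mem iSup_CsgDeg (mem_CsgDeg_iff no_sinks)

lemma gen_mem (x : Gen V) : x.cls k ∈ CsgDeg V k x.deg := by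
  cases x with
  | par z =>
    have := cls0_mem (k := k) z
    rwa [← length_arrows, ← length_arrows] at this
  | shift x =>
    have := cls1_mem (k := k) x.toPar
    rw [← length_arrows, ← length_arrows, ParPathPos.toPar] at this
    dsimp only at this
    rw [arrows_comp, length_cons] at this
    change cls1 k x.toPar ∈ CsgDeg V k (Gen.shift x).deg
    convert this using 2
    · simp only [Gen.deg, Gen.ups, Gen.downs]; push_cast; ring
    · rfl

lemma gen_fst_typ (x : Gen V) :
    (((combEquiv no_sinks (x.cls k)).1 : 𝐃) : 𝐋) ∈ typ k V x.ups.length x.downs.length := by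
  rw [combEquiv_fst]
  cases x with
  | par z =>
    change emb k V (cls k z) ∈ _
    rw [emb_cls, Gen.ups, Gen.downs, length_arrows, length_arrows]
    exact pout_mul_pin_mem_typ _ _
  | shift x =>
    change emb k V 0 ∈ _
    simp

lemma gen_snd_typ (x : Gen V) :
    (((combEquiv no_sinks (x.cls k)).2 : 𝐃) : 𝐋) ∈ typ k V x.ups.length (x.downs.length + 1) := by
  rw [combEquiv_snd]
  cases x with
  | par z =>
    change emb k V 0 ∈ _
    simp
  | shift x =>
    change emb k V (cls k x.toPar) ∈ _
    have := pout_mul_pin_mem_typ (k := k) x.toPar.bot x.toPar.top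
    rw [← length_arrows x.toPar.bot, ← length_arrows, ParPathPos.toPar] at this
    dsimp only at this
    rw [arrows_comp, length_cons] at this
    rw [emb_cls]
    exact this

include no_sinks in
lemma comb_ext {x y : Csg V k} (h1 : emb k V x.1 = emb k V y.1) (h2 : emb k V x.2 = emb k V y.2) :
    x = y := Prod.ext (emb_injective no_sinks h1) (emb_injective no_sinks h2)

variable {O : Ops k (Csg V k)} (hO : IsModel (CsgDeg V k) (combEquiv no_sinks) O)

include hO

/-- The braces of the model in the combinatorial complex. -/
lemma comb_brace_fst (x : Gen V) {n : ℕ} (dc : Fin n → ℤ) (c : Fin n → Csg V k)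
    (hc : ∀ r, c r ∈ CsgDeg V k (dc r)) :
    emb k V (O.brace x.deg dc (x.cls k) c).1 =
      ∑ b : Fin (n + 1), ∑ l : Fin b → Fin x.downs.length with Monotone l,
        ∑ i : Fin (n - b) → Fin x.ups.length with StrictMono i,
          ε (insExp (fun r => dc r - 1) x.ups.length x.downs.length b (fun r => l r)
            fun r => i r) •
            insVal (fun r => emb k V (c r).2) (emb k V (x.cls k).1) b (fun r => l r) fun r => i r :=
  hO.brace_fst (gen_mem x) (gen_fst_typ no_sinks x) dc c hc

lemma comb_brace_snd (x : Gen V) {n : ℕ} (dc : Fin n → ℤ) (c : Fin n → Csg V k)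
    (hc : ∀ r, c r ∈ CsgDeg V k (dc r)) :
    emb k V (O.brace x.deg dc (x.cls k) c).2 =
      ∑ b : Fin (n + 1), ∑ l : Fin b → Fin x.downs.length with Monotone l,
        ∑ i : Fin (n - b) → Fin x.ups.length with StrictMono i,
          ε (insExp (fun r => dc r - 1) x.ups.length x.downs.length b (fun r => l r)
            fun r => i r) •
            insVal (fun r => emb k V (c r).2) (emb k V (x.cls k).2) b (fun r => l r + 1) fun r => i r :=
  hO.brace_snd (gen_mem x) (gen_snd_typ no_sinks x) dc c hc

lemma comb_brace (x : Gen V) {n : ℕ} (y : Fin n → ParPath V) :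
    O.brace x.deg (fun j => shiftDeg (y j) + 1) (x.cls k) (fun j => cls1 k (y j)) =
      Comb.brace k x y := by
  have hc r : cls1 k (y r) ∈ CsgDeg V k (shiftDeg (y r) + 1) := cls1_mem (y r)
  have he (b : Fin (n + 1)) (l : Fin b → Fin x.downs.length) (i : Fin (n - b) → Fin x.ups.length) :
      insExp (fun r => shiftDeg (y r) + 1 - 1) x.ups.length x.downs.length b (fun r => l r)
        (fun r => i r) = Comb.braceExp x y b l i := by
    rw [insExp, Comb.braceExp]
    refine congrArg₂ _ (congrArg₂ _ rfl (sum_congr rfl fun r _ => ?_))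
      (sum_congr rfl fun r _ => ?_) <;> (rw [add_sub_cancel_right]; ring)
  refine comb_ext no_sinks ?_ ?_
  · rw [comb_brace_fst no_sinks hO x _ _ hc, Comb.brace]
    simp only [Prod.fst_sum, Prod.smul_fst, map_sum, map_smul, he]
    refine sum_congr rfl fun b _ => sum_congr rfl fun l hl => sum_congr rfl fun i hi =>
      congrArg _ ?_
    cases x with
    | par z =>
      refine Eq.trans ?_ (emb_braceWord_par z y b l (mem_filter.1 hl).2 i
        (mem_filter.1 hi).2).symm
      simp only [cls1, Gen.cls, cls0, emb_cls]
    | shift x =>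
      change insVal _ (emb k V 0) _ _ _ = emb k V 0
      rw [map_zero, insVal_zero]
  · rw [comb_brace_snd no_sinks hO x _ _ hc, Comb.brace]
    simp only [Prod.snd_sum, Prod.smul_snd, map_sum, map_smul, he]
    refine sum_congr rfl fun b _ => sum_congr rfl fun l hl => sum_congr rfl fun i hi =>
      congrArg _ ?_
    cases x with
    | par z =>
      change insVal _ (emb k V 0) _ _ _ = emb k V 0
      rw [map_zero, insVal_zero]
    | shift x =>
      refine Eq.trans ?_ (emb_braceWord_shift x y b l (mem_filter.1 hl).2 i
        (mem_filter.1 hi).2).symm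
      simp only [cls1, Gen.cls, emb_cls]

/-- The braces of the model vanish if some argument lies in the first summand. -/
lemma comb_mu_eq_zero (x : Csg V k) (n : ℕ) (y : Fin n → Csg V k) (hy : ∃ j, (y j).2 = 0) :
    O.mu 1 n ![x] y = 0 := by
  obtain ⟨j, hj⟩ := hy
  let g : Fin n → Csg V k →ₗ[k] Csg V k := fun i =>
    if i = j then LinearMap.inl k _ _ ∘ₗ LinearMap.fst k _ _ else LinearMap.id
  have hg (z : Gen V) i : g i (z.cls k) ∈ CsgDeg V k z.deg ∧ (i = j → (g i (z.cls k)).2 = 0) := by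
    by_cases h : i = j
    · simp only [g, if_pos h]
      exact ⟨⟨(gen_mem z).1, zero_mem _⟩, fun _ => rfl⟩
    · simp only [g, if_neg h]
      exact ⟨gen_mem z, fun h' => absurd h' h⟩
  have key (x : Gen V) : (O.mu 1 n ![x.cls k]).compLinearMap g = 0 := by
    refine multilinear_ext_span span_gen fun a ha => ?_
    choose z hz using ha
    have h0 : O.brace x.deg (fun i => (z i).deg) (x.cls k) (fun i => g i (a i)) = 0 := by
      have hc r : g r (a r) ∈ CsgDeg V k (z r).deg := hz r ▸ (hg (z r) r).1
      have h2 : emb k V (g j (a j)).2 = 0 := by rw [← hz j, (hg (z j) j).2 rfl, map_zero]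
      refine comb_ext no_sinks ?_ ?_
      · rw [comb_brace_fst no_sinks hO x _ _ hc, Prod.fst_zero, map_zero]
        exact sum_eq_zero fun b _ => sum_eq_zero fun l _ =>
          sum_eq_zero fun i _ => by rw [insVal_eq_zero _ _ _ _ _ j h2, smul_zero]
      · rw [comb_brace_snd no_sinks hO x _ _ hc, Prod.snd_zero, map_zero]
        exact sum_eq_zero fun b _ => sum_eq_zero fun l _ =>
          sum_eq_zero fun i _ => by rw [insVal_eq_zero _ _ _ _ _ j h2, smul_zero]
    rwa [Ops.brace, smul_eq_zero_iff_right (ksign_ne_zero _), ← vec_one fun _ => x.cls k] at h0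
  have hy : (fun i => g i (y i)) = y := by
    funext i
    by_cases h : i = j
    · subst h
      simp only [g, if_pos]
      exact Prod.ext rfl hj.symm
    · simp only [g, if_neg h, LinearMap.id_apply]
  have hx : x ∈ span k (Set.range fun x : Gen V => x.cls k) :=
    (span_gen (k := k) (V := V)) ▸ Submodule.mem_top
  induction hx using span_induction with
  | mem x hx =>
    obtain ⟨z, rfl⟩ := hx
    have := DFunLike.congr_fun (key z) y
    rwa [MultilinearMap.compLinearMap_apply, hy] at this
  | zero =>
    rw [(O.mu 1 n).map_coord_zero (m := ![0]) 0 rfl]; rfl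
  | add a b _ _ ha hb =>
    have := (O.mu 1 n).map_update_add ![0] 0 a b
    simp only [Matrix.vecCons, Fin.update_cons_zero] at this
    rw [Matrix.vecCons, this, add_apply]
    exact (congrArg₂ _ ha hb).trans (add_zero 0)
  | smul r a _ ha =>
    have := (O.mu 1 n).map_update_smul ![0] 0 r a
    simp only [Matrix.vecCons, Fin.update_cons_zero] at this
    rw [Matrix.vecCons, this, smul_apply]
    exact (congrArg _ ha).trans (smul_zero r)

omit hO in
lemma emb_fst_cls0 (z : ParPath V) : emb k V (cls0 k z).1 = parVal k z := emb_cls z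
omit hO in
lemma emb_snd_cls1 (z : ParPath V) : emb k V (cls1 k z).2 = parVal k z := emb_cls z

lemma comb_cup (x y : Gen V) : O.m 2 ![x.cls k, y.cls k] = Comb.cup k x y := by
  refine comb_ext no_sinks ?_ ?_
  · refine (congrArg Subtype.val (hO.m_two_fst (x.cls k) (y.cls k))).trans ?_
    change emb k V (x.cls k).1 * emb k V (y.cls k).1 = _
    cases x with
    | par z =>
      cases y with
      | par y =>
        simp only [Gen.cls, emb_fst_cls0, Comb.cup, emb_wordCls, val_append, val_word]
        rw [← mul_assoc, vert_mul_parVal, mul_assoc, ← mem_diag.1 (parVal_mem_diag y),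
          ← mul_assoc, parVal_mul_vert]
      | shift y =>
        simp only [Gen.cls, cls1, map_zero, mul_zero, Comb.cup]
    | shift x =>
      cases y with
      | par y => simp only [Gen.cls, cls1, map_zero, zero_mul, Comb.cup]
      | shift y => simp only [Gen.cls, cls1, map_zero, zero_mul, Comb.cup, Prod.fst_zero]
  · refine Eq.trans (hO.m_two_snd (x.cls k) (y.cls k)) ?_
    change emb k V (x.cls k).2 * emb k V (y.cls k).1 +
      𝔰 (emb k V (x.cls k).1) * emb k V (y.cls k).2 = _
    cases x with
    | par z =>
      cases y with
      | par y =>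
        simp only [Gen.cls, cls0, map_zero, mul_zero, zero_mul, Comb.cup, add_zero]
      | shift y =>
        have h0 : (cls0 k z).2 = 0 := rfl
        have h2 : (cls1 k y.toPar).1 = 0 := rfl
        simp only [Gen.cls, emb_fst_cls0, emb_snd_cls1, h0, h2, map_zero, mul_zero, zero_add,
          Comb.cup, emb_wordCls, val_append, val_word, val_cons, val_nil, mul_one, val_map_out,
          val_map_inn]
        have h := vert_mul_parts (k := k) y.toPar (P := 𝔰 (parVal k z)) (Q := 1)
          shift_mem_diag (one_mem _)
        rw [mul_one, mul_one, ParPathPos.toPar] at h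
        dsimp only at h
        rw [arrows_comp, outL_cons, ← mul_assoc (𝔰 _), shift_mul_out (parVal_mem_diag z)] at h
        rw [ParPathPos.toPar, ← h]
    | shift x =>
      cases y with
      | par y =>
        have h0 : (cls0 k y).2 = 0 := rfl
        have h2 : (cls1 k x.toPar).1 = 0 := rfl
        simp only [Gen.cls, emb_fst_cls0, emb_snd_cls1, h0, h2, map_zero, mul_zero, add_zero,
          Comb.cup, emb_wordCls, val_append, val_word]
        rw [← mul_assoc, show x.src = x.toPar.src from rfl, vert_mul_parVal, mul_assoc,
          ← mem_diag.1 (parVal_mem_diag y), ← mul_assoc, parVal_mul_vert]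
      | shift y =>
        simp only [Gen.cls, cls1, map_zero, zero_mul, mul_zero, Comb.cup, Prod.snd_zero, add_zero]

omit hO in
/-- The model of the combinatorial operations. -/
lemma comb_isCombinatorial (B : BInfty (CsgDeg V k))
    (hB : IsModel (CsgDeg V k) (combEquiv no_sinks) B.toOps) : IsCombinatorial k B where
  diff_par z := by
    refine comb_ext no_sinks ?_ ?_
    · exact (congrArg Subtype.val (hB.m_one_fst (cls0 k z))).trans (map_zero _).symm
    · refine (hB.m_one_snd (cls0 k z)).trans ?_
      change emb k V (cls0 k z).1 - 𝔰 (parity (emb k V (cls0 k z).1)) = _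
      rw [emb_fst_cls0, combEquiv_diff]
  diff_shift c := by
    refine comb_ext no_sinks ?_ ?_
    · exact (congrArg Subtype.val (hB.m_one_fst ((0, c) : Csg V k))).trans (map_zero _).symm
    · refine (hB.m_one_snd ((0, c) : Csg V k)).trans ?_
      change emb k V 0 - 𝔰 (parity (emb k V 0)) = emb k V 0
      simp only [map_zero, sub_zero]
  cup := comb_cup no_sinks hB
  brace_par := comb_mu_eq_zero no_sinks hB
  brace x n y _ := comb_brace no_sinks hB x y

omit hO in
/-- The combinatorial operations determine the brace `B_∞`-algebra. -/
lemma IsCombinatorial.eq {B B' : BInfty (CsgDeg V k)} (hb : B.IsBrace) (hb' : B'.IsBrace)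
    (hB : IsCombinatorial k B) (hB' : IsCombinatorial k B') : B = B' := by
  refine brace_ext hb hb' (S := Set.range fun x : Gen V => x.cls k)
    (T := (Set.range fun z => cls1 k z) ∪ {y | y.2 = 0}) span_gen ?_ ?_ ?_ ?_
  · rw [← top_le_iff, ← span_gen (k := k) (V := V)]
    refine Submodule.span_le.2 ?_
    rintro _ ⟨x, rfl⟩
    cases x with
    | par z => exact subset_span (Or.inr rfl)
    | shift x => exact subset_span (Or.inl ⟨_, rfl⟩)
  · rintro _ ⟨x, rfl⟩
    cases x with
    | par z => exact (hB.diff_par z).trans (hB'.diff_par z).symm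
    | shift x => exact (hB.diff_shift _).trans (hB'.diff_shift _).symm
  · rintro _ ⟨x, rfl⟩ _ ⟨y, rfl⟩
    exact (hB.cup x y).trans (hB'.cup x y).symm
  · rintro n hn _ ⟨x, rfl⟩ y hy
    by_cases h : ∃ j, (y j).2 = 0
    · rw [hB.brace_par _ n y h, hB'.brace_par _ n y h]
    · choose z hz using fun j => (hy j).resolve_right fun hj => h ⟨j, hj⟩
      obtain rfl : (fun j => cls1 k (z j)) = y := funext hz
      exact mu_eq_iff_brace.1 ((hB.brace x n z hn).trans (hB'.brace x n z hn).symm)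

end CombModel

/-! ### The algebra with radical square zero in the Leavitt algebra -/

section Rad

lemma pout_comp_path {a b c : V} (q : Path a b) (p : Path b c) :
    pout k (q.comp p) = pout k q * pout k p := by
  induction p with
  | nil => rw [Path.comp_nil, pout_nil, pout_vert]
  | cons p e ih => rw [Path.comp_cons, pout_cons, ih, pout_cons, mul_assoc]

lemma pout_mul_ne {a b c d : V} (q : Path a b) (p : Path c d) (h : b ≠ c) :
    pout k q * pout k p = 0 := by
  rw [← pout_vert q, ← vert_pout p, mul_assoc, ← mul_assoc (𝔳 b), (family k).vert_mul,
    if_neg h, zero_mul, mul_zero]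

variable (k V) in
/-- The linear map which sends the paths of length `j` to the products of their ghost arrows, and
all other paths to zero. -/
def pathLin (j : ℕ) : PathAlg k V →ₗ[k] 𝐋 :=
  Finsupp.linearCombination k fun P : TotalPath V => if P.2.2.length = j then pout k P.2.2 else 0

lemma pathLin_ofPath (j : ℕ) {a b : V} (p : Path a b) :
    pathLin k V j (ofPath k p) = if p.length = j then pout k p else 0 := by
  rw [pathLin, ofPath]
  erw [Finsupp.linearCombination_single, one_smul]

lemma pathLin_zero_mul (x y : PathAlg k V) :
    pathLin k V 0 (x * y) = pathLin k V 0 y * pathLin k V 0 x := by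
  induction x using path_ind with
  | h0 => simp
  | h2 a b ha hb => rw [add_mul, map_add, map_add, ha, hb, mul_add]
  | h3 c a ha => rw [smul_mul_assoc, map_smul, map_smul, ha, mul_smul_comm]
  | h1 a b p =>
    induction y using path_ind with
    | h0 => simp
    | h2 a b ha hb => rw [mul_add, map_add, map_add, ha, hb, add_mul]
    | h3 c a ha => rw [mul_smul_comm, map_smul, map_smul, ha, smul_mul_assoc]
    | h1 c d q =>
      by_cases h : d = a
      · subst h
        rw [ofPath_mul, pathLin_ofPath, pathLin_ofPath, pathLin_ofPath, Path.length_comp,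
          pout_comp_path]
        split_ifs <;> first | omega | simp
      · rw [ofPath_mul_ne k _ _ h, map_zero, pathLin_ofPath, pathLin_ofPath]
        split_ifs <;> simp [pout_mul_ne _ _ h]

lemma pathLin_one_mul (x y : PathAlg k V) : pathLin k V 1 (x * y) =
    pathLin k V 1 y * pathLin k V 0 x + pathLin k V 0 y * pathLin k V 1 x := by
  induction x using path_ind with
  | h0 => simp
  | h2 a b ha hb => simp only [add_mul, map_add, ha, hb, mul_add]; abel
  | h3 c a ha => simp only [smul_mul_assoc, map_smul, ha, mul_smul_comm, smul_add]
  | h1 a b p =>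
    induction y using path_ind with
    | h0 => simp
    | h2 a b ha hb => simp only [mul_add, map_add, ha, hb, add_mul]; abel
    | h3 c a ha => simp only [mul_smul_comm, map_smul, ha, smul_mul_assoc, smul_add]
    | h1 c d q =>
      simp only [pathLin_ofPath]
      by_cases h : d = a
      · subst h
        rw [ofPath_mul, pathLin_ofPath, Path.length_comp, pout_comp_path]
        split_ifs <;> first | omega | simp
      · rw [ofPath_mul_ne k _ _ h, map_zero]
        split_ifs <;> simp [pout_mul_ne _ _ h]

lemma pathLin_zero_eq (x : PathAlg k V) : pathLin k V 0 x = ∑ a : V, coeffLin k x a • 𝔳 a := by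
  induction x using path_ind with
  | h0 => simp
  | h2 a b ha hb => simp only [map_add, ha, hb, Pi.add_apply, add_smul, sum_add_distrib]
  | h3 c a ha => simp only [map_smul, ha, Pi.smul_apply, smul_assoc, smul_sum]
  | h1 a b p =>
    simp only [pathLin_ofPath, coeffLin_ofPath]
    cases p with
    | nil =>
      rw [sum_eq_single a]
      · simp
      · intro c _ h
        rw [if_neg, zero_smul]
        rintro ⟨⟩; exact h rfl
      · simp
    | cons p e =>
      rw [sum_eq_zero fun c _ => ?_, if_neg (by simp)]
      rw [if_neg, zero_smul]
      rintro ⟨⟩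

lemma pathLin_zero_of_mem {x : PathAlg k V} (hx : x ∈ J k V) : pathLin k V 0 x = 0 := by
  have h0 : coeffLin k x = 0 := hx
  simp [pathLin_zero_eq, h0]

lemma sq_J : J k V ^ 2 = J k V * J k V := by
  rw [Ideal.IsTwoSided.pow_succ, Submodule.pow_one]

lemma pathLin_eq_zero (j : Fin 2) {x : PathAlg k V} (hx : x ∈ J k V ^ 2) :
    pathLin k V j x = 0 := by
  rw [sq_J] at hx
  induction hx using Submodule.smul_induction_on' with
  | smul r hr n hn =>
    rw [smul_eq_mul]
    fin_cases j
    · exact (pathLin_zero_mul r n).trans (by rw [pathLin_zero_of_mem hr, mul_zero])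
    · exact (pathLin_one_mul r n).trans (by
        rw [pathLin_zero_of_mem hr, pathLin_zero_of_mem hn, mul_zero, zero_mul, add_zero])
  | add x hx y hy h1 h2 => rw [map_add, h1, h2, add_zero]

variable (k V) in
/-- The components of degree `0` and `-1` of an element of `Λ` in the Leavitt algebra: vertices
are sent to vertices and arrows to ghost arrows. -/
def lam (j : Fin 2) : RadSqZero k V →ₗ[k] 𝐋 :=
  ((J k V ^ 2).restrictScalars k).liftQ (pathLin k V j) (fun x hx =>
      pathLin_eq_zero j ((Submodule.restrictScalars_mem k _ x).1 hx)) ∘ₗ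
    (Submodule.Quotient.restrictScalarsEquiv k (J k V ^ 2)).symm.toLinearMap

lemma lam_mk (j : Fin 2) (x : PathAlg k V) :
    lam k V j (Ideal.Quotient.mk _ x) = pathLin k V j x := rfl

lemma lam_zero_mul (x y : RadSqZero k V) : lam k V 0 (x * y) = lam k V 0 y * lam k V 0 x := by
  obtain ⟨x, rfl⟩ := Ideal.Quotient.mk_surjective x
  obtain ⟨y, rfl⟩ := Ideal.Quotient.mk_surjective y
  exact pathLin_zero_mul x y

lemma lam_one_mul (x y : RadSqZero k V) : lam k V 1 (x * y) =
    lam k V 1 y * lam k V 0 x + lam k V 0 y * lam k V 1 x := by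
  obtain ⟨x, rfl⟩ := Ideal.Quotient.mk_surjective x
  obtain ⟨y, rfl⟩ := Ideal.Quotient.mk_surjective y
  exact pathLin_one_mul x y

lemma lam_pathCls (j : Fin 2) {a b : V} (p : Path a b) :
    lam k V j (pathCls k p) = if p.length = j then pout k p else 0 := pathLin_ofPath _ p

lemma lam_zero_e (a : V) : lam k V 0 (𝐒.e a) = 𝔳 a :=
  (lam_pathCls 0 _).trans (by simp)

lemma lam_one_e (a : V) : lam k V 1 (𝐒.e a) = 0 :=
  (lam_pathCls 1 _).trans (by simp)

lemma lam_zero_arrow {a b : V} (e : a ⟶ b) : lam k V 0 (pathCls k e.toPath) = 0 := by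
  simp [lam_pathCls, Quiver.Hom.toPath]

lemma pout_toPath {a b : V} (e : a ⟶ b) : pout k e.toPath = gen k (.out ⟨_, _, e⟩) := by
  simp [Quiver.Hom.toPath, vert_out_ite]

lemma lam_one_arrow {a b : V} (e : a ⟶ b) :
    lam k V 1 (pathCls k e.toPath) = gen k (.out ⟨_, _, e⟩) := by
  rw [lam_pathCls, pout_toPath]; simp [Quiver.Hom.toPath]

lemma lam_e_mul (j : Fin 2) (a : V) (x : RadSqZero k V) :
    lam k V j (𝐒.e a * x) = lam k V j x * 𝔳 a := by
  fin_cases j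
  · exact (lam_zero_mul _ _).trans (by rw [lam_zero_e]; rfl)
  · exact (lam_one_mul _ _).trans (by rw [lam_zero_e, lam_one_e, mul_zero, add_zero]; rfl)

lemma lam_mul_e (j : Fin 2) (a : V) (x : RadSqZero k V) :
    lam k V j (x * 𝐒.e a) = 𝔳 a * lam k V j x := by
  fin_cases j
  · exact (lam_zero_mul _ _).trans (by rw [lam_zero_e]; rfl)
  · exact (lam_one_mul _ _).trans (by rw [lam_zero_e, lam_one_e, zero_mul, zero_add]; rfl)

lemma lam_zero_of_aug {x : RadSqZero k V} (hx : 𝐒.aug x = 0) : lam k V 0 x = 0 := by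
  obtain ⟨x, rfl⟩ := Ideal.Quotient.mk_surjective x
  exact pathLin_zero_of_mem hx

lemma pathCls_mul {a b c : V} (p : Path b c) (q : Path a b) :
    pathCls k p * pathCls k q = pathCls k (q.comp p) := by
  rw [pathCls, pathCls, ← map_mul, ofPath_mul, pathCls]

lemma pathCls_mul_ne {a b c d : V} (p : Path a b) (q : Path c d) (h : d ≠ a) :
    pathCls k p * pathCls k q = 0 := by
  rw [pathCls, pathCls, ← map_mul, ofPath_mul_ne k p q h, map_zero]

lemma ofPath_mem_J {a b : V} (p : Path a b) (hp : 0 < p.length) : ofPath k p ∈ J k V :=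
  (mem_J k _).2 (subset_span ⟨a, b, p, hp, rfl⟩)

lemma pathCls_eq_zero {a b : V} (p : Path a b) (hp : 1 < p.length) : pathCls k p = 0 := by
  cases p with
  | nil => simp at hp
  | @cons c _ p e =>
    refine Ideal.Quotient.eq_zero_iff_mem.2 ?_
    rw [sq_J, show p.cons e = p.comp e.toPath from rfl, ← ofPath_mul]
    rw [Path.length_cons] at hp
    exact Ideal.mul_mem_mul (ofPath_mem_J _ (by simp [Quiver.Hom.toPath])) (ofPath_mem_J _ (by omega))

/-- `Λ` is spanned by the classes of the vertices and the arrows. -/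
lemma rad_ind {Q : RadSqZero k V → Prop} (h0 : Q 0) (h1 : ∀ a : V, Q (𝐒.e a))
    (h2 : ∀ (a b : V) (e : a ⟶ b), Q (pathCls k e.toPath)) (h3 : ∀ x y, Q x → Q y → Q (x + y))
    (h4 : ∀ (c : k) x, Q x → Q (c • x)) (x) : Q x := by
  obtain ⟨x, rfl⟩ := Ideal.Quotient.mk_surjective x
  induction x using path_ind with
  | h0 => rwa [map_zero]
  | h2 a b ha hb => rw [map_add]; exact h3 _ _ ha hb
  | h3 c a ha => exact h4 c _ ha
  | h1 a b p =>
    change Q (pathCls k p)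
    cases p with
    | nil => exact h1 a
    | cons p e =>
      cases p with
      | nil => exact h2 _ _ e
      | cons p f => rw [pathCls_eq_zero _ (by simp)]; exact h0

lemma projBar_arrow {a b : V} (e : a ⟶ b) :
    𝐒.projBar.1 (pathCls k e.toPath) = arrowCls k e := by
  refine Subtype.ext ?_
  have h : 𝐒.aug (pathCls k e.toPath) = 0 := (arrowCls k e).2
  change 𝐒.projLin (pathCls k e.toPath) = pathCls k e.toPath
  simp [Hoch.Split.projLin_apply, h]

lemma projBar_e (a : V) : 𝐒.projBar.1 (𝐒.e a) = 0 := by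
  refine Subtype.ext ?_
  change 𝐒.projLin (𝐒.e a) = 0
  simp [Hoch.Split.projLin_apply, 𝐒.aug_e]

lemma projBar_of_bar (a : 𝐒.bar) : 𝐒.projBar.1 a.1 = a := by
  refine Subtype.ext ?_
  have h : 𝐒.aug a.1 = 0 := a.2
  change 𝐒.projLin a.1 = a.1
  simp [Hoch.Split.projLin_apply, h]

/-- `Λ̄` is spanned by the arrows. -/
lemma bar_ind {Q : 𝐒.bar → Prop} (h0 : Q 0)
    (h2 : ∀ (a b : V) (e : a ⟶ b), Q (arrowCls k e)) (h3 : ∀ x y, Q x → Q y → Q (x + y))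
    (h4 : ∀ (c : k) x, Q x → Q (c • x)) (x) : Q x := by
  rw [← projBar_of_bar x]
  generalize (x.1 : RadSqZero k V) = y
  induction y using rad_ind with
  | h0 => exact (map_zero 𝐒.projBar.1).symm ▸ h0
  | h1 a => rwa [projBar_e]
  | h2 a b e => rw [projBar_arrow]; exact h2 a b e
  | h3 x y hx hy => exact (map_add 𝐒.projBar.1 x y).symm ▸ h3 _ _ hx hy
  | h4 c x hx => exact (map_smul 𝐒.projBar.1 c x).symm ▸ h4 c _ hx

lemma arrow_mul_arrow {a b c d : V} (e : a ⟶ b) (f : c ⟶ d) :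
    pathCls k e.toPath * pathCls k f.toPath = 0 := by
  by_cases h : d = a
  · subst h
    rw [pathCls_mul, pathCls_eq_zero]; simp [Quiver.Hom.toPath]
  · exact pathCls_mul_ne _ _ h

lemma bar_mul_bar (x y : 𝐒.bar) : (x.1 * y.1 : RadSqZero k V) = 0 := by
  induction x using bar_ind with
  | h0 => exact zero_mul _
  | h3 a b ha hb => exact (add_mul _ _ _).trans (by rw [ha, hb, add_zero])
  | h4 c a ha => exact (smul_mul_assoc c _ _).trans (by rw [ha, smul_zero])
  | h2 a b e =>
    induction y using bar_ind with
    | h0 => exact mul_zero _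
    | h3 a b ha hb => exact (mul_add _ _ _).trans (by rw [ha, hb, add_zero])
    | h4 c a ha => exact (mul_smul_comm c _ _).trans (by rw [ha, smul_zero])
    | h2 c d f => exact arrow_mul_arrow e f

lemma mulBar_eq_zero : 𝐒.mulBar = 0 := by
  refine Subtype.ext (LinearMap.ext fun z => ?_)
  induction z using Hoch.tensor_ind with
  | h0 => rw [map_zero, map_zero]
  | h2 a b ha hb => rw [map_add, ha, hb, map_add]
  | h1 x y =>
    change 𝐒.projBar.1 (x.1 * y.1 : RadSqZero k V) = 0
    rw [bar_mul_bar]; exact map_zero _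

end Rad

/-! ### Tensor powers in the Leavitt algebra -/

section Weights

variable (k V) in
/-- The map from `Λ̄` to the Leavitt algebra which sends arrows to ghost arrows. -/
def barW : 𝐒.bar →ₗ[k] 𝐋 := (lam k V 1 : 𝐒.alg →ₗ[k] 𝐋) ∘ₗ 𝐒.inclBar.1

lemma barW_arrow {a b : V} (e : a ⟶ b) : barW k V (arrowCls k e) = gen k (.out ⟨_, _, e⟩) :=
  lam_one_arrow e

lemma barW_L (i : V) (a : 𝐒.bar) : barW k V (𝐒.bar.L i a) = barW k V a * 𝔳 i := lam_e_mul 1 i a.1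

lemma barW_R (i : V) (a : 𝐒.bar) : barW k V (𝐒.bar.R i a) = 𝔳 i * barW k V a := lam_mul_e 1 i a.1

/-- A map from a bimodule over `E` to the Leavitt algebra which reverses the two actions. -/
structure Weight (M : Hoch.EBim k V) where
  f : M →ₗ[k] 𝐋
  map_L : ∀ i x, f (M.L i x) = f x * 𝔳 i
  map_R : ∀ i x, f (M.R i x) = 𝔳 i * f x

variable {M N : Hoch.EBim k V}

/-- The map `a ⊗ x ↦ φ(x) α(a)`. -/
def Weight.mul (α : Weight M) (φ : Weight N) : Weight (Hoch.tensor M N) where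
  f := Hoch.tlift ((LinearMap.mul k 𝐋).flip.compl₁₂ α.f φ.f) fun i x y => by
    simp only [LinearMap.compl₁₂_apply, LinearMap.flip_apply, LinearMap.mul_apply', α.map_R,
      φ.map_L, mul_assoc]
  map_L i x := by
    induction x using Hoch.tensor_ind with
    | h0 => simp
    | h2 a b ha hb => simp only [map_add, ha, hb, add_mul]
    | h1 a x => simp [α.map_L, mul_assoc]
  map_R i x := by
    induction x using Hoch.tensor_ind with
    | h0 => simp
    | h2 a b ha hb => simp only [map_add, ha, hb, mul_add]
    | h1 a x => simp [φ.map_R, mul_assoc]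

lemma Weight.mul_tm (α : Weight M) (φ : Weight N) (a : M) (x : N) :
    (α.mul φ).f (Hoch.tm _ _ a x) = φ.f x * α.f a := by
  simp [Weight.mul]

variable (k V) in
/-- The weight of `Λ̄`. -/
def barWt : Weight 𝐒.bar := ⟨barW k V, barW_L, barW_R⟩

/-- The map `a_n ⊗ ⋯ ⊗ a_1 ⊗ x ↦ φ(x) a_1 ⋯ a_n`. -/
def Weight.pow (φ : Weight M) : ∀ n, Weight (𝐒.pow M n)
  | 0 => φ
  | n + 1 => (barWt k V).mul (φ.pow n)

variable (M) in
/-- The element `a ⊗ x` of a tensor power. -/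
def ten (n : ℕ) : 𝐒.bar →ₗ[k] 𝐒.pow M n →ₗ[k] 𝐒.pow M (n + 1) :=
  Hoch.tm 𝐒.bar (𝐒.pow M n)

lemma ten_bal (n : ℕ) (i : V) (a : 𝐒.bar) (x : 𝐒.pow M n) :
    ten M n (𝐒.bar.R i a) x = ten M n a ((𝐒.pow M n).L i x) := Hoch.tm_bal i a x

lemma L_ten (n : ℕ) (i : V) (a : 𝐒.bar) (x : 𝐒.pow M n) :
    (𝐒.pow M (n + 1)).L i (ten M n a x) = ten M n (𝐒.bar.L i a) x := rfl

lemma R_ten (n : ℕ) (i : V) (a : 𝐒.bar) (x : 𝐒.pow M n) :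
    (𝐒.pow M (n + 1)).R i (ten M n a x) = ten M n a ((𝐒.pow M n).R i x) := rfl

lemma Weight.pow_ten (φ : Weight M) (n : ℕ) (a : 𝐒.bar) (x : 𝐒.pow M n) :
    (φ.pow (n + 1)).f (ten M n a x) = (φ.pow n).f x * barW k V a :=
  (barWt k V).mul_tm (φ.pow n) a x

lemma ten_ind {n : ℕ} {Q : 𝐒.pow M (n + 1) → Prop} (h0 : Q 0)
    (h1 : ∀ a x, Q (ten M n a x)) (h2 : ∀ a b, Q a → Q b → Q (a + b)) (z) : Q z :=
  Hoch.tensor_ind h0 h1 h2 z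

lemma pow_ind {n : ℕ} {Q : 𝐒.pow M (n + 1) → Prop} (h0 : Q 0)
    (h1 : ∀ (a b : V) (e : a ⟶ b) (x : 𝐒.pow M n), Q (ten M n (arrowCls k e) x))
    (h2 : ∀ a b, Q a → Q b → Q (a + b)) (z) : Q z := by
  refine ten_ind h0 (fun a => ?_) h2 z
  induction a using bar_ind with
  | h0 => intro x; rw [LinearMap.map_zero₂]; exact h0
  | h2 a b e => exact h1 a b e
  | h3 a b ha hb => exact fun y => (LinearMap.map_add₂ (ten M n) a b y).symm ▸ h2 _ _ (ha y) (hb y)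
  | h4 c a ha => intro x; rw [LinearMap.map_smul₂, ← map_smul]; exact ha _

variable (k V) in
/-- The weights of `Λ` of degrees `0` and `-1`. -/
def lamW (j : Fin 2) : Weight 𝐒.alg := ⟨lam k V j, lam_e_mul j, lam_mul_e j⟩

variable (k V) in
/-- The weight of `E`. -/
def baseW : Weight 𝐒.base where
  f := (lamW k V 0).f ∘ₗ 𝐒.inclE.1
  map_L i _ := lam_e_mul 0 i _
  map_R i _ := lam_mul_e 0 i _

lemma baseW_baseE (i : V) : (baseW k V).f (𝐒.baseE i) = 𝔳 i := lam_zero_e i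

lemma base_ind {Q : 𝐒.base → Prop} (h0 : Q 0) (h1 : ∀ i, Q (𝐒.baseE i))
    (h2 : ∀ a b, Q a → Q b → Q (a + b)) (h3 : ∀ (c : k) a, Q a → Q (c • a)) (x) : Q x := by
  obtain ⟨x, hx⟩ := x
  induction hx using span_induction with
  | mem x hx => obtain ⟨i, rfl⟩ := hx; exact h1 i
  | zero => exact h0
  | add x y hx hy h h' => exact h2 ⟨x, hx⟩ ⟨y, hy⟩ h h'
  | smul c x hx h => exact h3 c ⟨x, hx⟩ h

lemma base_L_baseE (i j : V) : 𝐒.base.L i (𝐒.baseE j) =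
    if i = j then 𝐒.baseE j else 0 := by
  refine Subtype.ext ?_
  change 𝐒.e i * 𝐒.e j = _
  split_ifs with h
  · rw [h, Hoch.Split.e_mul_self]; rfl
  · rw [Hoch.Split.e_mul_ne _ _ _ h]; rfl

lemma base_R_baseE (i j : V) : 𝐒.base.R i (𝐒.baseE j) =
    if i = j then 𝐒.baseE j else 0 := by
  refine Subtype.ext ?_
  change 𝐒.e j * 𝐒.e i = _
  split_ifs with h
  · rw [h, Hoch.Split.e_mul_self]; rfl
  · rw [Hoch.Split.e_mul_ne _ _ _ (Ne.symm h)]; rfl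

lemma bar_R_arrow (i : V) {a b : V} (e : a ⟶ b) : 𝐒.bar.R i (arrowCls k e) =
    if i = a then arrowCls k e else 0 := by
  refine Subtype.ext ?_
  change pathCls k e.toPath * pathCls k Path.nil = _
  split_ifs with h
  · subst h; rw [pathCls_mul, Path.nil_comp]; rfl
  · rw [pathCls_mul_ne _ _ h]; rfl

lemma bar_L_arrow (i : V) {a b : V} (e : a ⟶ b) : 𝐒.bar.L i (arrowCls k e) =
    if i = b then arrowCls k e else 0 := by
  refine Subtype.ext ?_
  change pathCls k Path.nil * pathCls k e.toPath = _
  split_ifs with h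
  · subst h; rw [pathCls_mul, Path.comp_nil]; rfl
  · rw [pathCls_mul_ne _ _ (Ne.symm h)]; rfl

end Weights

section Trace

variable (k) in
/-- The idempotent of a vertex in the tensor power with no factors. -/
def baseT (a : V) : 𝐒.T 0 := 𝐒.baseE a

lemma baseT_f (a : V) : ((baseW k V).pow 0).f (baseT k a) = 𝔳 a := baseW_baseE a

variable (k V) in
/-- The map `x ↦ g(e ⊗ x) e`. -/
def peel {m : ℕ} (e : 𝐐) : (𝐒.T (m + 1) →ₗ[k] 𝐋) →ₗ[k] 𝐒.T m →ₗ[k] 𝐋 :=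
  (LinearMap.mulRight k (𝔦 e)).compRight k ∘ₗ
    LinearMap.lcomp k 𝐋 (ten 𝐒.base m (arrowCls k e.hom))

variable (k V) in
/-- The sum of `g(γ) γ` over all paths `γ` of length `m`. -/
def tr : ∀ m, (𝐒.T m →ₗ[k] 𝐋) →ₗ[k] 𝐋
  | 0 => ∑ a : V, LinearMap.mulRight k (𝔳 a) ∘ₗ LinearMap.applyₗ (baseT k a)
  | m + 1 => ∑ e : 𝐐, tr m ∘ₗ peel k V e

lemma tr_zero (g : 𝐒.T 0 →ₗ[k] 𝐋) : tr k V 0 g = ∑ a : V, g (baseT k a) * 𝔳 a := by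
  rw [tr, LinearMap.sum_apply]; rfl

lemma peel_apply {m : ℕ} (e : 𝐐) (g : 𝐒.T (m + 1) →ₗ[k] 𝐋) (x : 𝐒.T m) :
    peel k V e g x = g (ten 𝐒.base m (arrowCls k e.hom) x) * 𝔦 e := rfl

lemma tr_succ {m : ℕ} (g : 𝐒.T (m + 1) →ₗ[k] 𝐋) :
    tr k V (m + 1) g = ∑ e : 𝐐, tr k V m (peel k V e g) := by
  rw [tr, LinearMap.sum_apply]; rfl

/-- Maps on `Λ̄^{⊗ m}` which are compatible with the left action are given by left multiplication
with an element of the Leavitt algebra. -/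
lemma tr_mul {m : ℕ} (g : 𝐒.T m →ₗ[k] 𝐋)
    (hg : ∀ i t, g ((𝐒.T m).L i t) = g t * 𝔳 i) (t) :
    tr k V m g * ((baseW k V).pow m).f t = g t := by
  induction m with
  | zero =>
    change 𝐒.base at t
    induction t using base_ind with
    | h0 => exact (congrArg _ (map_zero _)).trans ((mul_zero _).trans (map_zero _).symm)
    | h2 a b ha hb => exact (congrArg _ (map_add _ a b)).trans ((mul_add _ _ _).trans
        ((congrArg₂ _ ha hb).trans (map_add g a b).symm))
    | h3 c a ha => exact (congrArg _ (map_smul _ c a)).trans ((mul_smul_comm _ _ _).trans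
        ((congrArg _ ha).trans (map_smul g c a).symm))
    | h1 i =>
      refine (congrArg _ (baseW_baseE i)).trans ?_
      rw [tr_zero, sum_mul, sum_eq_single i]
      · rw [mul_assoc, vert_mul_self]
        exact (hg i _).symm.trans (congrArg g ((base_L_baseE i i).trans (if_pos rfl)))
      · exact fun j _ h => by rw [mul_assoc, (family k).vert_mul, if_neg h, mul_zero]
      · simp
  | succ m ih =>
    induction t using pow_ind with
    | h0 => rw [map_zero, map_zero, mul_zero]
    | h2 a b ha hb => rw [map_add, map_add, mul_add, ha, hb]
    | h1 a b f x =>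
      rw [Weight.pow_ten, barW_arrow, tr_succ, ← mul_assoc, sum_mul, sum_mul]
      have hp (e : 𝐐) : tr k V m (peel k V e g) * ((baseW k V).pow m).f x = peel k V e g x := by
        refine ih _ (fun i t => ?_) x
        rw [peel_apply, peel_apply, ← ten_bal, bar_R_arrow, mul_assoc, inn_vert_ite]
        by_cases h : i = e.left
        · rw [if_pos h, if_pos h.symm]
        · rw [if_neg h, if_neg (Ne.symm h), LinearMap.map_zero₂, map_zero, zero_mul, mul_zero]
      simp only [hp, peel_apply]
      rw [sum_eq_single (⟨a, b, f⟩ : 𝐐)]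
      · rw [mul_assoc, (family k).inn_out, if_pos rfl]
        refine (hg b _).symm.trans (congrArg g ?_)
        rw [L_ten m b _ x, bar_L_arrow, if_pos rfl]
      · exact fun e _ h => by rw [mul_assoc, (family k).inn_out, if_neg h, mul_zero]
      · simp

lemma tr_mulLeft {m : ℕ} (u : 𝐋) (g : 𝐒.T m →ₗ[k] 𝐋) :
    tr k V m (LinearMap.mulLeft k u ∘ₗ g) = u * tr k V m g := by
  induction m with
  | zero => simp only [tr_zero, mul_sum, comp_apply, LinearMap.mulLeft_apply, mul_assoc]
  | succ m ih =>
    rw [tr_succ, tr_succ, mul_sum]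
    refine sum_congr rfl fun e _ => ?_
    rw [← ih]
    refine congrArg _ (LinearMap.ext fun x => ?_)
    simp [peel_apply, mul_assoc]

lemma tr_baseW (m : ℕ) : tr k V m ((baseW k V).pow m).f = 1 := by
  induction m with
  | zero =>
    rw [tr_zero, ← (family k).sum_vert]
    exact sum_congr rfl fun a _ =>
      (congrArg (fun z => z * 𝔳 a) (baseT_f a)).trans (vert_mul_self a)
  | succ m ih =>
    rw [tr_succ, ← map_sum, ← ih]
    refine congrArg _ (LinearMap.ext fun x => ?_)
    rw [LinearMap.sum_apply]
    simp only [peel_apply, Weight.pow_ten, barW_arrow, mul_assoc]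
    rw [← mul_sum]
    exact (congrArg _ (family k).sum_out_inn).trans (mul_one _)

/-- The element which represents a map by left multiplication. -/
lemma tr_eq_of_forall {m : ℕ} {g : 𝐒.T m →ₗ[k] 𝐋} {u : 𝐋}
    (h : ∀ t, g t = u * ((baseW k V).pow m).f t) : tr k V m g = u := by
  rw [show g = LinearMap.mulLeft k u ∘ₗ ((baseW k V).pow m).f from LinearMap.ext h, tr_mulLeft,
    tr_baseW, mul_one]

lemma tr_comp_R {m : ℕ} (g : 𝐒.T m →ₗ[k] 𝐋) (i : V) :
    tr k V m (g ∘ₗ (𝐒.T m).R i) = tr k V m g * 𝔳 i := by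
  induction m with
  | zero =>
    rw [tr_zero, tr_zero, sum_mul]
    refine sum_congr rfl fun a _ => ?_
    rw [mul_assoc, (family k).vert_mul]
    refine (congrArg (fun z => g z * 𝔳 a) (base_R_baseE i a)).trans ?_
    by_cases h : i = a
    · rw [if_pos h, if_pos h.symm]; rfl
    · rw [if_neg h, if_neg (Ne.symm h), mul_zero]
      exact (congrArg (fun z => z * 𝔳 a) (map_zero g)).trans (zero_mul _)
  | succ m ih =>
    rw [tr_succ, tr_succ, sum_mul]
    exact sum_congr rfl fun e _ => ih (peel k V e g)

lemma tr_mem_diag {m : ℕ} {g : 𝐒.T m →ₗ[k] 𝐋}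
    (hg : ∀ i t, g ((𝐒.T m).R i t) = 𝔳 i * g t) : tr k V m g ∈ 𝐃 := by
  refine mem_diag.2 fun i => ?_
  rw [← tr_comp_R, ← tr_mulLeft]
  exact congrArg _ (LinearMap.ext fun t => (hg i t).symm)

lemma tr_mem_deg {m : ℕ} {d : ℤ} {g : 𝐒.T m →ₗ[k] 𝐋}
    (hg : ∀ t, g t ∈ deg k V d) : tr k V m g ∈ deg k V (d + m) := by
  induction m generalizing d with
  | zero =>
    rw [tr_zero]
    exact sum_mem fun a _ => mul_mem_deg (hg _) (gen_mem_deg (.vert a))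
  | succ m ih =>
    rw [tr_succ]
    refine sum_mem fun e _ => ?_
    have := ih (d := d + 1) (g := peel k V e g) fun t => mul_mem_deg (hg _) (gen_mem_deg (.inn e))
    convert this using 1
    push_cast; ring_nf

lemma typ_mul_vert {m p : ℕ} {x : 𝐋} (hx : x ∈ typ k V m p) (b : V) :
    x * 𝔳 b ∈ typ k V m p := by
  induction hx using span_induction with
  | mem x hx =>
    obtain ⟨D, U, a, rfl, rfl, rfl⟩ := hx
    have h1 : outL k D * (𝔳 a * innL k U) ∈ typ k V U.length D.length :=
      subset_span ⟨D, U, a, rfl, rfl, rfl⟩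
    cases U with
    | nil =>
      rw [innL_nil, mul_one] at h1 ⊢
      rw [mul_assoc, (family k).vert_mul]
      split_ifs
      exacts [h1, by simp]
    | cons e U =>
      rw [innL_cons] at h1 ⊢
      rw [mul_assoc, mul_assoc, mul_assoc, inn_vert_ite]
      split_ifs
      exacts [h1, by simp]
  | zero => simp
  | add x y _ _ hx hy => rw [add_mul]; exact add_mem hx hy
  | smul c x _ hx => rw [smul_mul_assoc]; exact smul_mem _ _ hx

lemma typ_mul_inn {m p : ℕ} {x : 𝐋} (hx : x ∈ typ k V m p) (e : 𝐐) :
    x * 𝔦 e ∈ typ k V (m + 1) p := by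
  induction hx using span_induction with
  | mem x hx =>
    obtain ⟨D, U, a, rfl, rfl, rfl⟩ := hx
    exact subset_span ⟨D, e :: U, a, rfl, rfl, by rw [innL_cons, mul_assoc, mul_assoc]⟩
  | zero => simp
  | add x y _ _ hx hy => rw [add_mul]; exact add_mem hx hy
  | smul c x _ hx => rw [smul_mul_assoc]; exact smul_mem _ _ hx

lemma tr_mem_typ {m n p : ℕ} {g : 𝐒.T m →ₗ[k] 𝐋}
    (hg : ∀ t, g t ∈ typ k V n p) : tr k V m g ∈ typ k V (n + m) p := by
  induction m generalizing n with
  | zero =>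
    rw [tr_zero]
    exact sum_mem fun a _ => typ_mul_vert (hg _) a
  | succ m ih =>
    rw [tr_succ]
    refine sum_mem fun e _ => ?_
    have := ih (n := n + 1) (g := peel k V e g) fun t => typ_mul_inn (hg _) e
    rwa [add_assoc, add_comm 1 m] at this

end Trace

section Structure

variable {M N P : Hoch.EBim k V}

lemma powMap_ten (f : Hoch.BHom M N) (n : ℕ) (a : 𝐒.bar) (x : 𝐒.pow M n) :
    (𝐒.powMap f (n + 1)).1 (ten M n a x) = ten N n a ((𝐒.powMap f n).1 x) := rfl

lemma pow_powMap {f : Hoch.BHom M N} {φ : Weight N} {ψ ψ' : Weight M} {u u' : 𝐋}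
    (h : ∀ x, φ.f (f.1 x) = u * ψ.f x + u' * ψ'.f x) (n : ℕ) (x : 𝐒.pow M n) :
    (φ.pow n).f ((𝐒.powMap f n).1 x) = u * (ψ.pow n).f x + u' * (ψ'.pow n).f x := by
  induction n with
  | zero => exact h x
  | succ n ih =>
    induction x using ten_ind with
    | h0 => simp only [map_zero, mul_zero, add_zero]
    | h1 a x => rw [powMap_ten, φ.pow_ten, ψ.pow_ten, ψ'.pow_ten, ih, add_mul, mul_assoc, mul_assoc]
    | h2 a b ha hb => simp only [map_add, ha, hb, mul_add]; abel

lemma pow_powMap_mul {f : Hoch.BHom M N} {φ : Weight N} {ψ : Weight M} {u : 𝐋}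
    (h : ∀ x, φ.f (f.1 x) = u * ψ.f x) (n : ℕ) (x : 𝐒.pow M n) :
    (φ.pow n).f ((𝐒.powMap f n).1 x) = u * (ψ.pow n).f x := by
  simpa using pow_powMap (u' := 0) (ψ' := ψ) (fun x => by rw [h, zero_mul, add_zero]) n x

lemma pow_powMap_eq {f : Hoch.BHom M N} {φ : Weight N} {ψ : Weight M}
    (h : ∀ x, φ.f (f.1 x) = ψ.f x) (n : ℕ) (x : 𝐒.pow M n) :
    (φ.pow n).f ((𝐒.powMap f n).1 x) = (ψ.pow n).f x := by
  simpa using pow_powMap_mul (u := 1) (fun x => by rw [h, one_mul]) n x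

lemma pow_glue (φ : Weight M) (n m : ℕ) (x : 𝐒.pow (𝐒.pow M n) m) :
    (φ.pow (n + m)).f ((𝐒.glue M n m).1 x) = ((φ.pow n).pow m).f x := by
  induction m with
  | zero => rfl
  | succ m ih =>
    induction x using ten_ind with
    | h0 => simp only [map_zero]
    | h1 a x => exact (φ.pow_ten (n + m) a _).trans (by rw [ih, Weight.pow_ten])
    | h2 a b ha hb => simp only [map_add, ha, hb]

lemma split_ten (n m : ℕ) (a : 𝐒.bar) (x : 𝐒.pow M (n + m)) :
    (𝐒.split M n (m + 1)).1 (ten M (n + m) a x) = ten _ m a ((𝐒.split M n m).1 x) := rfl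

lemma pow_split (φ : Weight M) (n m : ℕ) (x : 𝐒.pow M (n + m)) :
    ((φ.pow n).pow m).f ((𝐒.split M n m).1 x) = (φ.pow (n + m)).f x := by
  induction m with
  | zero => rfl
  | succ m ih =>
    change 𝐒.pow M (n + m + 1) at x
    induction x using ten_ind with
    | h0 => exact (map_zero _).trans (map_zero _).symm
    | h1 a x =>
      refine Eq.trans ?_ (φ.pow_ten (n + m) a x).symm
      rw [← ih, split_ten, Weight.pow_ten]
    | h2 a b ha hb =>
      exact (congrArg _ (map_add (𝐒.split M n (m + 1)).1 a b)).trans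
        ((map_add _ _ _).trans ((congrArg₂ _ ha hb).trans (map_add _ _ _).symm))

lemma pow_recast (φ : Weight M) {a b : ℕ} (h : a = b) (x : 𝐒.pow M a) :
    (φ.pow b).f ((𝐒.recast M a b).1 x) = (φ.pow a).f x := by
  subst h; rw [Hoch.Split.recast, dif_pos rfl]; rfl

lemma mul_assocInv (α : Weight M) (β : Weight N) (γ : Weight P)
    (x : Hoch.tensor M (Hoch.tensor N P)) :
    ((α.mul β).mul γ).f ((Hoch.assocInv M N P).1 x) = (α.mul (β.mul γ)).f x := by
  induction x using Hoch.tensor_ind with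
  | h0 => simp only [map_zero]
  | h2 a b ha hb => simp only [map_add, ha, hb]
  | h1 a x =>
    induction x using Hoch.tensor_ind with
    | h0 => simp only [map_zero]
    | h2 a b ha hb => simp only [map_add, ha, hb]
    | h1 b x => rw [Hoch.assocInv_tm]; simp only [Weight.mul_tm, mul_assoc]

lemma mul_assoc_f (α : Weight M) (β : Weight N) (γ : Weight P)
    (x : Hoch.tensor (Hoch.tensor M N) P) :
    (α.mul (β.mul γ)).f ((Hoch.assoc M N P).1 x) = ((α.mul β).mul γ).f x := by
  induction x using Hoch.tensor_ind with
  | h0 => simp only [map_zero]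
  | h2 a b ha hb => simp only [map_add, ha, hb]
  | h1 a x =>
    induction a using Hoch.tensor_ind with
    | h0 => rw [LinearMap.map_zero₂]; simp only [map_zero]
    | h2 a b ha hb => rw [LinearMap.map_add₂]; simp only [map_add, ha, hb]
    | h1 b y => rw [Hoch.assoc_tm]; simp only [Weight.mul_tm, mul_assoc]

lemma lam_zero_one : lam k V 0 1 = 1 := by
  rw [← 𝐒.idem.complete, map_sum, ← (family k).sum_vert]
  exact sum_congr rfl fun a _ => lam_zero_e a

lemma mul_tmap {M' N' : Hoch.EBim k V} (α : Weight M') (β : Weight N') (f : Hoch.BHom M M')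
    (g : Hoch.BHom N N') (x : M) (y : N) :
    (α.mul β).f ((Hoch.tmap f g).1 (Hoch.tm _ _ x y)) = β.f (g.1 y) * α.f (f.1 x) :=
  α.mul_tm β _ _

lemma mul_detach (ψ : Weight M) (n : ℕ) (x : 𝐒.pow M n) :
    (((baseW k V).pow n).mul ψ).f ((𝐒.detach M n).1 x) = (ψ.pow n).f x := by
  induction n with
  | zero =>
    exact (Weight.mul_tm _ _ _ _).trans
      ((congrArg _ (lam_zero_one (k := k) (V := V))).trans (mul_one _))
  | succ n ih =>
    refine (mul_assocInv (barWt k V) ((baseW k V).pow n) ψ _).trans ?_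
    induction x using ten_ind with
    | h0 => simp only [map_zero]
    | h1 a x =>
      refine (mul_tmap _ _ _ _ _ _).trans ?_
      rw [ih, Weight.pow_ten]; rfl
    | h2 a b ha hb => rw [map_add, map_add, map_add, ← ha, ← hb]

lemma pow_attach (α : Weight N) (ψ : Weight M) (n : ℕ) (x : Hoch.tensor (𝐒.pow N n) M) :
    ((α.mul ψ).pow n).f ((𝐒.attach M N n).1 x) = ((α.pow n).mul ψ).f x := by
  induction n with
  | zero => rfl
  | succ n ih =>
    refine Eq.trans ?_ (mul_assoc_f (barWt k V) (α.pow n) ψ x)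
    change ((barWt k V).mul ((α.mul ψ).pow n)).f ((Hoch.tmap _ _).1 ((Hoch.assoc _ _ _).1 x)) = _
    generalize (Hoch.assoc 𝐒.bar (𝐒.pow N n) M).1 x = y
    induction y using Hoch.tensor_ind with
    | h0 => simp only [map_zero]
    | h2 a b ha hb => simp only [map_add, ha, hb]
    | h1 a y => rw [mul_tmap, ih, Weight.mul_tm]; rfl

/-- The values of the weight are homogeneous of degree `-R` in the ghost arrows. -/
def Weight.Len (ψ : Weight M) (R : ℕ) : Prop :=
  ∀ y ∈ 𝐃, ∀ x, ψ.f x * y = (𝔰 ^ R) y * ψ.f x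

variable (M) in
/-- The zero weight. -/
def Weight.zero : Weight M := ⟨0, fun _ _ => (zero_mul _).symm, fun _ _ => (mul_zero _).symm⟩

lemma Weight.zero_len (R : ℕ) : (Weight.zero M).Len R := fun y _ _ =>
  (zero_mul y).trans (mul_zero _).symm

lemma Weight.zero_pow (n : ℕ) (x : 𝐒.pow M n) : ((Weight.zero M).pow n).f x = 0 := by
  induction n with
  | zero => rfl
  | succ n ih =>
    induction x using ten_ind with
    | h0 => rw [map_zero]
    | h1 a x => rw [Weight.pow_ten, ih, zero_mul]
    | h2 a b ha hb => rw [map_add, ha, hb, add_zero]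

lemma barW_mul {y : 𝐋} (hy : y ∈ 𝐃) (a : 𝐒.bar) : barW k V a * y = 𝔰 y * barW k V a := by
  induction a using bar_ind with
  | h0 => rw [map_zero, zero_mul, mul_zero]
  | h2 a b e => rw [barW_arrow, shift_mul_out hy]
  | h3 a b ha hb => rw [map_add, add_mul, ha, hb, mul_add]
  | h4 c a ha => rw [map_smul, smul_mul_assoc, ha, mul_smul_comm]

lemma Weight.Len.pow {ψ : Weight M} {R : ℕ} (h : ψ.Len R) (n : ℕ) : (ψ.pow n).Len (R + n) := by
  induction n with
  | zero => exact h
  | succ n ih =>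
    intro y hy x
    induction x using ten_ind with
    | h0 => rw [map_zero, zero_mul, mul_zero]
    | h1 a x =>
      rw [Weight.pow_ten, mul_assoc, barW_mul hy, ← mul_assoc, ih _ shift_mem_diag, mul_assoc,
        ← mul_apply, ← pow_succ]; rfl
    | h2 a b ha hb => rw [map_add, add_mul, ha, hb, mul_add]

lemma lamW_len (j : Fin 2) : (lamW k V j).Len j := by
  intro y hy x
  change lam k V j x * y = _ * lam k V j x
  induction x using rad_ind with
  | h0 => rw [map_zero, zero_mul, mul_zero]
  | h3 a b ha hb => rw [map_add, add_mul, ha, hb, mul_add]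
  | h4 c a ha => rw [map_smul, smul_mul_assoc, ha, mul_smul_comm]
  | h1 a =>
    fin_cases j
    exacts [by simpa [lam_zero_e] using mem_diag.1 hy a, by simp [lam_one_e]]
  | h2 a b e =>
    fin_cases j
    exacts [by simp [lam_zero_arrow], by simpa [lam_one_arrow] using (shift_mul_out hy _).symm]

end Structure

/-! ### Cochains in the Leavitt algebra -/

section Rho

variable {M N : Hoch.EBim k V}

/-- The components of a cochain in the Leavitt algebra. -/
def rho (j : Fin 2) {m p : ℕ} (f : 𝐒.Coch m p) : 𝐋 :=
  tr k V m (((lamW k V j).pow p).f ∘ₗ f.1)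

variable {m p : ℕ}

lemma rho_mul (j : Fin 2) (f : 𝐒.Coch m p) (t : 𝐒.T m) :
    ((lamW k V j).pow p).f (f.1 t) = rho j f * ((baseW k V).pow m).f t := by
  rw [rho, tr_mul]; · rfl
  intro i t
  change ((lamW k V j).pow p).f (f.1 _) = ((lamW k V j).pow p).f (f.1 t) * _
  rw [f.2.1, Weight.map_L]

lemma rho_eq {j : Fin 2} {f : 𝐒.Coch m p} {u : 𝐋}
    (h : ∀ t, ((lamW k V j).pow p).f (f.1 t) = u * ((baseW k V).pow m).f t) : rho j f = u :=
  tr_eq_of_forall h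

lemma rho_add (j : Fin 2) (f g : 𝐒.Coch m p) : rho j (f + g) = rho j f + rho j g := by
  rw [rho, rho, rho, ← map_add, ← LinearMap.comp_add]; rfl

lemma rho_smul (j : Fin 2) (c : k) (f : 𝐒.Coch m p) : rho j (c • f) = c • rho j f := by
  rw [rho, rho, ← map_smul, ← LinearMap.comp_smul]; rfl

lemma rho_mem_diag (j : Fin 2) (f : 𝐒.Coch m p) : rho j f ∈ 𝐃 := by
  refine tr_mem_diag fun i t => ?_
  change ((lamW k V j).pow p).f (f.1 _) = _ * ((lamW k V j).pow p).f (f.1 t)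
  rw [f.2.2, Weight.map_R]

/-- The values of `(1^{⊗ q} ⊗ h)(f ⊗ 1)`. -/
lemma pow_ext {n q : ℕ} (f : 𝐒.Coch n q)
    {h : Hoch.BHom (Hoch.tensor 𝐒.alg M) N} {φ : Weight N} {ψ ψ' : Weight M}
    {R R' : ℕ} (hR : ψ.Len R) (hR' : ψ'.Len R')
    (hh : ∀ (a : RadSqZero k V) (x : M), φ.f (h.1 (Hoch.tm 𝐒.alg M a x)) =
      ψ.f x * lam k V 0 a + ψ'.f x * lam k V 1 a) (z : 𝐒.pow M n) :
    (φ.pow q).f ((𝐒.ext f h).1 z) =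
      (𝔰 ^ R) (rho 0 f) * (ψ.pow n).f z + (𝔰 ^ R') (rho 1 f) * (ψ'.pow n).f z := by
  have h1 (x : Hoch.tensor 𝐒.alg M) : φ.f (h.1 x) =
      1 * ((lamW k V 0).mul ψ).f x + 1 * ((lamW k V 1).mul ψ').f x := by
    induction x using Hoch.tensor_ind with
    | h0 => simp only [map_zero, mul_zero, add_zero]
    | h2 a b ha hb => simp only [map_add, ha, hb, mul_add]; abel
    | h1 a x => rw [Weight.mul_tm, Weight.mul_tm, one_mul, one_mul]; exact hh a x
  have h2 (j : Fin 2) {χ : Weight M} {r : ℕ} (hr : χ.Len r) (x : Hoch.tensor (𝐒.T n) M) :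
      (((lamW k V j).pow q).mul χ).f ((Hoch.tmap f (Hoch.BHom.id M)).1 x) =
        (𝔰 ^ r) (rho j f) * (((baseW k V).pow n).mul χ).f x := by
    induction x using Hoch.tensor_ind with
    | h0 => simp only [map_zero, mul_zero]
    | h2 a b ha hb => simp only [map_add, ha, hb, mul_add]
    | h1 t x =>
      rw [mul_tmap, Weight.mul_tm, rho_mul, ← mul_assoc, ← mul_assoc, ← hr _ (rho_mem_diag j f)]; rfl
  refine (pow_powMap h1 q _).trans ?_
  rw [one_mul, one_mul]
  exact congrArg₂ _ ((pow_attach _ _ _ _).trans ((h2 0 hR _).trans (congrArg _ (mul_detach ψ n z))))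
    ((pow_attach _ _ _ _).trans ((h2 1 hR' _).trans (congrArg _ (mul_detach ψ' n z))))

lemma pow_ext_mul_zero {n q : ℕ} (f : 𝐒.Coch n q) (z : 𝐒.pow 𝐒.alg n) :
    ((lamW k V 0).pow q).f ((𝐒.ext f 𝐒.mul).1 z) = rho 0 f * ((lamW k V 0).pow n).f z := by
  refine (pow_ext f (ψ := lamW k V 0) (ψ' := Weight.zero _) (lamW_len 0) (Weight.zero_len 0)
    (fun a x => ?_) z).trans ?_
  · refine (lam_zero_mul a x).trans ?_
    change _ = lam k V 0 x * lam k V 0 a + 0 * _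
    rw [zero_mul, add_zero]
  · rw [Weight.zero_pow, mul_zero, add_zero]; rfl

lemma pow_ext_mul_one {n q : ℕ} (f : 𝐒.Coch n q) (z : 𝐒.pow 𝐒.alg n) :
    ((lamW k V 1).pow q).f ((𝐒.ext f 𝐒.mul).1 z) =
      𝔰 (rho 0 f) * ((lamW k V 1).pow n).f z + rho 1 f * ((lamW k V 0).pow n).f z :=
  pow_ext f (ψ := lamW k V 1) (ψ' := lamW k V 0) (lamW_len 1) (lamW_len 0)
    (fun a x => lam_one_mul a x) z

lemma barW_projBar (a : RadSqZero k V) : barW k V (𝐒.projBar.1 a) = lam k V 1 a := by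
  change lam k V 1 (𝐒.projLin a) = _
  rw [Hoch.Split.projLin_apply, map_sub, map_sum, sum_eq_zero, sub_zero]
  exact fun i _ => by rw [map_smul, lam_one_e, smul_zero]

lemma pow_ext_projBar {n q R : ℕ} (j : Fin 2) (f : 𝐒.Coch n q)
    (z : 𝐒.pow (𝐒.pow 𝐒.alg R) n) :
    (((lamW k V j).pow (R + 1)).pow q).f ((𝐒.ext (N := 𝐒.pow 𝐒.alg (R + 1)) f
      (Hoch.tmap 𝐒.projBar (Hoch.BHom.id _))).1 z) =
      (𝔰 ^ (j + R)) (rho 1 f) * (((lamW k V j).pow R).pow n).f z := by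
  refine (pow_ext f (ψ := Weight.zero _) (ψ' := (lamW k V j).pow R) (Weight.zero_len 0)
    ((lamW_len j).pow R) (fun a x => ?_) z).trans ?_
  · refine (mul_tmap (barWt k V) ((lamW k V j).pow R) _ _ _ _).trans ?_
    change ((lamW k V j).pow R).f x * barW k V (𝐒.projBar.1 a) = 0 * _ + _
    rw [zero_mul, zero_add]
    exact congrArg _ (barW_projBar a)
  · rw [Weight.zero_pow, mul_zero, zero_add]

end Rho

section Operations

variable {M N : Hoch.EBim k V} {m p n q : ℕ}

lemma cons_ten {a b : ℕ} (f : Hoch.BHom (𝐒.pow M a) (𝐒.pow N b)) (c : 𝐒.bar) (x : 𝐒.pow M a) :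
    (𝐒.cons f).1 (ten M a c x) = ten N b c (f.1 x) := rfl

lemma rho_cons (j : Fin 2) (f : 𝐒.Coch m p) :
    rho j (show 𝐒.Coch (m + 1) (p + 1) from 𝐒.cons f) = rho j f := by
  refine rho_eq fun t => ?_
  induction t using ten_ind with
  | h0 => simp only [map_zero, mul_zero]
  | h1 a x => rw [cons_ten, Weight.pow_ten, Weight.pow_ten, rho_mul, mul_assoc]
  | h2 a b ha hb => simp only [map_add, ha, hb, mul_add]

lemma rho_theta (j : Fin 2) (f : 𝐒.Coch m p) :
    rho j (𝐒.theta m p f) = ε ((m : ℤ) - p) • rho j f :=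
  (rho_smul j _ _).trans (congrArg _ (rho_cons j f))

lemma rho_zero (j : Fin 2) : rho j (0 : 𝐒.Coch m p) = 0 := by
  simpa using rho_smul j (0 : k) (0 : 𝐒.Coch m p)

lemma rho_neg (j : Fin 2) (f : 𝐒.Coch m p) : rho j (-f) = -rho j f := by
  refine eq_neg_of_add_eq_zero_left ?_
  rw [← rho_add, neg_add_cancel, rho_zero]

lemma rho_sum (j : Fin 2) {ι : Type*} (s : Finset ι) (f : ι → 𝐒.Coch m p) :
    rho j (∑ i ∈ s, f i) = ∑ i ∈ s, rho j (f i) := by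
  induction s using Finset.induction_on with
  | empty => exact rho_zero j
  | insert a s ha ih => rw [Finset.sum_insert ha, Finset.sum_insert ha, rho_add, ih]

lemma merge_apply (n : ℕ) (x : 𝐒.pow M (n + 2)) : (𝐒.merge M n).1 x = 0 := by
  change (Hoch.tmap 𝐒.mulBar _).1 ((Hoch.assocInv _ _ _).1 x) = 0
  generalize (Hoch.assocInv 𝐒.bar 𝐒.bar (𝐒.pow M n)).1 x = y
  rw [mulBar_eq_zero]
  induction y using Hoch.tensor_ind with
  | h0 => rw [map_zero]
  | h2 a b ha hb => rw [map_add, ha, hb, add_zero]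
  | h1 a y => exact LinearMap.map_zero₂ (Hoch.tm 𝐒.bar (𝐒.pow M n)) _

lemma lact_zero (p : ℕ) (x : 𝐒.Om (p + 1)) :
    ((lamW k V 0).pow p).f ((𝐒.lact p).1 x) = 0 := by
  induction p with
  | zero =>
    induction x using ten_ind with
    | h0 => simp only [map_zero]
    | h2 a b ha hb => rw [map_add, map_add, ha, hb, add_zero]
    | h1 a x =>
      refine (lam_zero_mul (a.1 : RadSqZero k V) x).trans ?_
      rw [lam_zero_of_aug a.2, mul_zero]
  | succ p ih =>
    change ((lamW k V 0).pow (p + 1)).f ((𝐒.merge _ p).1 x - (𝐒.cons (𝐒.lact p)).1 x) = 0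
    rw [merge_apply, zero_sub, map_neg, neg_eq_zero]
    induction x using ten_ind with
    | h0 => simp only [map_zero]
    | h2 a b ha hb => rw [map_add, map_add, ha, hb, add_zero]
    | h1 a x => rw [cons_ten, Weight.pow_ten, ih, zero_mul]

lemma lact_one (p : ℕ) (x : 𝐒.Om (p + 1)) :
    ((lamW k V 1).pow p).f ((𝐒.lact p).1 x) = ε p • ((lamW k V 0).pow (p + 1)).f x := by
  induction p with
  | zero =>
    rw [Nat.cast_zero, ksign_zero, one_smul]
    induction x using ten_ind with
    | h0 => simp only [map_zero]
    | h2 a b ha hb => rw [map_add, map_add, map_add, ha, hb]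
    | h1 a x =>
      refine (lam_one_mul (a.1 : RadSqZero k V) x).trans ?_
      rw [lam_zero_of_aug a.2, mul_zero, zero_add, Weight.pow_ten]; rfl
  | succ p ih =>
    change ((lamW k V 1).pow (p + 1)).f ((𝐒.merge _ p).1 x - (𝐒.cons (𝐒.lact p)).1 x) = _
    rw [merge_apply, zero_sub, map_neg, Nat.cast_succ, ksign_succ, neg_smul, neg_inj]
    induction x using ten_ind with
    | h0 => simp only [map_zero, smul_zero]
    | h2 a b ha hb => simp only [map_add, ha, hb, smul_add]
    | h1 a x => rw [cons_ten, Weight.pow_ten, ih, smul_mul_assoc, ← Weight.pow_ten]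

lemma contr_apply (m : ℕ) (t : 𝐒.T (m + 1)) : (𝐒.contr m).1 t = 0 := by
  induction m with
  | zero => rfl
  | succ m ih =>
    change (𝐒.merge _ m).1 t - (𝐒.cons (𝐒.contr m)).1 t = 0
    rw [merge_apply, zero_sub, neg_eq_zero]
    induction t using ten_ind with
    | h0 => rw [map_zero]
    | h2 a b ha hb => rw [map_add, ha, hb, add_zero]
    | h1 a x => rw [cons_ten, ih, map_zero]

lemma mul_incl (j : Fin 2) (x : Hoch.tensor 𝐒.bar 𝐒.base) :
    (lamW k V j).f ((𝐒.mul.comp (Hoch.tmap 𝐒.inclBar 𝐒.inclE)).1 x) =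
      (if j = 1 then 1 else 0) * ((barWt k V).mul (baseW k V)).f x := by
  induction x using Hoch.tensor_ind with
  | h0 => simp only [map_zero, mul_zero]
  | h2 a b ha hb => simp only [map_add, ha, hb, mul_add]
  | h1 a x =>
    rw [Weight.mul_tm]
    fin_cases j
    · refine (lam_zero_mul (a.1 : RadSqZero k V) x.1).trans ?_
      rw [lam_zero_of_aug a.2, mul_zero]; exact (zero_mul _).symm
    · refine (lam_one_mul (a.1 : RadSqZero k V) x.1).trans ?_
      rw [lam_zero_of_aug a.2, mul_zero, zero_add]; exact (one_mul _).symm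

lemma rho_ract (j : Fin 2) (f : 𝐒.Coch m p) :
    rho j (𝐒.ract f) = if j = 1 then 𝔰 (rho 0 f) else 0 := by
  have h (i : Fin 2) (t : 𝐒.T (m + 1)) : ((lamW k V i).pow m).f
      ((𝐒.powMap (𝐒.mul.comp (Hoch.tmap 𝐒.inclBar 𝐒.inclE)) m).1
        ((𝐒.split 𝐒.base 1 m).1 ((𝐒.recast 𝐒.base (m + 1) (1 + m)).1 t))) =
      (if i = 1 then 1 else 0) * ((baseW k V).pow (m + 1)).f t :=
    (pow_powMap_mul (mul_incl i) m _).trans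
      (congrArg _ ((pow_split (baseW k V) 1 m _).trans (pow_recast _ (add_comm m 1) t)))
  refine rho_eq fun t => ?_
  fin_cases j
  · exact (pow_ext_mul_zero f _).trans ((congrArg _ (h 0 t)).trans (by simp))
  · exact (pow_ext_mul_one f _).trans ((congrArg₂ _ (congrArg _ (h 1 t))
      (congrArg _ (h 0 t))).trans (by simp))

lemma rho_zero_lact (f : 𝐒.Coch m p) : rho 0 ((𝐒.lact p).comp (𝐒.cons f)) = 0 :=
  rho_eq fun _ => (lact_zero p _).trans (zero_mul _).symm

lemma rho_one_lact (f : 𝐒.Coch m p) : rho 1 ((𝐒.lact p).comp (𝐒.cons f)) = ε p • rho 0 f := by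
  refine rho_eq fun t => (lact_one p _).trans ?_
  rw [smul_mul_assoc]
  exact congrArg _ ((rho_mul (m := m + 1) (p := p + 1) 0 (𝐒.cons f) t).trans (by rw [rho_cons]))

lemma comp_contr (f : 𝐒.Coch m p) : Hoch.BHom.comp f (𝐒.contr m) = 0 := by
  refine Subtype.ext (LinearMap.ext fun t => ?_)
  exact (congrArg f.1 (contr_apply m t)).trans (map_zero _)

lemma rho_zero_diff (f : 𝐒.Coch m p) : rho 0 (𝐒.diff f) = 0 := by
  rw [Hoch.Split.diff, comp_contr, smul_zero, add_zero, rho_add, rho_neg, rho_smul, rho_smul,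
    rho_zero_lact, rho_ract]
  simp

lemma rho_one_diff (f : 𝐒.Coch m p) : rho 1 (𝐒.diff f) =
    ε p • 𝔰 (rho 0 f) - ε m • rho 0 f := by
  rw [Hoch.Split.diff, comp_contr, smul_zero, add_zero, rho_add, rho_neg, rho_smul, rho_smul,
    rho_one_lact, rho_ract, if_pos rfl, ksign_smul_smul, sub_add_cancel, neg_add_eq_sub]
  exact congrArg₂ _ (congrArg₂ _ (ksign_congr (by push_cast; grind)) rfl) rfl

lemma rho_glue_powMap (j : Fin 2) (g : 𝐒.Coch n q) (t : 𝐒.T (n + m)) :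
    ((lamW k V j).pow (q + m)).f ((𝐒.glue 𝐒.alg q m).1
      ((𝐒.powMap g m).1 ((𝐒.split 𝐒.base n m).1 t))) =
      rho j g * ((baseW k V).pow (n + m)).f t := by
  refine (pow_glue _ _ _ _).trans ((pow_powMap_mul (rho_mul j g) m _).trans ?_)
  rw [pow_split]

lemma rho_zero_cup (f : 𝐒.Coch m p) (g : 𝐒.Coch n q) :
    rho 0 (𝐒.cup f g) = ε ((m : ℤ) * n + p * q) • (rho 0 f * rho 0 g) := by
  rw [Hoch.Split.cup, rho_smul]
  refine congrArg _ (rho_eq fun t => ?_)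
  refine (pow_glue _ _ _ _).trans ((pow_powMap_mul (pow_ext_mul_zero f) q _).trans ?_)
  rw [mul_assoc]
  exact congrArg _ ((pow_split _ _ _ _).trans ((pow_recast _ (add_comm q m) _).trans
    (rho_glue_powMap 0 g t)))

lemma rho_one_cup (f : 𝐒.Coch m p) (g : 𝐒.Coch n q) :
    rho 1 (𝐒.cup f g) = ε ((m : ℤ) * n + p * q) •
      (𝔰 (rho 0 f) * rho 1 g + rho 1 f * rho 0 g) := by
  rw [Hoch.Split.cup, rho_smul]
  refine congrArg _ (rho_eq fun t => ?_)
  refine (pow_glue _ _ _ _).trans ((pow_powMap (pow_ext_mul_one f) q _).trans ?_)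
  rw [add_mul, mul_assoc, mul_assoc]
  refine congrArg₂ _ (congrArg _ ?_) (congrArg _ ?_)
  · exact (pow_split _ _ _ _).trans ((pow_recast _ (add_comm q m) _).trans
      (rho_glue_powMap 1 g t))
  · exact (pow_split _ _ _ _).trans ((pow_recast _ (add_comm q m) _).trans
      (rho_glue_powMap 0 g t))

end Operations

section Strands

variable {N : ℕ}

lemma rho_inner (j : Fin 2) (s : 𝐒.State N) (y : 𝐒.Cochain) (R : ℕ) (h : R + y.m ≤ s.A) :
    rho j (s.inner y R).F = (𝔰 ^ (j + R)) (rho 1 y.f) * rho j s.F := by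
  refine rho_eq fun t => ?_
  refine (pow_glue _ _ _ _).trans
    ((pow_powMap_eq (ψ := ((lamW k V j).pow (R + 1)).pow y.p) (fun x => pow_glue _ _ _ _) _ _).trans
      ((pow_powMap_mul (pow_ext_projBar j y.f) _ _).trans ?_))
  rw [mul_assoc]
  exact congrArg _ ((pow_powMap_eq (ψ := (lamW k V j).pow (R + y.m)) (fun x => pow_split _ _ _ _)
    _ _).trans ((pow_split _ _ _ _).trans ((pow_recast _ (by omega) _).trans (rho_mul j s.F t))))

lemma rho_zero_outer (s : 𝐒.State N) (x : 𝐒.Cochain) (h : x.m ≤ s.A) :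
    rho 0 (s.outer x).F = rho 0 x.f * rho 0 s.F := by
  refine rho_eq fun t => ?_
  refine (pow_glue _ _ _ _).trans ((pow_powMap_mul (pow_ext_mul_zero x.f) _ _).trans ?_)
  rw [mul_assoc]
  exact congrArg _ ((pow_split _ _ _ _).trans ((pow_recast _ (by omega) _).trans
    (rho_mul 0 s.F t)))

lemma rho_one_outer (s : 𝐒.State N) (x : 𝐒.Cochain) (h : x.m ≤ s.A) :
    rho 1 (s.outer x).F = 𝔰 (rho 0 x.f) * rho 1 s.F + rho 1 x.f * rho 0 s.F := by
  refine rho_eq fun t => ?_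
  refine (pow_glue _ _ _ _).trans ((pow_powMap (pow_ext_mul_one x.f) _ _).trans ?_)
  rw [add_mul, mul_assoc, mul_assoc]
  refine congrArg₂ _ (congrArg _ ?_) (congrArg _ ?_)
  · exact (pow_split _ _ _ _).trans ((pow_recast _ (by omega) _).trans (rho_mul 1 s.F t))
  · exact (pow_split _ _ _ _).trans ((pow_recast _ (by omega) _).trans (rho_mul 0 s.F t))

/-- Applying several cochains to the strands. -/
lemma rho_foldl {ι : Type*} (y : ι → 𝐒.Cochain) (R : ι → ℕ) (C : ℕ) (L : List ι)
    (hR : ∀ r ∈ L, R r ≤ C) (s : 𝐒.State N)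
    (hs : C + (L.map fun r => (y r).m).sum ≤ s.A) :
    (L.foldl (fun s r => s.inner (y r) (R r)) s).A + (L.map fun r => (y r).m).sum =
        s.A + (L.map fun r => (y r).p + 1).sum ∧
    ∀ j : Fin 2, rho j (L.foldl (fun s r => s.inner (y r) (R r)) s).F =
      (L.map fun r => (𝔰 ^ (j + R r)) (rho 1 (y r).f)).reverse.prod * rho j s.F := by
  induction L generalizing s with
  | nil => simp
  | cons r L ih =>
    rw [map_cons, List.sum_cons] at hs
    have hr := hR r (mem_cons_self ..)
    have hA : (s.inner (y r) (R r)).A + (y r).m = s.A + ((y r).p + 1) := by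
      rw [Hoch.Split.State.inner]; dsimp only; omega
    obtain ⟨h1, h2⟩ := ih (fun r' h => hR r' (mem_cons_of_mem _ h)) (s.inner (y r) (R r))
      (by omega)
    refine ⟨?_, fun j => ?_⟩
    · simp only [map_cons, List.sum_cons, List.foldl_cons]; omega
    · rw [List.foldl_cons, h2 j, rho_inner j s (y r) (R r) (by omega), map_cons,
        List.reverse_cons, List.prod_append, List.prod_singleton, mul_assoc]

end Strands

section BraceTerm

lemma sum_split_rev {M : Type*} [AddCommMonoid M] {c b : ℕ} (hb : b ≤ c) (g : Fin c → M) :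
    ∑ r : Fin b, g ⟨r, by omega⟩ + ∑ r : Fin (c - b), g ⟨c - 1 - r, by omega⟩ = ∑ r, g r := by
  obtain ⟨a, rfl⟩ := Nat.exists_eq_add_of_le hb
  rw [Fin.sum_univ_add]
  congr 1
  refine Finset.sum_bij' (fun r _ => ⟨a - 1 - r, by omega⟩) (fun r _ => ⟨a - 1 - r, by omega⟩)
    (fun _ _ => mem_univ _) (fun _ _ => mem_univ _) (fun r _ => ?_) (fun r _ => ?_)
    fun r _ => ?_
  · ext; simp only; omega
  · ext; simp only; omega
  · congr 1; ext; simp only [Fin.val_natAdd]; omega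

lemma sum_finRange_split {c b : ℕ} (hb : b ≤ c) (g : Fin c → ℕ) :
    ((finRange b).map fun r : Fin b => g ⟨r, by omega⟩).sum +
      ((finRange (c - b)).map fun r : Fin (c - b) => g ⟨c - 1 - r, by omega⟩).sum =
        ∑ r, g r := by
  rw [← List.ofFn_eq_map, ← List.ofFn_eq_map, List.sum_ofFn, List.sum_ofFn, sum_split_rev hb]

/-- The components of a summand of the brace operation. -/
lemma rho_braceTerm (j : Fin 2) (x : 𝐒.Cochain) {c : ℕ}
    (y : Fin c → 𝐒.Cochain) (b : Fin (c + 1)) (l : Fin b → Fin x.p)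
    (i : Fin (c - b) → Fin x.m) :
    rho j (Hoch.Split.braceTerm x y b l i) =
      insVal (fun r => rho 1 (y r).f) (rho j x.f) b (fun r => l r + j) fun r => i r := by
  unfold Hoch.Split.braceTerm
  extract_lets s₀ s₁ s₂ s₃
  have hm := sum_finRange_split (Nat.lt_succ_iff.1 b.2) fun r => (y r).m
  have hp := sum_finRange_split (Nat.lt_succ_iff.1 b.2) fun r => (y r).p + 1
  have hi : Hoch.Split.inputs x y = x.m + ∑ r, (y r).m := rfl
  have ho : Hoch.Split.outputs x y = x.p + ∑ r, ((y r).p + 1) := by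
    rw [Hoch.Split.outputs, sum_add_distrib]
    simp [add_assoc]
  have h0 : ∀ j : Fin 2, rho j s₀.F = if j = 0 then 1 else 0 := by
    intro j
    refine rho_eq fun t => ?_
    refine (pow_powMap (u := if j = 0 then 1 else 0) (u' := 0) (ψ := baseW k V) (ψ' := baseW k V)
      (fun x => ?_) _ t).trans (by rw [zero_mul, add_zero])
    rw [zero_mul, add_zero]
    induction x using base_ind with
    | h0 => simp only [map_zero, mul_zero]
    | h2 a b ha hb => simp only [map_add, ha, hb, mul_add]
    | h3 r a ha => rw [map_smul, map_smul, map_smul, ha, mul_smul_comm]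
    | h1 a =>
      fin_cases j
      · exact (one_mul _).symm
      · exact (lam_one_e a).trans (zero_mul _).symm
  have hA0 : s₀.A = Hoch.Split.inputs x y := rfl
  obtain ⟨hA1, h1⟩ := rho_foldl (fun r : Fin (c - b) => y ⟨c - 1 - r, by omega⟩)
    (fun r => (i r : ℕ)) x.m (finRange (c - b)) (fun r _ => (i r).2.le) s₀ (by omega)
  change s₁.A + _ = _ at hA1
  change ∀ j : Fin 2, rho j s₁.F = _ at h1
  have hA2 : s₂.A = x.p + (s₁.A - x.m) := rfl
  have h2 : rho j s₂.F = rho j x.f * rho 0 s₁.F := by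
    fin_cases j
    · exact rho_zero_outer s₁ x (by omega)
    · refine (rho_one_outer s₁ x (by omega)).trans ?_
      rw [h1 1, h0, if_neg (by decide), mul_zero, mul_zero, zero_add]
      rfl
  have hr : ∀ g : Fin b → ℕ, ((finRange b).reverse.map g).sum =
      ((finRange b).map g).sum := fun g => by rw [List.map_reverse, List.sum_reverse]
  obtain ⟨hA3, h3⟩ := rho_foldl (fun r : Fin b => y ⟨r, by omega⟩) (fun r => (l r : ℕ)) x.p
    (finRange b).reverse (fun r _ => (l r).2.le) s₂ (by rw [hr]; omega)
  change s₃.A + _ = _ at hA3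
  change ∀ j : Fin 2, rho j s₃.F = _ at h3
  rw [hr, hr] at hA3
  have hA : s₃.A = Hoch.Split.outputs x y := by omega
  refine rho_eq fun t => (pow_recast _ hA _).trans ((rho_mul j s₃.F t).trans ?_)
  rw [h3 j, h2, h1 0, h0, if_pos rfl, mul_one, insVal, List.map_reverse, List.reverse_reverse,
    ← List.ofFn_eq_map, ← List.ofFn_eq_map, ← mul_assoc]
  have h0 : ∀ n : ℕ, ((0 : Fin 2) : ℕ) + n = n := fun n => Nat.zero_add n
  simp only [add_comm (j : ℕ), h0]

end BraceTerm

/-! ### Spanning sets and dual cochains -/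

section Forms

lemma pathTensor_cons (M : Hoch.EBim k V) (x : M) {a b c : V} (p : Path a b) (e : b ⟶ c) :
    pathTensor k M x (p.cons e) = ten M p.length (arrowCls k e) (pathTensor k M x p) := by
  rw [pathTensor]
  rfl

lemma pathTensor_nil (M : Hoch.EBim k V) (x : M) (a : V) :
    pathTensor k M x (.nil : Path a a) = x := by
  rw [pathTensor]

lemma pow_pathTensor {M : Hoch.EBim k V} (φ : Weight M) (x : M) {a b : V} (p : Path a b)
    (hx : φ.f x * 𝔳 a = φ.f x) : (φ.pow p.length).f (pathTensor k M x p) =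
      φ.f x * pout k p := by
  induction p with
  | nil =>
    rw [pathTensor_nil, pout_nil]
    exact hx.symm
  | cons p e ih =>
    rw [pathTensor_cons, pout_cons, ← mul_assoc, ← ih]
    exact (φ.pow_ten _ _ _).trans (by rw [barW_arrow])

lemma pow_form {a b c : V} (j : Fin 2) (p : Path a b) (q : Path c a) :
    ((lamW k V j).pow p.length).f (form k p q) =
      if q.length = j then pout k (q.comp p) else 0 := by
  have h : (lamW k V j).f (pathCls k q) = if q.length = j then pout k q else 0 := lam_pathCls j q
  refine (pow_pathTensor (lamW k V j) (pathCls k q) p ?_).trans ?_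
  · rw [h]
    split_ifs
    · exact pout_vert q
    · exact zero_mul _
  · rw [h, pout_comp_path]
    split_ifs
    · rfl
    · exact zero_mul _

lemma L_pathTensor {M : Hoch.EBim k V} {x : M} {a b : V} (p : Path a b) (i : V)
    (hx : M.L i x = if i = a then x else 0) :
    (𝐒.pow M p.length).L i (pathTensor k M x p) =
      if i = b then pathTensor k M x p else 0 := by
  induction p with
  | nil => rw [pathTensor_nil]; exact hx
  | @cons b c p e _ =>
    rw [pathTensor_cons]
    refine (L_ten _ i _ _).trans ?_
    have hb := bar_L_arrow (k := k) i e
    by_cases h : i = c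
    · exact (congrArg (fun y => ten M p.length y (pathTensor k M x p)) (hb.trans (if_pos h))).trans
        (if_pos h).symm
    · exact (congrArg (fun y => ten M p.length y (pathTensor k M x p)) (hb.trans (if_neg h))).trans
        ((LinearMap.map_zero₂ _ _).trans (if_neg h).symm)

lemma R_pathTensor {M : Hoch.EBim k V} {x : M} {a b c : V} (p : Path a b) (i : V)
    (hx : M.R i x = if i = c then x else 0) :
    (𝐒.pow M p.length).R i (pathTensor k M x p) =
      if i = c then pathTensor k M x p else 0 := by
  induction p with
  | nil => rw [pathTensor_nil]; exact hx
  | cons p e ih =>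
    rw [pathTensor_cons]
    refine (R_ten _ i _ _).trans ?_
    by_cases h : i = c
    · exact (congrArg (ten M p.length (arrowCls k e)) (ih.trans (if_pos h))).trans (if_pos h).symm
    · exact (congrArg (ten M p.length (arrowCls k e)) (ih.trans (if_neg h))).trans
        ((map_zero _).trans (if_neg h).symm)

lemma L_pathCls {a b : V} (q : Path a b) (i : V) :
    𝐒.alg.L i (pathCls k q) = if i = b then pathCls k q else 0 := by
  change pathCls k Path.nil * pathCls k q = _
  split_ifs with h
  · subst h; rw [pathCls_mul, Path.comp_nil]
  · exact pathCls_mul_ne _ _ (Ne.symm h)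

lemma R_pathCls {a b : V} (q : Path a b) (i : V) :
    𝐒.alg.R i (pathCls k q) = if i = a then pathCls k q else 0 := by
  change pathCls k q * pathCls k Path.nil = _
  split_ifs with h
  · subst h; rw [pathCls_mul, Path.nil_comp]
  · exact pathCls_mul_ne _ _ h

lemma pow_monomial (P : TotalPath V) :
    ((baseW k V).pow P.2.2.length).f (monomial k P) = pout k P.2.2 := by
  refine (pow_pathTensor (baseW k V) (𝐒.baseE P.1) P.2.2 ?_).trans ?_
  · rw [baseW_baseE, vert_mul_self]
  · rw [baseW_baseE, vert_pout]

variable (k V) in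
/-- The forms given by a path of length `p` together with a vertex or an arrow. -/
def formSet (p : ℕ) : Set (𝐒.Om p) :=
  {x | ∃ (a b c : V) (r : Path a b) (q : Path c a) (h : r.length = p),
    q.length ≤ 1 ∧ x = h ▸ form k r q}

lemma span_formSet (p : ℕ) : span k (formSet k V p) = ⊤ := by
  refine Submodule.eq_top_iff'.2 fun x => ?_
  induction p with
  | zero =>
    change (RadSqZero k V) at x
    induction x using rad_ind with
    | h0 => exact zero_mem _
    | h1 a => exact subset_span ⟨a, a, a, .nil, .nil, rfl, Nat.zero_le _, by
        exact (pathTensor_nil 𝐒.alg (pathCls k Path.nil) a).symm⟩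
    | h2 a b e => exact subset_span ⟨b, b, a, .nil, e.toPath, rfl, le_rfl, by
        exact (pathTensor_nil 𝐒.alg (pathCls k e.toPath) b).symm⟩
    | h3 x y hx hy => exact add_mem hx hy
    | h4 c x hx => exact smul_mem _ c hx
  | succ p ih =>
    induction x using pow_ind with
    | h0 => exact zero_mem _
    | h2 a b ha hb => exact add_mem ha hb
    | h1 a b e x =>
      have hx := ih x
      clear ih
      induction hx using span_induction with
      | zero => rw [map_zero]; exact zero_mem _
      | add x y _ _ hx hy => rw [map_add]; exact add_mem hx hy
      | smul c x _ hx => rw [map_smul]; exact smul_mem _ c hx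
      | mem x hx =>
        obtain ⟨s, t, c, r, q, rfl, hq, rfl⟩ := hx
        dsimp only
        by_cases h : a = t
        · subst h
          exact subset_span ⟨s, b, c, r.cons e, q, rfl, hq, (pathTensor_cons _ _ r e).symm⟩
        · have : ten 𝐒.alg r.length (arrowCls k e) (form k r q) = 0 := by
            have h1 : 𝐒.bar.R a (arrowCls k e) = arrowCls k e := by
              rw [bar_R_arrow, if_pos rfl]
            rw [← h1, ten_bal]
            refine (congrArg _ ((L_pathTensor r a (L_pathCls q a)).trans (if_neg h))).trans ?_
            exact map_zero _
          rw [this]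
          exact zero_mem _

end Forms

section Injective

lemma comp_inj_of_length {a a' b c : V} (r : Path a b) (r' : Path a' b)
    (q : Path c a) (q' : Path c a') (hl : r.length = r'.length)
    (h : q.comp r = q'.comp r') :
    (⟨a, q, r⟩ : Σ a, Path c a × Path a b) = ⟨a', q', r'⟩ := by
  induction r with
  | nil =>
    cases r' with
    | nil => cases h; rfl
    | cons r' e => cases hl
  | cons r e ih =>
    cases r' with
    | nil => cases hl
    | cons r' e' =>
      rw [Path.comp_cons, Path.comp_cons] at h
      obtain rfl := Path.obj_eq_of_cons_eq_cons h
      cases Path.hom_heq_of_cons_eq_cons h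
      have := ih r' (Nat.succ.inj hl) (eq_of_heq (Path.heq_of_cons_eq_cons h))
      cases this
      rfl

lemma pow_recast_form {a b c : V} (j : Fin 2) {p : ℕ} (r : Path a b) (q : Path c a)
    (h : r.length = p) : ((lamW k V j).pow p).f (h ▸ form k r q) =
      if q.length = j then pout k (q.comp r) else 0 := by
  subst h
  exact pow_form j r q

variable (no_sinks : ∀ a : V, ∃ b : V, Nonempty (a ⟶ b))

include no_sinks in
/-- The two weights together are injective on differential forms. -/
lemma eq_zero_of_pow {p : ℕ} {x : 𝐒.Om p}
    (h : ∀ j, ((lamW k V j).pow p).f x = 0) : x = 0 := by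
  have hx : x ∈ span k (formSet k V p) := span_formSet (k := k) (V := V) p ▸ Submodule.mem_top
  obtain ⟨g, hg, rfl⟩ := Submodule.mem_span_set.1 hx
  suffices g = 0 by rw [this, Finsupp.sum_zero_index]
  ext y
  by_contra hy
  have hys : y ∈ g.support := Finsupp.mem_support_iff.2 hy
  obtain ⟨a, b, c, r, q, hr, hq, rfl⟩ := hg hys
  have h1 := congrArg (fun z => pin k (q.comp r) * z) (h ⟨q.length, by omega⟩)
  rw [Finsupp.sum] at h1
  simp only [map_sum, map_smul, mul_zero, mul_sum, mul_smul_comm] at h1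
  rw [sum_eq_single _ ?_ fun h => absurd hys h] at h1
  · rw [pow_recast_form, if_pos rfl, pin_mul_pout _ _ rfl, if_pos rfl] at h1
    exact (smul_eq_zero.1 h1).elim hy (vert_ne_zero no_sinks b)
  · intro y hys' hne
    obtain ⟨a', b', c', r', q', hr', hq', rfl⟩ := hg hys'
    rw [pow_recast_form]
    by_cases hl : q'.length = q.length
    · rw [if_pos hl, pin_mul_pout _ _
        (by rw [Path.length_comp, Path.length_comp, hl, hr, hr']), if_neg, smul_zero]
      intro he
      refine hne ?_
      injection he with h1 h2
      subst h1
      injection eq_of_heq h2 with h3 h4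
      subst h3
      cases comp_inj_of_length r r' q q' (hr.trans hr'.symm) (eq_of_heq h4)
      rfl
    · rw [if_neg hl, mul_zero, smul_zero]

include no_sinks in
/-- A cochain is determined by its components. -/
lemma eq_zero_of_rho {m p : ℕ} {f : 𝐒.Coch m p} (h : ∀ j, rho j f = 0) : f = 0 :=
  Subtype.ext <| LinearMap.ext fun t => eq_zero_of_pow no_sinks fun j => by
    rw [rho_mul, h, zero_mul]

variable (k V) in
/-- The span of the paths of length `n`. -/
def poutSpan (n : ℕ) : Submodule k 𝐋 :=
  span k {y | ∃ P : TotalPath V, P.2.2.length = n ∧ y = pout k P.2.2}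

lemma poutSpan_le_typ (n : ℕ) : poutSpan k V n ≤ typ k V 0 n := by
  refine Submodule.span_le.2 ?_
  rintro _ ⟨⟨a, b, p⟩, rfl, rfl⟩
  have := pout_mul_pin_mem_typ (k := k) p (.nil : Path b b)
  rwa [pin_nil, pout_vert] at this

lemma poutSpan_le_deg (n : ℕ) : poutSpan k V n ≤ deg k V (-n) := by
  refine Submodule.span_le.2 ?_
  rintro _ ⟨⟨a, b, p⟩, rfl, rfl⟩
  have := pout_mul_pin_mem_deg (k := k) p (.nil : Path b b)
  rw [pin_nil, pout_vert, Path.length_nil] at this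
  simpa using this

lemma pow_mem_poutSpan (j : Fin 2) {p : ℕ} (x : 𝐒.Om p) :
    ((lamW k V j).pow p).f x ∈ poutSpan k V (p + j) := by
  have hx : x ∈ span k (formSet k V p) := span_formSet (k := k) (V := V) p ▸ Submodule.mem_top
  induction hx using span_induction with
  | mem x hx =>
    obtain ⟨a, b, c, r, q, hr, hq, rfl⟩ := hx
    rw [pow_recast_form]
    split_ifs with h
    · exact subset_span ⟨⟨c, b, q.comp r⟩, by
        rw [Path.length_comp, hr, h, add_comm], rfl⟩
    · exact zero_mem _
  | zero => rw [map_zero]; exact zero_mem _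
  | add x y _ _ hx hy => rw [map_add]; exact add_mem hx hy
  | smul c x _ hx => rw [map_smul]; exact smul_mem _ c hx

lemma rho_mem_typ (j : Fin 2) {m p : ℕ} (f : 𝐒.Coch m p) :
    rho j f ∈ typ k V m (p + j) := by
  have := tr_mem_typ (g := ((lamW k V j).pow p).f ∘ₗ f.1)
    fun t => poutSpan_le_typ _ (pow_mem_poutSpan j (f.1 t))
  rwa [zero_add] at this

lemma rho_mem_deg (j : Fin 2) {m p : ℕ} (f : 𝐒.Coch m p) :
    rho j f ∈ deg k V ((m : ℤ) - p - j) := by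
  have := tr_mem_deg (g := ((lamW k V j).pow p).f ∘ₗ f.1)
    fun t => poutSpan_le_deg _ (pow_mem_poutSpan j (f.1 t))
  rwa [show (-((p + j : ℕ) : ℤ) + m : ℤ) = (m : ℤ) - p - j by push_cast; ring] at this

lemma pow_baseW_mem {m : ℕ} (t : 𝐒.T m) :
    ((baseW k V).pow m).f t ∈ poutSpan k V m := by
  induction m with
  | zero =>
    change 𝐒.base at t
    induction t using base_ind with
    | h0 => exact (congrArg (· ∈ _) (map_zero _)).mpr (zero_mem _)
    | h1 i => exact subset_span ⟨⟨i, i, .nil⟩, rfl, by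
        rw [pout_nil]; exact baseW_baseE i⟩
    | h2 a b ha hb => exact (congrArg (· ∈ _) (map_add _ a b)).mpr (add_mem ha hb)
    | h3 c a ha => exact (congrArg (· ∈ _) (map_smul _ c a)).mpr (smul_mem _ c ha)
  | succ m ih =>
    induction t using pow_ind with
    | h0 => rw [map_zero]; exact zero_mem _
    | h2 a b ha hb => rw [map_add]; exact add_mem ha hb
    | h1 a b e x =>
      rw [Weight.pow_ten, barW_arrow]
      have hx := ih x
      generalize ((baseW k V).pow m).f x = y at hx
      clear ih x
      induction hx using span_induction with
      | mem y hy =>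
        obtain ⟨⟨c, d, p⟩, rfl, rfl⟩ := hy
        by_cases h : d = a
        · subst h
          exact subset_span ⟨⟨c, b, p.cons e⟩, rfl, (pout_cons p e).symm⟩
        · dsimp only
          rw [← pout_vert, mul_assoc, vert_out_ite, if_neg h, mul_zero]
          exact zero_mem _
      | zero => rw [zero_mul]; exact zero_mem _
      | add x y _ _ hx hy => rw [add_mul]; exact add_mem hx hy
      | smul c x _ hx => rw [smul_mul_assoc]; exact smul_mem _ c hx

lemma pin_mul_pow_mem (P : TotalPath V) (t : 𝐒.T P.2.2.length) :
    pin k P.2.2 * ((baseW k V).pow _).f t ∈ span k {𝔳 P.2.1} := by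
  have ht := pow_baseW_mem t
  generalize ((baseW k V).pow P.2.2.length).f t = y at ht
  induction ht using span_induction with
  | mem y hy =>
    obtain ⟨P', h, rfl⟩ := hy
    rw [pin_mul_pout _ _ h.symm]
    split_ifs
    · exact Submodule.mem_span_singleton_self _
    · exact zero_mem _
  | zero => rw [mul_zero]; exact zero_mem _
  | add x y _ _ hx hy => rw [mul_add]; exact add_mem hx hy
  | smul c x _ hx => rw [mul_smul_comm]; exact smul_mem _ c hx

/-- The coefficient of a path in a tensor. -/
def coeffOf (P : TotalPath V) : 𝐒.T P.2.2.length →ₗ[k] k :=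
  (LinearEquiv.toSpanNonzeroSingleton k _ _ (vert_ne_zero (k := k) no_sinks P.2.1)).symm.toLinearMap
    ∘ₗ LinearMap.codRestrict _ (LinearMap.mulLeft k (pin k P.2.2) ∘ₗ ((baseW k V).pow _).f)
      (pin_mul_pow_mem P)

lemma coeffOf_smul (P : TotalPath V) (t : 𝐒.T P.2.2.length) :
    coeffOf no_sinks P t • 𝔳 P.2.1 = pin k P.2.2 * ((baseW k V).pow _).f t := by
  have := congrArg Subtype.val ((LinearEquiv.toSpanNonzeroSingleton k _ _
    (vert_ne_zero (k := k) no_sinks P.2.1)).apply_symm_apply ⟨_, pin_mul_pow_mem P t⟩)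
  exact this

lemma coeffOf_eq {P : TotalPath V} {t : 𝐒.T P.2.2.length} {c : k}
    (h : pin k P.2.2 * ((baseW k V).pow _).f t = c • 𝔳 P.2.1) :
    coeffOf no_sinks P t = c := by
  rw [← coeffOf_smul no_sinks] at h
  exact smul_left_injective k (vert_ne_zero (k := k) no_sinks P.2.1) h

/-- The cochain which sends the tensor of one path to a given form. -/
def dual (P : TotalPath V) {p : ℕ} (y : 𝐒.Om p)
    (hL : ∀ i, (𝐒.Om p).L i y = if i = P.2.1 then y else 0)
    (hR : ∀ i, (𝐒.Om p).R i y = if i = P.1 then y else 0) :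
    𝐒.Coch P.2.2.length p :=
  ⟨(coeffOf no_sinks P).smulRight y, fun i t => by
    rw [LinearMap.smulRight_apply, LinearMap.smulRight_apply, map_smul, hL]
    by_cases h : i = P.2.1
    · rw [if_pos h, coeffOf_eq no_sinks (c := coeffOf no_sinks P t)]
      rw [Weight.map_L, ← mul_assoc, ← coeffOf_smul no_sinks, smul_mul_assoc, h, vert_mul_self]
    · rw [if_neg h, coeffOf_eq no_sinks (c := 0), zero_smul, smul_zero]
      rw [Weight.map_L, ← mul_assoc, ← coeffOf_smul no_sinks, smul_mul_assoc, (family k).vert_mul,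
        if_neg (Ne.symm h), smul_zero, zero_smul], fun i t => by
    rw [LinearMap.smulRight_apply, LinearMap.smulRight_apply, map_smul, hR]
    by_cases h : i = P.1
    · rw [if_pos h, coeffOf_eq no_sinks (c := coeffOf no_sinks P t)]
      rw [Weight.map_R, ← mul_assoc, coeffOf_smul no_sinks, h, pin_vert]
    · rw [if_neg h, coeffOf_eq no_sinks (c := 0), zero_smul, smul_zero]
      rw [Weight.map_R, ← mul_assoc, ← pin_vert, mul_assoc (pin k _), (family k).vert_mul,
        if_neg (Ne.symm h), mul_zero, zero_mul, zero_smul]⟩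

variable {P : TotalPath V} {p : ℕ} {y : (radSplit k V).Om p}
    {hL : ∀ i, ((radSplit k V).Om p).L i y = if i = P.2.1 then y else 0}
    {hR : ∀ i, ((radSplit k V).Om p).R i y = if i = P.1 then y else 0}

lemma isDual_dual : IsDual k P (dual no_sinks P y hL hR) y := by
  refine ⟨?_, fun P' hl hP => ?_⟩
  · refine (congrArg (· • y) (coeffOf_eq no_sinks (c := 1) ?_)).trans (one_smul k y)
    rw [pow_monomial, pin_mul_pout _ _ rfl, if_pos rfl, one_smul]
  · refine (congrArg (· • y) (coeffOf_eq no_sinks (c := 0) ?_)).trans (zero_smul k y)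
    rw [pow_recast _ hl, pow_monomial, pin_mul_pout _ _ hl.symm, if_neg (Ne.symm hP), zero_smul]

lemma rho_dual (j : Fin 2) :
    rho j (dual no_sinks P y hL hR) = ((lamW k V j).pow p).f y * pin k P.2.2 := by
  refine rho_eq fun t => ?_
  have h1 : ((lamW k V j).pow p).f y * 𝔳 P.2.1 = ((lamW k V j).pow p).f y := by
    rw [← Weight.map_L, hL, if_pos rfl]
  refine (map_smul _ (coeffOf no_sinks P t) y).trans ?_
  rw [mul_assoc, ← coeffOf_smul no_sinks, mul_smul_comm, h1]

lemma L_form {a b c : V} (p : Path a b) (q : Path c a) (i : V) :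
    (𝐒.Om p.length).L i (form k p q) = if i = b then form k p q else 0 :=
  L_pathTensor p i (L_pathCls q i)

lemma R_form {a b c : V} (p : Path a b) (q : Path c a) (i : V) :
    (𝐒.Om p.length).R i (form k p q) = if i = c then form k p q else 0 :=
  R_pathTensor p i (R_pathCls q i)

include no_sinks in
/-- The cochain which sends the tensor of one path to a multiple of the form of two other paths. -/
lemma exists_dual {a b c : V} (r : k) (P : Path c b) (p : Path a b)
    (q : Path c a) : ∃ f : 𝐒.Coch P.length p.length,
      IsDual k ⟨c, b, P⟩ f (r • form k p q) ∧
      ∀ j : Fin 2, rho j f = if q.length = j then r • (pout k (q.comp p) * pin k P) else 0 := by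
  refine ⟨dual no_sinks ⟨c, b, P⟩ (r • form k p q) (fun i => ?_) (fun i => ?_),
    isDual_dual no_sinks, fun j => ?_⟩
  · rw [map_smul, L_form, smul_ite, smul_zero]
  · rw [map_smul, R_form, smul_ite, smul_zero]
  · rw [rho_dual, map_smul, pow_form]
    split_ifs
    · rw [smul_mul_assoc]
    · rw [smul_zero, zero_mul]

end Injective

section Signs

lemma two_mul_half (d : ℤ) : 2 * (d * (d + 1) / 2) = d * (d + 1) :=
  Int.mul_ediv_cancel' (Int.even_mul_succ_self d).two_dvd

lemma half_add (a b : ℤ) : (a + b) * (a + b + 1) / 2 =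
    a * (a + 1) / 2 + b * (b + 1) / 2 + a * b := by
  have h1 := two_mul_half (a + b)
  have h2 := two_mul_half a
  have h3 := two_mul_half b
  linarith

lemma half_sum {n : ℕ} (a : Fin n → ℤ) : (∑ r, a r) * (∑ r, a r + 1) / 2 + ∑ r, a r * a r =
    ∑ r, a r * (a r + 1) / 2 + ∑ r : Fin n, (∑ j ∈ Finset.univ.filter (fun j : Fin n => (j : ℕ) ≤ r), a j) * a r := by
  induction n with
  | zero => simp
  | succ n ih =>
    have h1 : ∀ r : Fin n, ∑ j ∈ Finset.univ.filter (fun j : Fin (n + 1) => (j : ℕ) ≤ (r.castSucc : ℕ)), a j =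
        ∑ j ∈ Finset.univ.filter (fun j : Fin n => (j : ℕ) ≤ r), a j.castSucc := by
      intro r
      rw [sum_filter, sum_filter, Fin.sum_univ_castSucc, if_neg, add_zero]
      · simp only [Fin.val_castSucc]
      · simp only [Fin.val_last, Fin.val_castSucc]; omega
    have h2 : ∑ j ∈ Finset.univ.filter (fun j : Fin (n + 1) => (j : ℕ) ≤ (Fin.last n : ℕ)), a j = ∑ j, a j := by
      refine sum_congr (filter_true_of_mem fun j _ => ?_) fun _ _ => rfl
      simp only [Fin.val_last]; omega
    have h3 := ih fun j => a j.castSucc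
    have h4 := half_add (∑ j : Fin n, a j.castSucc) (a (Fin.last n))
    simp only [Fin.sum_univ_castSucc (n := n), h1, h2]
    linarith

lemma kappaExp_succ (m p : ℕ) : kappaExp (m + 1) (p + 1) = kappaExp m p + ((m : ℤ) - p) := by
  rw [kappaExp, kappaExp]
  push_cast
  rw [add_sub_add_right_eq_sub]
  ring

lemma kappaExp_diff (m p : ℕ) : kappaExp (m + 1) p = kappaExp m p + m + 1 := by
  have h := half_add ((m : ℤ) - p) 1
  rw [kappaExp, kappaExp]
  push_cast
  rw [show (m : ℤ) + 1 - p = m - p + 1 by ring, h]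
  norm_num
  ring

lemma kappaExp_cup (m p n q : ℕ) : kappaExp (n + m) (p + q) =
    kappaExp m p + kappaExp n q + m * q + n * p - 2 * p * q + ((m : ℤ) - p) * (n - q) := by
  have h := half_add ((m : ℤ) - p) ((n : ℤ) - q)
  rw [kappaExp, kappaExp, kappaExp]
  push_cast
  rw [show (n : ℤ) + m - (p + q) = m - p + (n - q) by ring, h]
  ring

lemma ksign_braceExp (x : 𝐒.Cochain) {c : ℕ} (y : Fin c → 𝐒.Cochain)
    (b : Fin (c + 1)) (l : Fin b → Fin x.p) (i : Fin (c - b) → Fin x.m) :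
    ε (kappaExp (Hoch.Split.inputs x y) (Hoch.Split.outputs x y) +
      (b + Hoch.Split.braceExp x y b l i)) =
    ε (insExp (fun r => ((y r).m : ℤ) - (y r).p - 1) x.m x.p b (fun r => l r) (fun r => i r)
      + (kappaExp x.m x.p + ∑ r, kappaExp (y r).m (y r).p)) := by
  obtain ⟨b, hb⟩ := b
  have hb' : b ≤ c := by omega
  set a : Fin c → ℤ := fun r => ((y r).m : ℤ) - (y r).p - 1 with ha
  have hp : ∀ r, Hoch.Split.pdeg (y r) = a r := fun _ => rfl
  have hD : (Hoch.Split.inputs x y : ℤ) - Hoch.Split.outputs x y =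
      (x.m : ℤ) - x.p + ∑ r, a r := by
    rw [Hoch.Split.inputs, Hoch.Split.outputs, ha]
    simp only [sum_sub_distrib]
    push_cast
    simp
    ring
  have hκ : ∀ r, kappaExp (y r).m (y r).p =
      a r * (y r).p + (y r).p + a r * (a r + 1) / 2 + (a r + 1) := by
    intro r
    have h := half_add (a r) 1
    rw [kappaExp, show ((y r).m : ℤ) - (y r).p = a r + 1 by rw [ha]; ring, h]
    norm_num
    ring
  have hS := half_sum a
  have hT := half_add ((x.m : ℤ) - x.p) (∑ r, a r)
  have s1 := sum_split_rev hb' fun r : Fin c => (∑ j ∈ Finset.univ.filter (fun j : Fin c => (j : ℕ) ≤ r), a j) * a r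
  have s2 := sum_split_rev hb' a
  have hsq : ((∑ r, a r * a r : ℤ) : ZMod 2) = ∑ r, (a r : ZMod 2) := by
    push_cast
    refine sum_congr rfl fun r _ => ?_
    generalize (a r : ZMod 2) = z
    revert z
    decide
  have e1 : ∑ r : Fin b, ((∑ j ∈ Finset.univ.filter (fun j : Fin c => (j : ℕ) ≤ r), a j) + ((l r : ℕ) + 1 : ℤ) - 1) *
      a ⟨r, by omega⟩ = ∑ r : Fin b, (∑ j ∈ Finset.univ.filter (fun j : Fin c => (j : ℕ) ≤ r), a j) * a ⟨r, by omega⟩ +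
        ∑ r : Fin b, (l r : ℤ) * a ⟨r, by omega⟩ := by
    rw [← sum_add_distrib]
    exact sum_congr rfl fun r _ => by ring
  have e2 : ∑ r : Fin (c - b), ((∑ j ∈ Finset.univ.filter (fun j : Fin c => (j : ℕ) ≤ c - 1 - r), a j) + ((x.m : ℤ) - x.p) -
      ((i r : ℕ) + 1 : ℤ) - 1) * a ⟨c - 1 - r, by omega⟩ =
      ∑ r : Fin (c - b), (∑ j ∈ Finset.univ.filter (fun j : Fin c => (j : ℕ) ≤ c - 1 - r), a j) * a ⟨c - 1 - r, by omega⟩ +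
        ((x.m : ℤ) - x.p - 2) * ∑ r : Fin (c - b), a ⟨c - 1 - r, by omega⟩ -
        ∑ r : Fin (c - b), a ⟨c - 1 - r, by omega⟩ * i r := by
    rw [mul_sum, ← sum_add_distrib, ← sum_sub_distrib]
    exact sum_congr rfl fun r _ => by ring
  have e3 : ∑ r : Fin b, a ⟨r, by omega⟩ * ((x.m : ℤ) + x.p - (l r : ℕ)) =
      ((x.m : ℤ) + x.p) * ∑ r : Fin b, a ⟨r, by omega⟩ -
        ∑ r : Fin b, (l r : ℤ) * a ⟨r, by omega⟩ := by
    rw [mul_sum, ← sum_sub_distrib]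
    exact sum_congr rfl fun r _ => by ring
  have hc : ((c - b : ℕ) : ℤ) = c - b := by omega
  rw [Hoch.Split.braceExp, insExp, kappaExp, kappaExp, hD, hT]
  simp only [hp, hκ]
  rw [e1, e2, e3, hc]
  simp only [sum_add_distrib, Finset.sum_const, Finset.card_univ, Fintype.card_fin,
    nsmul_eq_mul, mul_one]
  refine ksign_congr ?_
  generalize (∑ r : Fin b, (∑ j ∈ Finset.univ.filter (fun j : Fin c => (j : ℕ) ≤ r), a j) * a ⟨r, by omega⟩) = A1 at *
  generalize (∑ r : Fin (c - b), (∑ j ∈ Finset.univ.filter (fun j : Fin c => (j : ℕ) ≤ c - 1 - r), a j) *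
    a ⟨c - 1 - r, by omega⟩) = A2 at *
  rw [← s1] at hS
  have hS' := congrArg (Int.cast : ℤ → ZMod 2) hS
  have s2' := congrArg (Int.cast : ℤ → ZMod 2) s2
  generalize (∑ r, a r * a r) = Q at *
  generalize (∑ r : Fin b, a ⟨r, by omega⟩) = B1 at *
  generalize (∑ r : Fin (c - b), a ⟨c - 1 - r, by omega⟩) = B2 at *
  generalize (∑ r, a r * (a r + 1) / 2) = H at *
  generalize (∑ r : Fin b, (l r : ℤ) * a ⟨r, by omega⟩) = L at *
  generalize (∑ r : Fin (c - b), a ⟨c - 1 - r, by omega⟩ * (i r : ℤ)) = I at *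
  generalize (∑ r, a r * ((y r).p : ℤ)) = U at *
  generalize (∑ r, ((y r).p : ℤ)) = W at *
  rw [← Int.cast_sum] at hsq
  generalize (∑ r, a r) = N at *
  generalize N * (N + 1) / 2 = J at *
  generalize ((x.m : ℤ) - x.p) * ((x.m : ℤ) - x.p + 1) / 2 = G
  clear hκ hT hD e1 e2 e3 hp hS s1 s2 hc
  push_cast at *
  have h2 : (2 : ZMod 2) = 0 := rfl
  linear_combination hS' + hsq + ((x.m : ZMod 2) - x.p) * (-s2') +
    ((x.m - x.p + N) * (Hoch.Split.outputs x y : ZMod 2) - Q + A1 + A2 + b + L - c + ((x.m : ZMod 2) - x.p - 1) * B2 - I - x.p * B1) * h2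

end Signs

section HochModel

variable (k V) in
/-- The components of the class of a cochain, with the sign of the map `κ`. -/
def comp (j : Fin 2) : 𝐒.CsgE →ₗ[k] 𝐋 :=
  colimLift (fun m p => ε (kappaExp m p) •
    ({ toFun := rho j, map_add' := rho_add j, map_smul' := rho_smul j } :
      𝐒.Coch m p →ₗ[k] 𝐋)) fun m p f => by
    change ε (kappaExp (m + 1) (p + 1)) • rho j _ = ε (kappaExp m p) • rho j f
    rw [rho_theta, ksign_smul_smul, kappaExp_succ]
    refine congrArg₂ _ (ksign_congr ?_) rfl
    push_cast
    grind

variable {m p n q : ℕ}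

lemma comp_cls (j : Fin 2) (f : 𝐒.Coch m p) :
    comp k V j (𝐒.cls f) = ε (kappaExp m p) • rho j f := colimLift_cl _ _ _ _ _

lemma cls_mem (f : 𝐒.Coch m p) :
    𝐒.cls f ∈ 𝐒.CsgEDeg ((m : ℤ) - p) := cl_mem_piece _

lemma comp_mem_diag (j : Fin 2) (x : 𝐒.CsgE) : comp k V j x ∈ 𝐃 := by
  induction x using colim_induction with
  | h0 => rw [map_zero]; exact zero_mem _
  | h1 m p f =>
    exact (comp_cls j f).symm ▸ Subalgebra.smul_mem _ (rho_mem_diag j f) _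
  | h2 a b ha hb => rw [map_add]; exact add_mem ha hb

lemma comp_mem_deg (d : ℤ) (x : 𝐒.CsgE) (hx : x ∈ 𝐒.CsgEDeg d) :
    (comp k V 0).prod (comp k V 1) x ∈ (deg k V d).prod (deg k V (d - 1)) := by
  obtain ⟨m, p, f, rfl, rfl⟩ := exists_of_mem_piece hx
  refine ⟨?_, ?_⟩
  · change comp k V 0 (𝐒.cls f) ∈ _
    rw [comp_cls]
    have := rho_mem_deg 0 f
    rw [show ((m : ℤ) - p - ((0 : Fin 2) : ℕ)) = m - p from sub_zero _] at this
    exact smul_mem _ _ this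
  · change comp k V 1 (𝐒.cls f) ∈ _
    rw [comp_cls]
    exact smul_mem _ _ (rho_mem_deg 1 f)

variable (no_sinks : ∀ a : V, ∃ b : V, Nonempty (a ⟶ b))

include no_sinks

lemma eq_zero_of_comp (d : ℤ) (x : 𝐒.CsgE) (hx : x ∈ 𝐒.CsgEDeg d)
    (h : (comp k V 0).prod (comp k V 1) x = 0) : x = 0 := by
  obtain ⟨m, p, f, rfl, rfl⟩ := exists_of_mem_piece hx
  have hf : f = 0 := by
    refine eq_zero_of_rho no_sinks fun j => ?_
    have hj : comp k V j (𝐒.cls f) = 0 := by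
      fin_cases j
      · exact congrArg Prod.fst h
      · exact congrArg Prod.snd h
    rw [comp_cls] at hj
    exact (smul_eq_zero.1 hj).resolve_left (ksign_ne_zero _)
  rw [hf, map_zero]

/-- The cochain `κ(γ, γ')`. -/
lemma exists_kappa_par (z : ParPath V) : ∃ f : 𝐒.Coch z.top.length z.bot.length,
    IsDual k ⟨z.src, z.tgt, z.top⟩ f (ε (kappaExp z.top.length z.bot.length) •
      form k z.bot (Path.nil : Path z.src z.src)) ∧
    comp k V 0 (𝐒.cls f) = parVal k z ∧ comp k V 1 (𝐒.cls f) = 0 := by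
  obtain ⟨f, hf, h⟩ := exists_dual no_sinks (ε (kappaExp z.top.length z.bot.length))
    z.top z.bot .nil
  refine ⟨f, hf, ?_, ?_⟩
  · rw [comp_cls, (h 0).trans (if_pos rfl), ksign_smul_self, Path.nil_comp, parVal]
  · rw [comp_cls, (h 1).trans (if_neg Nat.zero_ne_one), smul_zero]

/-- The cochain `κ(s⁻¹(γ, γ'))`. -/
lemma exists_kappa_shift (x : ParPathPos V) :
    ∃ f : 𝐒.Coch x.top.length x.rest.length,
    IsDual k ⟨x.src, x.tgt, x.top⟩ f
      (ε (kappaExp x.top.length x.rest.length) • form k x.rest x.b0.toPath) ∧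
    comp k V 0 (𝐒.cls f) = 0 ∧
    comp k V 1 (𝐒.cls f) = parVal k x.toPar := by
  obtain ⟨f, hf, h⟩ := exists_dual no_sinks (ε (kappaExp x.top.length x.rest.length))
    x.top x.rest x.b0.toPath
  refine ⟨f, hf, ?_, ?_⟩
  · rw [comp_cls, (h 0).trans (if_neg Nat.one_ne_zero), smul_zero]
  · rw [comp_cls, (h 1).trans (if_pos rfl), ksign_smul_self, parVal]
    rfl

lemma exists_comp (x : Csg V k) : ∃ w, comp k V 0 w = emb k V x.1 ∧ comp k V 1 w = emb k V x.2 := by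
  have hx : x ∈ span k (Set.range fun x : Gen V => x.cls k) :=
    (span_gen (k := k) (V := V)) ▸ Submodule.mem_top
  induction hx using span_induction with
  | mem x hx =>
    obtain ⟨x, rfl⟩ := hx
    cases x with
    | par z =>
      obtain ⟨f, -, h0, h1⟩ := exists_kappa_par (k := k) no_sinks z
      exact ⟨_, h0.trans (emb_fst_cls0 z).symm, h1.trans (map_zero _).symm⟩
    | shift x =>
      obtain ⟨f, -, h0, h1⟩ := exists_kappa_shift (k := k) no_sinks x
      exact ⟨_, h0.trans (map_zero _).symm, h1.trans (emb_snd_cls1 x.toPar).symm⟩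
  | zero => exact ⟨0, by simp, by simp⟩
  | add x y _ _ hx hy =>
    obtain ⟨a, ha, ha'⟩ := hx
    obtain ⟨b, hb, hb'⟩ := hy
    exact ⟨a + b, by simp [ha, hb], by simp [ha', hb']⟩
  | smul c x _ hx =>
    obtain ⟨a, ha, ha'⟩ := hx
    exact ⟨c • a, by simp [ha], by simp [ha']⟩

/-- The identification of the singular Hochschild complex with pairs of diagonal elements. -/
def hochEquiv : 𝐒.CsgE ≃ₗ[k] 𝐃 × 𝐃 :=
  LinearEquiv.ofBijective
    (((comp k V 0).codRestrict (Subalgebra.toSubmodule 𝐃) (comp_mem_diag 0)).prod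
      ((comp k V 1).codRestrict (Subalgebra.toSubmodule 𝐃) (comp_mem_diag 1)))
    ⟨fun x y h => injective_of_graded iSup_piece gradInd_pair comp_mem_deg
        (eq_zero_of_comp no_sinks) (Prod.ext (congrArg (fun z => (z.1 : 𝐋)) h)
          (congrArg (fun z => (z.2 : 𝐋)) h)), fun u => by
      obtain ⟨w, h0, h1⟩ := exists_comp no_sinks ((combEquiv no_sinks).symm u)
      rw [← combEquiv_fst no_sinks, LinearEquiv.apply_symm_apply] at h0
      rw [← combEquiv_snd no_sinks, LinearEquiv.apply_symm_apply] at h1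
      exact ⟨w, Prod.ext (Subtype.ext h0) (Subtype.ext h1)⟩⟩

lemma hochEquiv_fst (x : 𝐒.CsgE) :
    ((hochEquiv no_sinks x).1 : 𝐋) = comp k V 0 x := rfl
lemma hochEquiv_snd (x : 𝐒.CsgE) :
    ((hochEquiv no_sinks x).2 : 𝐋) = comp k V 1 x := rfl

lemma hochGraded : IsGraded 𝐒.CsgEDeg (hochEquiv no_sinks) :=
  isGraded_of_mem iSup_piece fun d x =>
    mem_iff_of_graded iSup_piece gradInd_pair comp_mem_deg (eq_zero_of_comp no_sinks) d x

lemma hoch_ext {x y : 𝐒.CsgE} (h : ∀ j, comp k V j x = comp k V j y) : x = y :=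
  (hochEquiv no_sinks).injective (Prod.ext (Subtype.ext (h 0)) (Subtype.ext (h 1)))

end HochModel

section HochOperations

variable {m p n q : ℕ} (no_sinks : ∀ a : V, ∃ b : V, Nonempty (a ⟶ b))

lemma prod_ofFn_smul {n : ℕ} (a : Fin n → ℤ) (z : Fin n → 𝐋) :
    (ofFn fun r => ε (a r) • z r).prod = ε (∑ r, a r) • (ofFn z).prod := by
  induction n with
  | zero => simp [ksign_zero]
  | succ n ih =>
    rw [ofFn_succ, ofFn_succ, prod_cons, prod_cons, ih, Fin.sum_univ_succ,
      ksign_add, smul_mul_smul_comm]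

lemma prod_reverse_ofFn_smul {n : ℕ} (a : Fin n → ℤ) (z : Fin n → 𝐋) :
    (ofFn fun r => ε (a r) • z r).reverse.prod =
      ε (∑ r, a r) • (ofFn z).reverse.prod := by
  induction n with
  | zero => simp [ksign_zero]
  | succ n ih =>
    rw [ofFn_succ, ofFn_succ, List.reverse_cons, List.reverse_cons, List.prod_append,
      List.prod_append, ih, Fin.sum_univ_succ, ksign_add, List.prod_singleton,
      List.prod_singleton, smul_mul_smul_comm, mul_comm (ε _)]

lemma insVal_ksign {c : ℕ} (a : Fin c → ℤ) (z : Fin c → 𝐋) (d : ℤ) (x : 𝐋)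
    (b : Fin (c + 1)) (l : Fin b → ℕ) (i : Fin (c - b) → ℕ) :
    insVal (fun r => ε (a r) • z r) (ε d • x) b l i =
      ε (d + ∑ r, a r) • insVal z x b l i := by
  simp only [insVal, map_smul]
  rw [prod_ofFn_smul (fun r : Fin b => a ⟨r, by omega⟩),
    prod_reverse_ofFn_smul (fun r : Fin (c - b) => a ⟨c - 1 - r, by omega⟩), smul_mul_smul_comm,
    smul_mul_smul_comm, ← ksign_add, ← ksign_add, ← sum_split_rev (Nat.lt_succ_iff.1 b.2) a]
  congr 2
  ring

lemma comp_brace (j : Fin 2) (x : 𝐒.Cochain) {c : ℕ}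
    (y : Fin c → 𝐒.Cochain) :
    comp k V j (𝐒.cls (Hoch.Split.brace x y)) =
      ∑ b : Fin (c + 1), ∑ l : Fin b → Fin x.p with Monotone l,
        ∑ i : Fin (c - b) → Fin x.m with StrictMono i,
          ε (insExp (fun r => ((y r).m : ℤ) - (y r).p - 1) x.m x.p b (fun r => l r)
            fun r => i r) • insVal (fun r => comp k V 1 (𝐒.cls (y r).f))
              (comp k V j (𝐒.cls x.f)) b (fun r => l r + j) fun r => i r := by
  rw [comp_cls, Hoch.Split.brace]
  simp only [rho_sum, rho_smul, rho_braceTerm, smul_sum, comp_cls, insVal_ksign,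
    ksign_smul_smul, ksign_braceExp]

/-- The model of the Hochschild operations. -/
lemma hoch_isSingularHochschild (B : BInfty 𝐒.CsgEDeg)
    (hB : IsModel 𝐒.CsgEDeg (hochEquiv no_sinks) B.toOps) :
    𝐒.IsSingularHochschild B where
  diff m p f := by
    refine hoch_ext no_sinks fun j => ?_
    fin_cases j
    · refine (congrArg Subtype.val (hB.m_one_fst (𝐒.cls f))).trans ?_
      exact ((comp_cls 0 _).trans ((congrArg _ (rho_zero_diff f)).trans (smul_zero _))).symm
    · refine (hB.m_one_snd (𝐒.cls f)).trans ?_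
      change comp k V 0 _ - 𝔰 (parity (comp k V 0 _)) = comp k V 1 _
      have h0 := rho_mem_deg 0 f
      rw [show ((m : ℤ) - p - ((0 : Fin 2) : ℕ)) = m - p from sub_zero _] at h0
      have h1 : ε (kappaExp m p + m + 1 + p) = -ε (kappaExp m p + (m - p)) := by
        rw [← ksign_succ]
        refine ksign_congr ?_
        push_cast
        grind
      have h2 : ε (kappaExp m p + m + 1 + m) = -ε (kappaExp m p) := by
        rw [← ksign_succ]
        refine ksign_congr ?_
        push_cast
        grind
      rw [comp_cls, comp_cls, rho_one_diff, map_smul, parity_of_mem h0, map_smul, map_smul,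
        smul_sub, ksign_smul_smul, ksign_smul_smul, ksign_smul_smul, kappaExp_diff, h1, h2, neg_smul,
        neg_smul]
      abel
  cup m p n q f g := by
    have hs : ε (kappaExp (n + m) (p + q) + ((m : ℤ) * n + p * q)) =
        ε (kappaExp m p + kappaExp n q) := by
      rw [kappaExp_cup]
      refine ksign_congr ?_
      push_cast
      grind
    refine hoch_ext no_sinks fun j => ?_
    fin_cases j
    · refine (congrArg Subtype.val (hB.m_two_fst (𝐒.cls f) (𝐒.cls g))).trans ?_
      change comp k V 0 _ * comp k V 0 _ = comp k V 0 _
      rw [comp_cls, comp_cls, comp_cls, rho_zero_cup, ksign_smul_smul, hs, smul_mul_smul_comm,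
        ksign_add]
    · refine (hB.m_two_snd (𝐒.cls f) (𝐒.cls g)).trans ?_
      change comp k V 1 _ * comp k V 0 _ + 𝔰 (comp k V 0 _) * comp k V 1 _ = comp k V 1 _
      rw [comp_cls, comp_cls, comp_cls, comp_cls, comp_cls, rho_one_cup, ksign_smul_smul, hs,
        map_smul, smul_mul_smul_comm, smul_mul_smul_comm, ksign_add, ← smul_add, add_comm]
  brace x c y _ := by
    have ht : ∀ j : Fin 2, comp k V j (𝐒.cls x.f) ∈ typ k V x.m (x.p + j) := by
      intro j
      rw [comp_cls]
      exact smul_mem _ _ (rho_mem_typ j x.f)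
    refine hoch_ext no_sinks fun j => ?_
    rw [comp_brace]
    fin_cases j
    · exact hB.brace_fst (cls_mem x.f) (ht 0) _ _ fun r => cls_mem (y r).f
    · exact hB.brace_snd (cls_mem x.f) (ht 1) _ _ fun r => cls_mem (y r).f

/-- The Hochschild operations determine the brace `B_∞`-algebra. -/
lemma IsSingularHochschild.eq {B B' : BInfty 𝐒.CsgEDeg} (hb : B.IsBrace)
    (hb' : B'.IsBrace) (hB : 𝐒.IsSingularHochschild B)
    (hB' : 𝐒.IsSingularHochschild B') : B = B' := by
  have hS : span k {x | ∃ c : 𝐒.Cochain, x = 𝐒.cls c.f} = ⊤ := by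
    refine Submodule.eq_top_iff'.2 fun x => ?_
    induction x using colim_induction with
    | h0 => exact zero_mem _
    | h1 m p f => exact subset_span ⟨⟨m, p, f⟩, rfl⟩
    | h2 a b ha hb => exact add_mem ha hb
  refine brace_ext hb hb' hS hS ?_ ?_ ?_
  · rintro _ ⟨x, rfl⟩
    exact (hB.diff _ _ x.f).trans (hB'.diff _ _ x.f).symm
  · rintro _ ⟨x, rfl⟩ _ ⟨y, rfl⟩
    exact (hB.cup _ _ _ _ x.f y.f).trans (hB'.cup _ _ _ _ x.f y.f).symm
  · rintro n hn _ ⟨x, rfl⟩ y hy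
    choose z hz using hy
    obtain rfl : y = fun j => 𝐒.cls (z j).f := funext hz
    exact mu_eq_iff_brace.1 ((hB.brace x n z hn).trans (hB'.brace x n z hn).symm)

end HochOperations

end Leavitt
end

theorem theorem11 {k : Type*} [Field k] {V : Type*} [Quiver V] [Fintype V]
    [∀ a b : V, Fintype (a ⟶ b)] (no_sinks : ∀ a : V, ∃ b : V, Nonempty (a ⟶ b)) :
    (∃! B : BInf.BInfty (Comb.CsgDeg V k), B.IsBrace ∧ Comb.IsCombinatorial k B) ∧
    (∃! B' : BInf.BInfty (PathAlgebra.radSplit k V).CsgEDeg,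
      B'.IsBrace ∧ (PathAlgebra.radSplit k V).IsSingularHochschild B') ∧
    ∀ (B : BInf.BInfty (Comb.CsgDeg V k))
      (B' : BInf.BInfty (PathAlgebra.radSplit k V).CsgEDeg),
      B.IsBrace → Comb.IsCombinatorial k B →
      B'.IsBrace → (PathAlgebra.radSplit k V).IsSingularHochschild B' →
      ∃ κ : BInf.BInftyHom B B', κ.IsStrict ∧ κ.IsIso ∧ PathAlgebra.IsKappa k κ := by
  have hg := Leavitt.combGraded (k := k) no_sinks
  have hg' := Leavitt.hochGraded (k := k) no_sinks
  obtain ⟨O, hO⟩ := Leavitt.exists_isModel hg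
  obtain ⟨O', hO'⟩ := Leavitt.exists_isModel hg'
  have hb := Leavitt.modelBInfty_isBrace hg hO
  have hb' := Leavitt.modelBInfty_isBrace hg' hO'
  have hc := Leavitt.comb_isCombinatorial no_sinks (Leavitt.modelBInfty hg hO) hO
  have hc' := Leavitt.hoch_isSingularHochschild no_sinks (Leavitt.modelBInfty hg' hO') hO'
  refine ⟨⟨_, ⟨hb, hc⟩, fun B h => Leavitt.IsCombinatorial.eq h.1 hb h.2 hc⟩,
    ⟨_, ⟨hb', hc'⟩, fun B h => Leavitt.IsSingularHochschild.eq h.1 hb' h.2 hc'⟩,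
    fun B B' h1 h2 h3 h4 => ?_⟩
  obtain rfl := Leavitt.IsCombinatorial.eq h1 hb h2 hc
  obtain rfl := Leavitt.IsSingularHochschild.eq h3 hb' h4 hc'
  obtain ⟨F, hs, hi, hF⟩ := Leavitt.exists_iso_of_isModel hg hg'
    (Leavitt.modelBInfty hg hO) (Leavitt.modelBInfty hg' hO') hO hO'
  refine ⟨F, hs, hi, fun z => ?_, fun x => ?_⟩
  · obtain ⟨f, hf, h0, h1⟩ := Leavitt.exists_kappa_par (k := k) no_sinks z
    refine ⟨f, hf, (hF _).trans ((LinearEquiv.symm_apply_eq _).2 (Prod.ext (Subtype.ext ?_)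
      (Subtype.ext ?_)))⟩
    · exact (Leavitt.emb_fst_cls0 z).trans h0.symm
    · exact (map_zero _).trans h1.symm
  · obtain ⟨f, hf, h0, h1⟩ := Leavitt.exists_kappa_shift (k := k) no_sinks x
    refine ⟨f, hf, (hF _).trans ((LinearEquiv.symm_apply_eq _).2 (Prod.ext (Subtype.ext ?_)
      (Subtype.ext ?_)))⟩
    · exact (map_zero _).trans h0.symm
    · exact (Leavitt.emb_snd_cls1 x.toPar).trans h1.symm
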